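/- Let $k$ be a field and let $V$ be a finite-dimensional graded $k$-vector space concentrated in positive odd degrees, with homogeneous basis $e_1,\dots,e_c$. Let $\Lambda=\bigwedge_k V$, regarded as a graded $k$-algebra with zero differential, and let $S=\operatorname{Sym}_k W=k[\chi_1,\dots,\chi_c]$ with $W=\Sigma^{-1}(V^\vee)$, so that $\chi_i$ is dual to $e_i$ and has upper degree $|e_i|+1$. Let $\Gamma=\operatorname{Hom}_k(S,k)$ be the graded dual of $S$. The universal resolution of a dg $\Lambda$-module $M$ is $\mathsf uM=\Lambda\otimes_k\Gamma\otimes_k M$ with differential $1\otimes1\otimes\partial^M+\sum_i(1\otimes\chi_i\otimes e_i-e_i\otimes\chi_i\otimes 1)$; put $\mathsf dM=\operatorname{Hom}_\Lambda(\mathsf uM,k)$, a dg $S$-module through the action of $S$ on $\Gamma$. The derived tensor product $M\otimes^{\mathrm L}_\Lambda N$ is $F\otimes_\Lambda N$ for any semifree resolution $F\simeq M$ over $\Lambda$. Let $M,N$ be dg $\Lambda$-modules such that each $\operatorname H_i(M)$ and each $\operatorname H_i(N)$ is finite dimensional over $k$ and $\operatorname H_i(M)=0=\operatorname H_i(N)$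 for $i\ll0$. Then there is an isomorphism in the derived category of dg $S$-modules $$\mathsf d(M\otimes^{\mathrm L}_\Lambda N)\simeq \mathsf dM\otimes_k\mathsf dN,$$ where $S$ acts on the right-hand side through the algebra map $\Delta\colon S\to S\otimes_kS$, $\chi_i\mapsto\chi_i\otimes1+1\otimes\chi_i$. Let $\operatorname{Proj}S$ be the set of homogeneous primes of $S$ not containing $S^{>0}$, with the Zariski topology, and let $\mathrm V^{\mathsf d}_\Lambda(M)=\operatorname{Supp}_S\operatorname H(\mathsf dM)$ be the set of $\mathfrak p\in\operatorname{Proj}S$ at which the homogeneous localization of $\operatorname H(\mathsf dM)$ is non-zero. For closed subsets $U,V$ of $\operatorname{Proj}S$ let $I,J\subseteq S^{>0}$ be the largest homogeneous ideals of $S$ contained in $S^{>0}$ that define $U$ and $V$ (so $\varnothing$ is defined by $S^{>0}$), and let $\operatorname{Join}(U,V)$ be the closure in $\operatorname{Proj}S$ of the set of all $\Delta^{-1}(\mathfrak P)$, where $\mathfrak P\in\operatorname{Proj}(S\otimes_kS)$ contains $I\otimes1$ and $1\otimes J$ but not all the $\chi_i\otimes 1+1\otimes\chi_i$. If $\operatorname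 H(M)$ and $\operatorname H(N)$ are finite dimensional over $k$ and both non-zero, then $$\mathrm V^{\mathsf d}_\Lambda(M\otimes^{\mathrm L}_\Lambda N)=\operatorname{Join}\bigl(\mathrm V^{\mathsf d}_\Lambda(M),\mathrm V^{\mathsf d}_\Lambda(N)\bigr);$$ if $\operatorname H(M)=0$ or $\operatorname H(N)=0$, then $\mathrm V^{\mathsf d}_\Lambda(M\otimes^{\mathrm L}_\Lambda N)=\varnothing$. -/

import Mathlib

universe u

open scoped TensorProduct

namespace DGJoin

noncomputable section

section Graded

variable {k : Type*} [Field k] {X Y Z : Type*} [AddCommGroup X] [Module k X]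
  [AddCommGroup Y] [Module k Y] [AddCommGroup Z] [Module k Z]

/-- A family of subspaces that spans and is separated by linear maps is an internal grading. -/
theorem isInternal_of_maps {gr : ℤ → Submodule k X} (htop : ⨆ i, gr i = ⊤)
    (q : ℤ → X →ₗ[k] Z) (h0 : ∀ i j x, x ∈ gr j → j ≠ i → q i x = 0)
    (h1 : ∀ i x, x ∈ gr i → q i x = 0 → x = 0) : DirectSum.IsInternal gr := by
  rw [DirectSum.isInternal_submodule_iff_iSupIndep_and_iSup_eq_top]
  refine ⟨fun i => ?_, htop⟩
  rw [Submodule.disjoint_def]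
  intro x hx hx'
  refine h1 i x hx ?_
  have : (⨆ j, ⨆ (_ : j ≠ i), gr j) ≤ LinearMap.ker (q i) := by
    refine iSup₂_le fun j hj y hy => ?_
    exact h0 i j y hy hj
  exact this hx'

/-- The map sending a homogeneous element `x` of degree `i` to `x` placed in slot `i`. -/
def coact {gr : ℤ → Submodule k X} (h : DirectSum.IsInternal gr) : X →ₗ[k] (ℤ →₀ X) :=
  (DirectSum.toModule k ℤ (ℤ →₀ X)
      (fun i => (Finsupp.lsingle i : X →ₗ[k] ℤ →₀ X).comp (gr i).subtype)).comp
    (LinearEquiv.ofBijective (DirectSum.coeLinearMap gr) h).symm.toLinearMap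

theorem coact_of_mem {gr : ℤ → Submodule k X} (h : DirectSum.IsInternal gr) {i : ℤ} {x : X}
    (hx : x ∈ gr i) : coact h x = Finsupp.single i x := by
  have : (LinearEquiv.ofBijective (DirectSum.coeLinearMap gr) h).symm x
      = DirectSum.lof k ℤ (fun i => gr i) i ⟨x, hx⟩ := by
    rw [LinearEquiv.symm_apply_eq]
    exact (DirectSum.coeLinearMap_lof gr (i := i) ⟨x, hx⟩).symm
  simp [coact, this]

/-- The criterion for a grading through a map of this kind. -/
theorem isInternal_of_coact {gr : ℤ → Submodule k X} (htop : ⨆ i, gr i = ⊤)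
    (D : X →ₗ[k] (ℤ →₀ X)) (hD : ∀ i x, x ∈ gr i → D x = Finsupp.single i x) :
    DirectSum.IsInternal gr := by
  refine isInternal_of_maps htop (fun i => (Finsupp.lapply i : (ℤ →₀ X) →ₗ[k] X).comp D) ?_ ?_
  · intro i j x hx hij
    simp [hD j x hx, hij]
  · intro i x hx h
    simpa [hD i x hx] using h

/-- The projection on the component of degree `i`. -/
def proj {gr : ℤ → Submodule k X} (h : DirectSum.IsInternal gr) (i : ℤ) : X →ₗ[k] X :=
  (Finsupp.lapply i : (ℤ →₀ X) →ₗ[k] X).comp (coact h)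

theorem proj_of_mem {gr : ℤ → Submodule k X} (h : DirectSum.IsInternal gr) {i : ℤ} {x : X}
    (hx : x ∈ gr i) (j : ℤ) : proj h j x = if i = j then x else 0 := by
  simp [proj, coact_of_mem h hx, Finsupp.single_apply]

/-- Linear maps that agree on homogeneous elements are equal. -/
theorem ext_gr {gr : ℤ → Submodule k X} (h : DirectSum.IsInternal gr) {f g : X →ₗ[k] Y}
    (hfg : ∀ i x, x ∈ gr i → f x = g x) : f = g := by
  have htop : ⨆ i, gr i = ⊤ := h.submodule_iSup_eq_top
  ext x
  have hx : x ∈ ⨆ i, gr i := by rw [htop]; trivial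
  have : (⨆ i, gr i) ≤ LinearMap.eqLocus f g := iSup_le fun i y hy => hfg i y hy
  exact this hx

/-- The sign involution of a graded vector space: `x ↦ (-1)^i x` for `x` of degree `i`. -/
def sgn {gr : ℤ → Submodule k X} (h : DirectSum.IsInternal gr) : X →ₗ[k] X :=
  (Finsupp.lsum k (fun i : ℤ => ((-1 : k) ^ i) • (LinearMap.id : X →ₗ[k] X))).comp (coact h)

theorem sgn_of_mem {gr : ℤ → Submodule k X} (h : DirectSum.IsInternal gr) {i : ℤ} {x : X}
    (hx : x ∈ gr i) : sgn h x = ((-1 : k) ^ i) • x := by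
  simp [sgn, coact_of_mem h hx]

theorem sgn_mem {gr : ℤ → Submodule k X} (h : DirectSum.IsInternal gr) {i : ℤ} {x : X}
    (hx : x ∈ gr i) : sgn h x ∈ gr i := by
  rw [sgn_of_mem h hx]; exact Submodule.smul_mem _ _ hx

theorem sgn_sgn {gr : ℤ → Submodule k X} (h : DirectSum.IsInternal gr) (x : X) :
    sgn h (sgn h x) = x := by
  have : (sgn h).comp (sgn h) = LinearMap.id := by
    refine ext_gr h fun i x hx => ?_
    simp only [LinearMap.comp_apply, sgn_of_mem h hx, map_smul, smul_smul, LinearMap.id_apply]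
    rw [← mul_zpow]; simp
  exact LinearMap.congr_fun this x

/-- A differential anticommutes with the sign involution. -/
theorem sgn_d {gr : ℤ → Submodule k X} (h : DirectSum.IsInternal gr) (d : X →ₗ[k] X)
    (hd : ∀ i x, x ∈ gr i → d x ∈ gr (i - 1)) (x : X) : sgn h (d x) = - d (sgn h x) := by
  have : (sgn h).comp d = - d.comp (sgn h) := by
    refine ext_gr h fun i x hx => ?_
    have h1 : (-1 : k) ^ (i - 1) = - (-1) ^ i := by
      rw [zpow_sub₀ (by simp)]; simp [div_neg]
    simp [sgn_of_mem h hx, sgn_of_mem h (hd i x hx), h1]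
  exact LinearMap.congr_fun this x

/-- The grading of a tensor product: the part of degree `n` is spanned by the `x ⊗ y` with `x`, `y`
homogeneous and `|x| + |y| = n`. -/
def tensorGr (gX : ℤ → Submodule k X) (gY : ℤ → Submodule k Y) (n : ℤ) :
    Submodule k (X ⊗[k] Y) :=
  Submodule.span k {t | ∃ i j x y, i + j = n ∧ x ∈ gX i ∧ y ∈ gY j ∧ t = x ⊗ₜ[k] y}

theorem tmul_mem {gX : ℤ → Submodule k X} {gY : ℤ → Submodule k Y} {i j n : ℤ} {x : X} {y : Y}
    (hx : x ∈ gX i) (hy : y ∈ gY j) (hn : i + j = n) : x ⊗ₜ[k] y ∈ tensorGr gX gY n :=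
  Submodule.subset_span ⟨i, j, x, y, hn, hx, hy, rfl⟩

/-- A map with the right effect on homogeneous pure tensors shifts degrees. -/
theorem tensorGr_map {gX : ℤ → Submodule k X} {gY : ℤ → Submodule k Y} {f : X ⊗[k] Y →ₗ[k] Z}
    {n : ℤ} {P : Submodule k Z}
    (h : ∀ i j x y, i + j = n → x ∈ gX i → y ∈ gY j → f (x ⊗ₜ[k] y) ∈ P)
    {t : X ⊗[k] Y} (ht : t ∈ tensorGr gX gY n) : f t ∈ P := by
  have : tensorGr gX gY n ≤ P.comap f := by
    refine Submodule.span_le.2 ?_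
    rintro _ ⟨i, j, x, y, hn, hx, hy, rfl⟩
    exact h i j x y hn hx hy
  exact this ht

theorem mem_of_top {gr : ℤ → Submodule k X} (h : DirectSum.IsInternal gr) {P : Submodule k X}
    (hP : ∀ i x, x ∈ gr i → x ∈ P) (x : X) : x ∈ P := by
  have htop : ⨆ i, gr i = ⊤ := h.submodule_iSup_eq_top
  have hx : x ∈ ⨆ i, gr i := by rw [htop]; trivial
  exact (iSup_le fun i y hy => hP i y hy : (⨆ i, gr i) ≤ P) hx

theorem tensor_top {gX : ℤ → Submodule k X} {gY : ℤ → Submodule k Y}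
    (hX : DirectSum.IsInternal gX) (hY : DirectSum.IsInternal gY) :
    ⨆ n, tensorGr gX gY n = ⊤ := by
  rw [eq_top_iff]
  rintro t -
  induction t with
  | zero => exact zero_mem _
  | add a b ha hb => exact add_mem ha hb
  | tmul x y =>
    refine mem_of_top hX (P := (⨆ n, tensorGr gX gY n).comap
      ((TensorProduct.mk k X Y).flip y)) (fun i x hx => ?_) x
    refine mem_of_top hY (P := (⨆ n, tensorGr gX gY n).comap
      (TensorProduct.mk k X Y x)) (fun j y hy => ?_) y
    exact Submodule.mem_iSup_of_mem (i + j) (tmul_mem hx hy rfl)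

theorem tensor_internal {gX : ℤ → Submodule k X} {gY : ℤ → Submodule k Y}
    (hX : DirectSum.IsInternal gX) (hY : DirectSum.IsInternal gY) :
    DirectSum.IsInternal (tensorGr gX gY) := by
  classical
  refine isInternal_of_coact (tensor_top hX hY)
    ((Finsupp.lmapDomain (X ⊗[k] Y) k (fun p : ℤ × ℤ => p.1 + p.2)).comp
      ((finsuppTensorFinsupp k k X Y ℤ ℤ).toLinearMap.comp
        (TensorProduct.map (coact hX) (coact hY)))) ?_
  intro n t ht
  refine LinearMap.mem_eqLocus.1 ((Submodule.span_le.2 ?_ :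
    tensorGr gX gY n ≤ LinearMap.eqLocus _ (Finsupp.lsingle n)) ht)
  rintro _ ⟨i, j, x, y, rfl, hx, hy, rfl⟩
  simp [coact_of_mem hX hx, coact_of_mem hY hy]

/-- The differential `x ⊗ y ↦ dx ⊗ y + (-1)^{|x|} x ⊗ dy` of a tensor product. -/
def tensorD {gX : ℤ → Submodule k X} (hX : DirectSum.IsInternal gX) (dX : X →ₗ[k] X)
    (dY : Y →ₗ[k] Y) : X ⊗[k] Y →ₗ[k] X ⊗[k] Y :=
  TensorProduct.map dX LinearMap.id + TensorProduct.map (sgn hX) dY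

theorem tensorD_tmul {gX : ℤ → Submodule k X} (hX : DirectSum.IsInternal gX) (dX : X →ₗ[k] X)
    (dY : Y →ₗ[k] Y) (x : X) (y : Y) :
    tensorD hX dX dY (x ⊗ₜ y) = dX x ⊗ₜ y + sgn hX x ⊗ₜ dY y := by
  simp [tensorD]

theorem tensorD_mem {gX : ℤ → Submodule k X} {gY : ℤ → Submodule k Y}
    (hX : DirectSum.IsInternal gX) {dX : X →ₗ[k] X} {dY : Y →ₗ[k] Y}
    (hdX : ∀ i x, x ∈ gX i → dX x ∈ gX (i - 1)) (hdY : ∀ i y, y ∈ gY i → dY y ∈ gY (i - 1))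
    (n : ℤ) (t : X ⊗[k] Y) (ht : t ∈ tensorGr gX gY n) :
    tensorD hX dX dY t ∈ tensorGr gX gY (n - 1) := by
  refine tensorGr_map ?_ ht
  intro i j x y hn hx hy
  rw [tensorD_tmul]
  exact add_mem (tmul_mem (hdX i x hx) hy (by omega))
    (tmul_mem (sgn_mem hX hx) (hdY j y hy) (by omega))

theorem tensorD_tensorD {gX : ℤ → Submodule k X} (hX : DirectSum.IsInternal gX)
    {dX : X →ₗ[k] X} {dY : Y →ₗ[k] Y} (hdX : ∀ i x, x ∈ gX i → dX x ∈ gX (i - 1))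
    (hX2 : ∀ x, dX (dX x) = 0) (hY2 : ∀ y, dY (dY y) = 0) (t : X ⊗[k] Y) :
    tensorD hX dX dY (tensorD hX dX dY t) = 0 := by
  induction t with
  | zero => simp
  | add a b ha hb => simp [ha, hb]
  | tmul x y =>
    simp [tensorD_tmul, hX2, hY2, sgn_d hX dX hdX, TensorProduct.neg_tmul]

end Graded

section Homs

variable {k : Type*} [Field k] {A : Type*} [Ring A] [Algebra k A]
  {X : Type*} [AddCommGroup X] [Module k X] [Module A X]

/-- For a graded module `X` over an augmented algebra `ε : A → k`: the `A`-linear maps `X → k` of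
(lower) degree `n`, where `k` sits in degree `0`; such a map vanishes on all homogeneous elements
of degree different from `-n`. -/
def homPiece (ε : A →ₐ[k] k) (gr : ℤ → Submodule k X) (n : ℤ) :
    Submodule k (X →ₗ[k] k) where
  carrier := {f | (∀ (a : A) (x : X), f (a • x) = ε a * f x) ∧
    ∀ i, i ≠ -n → ∀ x ∈ gr i, f x = 0}
  add_mem' := by
    rintro f g ⟨hf, hf'⟩ ⟨hg, hg'⟩
    refine ⟨fun a x => ?_, fun i hi x hx => ?_⟩
    · simp [hf, hg, mul_add]
    · simp [hf' i hi x hx, hg' i hi x hx]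
  zero_mem' := by simp
  smul_mem' := by
    rintro c f ⟨hf, hf'⟩
    refine ⟨fun a x => ?_, fun i hi x hx => ?_⟩
    · simp [hf, mul_left_comm]
    · simp [hf' i hi x hx]

/-- The sum of the spaces of homogeneous `A`-linear maps `X → k`. -/
def gradedHom (ε : A →ₐ[k] k) (gr : ℤ → Submodule k X) : Submodule k (X →ₗ[k] k) :=
  ⨆ n, homPiece ε gr n

/-- The graded vector space `Hom_A(X, k)`. -/
def HomSp (ε : A →ₐ[k] k) (gr : ℤ → Submodule k X) : Type _ := gradedHom ε gr

instance (ε : A →ₐ[k] k) (gr : ℤ → Submodule k X) : AddCommGroup (HomSp ε gr) :=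
  inferInstanceAs (AddCommGroup (gradedHom ε gr))

instance (ε : A →ₐ[k] k) (gr : ℤ → Submodule k X) : Module k (HomSp ε gr) :=
  inferInstanceAs (Module k (gradedHom ε gr))

/-- The underlying linear map `X → k` of an element of `Hom_A(X, k)`. -/
def HomSp.toLin (ε : A →ₐ[k] k) (gr : ℤ → Submodule k X) : HomSp ε gr →ₗ[k] (X →ₗ[k] k) where
  toFun f := f.1
  map_add' _ _ := rfl
  map_smul' _ _ := rfl

theorem HomSp.ext {ε : A →ₐ[k] k} {gr : ℤ → Submodule k X} {f g : HomSp ε gr}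
    (h : ∀ x, HomSp.toLin ε gr f x = HomSp.toLin ε gr g x) : f = g :=
  Subtype.ext (LinearMap.ext h)

/-- Elements of `Hom_A(X, k)` from linear maps. -/
def HomSp.mk {ε : A →ₐ[k] k} {gr : ℤ → Submodule k X} (f : X →ₗ[k] k)
    (hf : f ∈ gradedHom ε gr) : HomSp ε gr := ⟨f, hf⟩

@[simp] theorem HomSp.toLin_mk {ε : A →ₐ[k] k} {gr : ℤ → Submodule k X} (f : X →ₗ[k] k)
    (hf : f ∈ gradedHom ε gr) : HomSp.toLin ε gr (HomSp.mk f hf) = f := rfl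

theorem HomSp.toLin_mem {ε : A →ₐ[k] k} {gr : ℤ → Submodule k X} (f : HomSp ε gr) :
    HomSp.toLin ε gr f ∈ gradedHom ε gr := f.2

/-- The grading of `Hom_A(X, k)`. -/
def homGr (ε : A →ₐ[k] k) (gr : ℤ → Submodule k X) (n : ℤ) : Submodule k (HomSp ε gr) :=
  (homPiece ε gr n).comap (HomSp.toLin ε gr)

theorem homPiece_le (ε : A →ₐ[k] k) (gr : ℤ → Submodule k X) (n : ℤ) :
    homPiece ε gr n ≤ gradedHom ε gr := le_iSup (homPiece ε gr) n

theorem gradedHom_le {ε : A →ₐ[k] k} {gr : ℤ → Submodule k X}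
    {P : Submodule k (X →ₗ[k] k)} (h : ∀ n, homPiece ε gr n ≤ P) : gradedHom ε gr ≤ P :=
  iSup_le h

theorem homGr_top (ε : A →ₐ[k] k) (gr : ℤ → Submodule k X) : ⨆ n, homGr ε gr n = ⊤ := by
  rw [eq_top_iff]
  rintro f -
  have key : gradedHom ε gr ≤ (⨆ n, homGr ε gr n).map (HomSp.toLin ε gr) := by
    refine gradedHom_le fun n g hg => ?_
    exact ⟨HomSp.mk g (homPiece_le ε gr n hg), Submodule.mem_iSup_of_mem n hg, rfl⟩
  obtain ⟨g, hg, hgf⟩ := key f.toLin_mem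
  have : g = f := HomSp.ext fun x => by rw [hgf]
  rwa [← this]

theorem homPiece_proj_ne {ε : A →ₐ[k] k} {gr : ℤ → Submodule k X}
    (h : DirectSum.IsInternal gr) {i j : ℤ} {f : X →ₗ[k] k} (hf : f ∈ homPiece ε gr j)
    (hij : j ≠ i) : f.comp (proj h (-i)) = 0 := by
  refine ext_gr h fun l x hx => ?_
  rw [LinearMap.comp_apply, proj_of_mem h hx]
  split_ifs with hl
  · exact hf.2 l (by omega) x hx
  · simp

theorem homPiece_proj {ε : A →ₐ[k] k} {gr : ℤ → Submodule k X}
    (h : DirectSum.IsInternal gr) {i : ℤ} {f : X →ₗ[k] k} (hf : f ∈ homPiece ε gr i) :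
    f.comp (proj h (-i)) = f := by
  refine ext_gr h fun l x hx => ?_
  rw [LinearMap.comp_apply, proj_of_mem h hx]
  split_ifs with hl
  · rfl
  · rw [map_zero, hf.2 l hl x hx]

theorem homGr_internal (ε : A →ₐ[k] k) {gr : ℤ → Submodule k X}
    (h : DirectSum.IsInternal gr) : DirectSum.IsInternal (homGr ε gr) := by
  refine isInternal_of_maps (homGr_top ε gr)
    (fun n => (LinearMap.lcomp k k (proj h (-n))).comp (HomSp.toLin ε gr)) ?_ ?_
  · intro i j f hf hij
    exact homPiece_proj_ne (f := HomSp.toLin ε gr f) h hf hij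
  · intro i f hf h0
    have h2 := homPiece_proj (f := HomSp.toLin ε gr f) h hf
    exact HomSp.ext fun x => by rw [← h2]; exact LinearMap.congr_fun h0 x

end Homs

section PolyAction

open MvPolynomial

variable {k : Type*} [Field k] {σ : Type*} {X : Type*} [AddCommGroup X] [Module k X]

/-- The polynomial ring on variables `χ i` of lower degree `-w i`, that is of upper degree `w i`:
its part of lower degree `n`. -/
def polyGr (k : Type*) [Field k] (w : σ → ℕ) (n : ℤ) : Submodule k (MvPolynomial σ k) :=
  weightedHomogeneousSubmodule k (fun i => -(w i : ℤ)) n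

theorem polyGr_internal (w : σ → ℕ) : DirectSum.IsInternal (polyGr k w) := by
  classical
  let _ := weightedGradedAlgebra k (fun i => -(w i : ℤ))
  exact DirectSum.Decomposition.isInternal (weightedHomogeneousSubmodule k (fun i => -(w i : ℤ)))

theorem X_mem_polyGr (w : σ → ℕ) (i : σ) : (MvPolynomial.X i : MvPolynomial σ k) ∈ polyGr k w (-(w i : ℤ)) :=
  isWeightedHomogeneous_X k (fun i => -(w i : ℤ)) i

/-- Induction principle for homogeneous polynomials. -/
theorem polyGr_induction (w : σ → ℕ) {n : ℤ} {P : Submodule k (MvPolynomial σ k)}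
    (h : ∀ m : σ →₀ ℕ, Finsupp.weight (fun i => -(w i : ℤ)) m = n → monomial m 1 ∈ P)
    {s : MvPolynomial σ k} (hs : s ∈ polyGr k w n) : s ∈ P := by
  rw [s.as_sum]
  refine sum_mem fun m hm => ?_
  have h1 : monomial m (coeff m s) = coeff m s • (monomial m 1 : MvPolynomial σ k) := by
    simp [smul_monomial]
  rw [h1]
  exact P.smul_mem _ (h m (hs (mem_support_iff.1 hm)))

theorem act_mem (w : σ → ℕ) {gr : ℤ → Submodule k X}
    (ψ : MvPolynomial σ k →ₐ[k] Module.End k X)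
    (hψ : ∀ i j x, x ∈ gr j → ψ (MvPolynomial.X i) x ∈ gr (j - w i)) {n j : ℤ}
    {s : MvPolynomial σ k} (hs : s ∈ polyGr k w n) {x : X} (hx : x ∈ gr j) :
    ψ s x ∈ gr (n + j) := by
  refine polyGr_induction w (P := (gr (n + j)).comap ((LinearMap.applyₗ x).comp ψ.toLinearMap))
    ?_ hs
  intro m hm
  show ψ (monomial m 1) x ∈ gr (n + j)
  clear hs
  induction m using Finsupp.induction generalizing n with
  | zero =>
    have : (monomial (0 : σ →₀ ℕ) (1 : k)) = 1 := rfl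
    simp only [map_zero] at hm
    subst hm
    simpa [this] using hx
  | single_add i b m _ _ ih =>
    clear ‹i ∉ m.support› ‹b ≠ 0›
    have h2 := ih rfl
    rw [map_add, Finsupp.weight_single] at hm
    have h3 : (monomial (Finsupp.single i b + m) (1 : k)) = MvPolynomial.X i ^ b * monomial m 1 := by
      rw [X_pow_eq_monomial, monomial_mul, one_mul]
    rw [h3, map_mul, map_pow, Module.End.mul_apply]
    clear h3
    generalize ψ (monomial m 1) x = y at h2
    have h4 : ∀ b : ℕ, (ψ (MvPolynomial.X i) ^ b) y ∈
        gr (Finsupp.weight (fun i => -(w i : ℤ)) m + j - b * w i) := by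
      intro b
      induction b with
      | zero => simpa using h2
      | succ b ihb =>
        rw [pow_succ', Module.End.mul_apply]
        have := hψ i _ _ ihb
        convert this using 2
        push_cast; ring
    convert h4 b using 2
    rw [← hm]; simp; ring

/-- If all variables have even degree, so do all non-zero homogeneous polynomials. -/
theorem polyGr_even (w : σ → ℕ) (hw : ∀ i, Even (w i)) {n : ℤ} {s : MvPolynomial σ k}
    (hs : s ∈ polyGr k w n) (x : X) : ((-1 : k) ^ n) • x = x ∨ s = 0 := by
  by_cases h0 : s = 0
  · exact Or.inr h0
  · left
    obtain ⟨m, hm⟩ := ne_zero_iff.1 h0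
    have h1 := hs hm
    have : Even n := by
      rw [← h1, Finsupp.weight_apply]
      refine Finset.even_sum _ fun i _ => ?_
      have := (Int.even_coe_nat (w i)).2 (hw i)
      simpa using Even.mul_left this.neg _
    simp [this.neg_one_zpow]

theorem act_comm (ψ : MvPolynomial σ k →ₐ[k] Module.End k X) (d : Module.End k X)
    (h : ∀ i, Commute d (ψ (MvPolynomial.X i))) (s : MvPolynomial σ k) : Commute d (ψ s) := by
  induction s using MvPolynomial.induction_on with
  | C a =>
    have : (C a : MvPolynomial σ k) = algebraMap k _ a := rfl
    rw [this, AlgHom.commutes]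
    exact (Algebra.commutes a d).symm
  | add p q hp hq => rw [map_add]; exact hp.add_right hq
  | mul_X p i hp => rw [map_mul]; exact hp.mul_right (h i)

variable {A : Type*} [Ring A] [Algebra k A] [Module A X]

theorem precomp_mem {ε : A →ₐ[k] k} {gr : ℤ → Submodule k X} {e : ℤ} (T : Module.End k X)
    (hT : ∀ j x, x ∈ gr j → T x ∈ gr (j + e)) (hA : ∀ (a : A) x, T (a • x) = a • T x)
    {n : ℤ} {f : X →ₗ[k] k} (hf : f ∈ homPiece ε gr n) :
    f.comp T ∈ homPiece ε gr (n + e) := by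
  refine ⟨fun a x => ?_, fun i hi x hx => ?_⟩
  · simp [hA, hf.1]
  · exact hf.2 (i + e) (by omega) _ (hT i x hx)

/-- A polynomial ring acting on `X` acts on `Hom_A(X, k)` by `(s • f)(x) = f(s • x)`. -/
def homAct (ε : A →ₐ[k] k) (gr : ℤ → Submodule k X) (w : σ → ℕ)
    (ψ : MvPolynomial σ k →ₐ[k] Module.End k X)
    (hψ : ∀ i j x, x ∈ gr j → ψ (MvPolynomial.X i) x ∈ gr (j - w i))
    (hA : ∀ i (a : A) x, ψ (MvPolynomial.X i) (a • x) = a • ψ (MvPolynomial.X i) x) :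
    MvPolynomial σ k →ₐ[k] Module.End k (HomSp ε gr) :=
  have key : ∀ s : MvPolynomial σ k, ∀ f ∈ gradedHom ε gr, f.comp (ψ s) ∈ gradedHom ε gr := by
    intro s
    induction s using MvPolynomial.induction_on with
    | C a =>
      intro f hf
      have : f.comp (ψ (C a)) = a • f := by
        have : (C a : MvPolynomial σ k) = algebraMap k _ a := rfl
        rw [this, AlgHom.commutes]
        ext x
        simp [Module.algebraMap_end_apply]
      rw [this]
      exact Submodule.smul_mem _ _ hf
    | add p q hp hq =>
      intro f hf
      rw [map_add, LinearMap.comp_add]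
      exact add_mem (hp f hf) (hq f hf)
    | mul_X p i hp =>
      intro f hf
      rw [map_mul, Module.End.mul_eq_comp, ← LinearMap.comp_assoc]
      have h1 : gradedHom ε gr ≤
          (gradedHom ε gr).comap (LinearMap.lcomp k k (ψ (MvPolynomial.X i))) := by
        refine gradedHom_le fun n g hg => ?_
        exact homPiece_le ε gr _ (precomp_mem (e := -(w i : ℤ)) _ (hψ i) (hA i) hg)
      exact h1 (hp f hf)
  AlgHom.ofLinearMap
    { toFun := fun s =>
        { toFun := fun f => HomSp.mk ((HomSp.toLin ε gr f).comp (ψ s)) (key s _ f.toLin_mem)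
          map_add' := fun f g => HomSp.ext fun x => rfl
          map_smul' := fun c f => HomSp.ext fun x => rfl }
      map_add' := fun s t => LinearMap.ext fun f => HomSp.ext fun x => by simp
      map_smul' := fun c s => LinearMap.ext fun f => HomSp.ext fun x => by simp }
    (LinearMap.ext fun f => HomSp.ext fun x => by simp)
    (fun s t => LinearMap.ext fun f => HomSp.ext fun x => by simp [mul_comm s t])

theorem homAct_apply (ε : A →ₐ[k] k) (gr : ℤ → Submodule k X) (w : σ → ℕ)
    (ψ : MvPolynomial σ k →ₐ[k] Module.End k X)
    (hψ : ∀ i j x, x ∈ gr j → ψ (MvPolynomial.X i) x ∈ gr (j - w i))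
    (hA : ∀ i (a : A) x, ψ (MvPolynomial.X i) (a • x) = a • ψ (MvPolynomial.X i) x)
    (s : MvPolynomial σ k) (f : HomSp ε gr) (x : X) :
    HomSp.toLin ε gr (homAct ε gr w ψ hψ hA s f) x = HomSp.toLin ε gr f (ψ s x) := rfl

theorem homAct_mem (ε : A →ₐ[k] k) (gr : ℤ → Submodule k X) (w : σ → ℕ)
    (ψ : MvPolynomial σ k →ₐ[k] Module.End k X)
    (hψ : ∀ i j x, x ∈ gr j → ψ (MvPolynomial.X i) x ∈ gr (j - w i))
    (hA : ∀ i (a : A) x, ψ (MvPolynomial.X i) (a • x) = a • ψ (MvPolynomial.X i) x)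
    (i : σ) (j : ℤ) (f : HomSp ε gr) (hf : f ∈ homGr ε gr j) :
    homAct ε gr w ψ hψ hA (MvPolynomial.X i) f ∈ homGr ε gr (j - w i) :=
  precomp_mem (e := -(w i : ℤ)) _ (hψ i) (hA i) hf

end PolyAction

section DG

variable {k : Type u} [Field k] {A : Type u} [Ring A] [Algebra k A]

/-- A (left) dg module over the graded algebra `(A, 𝒜)` with zero differential. Gradings are lower
gradings: the differential has degree `-1`, and `d (a m) = (-1)^{|a|} a (d m)`. -/
structure DGModule (𝒜 : ℤ → Submodule k A) where
  carrier : Type u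
  [grp : AddCommGroup carrier]
  [modk : Module k carrier]
  [modA : Module A carrier]
  [tower : IsScalarTower k A carrier]
  gr : ℤ → Submodule k carrier
  internal : DirectSum.IsInternal gr
  smul_mem : ∀ {i j : ℤ} {a : A} {x : carrier}, a ∈ 𝒜 i → x ∈ gr j → a • x ∈ gr (i + j)
  d : carrier →ₗ[k] carrier
  d_mem : ∀ (i : ℤ) (x : carrier), x ∈ gr i → d x ∈ gr (i - 1)
  d_d : ∀ x : carrier, d (d x) = 0
  d_smul : ∀ {i : ℤ} {a : A} (x : carrier), a ∈ 𝒜 i → d (a • x) = ((-1 : k) ^ i) • a • d x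

attribute [instance] DGModule.grp DGModule.modk DGModule.modA DGModule.tower

variable {𝒜 : ℤ → Submodule k A}

/-- A morphism of dg modules: linear, of degree `0`, compatible with the differentials. -/
structure DGHom (X Y : DGModule 𝒜) where
  toFun : X.carrier →ₗ[A] Y.carrier
  map_mem : ∀ {i : ℤ} {x : X.carrier}, x ∈ X.gr i → toFun x ∈ Y.gr i
  map_d : ∀ x : X.carrier, toFun (X.d x) = Y.d (toFun x)

/-- A quasi-isomorphism: the induced map in homology is injective and surjective. -/
def DGHom.IsQuasiIso {X Y : DGModule 𝒜} (f : DGHom X Y) : Prop :=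
  (∀ x, X.d x = 0 → (∃ y, Y.d y = f.toFun x) → ∃ x', X.d x' = x) ∧
  (∀ y, Y.d y = 0 → ∃ x, X.d x = 0 ∧ ∃ y', y = f.toFun x + Y.d y')

/-- Isomorphism in the derived category: the dg modules are linked by a zigzag of
quasi-isomorphisms. -/
def DerivedIso (X Y : DGModule 𝒜) : Prop :=
  Relation.EqvGen (fun X Y : DGModule 𝒜 => ∃ f : DGHom X Y, f.IsQuasiIso) X Y

/-- The homology of a dg module, as a vector space (the sum of all `H_i`). -/
abbrev Homology (X : DGModule 𝒜) : Type u :=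
  LinearMap.ker X.d ⧸ (LinearMap.range X.d).comap (LinearMap.ker X.d).subtype

/-- The part `H_i` of the homology: the classes of the cycles of degree `i`. -/
def homologyGr (X : DGModule 𝒜) (i : ℤ) : Submodule k (Homology X) :=
  ((X.gr i).comap (LinearMap.ker X.d).subtype).map (Submodule.mkQ _)

/-- Membership in `D^+_fg`: each `H_i` is finite dimensional, and `H_i = 0` for `i ≪ 0`. -/
def IsFgBoundedBelow (X : DGModule 𝒜) : Prop :=
  (∀ i, FiniteDimensional k (homologyGr X i)) ∧ ∃ n : ℤ, ∀ i < n, homologyGr X i = ⊥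

/-- A semifree dg module: it has a homogeneous basis over `A`, sorted into levels, such that the
differential of a basis element lies in the span of the basis elements of lower level; the spans
of the basis elements of level `≤ n` form a filtration whose subquotients are coproducts of
suspensions of `A`. -/
def IsSemifree (F : DGModule 𝒜) : Prop :=
  ∃ (I : Type u) (b : Module.Basis I A F.carrier) (level : I → ℕ),
    (∀ i, ∃ n, b i ∈ F.gr n) ∧
    ∀ i, F.d (b i) ∈ Submodule.span A (b '' {j | level j < level i})

section Quot

variable {X : Type u} [AddCommGroup X] [Module k X] [Module A X]
  {Z : Type*} [AddCommGroup Z] [Module k Z]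

/-- A `k`-linear map that kills all `a • x` for `x ∈ s` and `a` homogeneous kills the span. -/
theorem span_induction_gr (h𝒜 : ⨆ i, 𝒜 i = ⊤) {s : Set X} {f : X →ₗ[k] Z}
    (h : ∀ i, ∀ a ∈ 𝒜 i, ∀ x ∈ s, f (a • x) = 0) (x : X) (hx : x ∈ Submodule.span A s) :
    f x = 0 := by
  have hA : ∀ (a : A), ∀ y ∈ s, f (a • y) = 0 := by
    intro a y hy
    have ha : a ∈ ⨆ i, 𝒜 i := by rw [h𝒜]; trivial
    induction ha using Submodule.iSup_induction' with
    | mem i a ha => exact h i a ha y hy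
    | zero => simp
    | add a b _ _ ha hb => rw [add_smul, map_add, ha, hb, add_zero]
  induction hx using Submodule.closure_induction with
  | zero => simp
  | add x y _ _ hx hy => rw [map_add, hx, hy, add_zero]
  | smul_mem a x hx => exact hA a x hx

variable [IsScalarTower k A X]

/-- The quotient of an `A`-module by the submodule spanned by a set. -/
def QSp (A : Type u) [Ring A] {X : Type u} [AddCommGroup X] [Module A X] (s : Set X) : Type u :=
  X ⧸ Submodule.span A s

instance (s : Set X) : AddCommGroup (QSp A s) :=
  inferInstanceAs (AddCommGroup (X ⧸ Submodule.span A s))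

instance (s : Set X) : Module A (QSp A s) :=
  inferInstanceAs (Module A (X ⧸ Submodule.span A s))

instance (s : Set X) : Module k (QSp A s) :=
  inferInstanceAs (Module k (X ⧸ Submodule.span A s))

instance (s : Set X) : IsScalarTower k A (QSp A s) :=
  inferInstanceAs (IsScalarTower k A (X ⧸ Submodule.span A s))

/-- The projection on the quotient. -/
def QSp.proj (s : Set X) : X →ₗ[A] QSp A s := (Submodule.span A s).mkQ

theorem QSp.proj_surjective (s : Set X) : Function.Surjective (QSp.proj (A := A) s) :=
  Submodule.mkQ_surjective _

theorem QSp.proj_eq_zero {s : Set X} {x : X} :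
    QSp.proj (A := A) s x = 0 ↔ x ∈ Submodule.span A s :=
  Submodule.Quotient.mk_eq_zero _

theorem QSp.proj_smul (s : Set X) (c : k) (x : X) :
    QSp.proj (A := A) s (c • x) = c • QSp.proj (A := A) s x := rfl

/-- The linear map induced on the quotient. -/
def QSp.lift (s : Set X) (f : X →ₗ[k] Z) (hf : ∀ x ∈ Submodule.span A s, f x = 0) :
    QSp A s →ₗ[k] Z where
  toFun := QuotientAddGroup.lift (Submodule.span A s).toAddSubgroup f.toAddMonoidHom hf
  map_add' := map_add _
  map_smul' := by
    intro c x
    obtain ⟨x, rfl⟩ := QSp.proj_surjective s x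
    exact f.map_smul c x

theorem QSp.lift_proj (s : Set X) (f : X →ₗ[k] Z) (hf : ∀ x ∈ Submodule.span A s, f x = 0)
    (x : X) : QSp.lift s f hf (QSp.proj s x) = f x := rfl

end Quot

/-- The quotient of a dg module by a dg submodule generated by homogeneous elements. -/
def DGModule.quotient (X : DGModule 𝒜) (h𝒜 : ⨆ i, 𝒜 i = ⊤) (s : Set X.carrier)
    (hs : ∀ x ∈ s, ∃ i, x ∈ X.gr i) (hd : ∀ x ∈ s, X.d x ∈ Submodule.span A s) :
    DGModule 𝒜 :=
  let q : X.carrier →ₗ[k] QSp A s := (QSp.proj s).restrictScalars k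
  have hd' : ∀ x ∈ Submodule.span A s, q.comp X.d x = 0 :=
    span_induction_gr h𝒜 fun i a ha x hx => by
      show QSp.proj s (X.d (a • x)) = 0
      rw [X.d_smul x ha, QSp.proj_smul, map_smul, QSp.proj_eq_zero.2 (hd x hx), smul_zero,
        smul_zero]
  { carrier := QSp A s
    gr := fun i => (X.gr i).map q
    internal := by
      have hq : Function.Surjective q := QSp.proj_surjective s
      have htop : ⨆ i, (X.gr i).map q = ⊤ := by
        rw [← Submodule.map_iSup, X.internal.submodule_iSup_eq_top, Submodule.map_top,
          LinearMap.range_eq_top.2 hq]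
      let f : X.carrier →ₗ[k] (ℤ →₀ QSp A s) :=
        (Finsupp.mapRange.linearMap q).comp (coact X.internal)
      have hf : ∀ i y, y ∈ X.gr i → f y = Finsupp.single i (QSp.proj s y) := by
        intro i y hy
        simp only [f, LinearMap.comp_apply, coact_of_mem X.internal hy]
        simp [q]
      have hker : ∀ x ∈ Submodule.span A s, f x = 0 :=
        span_induction_gr h𝒜 fun i a ha x hx => by
          obtain ⟨j, hj⟩ := hs x hx
          rw [hf _ _ (X.smul_mem ha hj), map_smul,
            QSp.proj_eq_zero.2 (Submodule.subset_span hx), smul_zero, Finsupp.single_zero]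
      refine isInternal_of_coact htop (QSp.lift s f hker) ?_
      rintro i _ ⟨y, hy, rfl⟩
      exact hf i y hy
    smul_mem := by
      rintro i j a _ ha ⟨x, hx, rfl⟩
      exact ⟨a • x, X.smul_mem ha hx, map_smul (QSp.proj s) a x⟩
    d := QSp.lift s (q.comp X.d) hd'
    d_mem := by
      rintro i _ ⟨x, hx, rfl⟩
      exact ⟨X.d x, X.d_mem i x hx, rfl⟩
    d_d := by
      intro x
      obtain ⟨x, rfl⟩ := QSp.proj_surjective s x
      show QSp.proj s (X.d (X.d x)) = 0
      rw [X.d_d, map_zero]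
    d_smul := by
      intro i a x ha
      obtain ⟨x, rfl⟩ := QSp.proj_surjective s x
      show QSp.proj s (X.d (a • x)) = _ • a • QSp.proj s (X.d x)
      rw [X.d_smul x ha, QSp.proj_smul, map_smul] }

theorem sgn_smul (X : DGModule 𝒜) {i : ℤ} {a : A} (ha : a ∈ 𝒜 i) (x : X.carrier) :
    sgn X.internal (a • x) = ((-1 : k) ^ i) • a • sgn X.internal x := by
  have : (sgn X.internal).comp (Algebra.lsmul k k X.carrier a) =
      ((-1 : k) ^ i) • (Algebra.lsmul k k X.carrier a : X.carrier →ₗ[k] X.carrier).comp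
        (sgn X.internal) := by
    refine ext_gr X.internal fun j x hx => ?_
    have h2 := sgn_of_mem X.internal (X.smul_mem ha hx)
    simp only [LinearMap.comp_apply, Algebra.lsmul_coe, LinearMap.smul_apply, h2,
      sgn_of_mem X.internal hx]
    rw [zpow_add₀ (by simp), mul_smul, smul_comm a]
  exact LinearMap.congr_fun this x

/-- The tensor product `X ⊗_k Y` with `A` acting on the left factor. -/
def tensorLeft {B : Type u} [Ring B] [Algebra k B] {ℬ : ℤ → Submodule k B}
    (X : DGModule 𝒜) (Y : DGModule ℬ) : DGModule 𝒜 where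
  carrier := X.carrier ⊗[k] Y.carrier
  gr := tensorGr X.gr Y.gr
  internal := tensor_internal X.internal Y.internal
  smul_mem := by
    intro i j a t ha ht
    refine tensorGr_map (f := (LinearMap.rTensor Y.carrier (Algebra.lsmul k k X.carrier a))) ?_ ht
    intro p q x y hpq hx hy
    exact tmul_mem (X.smul_mem ha hx) hy (by omega)
  d := tensorD X.internal X.d Y.d
  d_mem := tensorD_mem X.internal X.d_mem Y.d_mem
  d_d := tensorD_tensorD X.internal X.d_mem X.d_d Y.d_d
  d_smul := by
    intro i a t ha
    induction t with
    | zero => simp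
    | add s t hs ht => simp only [smul_add, map_add, hs, ht]
    | tmul x y =>
      have h1 := sgn_smul X ha x
      simp only [TensorProduct.smul_tmul', tensorD_tmul, X.d_smul x ha, h1, smul_add]

/-- The relations `a x ⊗ y = (-1)^{|a||x|} x ⊗ a y` that define `X ⊗_A Y`; a left module `X` is a
right module through `x a = (-1)^{|a||x|} a x`. -/
def tensorRel (X Y : DGModule 𝒜) : Set (X.carrier ⊗[k] Y.carrier) :=
  {t | ∃ (i j l : ℤ) (a : A) (x : X.carrier) (y : Y.carrier), a ∈ 𝒜 i ∧ x ∈ X.gr j ∧ y ∈ Y.gr l ∧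
    t = (a • x) ⊗ₜ[k] y - ((-1 : k) ^ (i * j)) • (x ⊗ₜ[k] (a • y))}

/-- The tensor product `X ⊗_A Y` of dg modules over a graded-commutative algebra. -/
def tensorOver (h𝒜 : ⨆ i, 𝒜 i = ⊤) (X Y : DGModule 𝒜) : DGModule 𝒜 :=
  (tensorLeft X Y).quotient h𝒜 (tensorRel X Y)
    (by
      rintro _ ⟨i, j, l, a, x, y, ha, hx, hy, rfl⟩
      refine ⟨i + j + l, sub_mem (tmul_mem (X.smul_mem ha hx) hy rfl)
        (Submodule.smul_mem _ _ (tmul_mem hx (Y.smul_mem ha hy) (by ring)))⟩)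
    (by
      rintro _ ⟨i, j, l, a, x, y, ha, hx, hy, rfl⟩
      have h1 : (a • X.d x) ⊗ₜ[k] y - ((-1 : k) ^ (i * (j - 1))) • (X.d x ⊗ₜ[k] (a • y)) ∈
          Submodule.span A (tensorRel X Y) :=
        Submodule.subset_span ⟨i, j - 1, l, a, X.d x, y, ha, X.d_mem j x hx, hy, rfl⟩
      have h2 : (a • x) ⊗ₜ[k] Y.d y - ((-1 : k) ^ (i * j)) • (x ⊗ₜ[k] (a • Y.d y)) ∈
          Submodule.span A (tensorRel X Y) :=
        Submodule.subset_span ⟨i, j, l - 1, a, x, Y.d y, ha, hx, Y.d_mem l y hy, rfl⟩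
      have h3 := add_mem
        (((Submodule.span A (tensorRel X Y)).restrictScalars k).smul_mem ((-1 : k) ^ i) h1)
        (((Submodule.span A (tensorRel X Y)).restrictScalars k).smul_mem ((-1 : k) ^ (i + j)) h2)
      have key : tensorD X.internal X.d Y.d
          ((a • x) ⊗ₜ[k] y - ((-1 : k) ^ (i * j)) • (x ⊗ₜ[k] (a • y))) = 
          (-1 : k) ^ i • ((a • X.d x) ⊗ₜ[k] y -
            ((-1 : k) ^ (i * (j - 1))) • (X.d x ⊗ₜ[k] (a • y))) +
          (-1 : k) ^ (i + j) • ((a • x) ⊗ₜ[k] Y.d y -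
            ((-1 : k) ^ (i * j)) • (x ⊗ₜ[k] (a • Y.d y))) := by
        have hs : (-1 : k) ^ i * (-1 : k) ^ (i * (j - 1)) = (-1) ^ (i * j) := by
          rw [← zpow_add₀ (by simp)]; congr 1; ring
        have e1 : tensorD X.internal X.d Y.d ((a • x) ⊗ₜ[k] y) =
            (-1 : k) ^ i • ((a • X.d x) ⊗ₜ[k] y) + (-1 : k) ^ (i + j) • ((a • x) ⊗ₜ[k] Y.d y) := by
          rw [tensorD_tmul, X.d_smul x ha, sgn_of_mem X.internal (X.smul_mem ha hx),
            ← TensorProduct.smul_tmul' ((-1 : k) ^ i), ← TensorProduct.smul_tmul' ((-1 : k) ^ (i + j))]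
        have e2 : tensorD X.internal X.d Y.d (x ⊗ₜ[k] (a • y)) =
            X.d x ⊗ₜ[k] (a • y) + ((-1 : k) ^ (j + i)) • (x ⊗ₜ[k] (a • Y.d y)) := by
          rw [tensorD_tmul, Y.d_smul y ha, sgn_of_mem X.internal hx, TensorProduct.tmul_smul ((-1 : k) ^ i),
            ← TensorProduct.smul_tmul' ((-1 : k) ^ j), smul_smul, zpow_add₀ (by simp), mul_comm]
        rw [map_sub, map_smul, e1, e2]
        simp only [smul_sub, smul_add, smul_smul, hs]
        rw [mul_comm ((-1 : k) ^ (i * j)) ((-1 : k) ^ (j + i)), add_comm j i]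
        abel
      show tensorD X.internal X.d Y.d _ ∈ _
      rw [key]
      exact h3)

section HomK

variable (ε : A →ₐ[k] k) (F : DGModule 𝒜)

theorem homD_mem_piece (h𝒜 : ⨆ i, 𝒜 i = ⊤) {n : ℤ} {f : F.carrier →ₗ[k] k}
    (hf : f ∈ homPiece ε F.gr n) :
    -(f.comp ((sgn F.internal).comp F.d)) ∈ homPiece ε F.gr (n - 1) := by
  refine neg_mem ⟨fun a x => ?_, fun i hi x hx => ?_⟩
  · have ha : a ∈ ⨆ i, 𝒜 i := by rw [h𝒜]; trivial
    induction ha using Submodule.iSup_induction' with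
    | mem i a ha =>
      have h1 : sgn F.internal (F.d (a • x)) = a • sgn F.internal (F.d x) := by
        rw [F.d_smul x ha, map_smul, sgn_smul F ha, smul_smul, ← mul_zpow]
        simp
      simp only [LinearMap.comp_apply, h1, hf.1]
    | zero => simp
    | add a b _ _ ha hb => rw [add_smul, map_add, ha, hb, map_add, add_mul]
  · exact hf.2 (i - 1) (by omega) _ (sgn_mem F.internal (F.d_mem i x hx))

/-- The differential of `Hom_A(F, k)`: `∂ f = -(-1)^{|f|} f ∘ ∂`. A map `f` of degree `n` only sees
elements of degree `-n`, so the sign may be inserted after `∂`. -/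
def homD (h𝒜 : ⨆ i, 𝒜 i = ⊤) : HomSp ε F.gr →ₗ[k] HomSp ε F.gr where
  toFun f := HomSp.mk (-((HomSp.toLin ε F.gr f).comp ((sgn F.internal).comp F.d))) (by
    have h1 : gradedHom ε F.gr ≤ (gradedHom ε F.gr).comap
        (-(LinearMap.lcomp k k ((sgn F.internal).comp F.d))) :=
      gradedHom_le fun n g hg => homPiece_le ε F.gr (n - 1) (homD_mem_piece ε F h𝒜 hg)
    exact h1 f.toLin_mem)
  map_add' f g := HomSp.ext fun x => by
    show - HomSp.toLin ε F.gr (f + g) (sgn F.internal (F.d x)) =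
      - HomSp.toLin ε F.gr f (sgn F.internal (F.d x)) +
        - HomSp.toLin ε F.gr g (sgn F.internal (F.d x))
    rw [map_add, LinearMap.add_apply, neg_add]
  map_smul' r f := HomSp.ext fun x => by
    show - HomSp.toLin ε F.gr (r • f) (sgn F.internal (F.d x)) =
      r • - HomSp.toLin ε F.gr f (sgn F.internal (F.d x))
    rw [map_smul, LinearMap.smul_apply, smul_neg]

theorem homD_apply (h𝒜 : ⨆ i, 𝒜 i = ⊤) (f : HomSp ε F.gr) (x : F.carrier) :
    HomSp.toLin ε F.gr (homD ε F h𝒜 f) x = - HomSp.toLin ε F.gr f (sgn F.internal (F.d x)) := rfl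

theorem homD_mem (h𝒜 : ⨆ i, 𝒜 i = ⊤) (n : ℤ) (f : HomSp ε F.gr) (hf : f ∈ homGr ε F.gr n) :
    homD ε F h𝒜 f ∈ homGr ε F.gr (n - 1) :=
  homD_mem_piece ε F h𝒜 hf

theorem homD_homD (h𝒜 : ⨆ i, 𝒜 i = ⊤) (f : HomSp ε F.gr) : homD ε F h𝒜 (homD ε F h𝒜 f) = 0 :=
  HomSp.ext fun x => by
    rw [homD_apply, homD_apply, sgn_d F.internal F.d F.d_mem, map_neg,
      sgn_sgn, F.d_d]
    simp

end HomK

end DG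

section Exterior

variable (k : Type u) [Field k] {c : ℕ}

/-- The exterior algebra over `k` on a vector space with basis `e 1, …, e c`. -/
abbrev Ext (c : ℕ) : Type u := ExteriorAlgebra k (Fin c → k)

/-- The generator `e i` of the exterior algebra. -/
def gen (i : Fin c) : Ext k c := ExteriorAlgebra.ι k (Pi.single i 1)

/-- The lower grading of the exterior algebra with `e i` in degree `deg i`: the part of degree `n`
is spanned by the products of generators with total degree `n`. -/
def extGr (deg : Fin c → ℕ) (n : ℤ) : Submodule k (Ext k c) :=
  Submodule.span k {x | ∃ l : List (Fin c), (l.map fun i => (deg i : ℤ)).sum = n ∧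
    x = (l.map (gen k)).prod}

variable {k}

theorem gen_sq (i : Fin c) : gen k i * gen k i = 0 := ExteriorAlgebra.ι_sq_zero _

theorem gen_anticomm (i j : Fin c) : gen k i * gen k j = - (gen k j * gen k i) :=
  eq_neg_of_add_eq_zero_left (ExteriorAlgebra.ι_add_mul_swap _ _)

theorem ext_induction {P : Submodule k (Ext k c)}
    (h : ∀ l : List (Fin c), (l.map (gen k)).prod ∈ P) (x : Ext k c) : x ∈ P := by
  have key : ∀ x : Ext k c,
      x ∈ Submodule.span k (Set.range fun l : List (Fin c) => (l.map (gen k)).prod) := by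
    intro x
    induction x using ExteriorAlgebra.induction with
    | algebraMap r =>
      rw [Algebra.algebraMap_eq_smul_one]
      exact Submodule.smul_mem _ _ (Submodule.subset_span ⟨[], by simp⟩)
    | ι v =>
      have hv : v = ∑ i, v i • (Pi.single i (1 : k) : Fin c → k) := by
        ext j; simp [Finset.sum_apply, Pi.single_apply]
      rw [hv, map_sum]
      refine sum_mem fun i _ => ?_
      rw [map_smul]
      exact Submodule.smul_mem _ _ (Submodule.subset_span ⟨[i], by simp [gen]⟩)
    | mul a b ha hb =>
      have := Submodule.mul_mem_mul ha hb
      rw [Submodule.span_mul_span] at this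
      refine Submodule.span_mono ?_ this
      rintro _ ⟨_, ⟨l, rfl⟩, _, ⟨l', rfl⟩, rfl⟩
      exact ⟨l ++ l', by simp⟩
    | add a b ha hb => exact add_mem ha hb
  refine (Submodule.span_le.2 ?_ : _ ≤ P) (key x)
  rintro _ ⟨l, rfl⟩
  exact h l

theorem prod_mem_extGr (deg : Fin c → ℕ) (l : List (Fin c)) :
    (l.map (gen k)).prod ∈ extGr k deg (l.map fun i => (deg i : ℤ)).sum :=
  Submodule.subset_span ⟨l, rfl, rfl⟩

theorem extGr_top (deg : Fin c → ℕ) : ⨆ n, extGr k deg n = ⊤ := by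
  rw [eq_top_iff]
  rintro x -
  exact ext_induction (fun l => Submodule.mem_iSup_of_mem _ (prod_mem_extGr deg l)) x

theorem extGr_le {deg : Fin c → ℕ} {n : ℤ} {P : Submodule k (Ext k c)}
    (h : ∀ l : List (Fin c), (l.map fun i => (deg i : ℤ)).sum = n → (l.map (gen k)).prod ∈ P)
    {x : Ext k c} (hx : x ∈ extGr k deg n) : x ∈ P := by
  refine (Submodule.span_le.2 ?_ : extGr k deg n ≤ P) hx
  rintro _ ⟨l, hl, rfl⟩
  exact h l hl

theorem extGr_mul {deg : Fin c → ℕ} {m n : ℤ} {x y : Ext k c} (hx : x ∈ extGr k deg m)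
    (hy : y ∈ extGr k deg n) : x * y ∈ extGr k deg (m + n) := by
  refine extGr_le (P := (extGr k deg (m + n)).comap (LinearMap.mulRight k y)) (fun l hl => ?_) hx
  refine extGr_le (P := (extGr k deg (m + n)).comap (LinearMap.mulLeft k _)) (fun l' hl' => ?_) hy
  exact Submodule.subset_span ⟨l ++ l', by simp [hl, hl'], by simp⟩

theorem gen_mem (deg : Fin c → ℕ) (i : Fin c) : gen k i ∈ extGr k deg (deg i) := by
  simpa using prod_mem_extGr (k := k) deg [i]

/-- A sum of anticommuting elements of square zero has square zero. -/
theorem sum_sq_zero {R : Type*} [Ring R] {ι : Type*} (s : Finset ι) (a : ι → R)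
    (h1 : ∀ i, a i * a i = 0) (h2 : ∀ i j, a i * a j = - (a j * a i)) :
    (∑ i ∈ s, a i) * (∑ i ∈ s, a i) = 0 := by
  classical
  induction s using Finset.induction with
  | empty => simp
  | insert i s hi ih =>
    rw [Finset.sum_insert hi, add_mul, mul_add, mul_add, ih, h1, Finset.mul_sum, Finset.sum_mul]
    simp [h2 i]

theorem extGr_internal (deg : Fin c → ℕ) : DirectSum.IsInternal (extGr k deg) := by
  let a : Fin c → AddMonoidAlgebra (Ext k c) ℤ := fun i =>
    AddMonoidAlgebra.single (deg i : ℤ) (gen k i)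
  let f : (Fin c → k) →ₗ[k] AddMonoidAlgebra (Ext k c) ℤ :=
    ∑ i, (LinearMap.toSpanSingleton k _ (a i)).comp (LinearMap.proj i)
  have hf : ∀ v, f v = ∑ i, v i • a i := fun v => by simp [f]
  have hsq : ∀ v, f v * f v = 0 := by
    intro v
    rw [hf]
    refine sum_sq_zero _ _ (fun i => ?_) (fun i j => ?_)
    · simp only [a, smul_mul_smul_comm, AddMonoidAlgebra.single_mul_single, gen_sq,
        AddMonoidAlgebra.single_zero, smul_zero]
    · simp only [a, smul_mul_smul_comm, AddMonoidAlgebra.single_mul_single]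
      rw [gen_anticomm i j, add_comm (deg i : ℤ), mul_comm (v i)]
      simp
  let D : Ext k c →ₐ[k] AddMonoidAlgebra (Ext k c) ℤ := ExteriorAlgebra.lift k ⟨f, hsq⟩
  have hD : ∀ i, D (gen k i) = AddMonoidAlgebra.single (deg i : ℤ) (gen k i) := by
    intro i
    show D (ExteriorAlgebra.ι k _) = _
    rw [ExteriorAlgebra.lift_ι_apply, hf, Finset.sum_eq_single i]
    · simp [a]
    · intro j _ hj; simp [hj]
    · simp
  have hDl : ∀ l : List (Fin c), D (l.map (gen k)).prod =
      AddMonoidAlgebra.single (l.map fun i => (deg i : ℤ)).sum (l.map (gen k)).prod := by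
    intro l
    induction l with
    | nil => simp
    | cons i l ih =>
      simp only [List.map_cons, List.prod_cons, List.sum_cons, map_mul, ih, hD,
        AddMonoidAlgebra.single_mul_single]
  refine isInternal_of_coact (extGr_top deg)
    ((AddMonoidAlgebra.coeffLinearEquiv k).toLinearMap.comp D.toLinearMap) ?_
  intro n x hx
  refine LinearMap.mem_eqLocus.1 (extGr_le (P := LinearMap.eqLocus _ (Finsupp.lsingle n))
    (fun l hl => ?_) hx)
  simp only [LinearMap.mem_eqLocus, LinearMap.comp_apply, AlgHom.toLinearMap_apply, hDl, hl]
  rfl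

theorem involute_of_mem {deg : Fin c → ℕ} (hdeg : ∀ i, Odd (deg i)) {n : ℤ} {x : Ext k c}
    (hx : x ∈ extGr k deg n) : CliffordAlgebra.involute x = ((-1 : k) ^ n) • x := by
  refine LinearMap.mem_eqLocus.1 (extGr_le
    (P := LinearMap.eqLocus (CliffordAlgebra.involute (Q := (0 : QuadraticForm k (Fin c → k)))
      ).toLinearMap (((-1 : k) ^ n) • LinearMap.id)) (fun l hl => ?_) hx)
  simp only [LinearMap.mem_eqLocus, AlgHom.toLinearMap_apply, LinearMap.smul_apply,
    LinearMap.id_apply]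
  subst hl
  clear hx
  induction l with
  | nil => simp
  | cons i l ih =>
    have h1 : CliffordAlgebra.involute (gen k i) = - gen k i := CliffordAlgebra.involute_ι _
    have h2 : (-1 : k) ^ (deg i : ℤ) = -1 := Odd.neg_one_zpow ((Int.odd_coe_nat _).2 (hdeg i))
    simp only [List.map_cons, List.prod_cons, List.sum_cons, map_mul, ih, h1]
    rw [zpow_add₀ (by simp), h2]
    simp

theorem involute_mem {deg : Fin c → ℕ} (hdeg : ∀ i, Odd (deg i)) {n : ℤ} {x : Ext k c}
    (hx : x ∈ extGr k deg n) : CliffordAlgebra.involute x ∈ extGr k deg n := by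
  rw [involute_of_mem hdeg hx]
  exact Submodule.smul_mem _ _ hx

theorem gen_mul (i : Fin c) (x : Ext k c) :
    gen k i * x = CliffordAlgebra.involute x * gen k i := by
  refine LinearMap.mem_eqLocus.1 (ext_induction (P := LinearMap.eqLocus
    (LinearMap.mulLeft k (gen k i)) ((LinearMap.mulRight k (gen k i)).comp
      (CliffordAlgebra.involute (Q := (0 : QuadraticForm k (Fin c → k)))).toLinearMap))
    (fun l => ?_) x)
  simp only [LinearMap.mem_eqLocus, LinearMap.mulLeft_apply, LinearMap.comp_apply,
    AlgHom.toLinearMap_apply, LinearMap.mulRight_apply]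
  induction l with
  | nil => simp
  | cons j l ih =>
    have h1 : CliffordAlgebra.involute (gen k j) = - gen k j := CliffordAlgebra.involute_ι _
    simp only [List.map_cons, List.prod_cons, map_mul, h1]
    rw [mul_assoc, ← ih, ← mul_assoc, ← mul_assoc, gen_anticomm i j]
    simp

end Exterior

section Resolution

open MvPolynomial

variable (k : Type u) [Field k] {c : ℕ} (deg : Fin c → ℕ)

/-- The polynomial ring `S = k[χ 1, …, χ c]`. -/
abbrev Poly (c : ℕ) : Type u := MvPolynomial (Fin c) k

/-- The upper degrees of the variables: `χ i` has upper degree `deg i + 1`. -/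
abbrev wt (i : Fin c) : ℕ := deg i + 1

/-- The grading of `S` by lower degrees; `χ i` has lower degree `-(deg i + 1)`. -/
abbrev sGr (n : ℤ) : Submodule k (Poly k c) := polyGr k (wt deg) n

/-- The graded dual `Γ = Hom_k(S, k)`. -/
abbrev Gam : Type u := HomSp (AlgHom.id k k) (sGr k deg)

/-- The grading of `Γ`. -/
abbrev gamGr (n : ℤ) : Submodule k (Gam k deg) := homGr (AlgHom.id k k) (sGr k deg) n

/-- The action of `S` on `Γ`, `(χ • α)(s) = α(χ s)`. -/
def gamAct : Poly k c →ₐ[k] Module.End k (Gam k deg) :=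
  homAct (AlgHom.id k k) (sGr k deg) (wt deg) (Algebra.lmul k (Poly k c))
    (fun i j x hx => by
      have h := (isWeightedHomogeneous_X k (fun i => -(wt deg i : ℤ)) i).mul
        (show IsWeightedHomogeneous _ x j from hx)
      have e : j - (wt deg i : ℤ) = -(wt deg i : ℤ) + j := by ring
      show X i * x ∈ polyGr k (wt deg) _
      rw [e]
      exact h)
    (fun i a x => by simp)

variable {deg}

/-- Dg `Λ`-modules, `Λ` the exterior algebra on `e i` of degree `deg i`. -/
abbrev DGExt (deg : Fin c → ℕ) := DGModule (extGr k deg)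

/-- Dg `S`-modules. -/
abbrev DGPoly (deg : Fin c → ℕ) := DGModule (sGr k deg)

variable {k} (M : DGExt k deg)

/-- The vector space underlying the universal resolution, `Λ ⊗ Γ ⊗ M`. -/
abbrev UnivSp : Type u := Ext k c ⊗[k] (Gam k deg ⊗[k] M.carrier)

/-- The grading of the universal resolution. -/
abbrev univGr (n : ℤ) : Submodule k (UnivSp M) :=
  tensorGr (extGr k deg) (tensorGr (gamGr k deg) M.gr) n

theorem univGr_internal : DirectSum.IsInternal (univGr M) :=
  tensor_internal (extGr_internal deg)
    (tensor_internal (homGr_internal _ (polyGr_internal (wt deg))) M.internal)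

theorem univ_ext {Z : Type*} [AddCommGroup Z] [Module k Z] {f g : UnivSp M →ₗ[k] Z}
    (h : ∀ a γ m, f (a ⊗ₜ[k] (γ ⊗ₜ[k] m)) = g (a ⊗ₜ[k] (γ ⊗ₜ[k] m))) : f = g := by
  refine TensorProduct.ext (LinearMap.ext fun a => ?_)
  exact TensorProduct.ext' fun γ m => h a γ m

theorem univ_mem {n : ℤ} {Z : Type*} [AddCommGroup Z] [Module k Z] {P : Submodule k Z}
    {f : UnivSp M →ₗ[k] Z}
    (h : ∀ p q r a γ m, p + (q + r) = n → a ∈ extGr k deg p → γ ∈ gamGr k deg q → m ∈ M.gr r →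
      f (a ⊗ₜ[k] (γ ⊗ₜ[k] m)) ∈ P) {t : UnivSp M} (ht : t ∈ univGr M n) : f t ∈ P := by
  refine tensorGr_map (fun p s a y hn ha hy => ?_) ht
  refine tensorGr_map (f := f.comp (TensorProduct.mk k _ _ a)) (fun q r γ m hs hγ hm => ?_) hy
  exact h p q r a γ m (by omega) ha hγ hm

/-- The sign involution of `Λ`, `a ↦ (-1)^{|a|} a` (all generators have odd degree). -/
abbrev inv : Ext k c →ₗ[k] Ext k c :=
  (CliffordAlgebra.involute (Q := (0 : QuadraticForm k (Fin c → k)))).toLinearMap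

/-- Multiplication by `e i` on a dg `Λ`-module. -/
abbrev eAct (i : Fin c) : M.carrier →ₗ[k] M.carrier := Algebra.lsmul k k M.carrier (gen k i)

/-- The summand `1 ⊗ 1 ⊗ ∂` of the differential (with the sign from moving `∂` past `Λ`). -/
def univD0 : Module.End k (UnivSp M) :=
  TensorProduct.map inv (TensorProduct.map LinearMap.id M.d)

/-- The summand `1 ⊗ χ i ⊗ e i - e i ⊗ χ i ⊗ 1` of the differential (with the sign from moving
the odd `e i` past `Λ`; the degrees of `Γ` are even). -/
def univD1 (i : Fin c) : Module.End k (UnivSp M) :=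
  TensorProduct.map inv (TensorProduct.map (gamAct k deg (X i)) (eAct M i)) -
    TensorProduct.map (LinearMap.mulLeft k (gen k i))
      (TensorProduct.map (gamAct k deg (X i)) LinearMap.id)

/-- The differential `1 ⊗ 1 ⊗ ∂ + ∑ i, (1 ⊗ χ i ⊗ e i - e i ⊗ χ i ⊗ 1)` of the universal
resolution. -/
def univD : Module.End k (UnivSp M) := univD0 M + ∑ i, univD1 M i

theorem univD0_tmul (a : Ext k c) (γ : Gam k deg) (m : M.carrier) :
    univD0 M (a ⊗ₜ (γ ⊗ₜ m)) = CliffordAlgebra.involute a ⊗ₜ (γ ⊗ₜ M.d m) := rfl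

theorem univD1_tmul (i : Fin c) (a : Ext k c) (γ : Gam k deg) (m : M.carrier) :
    univD1 M i (a ⊗ₜ (γ ⊗ₜ m)) =
      CliffordAlgebra.involute a ⊗ₜ (gamAct k deg (X i) γ ⊗ₜ (gen k i • m)) -
      (gen k i * a) ⊗ₜ (gamAct k deg (X i) γ ⊗ₜ m) := rfl

theorem d_gen (hdeg : ∀ i, Odd (deg i)) (i : Fin c) (m : M.carrier) :
    M.d (gen k i • m) = - (gen k i • M.d m) := by
  rw [M.d_smul m (gen_mem deg i), Odd.neg_one_zpow ((Int.odd_coe_nat _).2 (hdeg i)), neg_smul,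
    one_smul]

theorem involute_gen (i : Fin c) :
    CliffordAlgebra.involute (gen k i) = - gen k i := CliffordAlgebra.involute_ι _

theorem gen_smul_anticomm (i j : Fin c) (m : M.carrier) :
    gen k i • gen k j • m = - (gen k j • gen k i • m) := by
  rw [← mul_smul, ← mul_smul, gen_anticomm, neg_smul]

theorem gen_smul_sq (i : Fin c) (m : M.carrier) : gen k i • gen k i • m = 0 := by
  rw [← mul_smul, gen_sq, zero_smul]

theorem gamAct_comm (i j : Fin c) (γ : Gam k deg) :
    gamAct k deg (X i) (gamAct k deg (X j) γ) = gamAct k deg (X j) (gamAct k deg (X i) γ) := by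
  rw [← Module.End.mul_apply, ← Module.End.mul_apply, ← map_mul, ← map_mul, mul_comm]

theorem univD0_sq : univD0 M * univD0 M = 0 := by
  refine univ_ext M fun a γ m => ?_
  simp [univD0_tmul, M.d_d]

theorem univD0_D1 (hdeg : ∀ i, Odd (deg i)) (i : Fin c) :
    univD0 M * univD1 M i + univD1 M i * univD0 M = 0 := by
  refine univ_ext M fun a γ m => ?_
  simp [univD0_tmul, univD1_tmul, d_gen M hdeg, TensorProduct.tmul_neg, TensorProduct.neg_tmul,
    involute_gen]

theorem univD1_anticomm (i j : Fin c) : univD1 M i * univD1 M j = - (univD1 M j * univD1 M i) := by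
  refine univ_ext M fun a γ m => ?_
  have h1 : gen k i * (gen k j * a) = - (gen k j * (gen k i * a)) := by
    rw [← mul_assoc, gen_anticomm, neg_mul, mul_assoc]
  simp only [Module.End.mul_apply, univD1_tmul, map_sub, map_mul, involute_gen,
    CliffordAlgebra.involute_involute, gen_smul_anticomm M i j, gamAct_comm i j, h1,
    TensorProduct.tmul_neg, TensorProduct.neg_tmul, LinearMap.neg_apply, neg_mul]
  abel

theorem univD1_sq (i : Fin c) : univD1 M i * univD1 M i = 0 := by
  refine univ_ext M fun a γ m => ?_
  have h1 : gen k i * (gen k i * a) = 0 := by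
    rw [← mul_assoc, gen_sq, zero_mul]
  simp [univD1_tmul, involute_gen, gen_smul_sq, h1, TensorProduct.neg_tmul]

theorem univD_sq (hdeg : ∀ i, Odd (deg i)) : univD M * univD M = 0 := by
  have h1 := sum_sq_zero Finset.univ (univD1 M) (univD1_sq M) (univD1_anticomm M)
  have h2 : univD0 M * (∑ i, univD1 M i) + (∑ i, univD1 M i) * univD0 M = 0 := by
    rw [Finset.mul_sum, Finset.sum_mul, ← Finset.sum_add_distrib]
    exact Finset.sum_eq_zero fun i _ => univD0_D1 M hdeg i
  rw [univD, add_mul, mul_add, mul_add, univD0_sq, h1, zero_add, add_zero, h2]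

theorem gamAct_mem (i : Fin c) {j : ℤ} {γ : Gam k deg} (hγ : γ ∈ gamGr k deg j) :
    gamAct k deg (X i) γ ∈ gamGr k deg (j - wt deg i) :=
  homAct_mem _ _ _ _ _ _ i j γ hγ

theorem univD_mem (hdeg : ∀ i, Odd (deg i)) (n : ℤ) (t : UnivSp M) (ht : t ∈ univGr M n) :
    univD M t ∈ univGr M (n - 1) := by
  refine univ_mem M (fun p q r a γ m hn ha hγ hm => ?_) ht
  rw [univD, LinearMap.add_apply, LinearMap.sum_apply]
  refine add_mem ?_ (sum_mem fun i _ => ?_)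
  · rw [univD0_tmul]
    exact tmul_mem (involute_mem hdeg ha) (tmul_mem hγ (M.d_mem r m hm) rfl) (by omega)
  · rw [univD1_tmul]
    have h1 := gamAct_mem i hγ
    refine sub_mem (tmul_mem (involute_mem hdeg ha)
      (tmul_mem h1 (M.smul_mem (gen_mem deg i) hm) rfl) ?_)
      (tmul_mem (extGr_mul (gen_mem deg i) ha) (tmul_mem h1 hm rfl) ?_)
    · push_cast; omega
    · push_cast; omega

theorem univD_smul (a : Ext k c) (t : UnivSp M) :
    univD M (a • t) = CliffordAlgebra.involute a • univD M t := by
  have : (univD M).comp (Algebra.lsmul k k (UnivSp M) a) =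
      (Algebra.lsmul k k (UnivSp M) (CliffordAlgebra.involute a)).comp (univD M) := by
    refine univ_ext M fun b γ m => ?_
    have h : ∀ i, gen k i * (a * b) = CliffordAlgebra.involute a * (gen k i * b) := fun i => by
      rw [← mul_assoc, gen_mul, mul_assoc]
    simp only [LinearMap.comp_apply, Algebra.lsmul_coe, TensorProduct.smul_tmul', smul_eq_mul,
      univD, LinearMap.add_apply, LinearMap.sum_apply, univD0_tmul, univD1_tmul, map_mul, smul_add,
      Finset.smul_sum, smul_sub, h]
  exact LinearMap.congr_fun this t

/-- The universal resolution of a dg `Λ`-module. -/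
def univ (hdeg : ∀ i, Odd (deg i)) : DGExt k deg where
  carrier := UnivSp M
  gr := univGr M
  internal := univGr_internal M
  smul_mem := by
    intro i j a t ha ht
    refine univ_mem M (f := (Algebra.lsmul k k (UnivSp M) a)) (fun p q r b γ m hn hb hγ hm => ?_) ht
    exact tmul_mem (extGr_mul ha hb) (tmul_mem hγ hm rfl) (by omega)
  d := univD M
  d_mem := univD_mem M hdeg
  d_d := fun t => LinearMap.congr_fun (univD_sq M hdeg) t
  d_smul := by
    intro i a t ha
    rw [univD_smul, involute_of_mem hdeg ha, smul_assoc]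

/-- The action of `S` on the universal resolution through `Γ`. -/
def univAct : Poly k c →ₐ[k] Module.End k (UnivSp M) :=
  (Module.End.lTensorAlgHom k (Gam k deg ⊗[k] M.carrier) (Ext k c)).comp
    ((Module.End.rTensorAlgHom k (Gam k deg) M.carrier).comp (gamAct k deg))

theorem univAct_tmul (s : Poly k c) (a : Ext k c) (γ : Gam k deg) (m : M.carrier) :
    univAct M s (a ⊗ₜ (γ ⊗ₜ m)) = a ⊗ₜ (gamAct k deg s γ ⊗ₜ m) := rfl

theorem univAct_deg (i : Fin c) (j : ℤ) (t : UnivSp M) (ht : t ∈ univGr M j) :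
    univAct M (X i) t ∈ univGr M (j - wt deg i) := by
  refine univ_mem M (fun p q r a γ m hn ha hγ hm => ?_) ht
  rw [univAct_tmul]
  exact tmul_mem ha (tmul_mem (gamAct_mem i hγ) hm rfl) (by omega)

theorem univAct_smul (i : Fin c) (a : Ext k c) (t : UnivSp M) :
    univAct M (X i) (a • t) = a • univAct M (X i) t := by
  have : (univAct M (X i)).comp (Algebra.lsmul k k (UnivSp M) a) =
      (Algebra.lsmul k k (UnivSp M) a).comp (univAct M (X i)) :=
    univ_ext M fun b γ m => by
      simp [univAct_tmul, TensorProduct.smul_tmul']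
  exact LinearMap.congr_fun this t

theorem univAct_d (i : Fin c) (t : UnivSp M) :
    univAct M (X i) (univD M t) = univD M (univAct M (X i) t) := by
  have : (univAct M (X i)).comp (univD M) = (univD M).comp (univAct M (X i)) :=
    univ_ext M fun b γ m => by
      simp only [LinearMap.comp_apply, univD, LinearMap.add_apply, LinearMap.sum_apply,
        univD0_tmul, univD1_tmul, map_add, map_sum, map_sub, univAct_tmul, gamAct_comm i]
  exact LinearMap.congr_fun this t

theorem sgn_even {k : Type*} [Field k] {X : Type*} [AddCommGroup X] [Module k X]
    {gr : ℤ → Submodule k X} (h : DirectSum.IsInternal gr) (T : X →ₗ[k] X) {e : ℕ} (he : Even e)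
    (hT : ∀ j x, x ∈ gr j → T x ∈ gr (j - e)) (x : X) : sgn h (T x) = T (sgn h x) := by
  have : (sgn h).comp T = T.comp (sgn h) := ext_gr h fun i x hx => by
    have h1 : (-1 : k) ^ (i - (e : ℤ)) = (-1) ^ i := by
      rw [zpow_sub₀ (by simp), Even.neg_one_zpow ((Int.even_coe_nat e).2 he), div_one]
    simp [sgn_of_mem h hx, sgn_of_mem h (hT i x hx), h1]
  exact LinearMap.congr_fun this x

theorem wt_even (hdeg : ∀ i, Odd (deg i)) (i : Fin c) : Even (wt deg i) := (hdeg i).add_one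

/-- A dg `S`-module from a complex on which the variables of `S` act. -/
def DGPoly.ofAct (hdeg : ∀ i, Odd (deg i)) (C : Type u) [AddCommGroup C] [Module k C]
    (gr : ℤ → Submodule k C) (internal : DirectSum.IsInternal gr) (d : C →ₗ[k] C)
    (d_mem : ∀ (i : ℤ) (x : C), x ∈ gr i → d x ∈ gr (i - 1)) (d_d : ∀ x : C, d (d x) = 0)
    (ψ : Poly k c →ₐ[k] Module.End k C)
    (hψ : ∀ i j x, x ∈ gr j → ψ (X i) x ∈ gr (j - wt deg i))
    (hd : ∀ i x, d (ψ (X i) x) = ψ (X i) (d x)) : DGPoly k deg :=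
  letI : Module (Poly k c) C := Module.compHom C ψ.toRingHom
  { carrier := C
    tower := ⟨fun r s x => by
      show ψ (r • s) x = r • ψ s x
      rw [map_smul]; rfl⟩
    gr := gr
    internal := internal
    smul_mem := fun hs hx => act_mem (wt deg) ψ hψ hs hx
    d := d
    d_mem := d_mem
    d_d := d_d
    d_smul := by
      intro i s x hs
      have h1 : d (ψ s x) = ψ s (d x) :=
        LinearMap.congr_fun (act_comm ψ d (fun i => LinearMap.ext (hd i)) s).eq x
      show d (ψ s x) = (-1 : k) ^ i • ψ s (d x)
      rcases polyGr_even (wt deg) (wt_even hdeg) hs (ψ s (d x)) with h | h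
      · rw [h, h1]
      · rw [h]; simp }

/-- The action of `S` on the dg module `u M`. -/
def univActDG (hdeg : ∀ i, Odd (deg i)) : Poly k c →ₐ[k] Module.End k (univ M hdeg).carrier :=
  univAct M

/-- The functor `d` on objects: the dg `S`-module `d M = Hom_Λ(u M, k)`, with `S` acting through
the universal resolution `u M`. -/
def dgDual (hdeg : ∀ i, Odd (deg i)) : DGPoly k deg :=
  DGPoly.ofAct hdeg (HomSp (ExteriorAlgebra.algebraMapInv : Ext k c →ₐ[k] k) (univ M hdeg).gr)
    (homGr _ _) (homGr_internal _ (univ M hdeg).internal)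
    (homD _ (univ M hdeg) (extGr_top deg)) (homD_mem _ _ _) (homD_homD _ _ _)
    (homAct _ (univ M hdeg).gr (wt deg) (univActDG M hdeg) (univAct_deg M) (univAct_smul M))
    (homAct_mem _ _ _ _ _ _)
    (fun i f => HomSp.ext fun x => by
      have h1 : univActDG M hdeg (X i) (sgn (univ M hdeg).internal ((univ M hdeg).d x)) =
          sgn (univ M hdeg).internal ((univ M hdeg).d (univActDG M hdeg (X i) x)) :=
        (sgn_even (univ M hdeg).internal (univActDG M hdeg (X i)) (wt_even hdeg i)
          (univAct_deg M i) _).symm.trans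
          (congrArg (sgn (univ M hdeg).internal) (univAct_d M i x))
      exact congrArg (fun z => - HomSp.toLin _ _ f z) h1)

end Resolution

section Diagonal

open MvPolynomial

variable {k : Type u} [Field k] {c : ℕ} {deg : Fin c → ℕ}

/-- The Hopf diagonal `Δ : S → S ⊗ S`, `χ i ↦ χ i ⊗ 1 + 1 ⊗ χ i`. -/
def diag (k : Type u) [Field k] (c : ℕ) : Poly k c →ₐ[k] Poly k c ⊗[k] Poly k c :=
  aeval fun i => X i ⊗ₜ[k] 1 + 1 ⊗ₜ[k] X i

/-- The action of `S` on `P ⊗_k Q` through the diagonal, where `S ⊗ S` acts by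
`(s ⊗ t)(x ⊗ y) = s x ⊗ t y` (all degrees of `S` are even). -/
def diagAct (P Q : DGPoly k deg) : Poly k c →ₐ[k] Module.End k (P.carrier ⊗[k] Q.carrier) :=
  ((Module.endTensorEndAlgHom (R := k) (S := k) (A := k) (M := P.carrier)
      (N := Q.carrier)).comp
    (Algebra.TensorProduct.map (Algebra.lsmul k k P.carrier) (Algebra.lsmul k k Q.carrier))).comp
    (diag k c)

theorem diagAct_X (P Q : DGPoly k deg) (i : Fin c) (x : P.carrier) (y : Q.carrier) :
    diagAct P Q (X i) (x ⊗ₜ y) = ((X i : Poly k c) • x) ⊗ₜ y + x ⊗ₜ ((X i : Poly k c) • y) := by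
  simp [diagAct, diag, Module.endTensorEndAlgHom_apply]

theorem d_X (hdeg : ∀ i, Odd (deg i)) (P : DGPoly k deg) (i : Fin c) (x : P.carrier) :
    P.d ((X i : Poly k c) • x) = (X i : Poly k c) • P.d x := by
  rw [P.d_smul x (X_mem_polyGr (wt deg) i),
    Even.neg_one_zpow ((Int.even_coe_nat _).2 (wt_even hdeg i)).neg, one_smul]

theorem X_smul_mem (P : DGPoly k deg) {i : Fin c} {j : ℤ} {x : P.carrier} (hx : x ∈ P.gr j) :
    (X i : Poly k c) • x ∈ P.gr (j - wt deg i) := by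
  have := P.smul_mem (X_mem_polyGr (wt deg) i) hx
  rwa [neg_add_eq_sub] at this

/-- The dg `S`-module `P ⊗_k Q`, with `S` acting through the diagonal. -/
def diagTensor (hdeg : ∀ i, Odd (deg i)) (P Q : DGPoly k deg) : DGPoly k deg :=
  DGPoly.ofAct hdeg (P.carrier ⊗[k] Q.carrier) (tensorGr P.gr Q.gr)
    (tensor_internal P.internal Q.internal) (tensorD P.internal P.d Q.d)
    (tensorD_mem P.internal P.d_mem Q.d_mem) (tensorD_tensorD P.internal P.d_mem P.d_d Q.d_d)
    (diagAct P Q)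
    (fun i j t ht => by
      refine tensorGr_map (fun p q x y hn hx hy => ?_) ht
      rw [diagAct_X]
      exact add_mem (tmul_mem (X_smul_mem P hx) hy (by omega))
        (tmul_mem hx (X_smul_mem Q hy) (by omega)))
    (fun i t => by
      induction t with
      | zero => simp
      | add s t hs ht => simp only [map_add, hs, ht]
      | tmul x y =>
        have h1 : sgn P.internal ((X i : Poly k c) • x) = (X i : Poly k c) • sgn P.internal x :=
          sgn_even P.internal (Algebra.lsmul k k P.carrier (X i : Poly k c)) (wt_even hdeg i)
            (fun j x hx => X_smul_mem P hx) x
        simp only [diagAct_X, map_add, tensorD_tmul, d_X hdeg, h1]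
        abel)

end Diagonal

section Support

open MvPolynomial

/-- The polynomial ring on variables of positive degrees `w i`, as an `ℕ`-graded ring. -/
abbrev projGr (k : Type*) [Field k] {σ : Type*} (w : σ → ℕ) : ℕ → Submodule k (MvPolynomial σ k) :=
  weightedHomogeneousSubmodule k w

instance (k : Type*) [Field k] {σ : Type*} (w : σ → ℕ) : GradedAlgebra (projGr k w) :=
  weightedGradedAlgebra k w

variable (k : Type u) [Field k] {c : ℕ} (deg : Fin c → ℕ)

/-- `Proj S`, with the Zariski topology; `S` is graded by upper degrees. -/
abbrev ProjS : Type u := ProjectiveSpectrum (projGr k (wt deg))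

/-- `Proj (S ⊗ S)`, where `S ⊗ S = Sym (W ⊕ W)` is a polynomial ring on two copies of the
variables. -/
abbrev ProjSS : Type u := ProjectiveSpectrum (projGr k (Sum.elim (wt deg) (wt deg)))

/-- The identification `S ⊗ S = Sym (W ⊕ W)`. -/
def tensorToSum (c : ℕ) : Poly k c ⊗[k] Poly k c →ₐ[k] MvPolynomial (Fin c ⊕ Fin c) k :=
  Algebra.TensorProduct.lift (rename Sum.inl) (rename Sum.inr) (fun _ _ => Commute.all _ _)

/-- The diagonal `Δ` as a map into `Sym (W ⊕ W)`. -/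
def diagSum (c : ℕ) : Poly k c →ₐ[k] MvPolynomial (Fin c ⊕ Fin c) k :=
  (tensorToSum k c).comp (diag k c)

variable {k deg}

/-- The largest homogeneous ideal `I ⊆ S^{>0}` that defines a subset of `Proj S`. In particular the
empty set is defined by `S^{>0}`. -/
def defIdeal (U : Set (ProjS k deg)) : Ideal (Poly k c) :=
  (ProjectiveSpectrum.vanishingIdeal U).toIdeal ⊓
    (HomogeneousIdeal.irrelevant (projGr k (wt deg))).toIdeal

/-- `J(U, V) = Proj (S/I ⊗ S/J)` as a closed subset of `Proj (S ⊗ S)`, for `I` and `J` the ideals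
of `U` and `V`. -/
def prodLocus (U V : Set (ProjS k deg)) : Set (ProjSS k deg) :=
  {P | (defIdeal U).map (rename Sum.inl : _ →ₐ[k] MvPolynomial (Fin c ⊕ Fin c) k) ≤
      P.asHomogeneousIdeal.toIdeal ∧
    (defIdeal V).map (rename Sum.inr : _ →ₐ[k] MvPolynomial (Fin c ⊕ Fin c) k) ≤
      P.asHomogeneousIdeal.toIdeal}

/-- The anti-diagonal in `Proj (S ⊗ S)`: the zero locus of the `χ i ⊗ 1 + 1 ⊗ χ i`. -/
def antiDiagonal (k : Type u) [Field k] (deg : Fin c → ℕ) : Set (ProjSS k deg) :=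
  {P | ∀ i, diagSum k c (X i) ∈ P.asHomogeneousIdeal.toIdeal}

/-- The join of two closed subsets of `Proj S`: the closure of `δ (J(U, V) ∖ D)`, where `D` is the
anti-diagonal and `δ : Proj (S ⊗ S) ∖ D → Proj S` sends a prime to its preimage under `Δ`. -/
def join (U V : Set (ProjS k deg)) : Set (ProjS k deg) :=
  closure {p | ∃ P ∈ prodLocus U V \ antiDiagonal k deg,
    p.asHomogeneousIdeal.toIdeal = P.asHomogeneousIdeal.toIdeal.comap (diagSum k c)}

/-- The homogeneous elements of `S` outside a homogeneous prime. -/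
def homogeneousCompl (p : ProjS k deg) : Submonoid (Poly k c) where
  carrier := {s | (∃ n, s ∈ projGr k (wt deg) n) ∧ s ∉ p.asHomogeneousIdeal.toIdeal}
  one_mem' := ⟨⟨0, isWeightedHomogeneous_one k _⟩,
    (Ideal.ne_top_iff_one _).1 p.isPrime.ne_top⟩
  mul_mem' := by
    rintro a b ⟨⟨m, ha⟩, ha'⟩ ⟨⟨n, hb⟩, hb'⟩
    exact ⟨⟨m + n, IsWeightedHomogeneous.mul ha hb⟩, fun h => (p.isPrime.mem_or_mem h).elim ha' hb'⟩

/-- The support of an `S`-module: the `p` in `Proj S` with non-zero homogeneous localization. -/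
def Supp (deg : Fin c → ℕ) (H : Type u) [AddCommGroup H] [Module (Poly k c) H] :
    Set (ProjS k deg) :=
  {p | Nontrivial (LocalizedModule (homogeneousCompl p) H)}

/-- The differential of a dg `S`-module is `S`-linear, as `S` sits in even degrees. -/
def dLin (hdeg : ∀ i, Odd (deg i)) (P : DGPoly k deg) : P.carrier →ₗ[Poly k c] P.carrier where
  toFun := P.d
  map_add' := map_add _
  map_smul' := by
    intro s x
    exact LinearMap.congr_fun (act_comm (Algebra.lsmul k k P.carrier) P.d
      (fun i => LinearMap.ext (d_X hdeg P i)) s).eq x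

/-- The homology of a dg `S`-module, as an `S`-module. -/
abbrev polyHomology (hdeg : ∀ i, Odd (deg i)) (P : DGPoly k deg) : Type u :=
  LinearMap.ker (dLin hdeg P) ⧸
    (LinearMap.range (dLin hdeg P)).comap (LinearMap.ker (dLin hdeg P)).subtype

/-- The cohomological support `V^d_Λ(M) = Supp_S H(d M)`. -/
def cohSupport (hdeg : ∀ i, Odd (deg i)) (M : DGExt k deg) : Set (ProjS k deg) :=
  Supp deg (polyHomology hdeg (dgDual M hdeg))

end Support

end

end DGJoin

/-!
# Duality and supports for dg modules over an exterior algebra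

Dual side. A `Λ`-linear map from the universal resolution `Λ ⊗ (Γ ⊗ M)` to `k` is the same as a functional on
`Γ ⊗ M`, so `d M` is the graded `k`-dual of the dg `S`-module `K M = Γ ⊗ M` with differential
`1 ⊗ ∂ + ∑ χ i ⊗ e i` (`dgDualToDual`). The functor `K` preserves quasi-isomorphisms
(`DGHom.IsQuasiIso.Kmap`): `Γ ⊗ M` is filtered by the powers of the variables, which act on it by surjective,
locally nilpotent maps, and the elements killed by all of them form the complex `M`. Over a field,
quasi-isomorphisms are homotopy equivalences, hence are also preserved by duals and by tensor products.

Tensor products. The product of `Γ`, which is dual to the map `Δ` on `S`, gives a morphism of dg `S`-modules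
`K F ⊗ K N → K (F ⊗_Λ N)`. For `F = Λ` it is a quasi-isomorphism, since the Koszul complex `K Λ` contracts to
`k` (`koszul_acyclic`); for semifree `F` its mapping cone is built from copies of the cone for `Λ`, level by
level (`IsSemifree.kMul_isQuasiIso`). The tensor product of the duals of `K F` and `K N` maps to the dual of
`K F ⊗ K N`, by a quasi-isomorphism if both complexes retract, up to homotopy, to complexes that are
degreewise finite-dimensional and bounded below (`dualTensor_isQuasiIso`). This property holds for `M` and `N`
by the assumptions on their homology, and passes from `M` to `K M` by the perturbation lemma
(`HasFiniteType.K`). Together this is `derivedIso_dgDual_tensorOver`.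

Supports. By the Künneth isomorphism, the homology of `d M ⊗ d N` is `X ⊗ Y` with `X = H(d M)` and
`Y = H(d N)`, compatibly with the action of `S ⊗ S` (`exists_kunneth`). If `H(M)` is finite-dimensional, then
`X` is finitely generated over `S` (`exists_fg_cycles`, by perturbation once more), so that its support is the
zero locus of its annihilator, a homogeneous ideal; likewise for `Y`. As `k` is a field, the annihilator of
`X ⊗ Y` in `S ⊗ S` is `ann X ⊗ S + S ⊗ ann Y` (`tAct_eq_zero_iff`). Hence a prime `q` lies in the support of
`X ⊗ Y` if and only if `Δ` maps no homogeneous element outside `q` into this ideal. In that case some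
homogeneous prime `P` of `S ⊗ S` contains the ideal and satisfies `Δ⁻¹(P) ⊆ q`, that is, `q` lies in the
closure of the point `Δ⁻¹(P)` of the join (`mem_join`). The annihilators are proper ideals, hence contained in
`S^{>0}`, because `X` and `Y` are non-zero when `H(M)` and `H(N)` are: acyclicity is reflected by `K`
(`K_acyclic_iff`) and by duals (`dual_acyclic_iff`).
-/

namespace DGJoin

noncomputable section

/-! ### Homogeneous maps and generalized inverses -/

section HomogeneousMaps

variable {k : Type*} [Field k] {X Y Z : Type*} [AddCommGroup X] [Module k X]
  [AddCommGroup Y] [Module k Y] [AddCommGroup Z] [Module k Z]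
  {gX : ℤ → Submodule k X} {gY : ℤ → Submodule k Y} {gZ : ℤ → Submodule k Z}

/-- A linear map between graded vector spaces is homogeneous of degree `e`. -/
def IsHom (gX : ℤ → Submodule k X) (gY : ℤ → Submodule k Y) (e : ℤ) (f : X →ₗ[k] Y) : Prop :=
  ∀ n x, x ∈ gX n → f x ∈ gY (n + e)

theorem IsHom.comp {e e' : ℤ} {g : Y →ₗ[k] Z} {f : X →ₗ[k] Y} (hg : IsHom gY gZ e' g)
    (hf : IsHom gX gY e f) {e'' : ℤ} (h : e + e' = e'') : IsHom gX gZ e'' (g.comp f) := by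
  intro n x hx
  have := hg _ _ (hf n x hx)
  rwa [add_assoc, h] at this

theorem IsHom.add {e : ℤ} {f g : X →ₗ[k] Y} (hf : IsHom gX gY e f) (hg : IsHom gX gY e g) :
    IsHom gX gY e (f + g) := fun n x hx => add_mem (hf n x hx) (hg n x hx)

theorem IsHom.sub {e : ℤ} {f g : X →ₗ[k] Y} (hf : IsHom gX gY e f) (hg : IsHom gX gY e g) :
    IsHom gX gY e (f - g) := fun n x hx => sub_mem (hf n x hx) (hg n x hx)

theorem isHom_id : IsHom gX gX 0 LinearMap.id := fun n x hx => by simpa using hx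

theorem isHom_zero (e : ℤ) : IsHom gX gY e 0 := fun n x _ => by simp

theorem proj_mem (h : DirectSum.IsInternal gX) (i : ℤ) (x : X) : proj h i x ∈ gX i := by
  refine mem_of_top h (P := (gX i).comap (proj h i)) (fun j y hy => ?_) x
  show proj h i y ∈ gX i
  rw [proj_of_mem h hy]
  split_ifs with hij
  · exact hij ▸ hy
  · exact zero_mem _

theorem proj_self (h : DirectSum.IsInternal gX) {i : ℤ} {x : X} (hx : x ∈ gX i) :
    proj h i x = x := by simp [proj_of_mem h hx]

theorem proj_isHom (hX : DirectSum.IsInternal gX) (hY : DirectSum.IsInternal gY) {e : ℤ}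
    {f : X →ₗ[k] Y} (hf : IsHom gX gY e f) (n : ℤ) (x : X) :
    proj hY (n + e) (f x) = f (proj hX n x) := by
  have : (proj hY (n + e)).comp f = f.comp (proj hX n) := by
    refine ext_gr hX fun i x hx => ?_
    rw [LinearMap.comp_apply, LinearMap.comp_apply, proj_of_mem hX hx, proj_of_mem hY (hf i x hx)]
    by_cases h : i = n
    · simp [h]
    · simp [h]
  exact LinearMap.congr_fun this x

/-- A subspace that contains all homogeneous components of an element contains the element. -/
theorem mem_of_proj (h : DirectSum.IsInternal gX) {P : Submodule k X} {x : X}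
    (hx : ∀ i, proj h i x ∈ P) : x ∈ P := by
  have e : (Finsupp.lsum k (fun _ : ℤ => (LinearMap.id : X →ₗ[k] X))).comp (coact h)
      = LinearMap.id := by
    refine ext_gr h fun i y hy => ?_
    simp [coact_of_mem h hy]
  have e' := LinearMap.congr_fun e x
  rw [LinearMap.id_apply] at e'
  rw [← e']
  exact sum_mem fun i _ => hx i

theorem eq_zero_of_proj (h : DirectSum.IsInternal gX) {x : X} (hx : ∀ i, proj h i x = 0) :
    x = 0 :=
  (Submodule.mem_bot k).1 (mem_of_proj h fun i => (Submodule.mem_bot k).2 (hx i))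

/-- The part of degree `e` of a linear map. -/
def homPart (hX : DirectSum.IsInternal gX) (hY : DirectSum.IsInternal gY) (e : ℤ)
    (f : X →ₗ[k] Y) : X →ₗ[k] Y :=
  (Finsupp.lsum k (fun n : ℤ => (proj hY (n + e)).comp f)).comp (coact hX)

theorem homPart_of_mem (hX : DirectSum.IsInternal gX) (hY : DirectSum.IsInternal gY) (e : ℤ)
    (f : X →ₗ[k] Y) {n : ℤ} {x : X} (hx : x ∈ gX n) :
    homPart hX hY e f x = proj hY (n + e) (f x) := by
  simp [homPart, coact_of_mem hX hx]

theorem isHom_homPart (hX : DirectSum.IsInternal gX) (hY : DirectSum.IsInternal gY) (e : ℤ)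
    (f : X →ₗ[k] Y) : IsHom gX gY e (homPart hX hY e f) := fun n x hx => by
  rw [homPart_of_mem hX hY e f hx]; exact proj_mem hY _ _

/-- Maps of odd degree anticommute with the sign involution. -/
theorem sgn_odd (hX : DirectSum.IsInternal gX) (hY : DirectSum.IsInternal gY) {e : ℤ}
    (he : Odd e) {f : X →ₗ[k] Y} (hf : IsHom gX gY e f) (x : X) :
    sgn hY (f x) = - f (sgn hX x) := by
  have : (sgn hY).comp f = - f.comp (sgn hX) := by
    refine ext_gr hX fun i x hx => ?_
    simp [sgn_of_mem hX hx, sgn_of_mem hY (hf i x hx), zpow_add₀, he.neg_one_zpow]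
  exact LinearMap.congr_fun this x

theorem sgn_hom_zero (hX : DirectSum.IsInternal gX) (hY : DirectSum.IsInternal gY)
    {f : X →ₗ[k] Y} (hf : IsHom gX gY 0 f) (x : X) :
    sgn hY (f x) = f (sgn hX x) := by
  have : (sgn hY).comp f = f.comp (sgn hX) := by
    refine ext_gr hX fun i x hx => ?_
    have h := hf i x hx
    rw [add_zero] at h
    simp [sgn_of_mem hX hx, sgn_of_mem hY h]
  exact LinearMap.congr_fun this x

theorem isHom_sgn (hX : DirectSum.IsInternal gX) : IsHom gX gX 0 (sgn hX) := fun n x hx => by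
  rw [add_zero]; exact sgn_mem hX hx

/-- Every linear map over a field has a generalized inverse. -/
theorem exists_generalized_inverse (d : X →ₗ[k] Y) : ∃ g : Y →ₗ[k] X, ∀ x, d (g (d x)) = d x := by
  obtain ⟨s, hs⟩ := d.rangeRestrict.exists_rightInverse_of_surjective d.range_rangeRestrict
  obtain ⟨g, hg⟩ := LinearMap.exists_extend s
  refine ⟨g, fun x => ?_⟩
  have h1 : g (d x) = s (d.rangeRestrict x) := LinearMap.congr_fun hg (d.rangeRestrict x)
  rw [h1]
  exact congrArg Subtype.val (LinearMap.congr_fun hs (d.rangeRestrict x))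

/-- A differential has a generalized inverse of degree `1`: the part of degree `1` of any generalized
inverse. -/
theorem exists_graded_inverse (hX : DirectSum.IsInternal gX) {d : X →ₗ[k] X}
    (hd : IsHom gX gX (-1) d) :
    ∃ h : X →ₗ[k] X, IsHom gX gX 1 h ∧ ∀ x, d (h (d x)) = d x := by
  obtain ⟨g, hg⟩ := exists_generalized_inverse d
  refine ⟨homPart hX hX 1 g, isHom_homPart hX hX 1 g, fun x => ?_⟩
  have : (d.comp (homPart hX hX 1 g)).comp d = d := by
    refine ext_gr hX fun n x hx => ?_
    rw [LinearMap.comp_apply, LinearMap.comp_apply, homPart_of_mem hX hX 1 g (hd n x hx),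
      ← proj_isHom hX hX hd, hg]
    exact proj_self hX (by simpa using hd n x hx)
  exact LinearMap.congr_fun this x

/-- A linear map of finite rank is a finite sum of maps of rank one. -/
theorem exists_finite_rank {α : X →ₗ[k] Y} {P : Submodule k Y} [FiniteDimensional k P]
    (hα : ∀ x, α x ∈ P) : ∃ (n : ℕ) (v : Fin n → Y) (ξ : Fin n → X →ₗ[k] k),
      (∀ t, v t ∈ P) ∧ (∀ x, α x = ∑ t, ξ t x • v t) ∧ ∀ t x, α x = 0 → ξ t x = 0 := by
  let b := Module.finBasis k P
  let α' : X →ₗ[k] P := α.codRestrict P hα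
  refine ⟨_, fun t => b t, fun t => (b.coord t).comp α', fun t => (b t).2, fun x => ?_,
    fun t x hx => ?_⟩
  · have := congrArg P.subtype (b.sum_repr (α' x))
    rw [map_sum] at this
    exact this.symm
  · have : α' x = 0 := Subtype.ext hx
    simp [this]

end HomogeneousMaps

/-! ### Acyclic complexes and cones -/

section Acyclic

variable {k : Type*} [Field k] {X Y V W : Type*} [AddCommGroup X] [Module k X]
  [AddCommGroup Y] [Module k Y] [AddCommGroup V] [Module k V] [AddCommGroup W] [Module k W]

/-- Every cycle is a boundary. -/
def Acyclic (D : V →ₗ[k] V) : Prop := ∀ v, D v = 0 → ∃ w, D w = v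

/-- Over a field, an acyclic complex is contractible. -/
theorem Acyclic.exists_contraction {D : V →ₗ[k] V} (hD : ∀ v, D (D v) = 0) (h : Acyclic D) :
    ∃ H : V →ₗ[k] V, ∀ v, D (H v) + H (D v) = v := by
  obtain ⟨g, hg⟩ := exists_generalized_inverse D
  -- `1 - D H - H D = (1 - D g) (1 - g D)`, and `1 - g D` has values in the cycles, that is, in the
  -- boundaries, which `1 - D g` kills
  refine ⟨g - D.comp (g.comp g), fun v => ?_⟩
  obtain ⟨w, hw⟩ := h (v - g (D v)) (by rw [map_sub, hg, sub_self])
  have h2 : D (g (v - g (D v))) = v - g (D v) := by rw [← hw, hg]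
  simp only [LinearMap.sub_apply, LinearMap.comp_apply, map_sub, hD] at h2 ⊢
  rw [sub_zero]
  have : D (g v) = v - g (D v) + D (g (g (D v))) := by rw [← h2]; abel
  rw [this]; abel

/-- The differential `(x, y) ↦ (-d x, f x + d y)` of the mapping cone. -/
def coneD (dX : X →ₗ[k] X) (dY : Y →ₗ[k] Y) (f : X →ₗ[k] Y) : X × Y →ₗ[k] X × Y :=
  LinearMap.prod (-(dX.comp (LinearMap.fst k X Y)))
    (f.comp (LinearMap.fst k X Y) + dY.comp (LinearMap.snd k X Y))

theorem coneD_apply (dX : X →ₗ[k] X) (dY : Y →ₗ[k] Y) (f : X →ₗ[k] Y) (v : X × Y) :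
    coneD dX dY f v = (-dX v.1, f v.1 + dY v.2) := rfl

theorem coneD_coneD {dX : X →ₗ[k] X} {dY : Y →ₗ[k] Y} {f : X →ₗ[k] Y}
    (hX : ∀ x, dX (dX x) = 0) (hY : ∀ y, dY (dY y) = 0) (hf : ∀ x, f (dX x) = dY (f x))
    (v : X × Y) : coneD dX dY f (coneD dX dY f v) = 0 := by
  simp [coneD_apply, hX, hY, hf]

/-- Dévissage along commuting, locally nilpotent, split surjective endomorphisms `χ i` of a complex:
it is acyclic if and only if the subcomplex of elements killed by all `χ i` is. -/
theorem acyclic_iff_ker {ι : Type*} [Finite ι] (D : V →ₗ[k] V) (hD : ∀ v, D (D v) = 0)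
    (χ y : ι → V →ₗ[k] V) (hχD : ∀ i v, χ i (D v) = D (χ i v))
    (hχy : ∀ i v, χ i (y i v) = v) (hcomm : ∀ i j, i ≠ j → ∀ v, χ i (y j v) = y j (χ i v))
    (hχ : ∀ i j v, χ i (χ j v) = χ j (χ i v)) (hnil : ∀ i v, ∃ r : ℕ, (χ i ^ r) v = 0) :
    Acyclic D ↔ ∀ v, (∀ i, χ i v = 0) → D v = 0 → ∃ w, (∀ i, χ i w = 0) ∧ D w = v := by
  classical
  let _ := Fintype.ofFinite ι
  -- `P J`: the elements killed by the `χ i`, `i ∈ J`, form an acyclic complex; `J` is enlarged one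
  -- element at a time
  let P : Finset ι → Prop := fun J =>
    ∀ v, (∀ i ∈ J, χ i v = 0) → D v = 0 → ∃ w, (∀ i ∈ J, χ i w = 0) ∧ D w = v
  have step : ∀ (j : ι) (J : Finset ι), j ∉ J → (P J ↔ P (insert j J)) := by
    intro j J hj
    have hy : ∀ v, (∀ i ∈ J, χ i v = 0) → ∀ i ∈ J, χ i (y j v) = 0 := fun v hv i hi => by
      rw [hcomm i j (fun h => hj (h ▸ hi)), hv i hi, map_zero]
    constructor
    · intro h v hv hDv
      -- `v = D w` with a cycle `χ j w = D z`: then `w - D (y j z)` is a primitive killed by `χ j`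
      obtain ⟨w, hw, rfl⟩ := h v (fun i hi => hv i (Finset.mem_insert_of_mem hi)) hDv
      obtain ⟨z, hz, hzw⟩ := h (χ j w) (fun i hi => by rw [hχ, hw i hi, map_zero])
        (by rw [← hχD]; exact hv j (Finset.mem_insert_self _ _))
      refine ⟨w - D (y j z), fun i hi => ?_, by rw [map_sub, hD, sub_zero]⟩
      rcases Finset.mem_insert.1 hi with rfl | hi
      · rw [map_sub, hχD, hχy, hzw, sub_self]
      · rw [map_sub, hw i hi, hχD, hy z hz i hi, map_zero, sub_zero]
    · intro h
      -- induction on `r`: a primitive `w` of `χ j v` lifts to `y j w`, and `v - D (y j w)` is killed by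
      -- `χ j`
      have key : ∀ r : ℕ, ∀ v, (χ j ^ r) v = 0 → (∀ i ∈ J, χ i v = 0) → D v = 0 →
          ∃ w, (∀ i ∈ J, χ i w = 0) ∧ D w = v := by
        intro r
        induction r with
        | zero =>
          intro v hv _ _
          have hv' : v = 0 := hv
          exact ⟨0, fun i _ => by simp, by simp [hv']⟩
        | succ r ih =>
          intro v hr hv hDv
          obtain ⟨w, hw, hwv⟩ := ih (χ j v) (by rw [pow_succ] at hr; exact hr)
            (fun i hi => by rw [hχ, hv i hi, map_zero]) (by rw [← hχD, hDv, map_zero])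
          obtain ⟨z, hz, hzv⟩ := h (v - D (y j w)) (fun i hi => by
            rcases Finset.mem_insert.1 hi with rfl | hi
            · rw [map_sub, hχD, hχy, hwv, sub_self]
            · rw [map_sub, hv i hi, hχD, hy w hw i hi, map_zero, sub_zero])
            (by rw [map_sub, hDv, hD, sub_zero])
          exact ⟨z + y j w, fun i hi => by
            rw [map_add, hz i (Finset.mem_insert_of_mem hi), hy w hw i hi, add_zero],
            by rw [map_add, hzv]; abel⟩
      intro v hv hDv
      obtain ⟨r, hr⟩ := hnil j v
      exact key r v hr hv hDv
  have all : ∀ J : Finset ι, P ∅ ↔ P J := by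
    intro J
    induction J using Finset.induction with
    | empty => exact Iff.rfl
    | insert j J hj ih => exact ih.trans (step j J hj)
  have h := all Finset.univ
  simpa [P, Acyclic] using h

/-- A complex which is a direct sum of copies of an acyclic complex `V₀`, up to terms of lower level
in the differential, is acyclic. -/
theorem acyclic_of_levels {I : Type*} (level : I → ℕ) (D : V →ₗ[k] V) (hD : ∀ v, D (D v) = 0)
    (D₀ : W →ₗ[k] W) (h₀ : Acyclic D₀) (e : (I →₀ W) ≃ₗ[k] V)
    (he : ∀ i w j, level i ≤ level j →
      e.symm (D (e (Finsupp.single i w))) j = Finsupp.single i (D₀ w) j) : Acyclic D := by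
  classical
  -- induction on a bound `n` of the levels in which `f` has coordinates: subtracting the boundary of
  -- primitives of the coordinates of top level lowers the bound
  have key : ∀ n : ℕ, ∀ f : I →₀ W, (∀ i, n ≤ level i → f i = 0) → D (e f) = 0 →
      ∃ w, D w = e f := by
    intro n
    induction n with
    | zero =>
      intro f hf _
      have : f = 0 := Finsupp.ext fun i => hf i (Nat.zero_le _)
      exact ⟨0, by simp [this]⟩
    | succ n ih =>
      intro f hf hDf
      -- coordinates of level `n` of the differential of an element of level at most `n`
      have top : ∀ g : I →₀ W, (∀ i, n + 1 ≤ level i → g i = 0) → ∀ j, n ≤ level j →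
          e.symm (D (e g)) j = D₀ (g j) := by
        intro g hg j hj
        have h1 : ∀ i ∈ g.support, e.symm (D (e (Finsupp.single i (g i)))) j =
            Finsupp.single i (D₀ (g i)) j := by
          intro i hi
          refine he i (g i) j (le_trans ?_ hj)
          by_contra hlt
          exact Finsupp.mem_support_iff.1 hi (hg i (by omega))
        have h2 : e.symm (D (e g)) j =
            ∑ i ∈ g.support, e.symm (D (e (Finsupp.single i (g i)))) j := by
          conv_lhs => rw [← Finsupp.sum_single g, Finsupp.sum, map_sum, map_sum, map_sum,
            Finsupp.finsetSum_apply]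
        rw [h2, Finset.sum_congr rfl h1]
        by_cases hj' : j ∈ g.support
        · rw [Finset.sum_eq_single j]
          · simp
          · intro b _ hb; simp [hb]
          · intro h; exact absurd hj' h
        · rw [Finsupp.notMem_support_iff.1 hj', map_zero]
          refine Finset.sum_eq_zero fun i hi => ?_
          have : i ≠ j := fun h => hj' (h ▸ hi)
          simp [this]
      have hcyc : ∀ j, n ≤ level j → D₀ (f j) = 0 := fun j hj => by
        rw [← top f hf j hj, hDf]; simp
      choose! u hu using h₀
      let g : I →₀ W := Finsupp.onFinset (f.support.filter fun i => n ≤ level i)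
        (fun i => if i ∈ f.support ∧ n ≤ level i then u (f i) else 0) (by
          intro i hi
          rw [Finset.mem_filter]
          by_contra h
          exact hi (if_neg h))
      have hgj : ∀ j, n ≤ level j → D₀ (g j) = f j := by
        intro j hj
        by_cases hj' : j ∈ f.support
        · have : g j = u (f j) := if_pos ⟨hj', hj⟩
          rw [this, hu _ (hcyc j hj)]
        · have : g j = 0 := if_neg (fun h => hj' h.1)
          rw [this, Finsupp.notMem_support_iff.1 hj', map_zero]
      have hg : ∀ i, n + 1 ≤ level i → g i = 0 := by
        intro i hi
        refine if_neg fun h => Finsupp.mem_support_iff.1 h.1 (hf i hi)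
      obtain ⟨w, hw⟩ := ih (f - e.symm (D (e g))) (fun i hi => by
        rw [Finsupp.sub_apply, top g hg i hi, hgj i hi, sub_self])
        (by rw [map_sub, LinearEquiv.apply_symm_apply, map_sub, hDf, hD, sub_zero])
      refine ⟨w + e g, ?_⟩
      rw [map_add, hw, map_sub, LinearEquiv.apply_symm_apply]
      abel
  intro v hv
  obtain ⟨f, rfl⟩ := e.surjective v
  obtain ⟨n, hn⟩ : ∃ n, ∀ i ∈ f.support, level i < n :=
    ⟨f.support.sup level + 1, fun i hi => Nat.lt_succ_of_le (Finset.le_sup hi)⟩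
  refine key n f (fun i hi => ?_) hv
  by_contra h
  exact absurd (hn i (Finsupp.mem_support_iff.2 h)) (by omega)

/-- The perturbation lemma: if `d h + h d = 1 - π` and the perturbation `τ` is such that `1 + τ h` is
invertible with inverse `a`, then `h a` is a homotopy, for `d + τ`, from the identity to
`(1 - h a τ) π a`, where `1 - h a τ` is the inverse of `1 + h τ`. -/
theorem perturbation {R : Type*} [Ring R] {d τ h π a : R} (hτ : τ * τ = 0)
    (hdτ : d * τ = - (τ * d)) (hh : d * h + h * d = 1 - π) (ha : a * (1 + τ * h) = 1)
    (ha' : (1 + τ * h) * a = 1) :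
    (d + τ) * (h * a) + (h * a) * (d + τ) = 1 - (1 - h * a * τ) * π * a := by
  have hu : (1 - h * a * τ) * (1 + h * τ) = 1 := by
    calc _ = 1 + h * τ - h * (a * (1 + τ * h)) * τ := by noncomm_ring
      _ = 1 := by rw [ha]; noncomm_ring
  have hu' : (1 - h * a * τ) * h = h * a := by
    calc (1 - h * a * τ) * h = h * (1 + a - a * (1 + τ * h)) := by noncomm_ring
      _ = h * a := by rw [ha]; noncomm_ring
  have key : (1 + h * τ) * (d + τ) * h + h * (d + τ) * (1 + τ * h) =
      (1 + h * τ) * (1 + τ * h) - π := by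
    calc _ = (d * h + h * d) + τ * h + h * τ + h * (τ * τ) * h + h * (τ * τ) * h +
          (h * (τ * d) * h + h * (d * τ) * h) := by noncomm_ring
      _ = (1 + h * τ) * (1 + τ * h) - π + h * (τ * τ) * h := by
        rw [hh, hdτ]; noncomm_ring
      _ = _ := by rw [hτ]; noncomm_ring
  calc (d + τ) * (h * a) + (h * a) * (d + τ)
      = ((1 - h * a * τ) * (1 + h * τ)) * (d + τ) * h * a +
        ((1 - h * a * τ) * h) * (d + τ) * ((1 + τ * h) * a) := by rw [hu, ha', hu']; noncomm_ring
    _ = (1 - h * a * τ) * ((1 + h * τ) * (d + τ) * h + h * (d + τ) * (1 + τ * h)) * a := by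
        noncomm_ring
    _ = ((1 - h * a * τ) * (1 + h * τ)) * ((1 + τ * h) * a) - (1 - h * a * τ) * π * a := by
        rw [key]; noncomm_ring
    _ = _ := by rw [hu, ha', one_mul]

/-- If `n` is locally nilpotent, then `1 + n` is bijective; a subspace stable under `n` is stable under
the inverse. -/
theorem exists_inverse_one_add {n : Module.End k V} (hn : ∀ v, ∃ r : ℕ, (n ^ r) v = 0) :
    ∃ a : Module.End k V, a * (1 + n) = 1 ∧ (1 + n) * a = 1 ∧
      ∀ P : Submodule k V, (∀ v ∈ P, n v ∈ P) → ∀ v ∈ P, a v ∈ P := by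
  have hsurj : ∀ P : Submodule k V, (∀ v ∈ P, n v ∈ P) → ∀ v ∈ P, ∃ w ∈ P, (1 + n : Module.End k V) w = v := by
    intro P hP v hv
    obtain ⟨r, hr⟩ := hn v
    induction r generalizing v with
    | zero => exact ⟨0, zero_mem _, by simpa using hr.symm⟩
    | succ r ih =>
      obtain ⟨w, hw, hwv⟩ := ih (n v) (hP v hv) (by rw [pow_succ] at hr; exact hr)
      refine ⟨v - w, sub_mem hv hw, ?_⟩
      rw [map_sub, hwv]
      simp
  have hbij : Function.Bijective (1 + n : Module.End k V) := by
    refine ⟨fun v w h => ?_, fun v => ?_⟩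
    · have h1 : n (v - w) = -(v - w) := by
        have : (1 + n : Module.End k V) (v - w) = 0 := by rw [map_sub, h, sub_self]
        exact eq_neg_of_add_eq_zero_right this
      obtain ⟨r, hr⟩ := hn (v - w)
      have h2 : ∀ r : ℕ, (n ^ r) (v - w) = 0 → v - w = 0 := by
        intro r
        induction r with
        | zero => intro h; exact h
        | succ r ih =>
          intro h
          rw [pow_succ, Module.End.mul_apply, h1, map_neg, neg_eq_zero] at h
          exact ih h
      exact sub_eq_zero.1 (h2 r hr)
    · obtain ⟨w, -, hw⟩ := hsurj ⊤ (fun _ _ => trivial) v trivial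
      exact ⟨w, hw⟩
  let e := LinearEquiv.ofBijective (1 + n : Module.End k V) hbij
  have h1 : ∀ v, e.symm ((1 + n : Module.End k V) v) = v := fun v => e.symm_apply_apply v
  refine ⟨e.symm.toLinearMap, LinearMap.ext h1, LinearMap.ext fun v => e.apply_symm_apply v, ?_⟩
  intro P hP v hv
  obtain ⟨w, hw, rfl⟩ := hsurj P hP v hv
  show e.symm ((1 + n : Module.End k V) w) ∈ P
  rwa [h1]

end Acyclic

/-! ### Quasi-isomorphisms over a field are homotopy equivalences -/

section HomPart

variable {k : Type*} [Field k] {X Y Z : Type*} [AddCommGroup X] [Module k X]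
  [AddCommGroup Y] [Module k Y] [AddCommGroup Z] [Module k Z]
  {gX : ℤ → Submodule k X} {gY : ℤ → Submodule k Y} {gZ : ℤ → Submodule k Z}
  (hX : DirectSum.IsInternal gX) (hY : DirectSum.IsInternal gY) (hZ : DirectSum.IsInternal gZ)

theorem homPart_comp_right {e e' : ℤ} {f : X →ₗ[k] Y} (hf : IsHom gX gY e f) (g : Y →ₗ[k] Z) :
    (homPart hY hZ e' g).comp f = homPart hX hZ (e + e') (g.comp f) :=
  ext_gr hX fun n x hx => by
    rw [LinearMap.comp_apply, homPart_of_mem hY hZ e' g (hf n x hx), homPart_of_mem hX hZ _ _ hx,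
      add_assoc]
    rfl

theorem homPart_comp_left {e e' : ℤ} {f : Y →ₗ[k] Z} (hf : IsHom gY gZ e f) (g : X →ₗ[k] Y) :
    f.comp (homPart hX hY e' g) = homPart hX hZ (e' + e) (f.comp g) :=
  ext_gr hX fun n x hx => by
    rw [LinearMap.comp_apply, homPart_of_mem hX hY e' g hx, homPart_of_mem hX hZ _ _ hx,
      ← add_assoc, LinearMap.comp_apply, proj_isHom hY hZ hf]

theorem homPart_add (e : ℤ) (f g : X →ₗ[k] Y) :
    homPart hX hY e (f + g) = homPart hX hY e f + homPart hX hY e g :=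
  ext_gr hX fun n x hx => by simp [homPart_of_mem hX hY e _ hx]

theorem homPart_self {e : ℤ} {f : X →ₗ[k] Y} (hf : IsHom gX gY e f) : homPart hX hY e f = f :=
  ext_gr hX fun n x hx => by rw [homPart_of_mem hX hY e f hx, proj_self hY (hf n x hx)]

end HomPart

section Equivalences

variable {k : Type u} [Field k] {A : Type u} [Ring A] [Algebra k A] {𝒜 : ℤ → Submodule k A}
  {X Y : DGModule 𝒜}

theorem DGModule.d_isHom (X : DGModule 𝒜) : IsHom X.gr X.gr (-1) X.d := X.d_mem

/-- The `k`-linear map underlying a morphism of dg modules. -/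
def DGHom.lin (f : DGHom X Y) : X.carrier →ₗ[k] Y.carrier := f.toFun.restrictScalars k

theorem DGHom.lin_apply (f : DGHom X Y) (x : X.carrier) : f.lin x = f.toFun x := rfl

theorem DGHom.lin_isHom (f : DGHom X Y) : IsHom X.gr Y.gr 0 f.lin := fun n x hx => by
  rw [add_zero]; exact f.map_mem hx

theorem DGHom.lin_d (f : DGHom X Y) (x : X.carrier) : f.lin (X.d x) = Y.d (f.lin x) := f.map_d x

/-- A morphism is a quasi-isomorphism if and only if its mapping cone is acyclic. -/
theorem DGHom.isQuasiIso_iff (f : DGHom X Y) :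
    f.IsQuasiIso ↔ Acyclic (coneD X.d Y.d f.lin) := by
  constructor
  · rintro ⟨hi, hs⟩ ⟨x, y⟩ h
    rw [coneD_apply, Prod.mk_eq_zero, neg_eq_zero] at h
    obtain ⟨h1, h2⟩ := h
    obtain ⟨x', rfl⟩ := hi x h1 ⟨-y, by rw [map_neg]; exact neg_eq_of_add_eq_zero_left h2⟩
    obtain ⟨x1, hx1, y1, hy1⟩ := hs (f.lin x' + y) (by rw [map_add, ← f.lin_d]; exact h2)
    refine ⟨(x1 - x', y1), ?_⟩
    have : y = f.lin x1 + Y.d y1 - f.lin x' := by rw [f.lin_apply x1, ← hy1]; abel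
    rw [coneD_apply, this]
    simp only [map_sub, hx1, Prod.mk.injEq]
    constructor <;> abel
  · intro h
    refine ⟨fun x hx => ?_, fun y hy => ?_⟩
    · rintro ⟨y, hy⟩
      obtain ⟨w, hw⟩ := h (x, -y) (by
        rw [coneD_apply, Prod.mk_eq_zero]
        exact ⟨by simp [hx], by simp [hy, f.lin_apply]⟩)
      exact ⟨-w.1, by rw [map_neg]; exact congrArg Prod.fst hw⟩
    · obtain ⟨w, hw⟩ := h (0, y) (by simp [coneD_apply, hy])
      rw [coneD_apply, Prod.mk.injEq, neg_eq_zero] at hw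
      exact ⟨w.1, hw.1, w.2, hw.2.symm⟩

/-- A morphism of complexes that is invertible up to `k`-linear homotopy. -/
def IsHEquiv (f : DGHom X Y) : Prop :=
  ∃ (p : Y.carrier →ₗ[k] X.carrier) (h : X.carrier →ₗ[k] X.carrier)
    (h' : Y.carrier →ₗ[k] Y.carrier),
    IsHom Y.gr X.gr 0 p ∧ IsHom X.gr X.gr 1 h ∧ IsHom Y.gr Y.gr 1 h' ∧
    (∀ y, p (Y.d y) = X.d (p y)) ∧ (∀ x, p (f.lin x) + (X.d (h x) + h (X.d x)) = x) ∧
    ∀ y, f.lin (p y) + (Y.d (h' y) + h' (Y.d y)) = y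

/-- Over a field, a quasi-isomorphism is a homotopy equivalence: the entries of a contraction of the
mapping cone are a homotopy inverse and the two homotopies, once replaced by their homogeneous parts.
-/
theorem DGHom.IsQuasiIso.isHEquiv {f : DGHom X Y} (hf : f.IsQuasiIso) : IsHEquiv f := by
  obtain ⟨H, hH⟩ := ((f.isQuasiIso_iff).1 hf).exists_contraction
    (coneD_coneD X.d_d Y.d_d f.lin_d)
  let p : Y.carrier →ₗ[k] X.carrier :=
    (LinearMap.fst k _ _).comp (H.comp (LinearMap.inr k X.carrier Y.carrier))
  let h : X.carrier →ₗ[k] X.carrier :=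
    -(LinearMap.fst k _ _).comp (H.comp (LinearMap.inl k X.carrier Y.carrier))
  let h' : Y.carrier →ₗ[k] Y.carrier :=
    (LinearMap.snd k _ _).comp (H.comp (LinearMap.inr k X.carrier Y.carrier))
  have e1 : p.comp Y.d = X.d.comp p := LinearMap.ext fun y => by
    have := congrArg Prod.fst (hH (0, y))
    simp only [coneD_apply, Prod.fst_add, map_zero, neg_zero, zero_add] at this
    exact eq_of_sub_eq_zero (by rw [← this]; simp [p]; abel)
  have e2 : p.comp f.lin + (X.d.comp h + h.comp X.d) = LinearMap.id := LinearMap.ext fun x => by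
    have h1 := congrArg Prod.fst (hH (x, 0))
    have h2 : H (-X.d x, f.lin x) = - H (X.d x, 0) + H (0, f.lin x) := by
      rw [← map_neg H, ← map_add]; simp
    simp only [coneD_apply, Prod.fst_add, map_zero, add_zero, h2, Prod.fst_neg] at h1
    simp only [LinearMap.add_apply, LinearMap.comp_apply, p, h, LinearMap.neg_apply, map_neg,
      LinearMap.fst_apply, LinearMap.inl_apply, LinearMap.inr_apply, LinearMap.id_apply]
    rw [add_comm, add_assoc]
    exact h1
  have e3 : f.lin.comp p + (Y.d.comp h' + h'.comp Y.d) = LinearMap.id :=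
    LinearMap.ext fun y => by
    have h1 := congrArg Prod.snd (hH (0, y))
    simp only [coneD_apply, Prod.snd_add, map_zero, neg_zero, zero_add] at h1
    simp only [LinearMap.add_apply, LinearMap.comp_apply, p, h',
      LinearMap.fst_apply, LinearMap.snd_apply, LinearMap.inr_apply, LinearMap.id_apply]
    rw [← add_assoc]
    exact h1
  refine ⟨homPart Y.internal X.internal 0 p, homPart X.internal X.internal 1 h,
    homPart Y.internal Y.internal 1 h', isHom_homPart _ _ _ _, isHom_homPart _ _ _ _,
    isHom_homPart _ _ _ _, fun y => ?_, fun x => ?_, fun y => ?_⟩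
  · refine LinearMap.congr_fun (f := (homPart Y.internal X.internal 0 p).comp Y.d)
      (g := X.d.comp (homPart Y.internal X.internal 0 p)) ?_ y
    rw [homPart_comp_right _ _ _ Y.d_isHom, homPart_comp_left _ _ _ X.d_isHom, e1, add_comm]
  · refine LinearMap.congr_fun (f := (homPart Y.internal X.internal 0 p).comp f.lin +
      (X.d.comp (homPart X.internal X.internal 1 h) + (homPart X.internal X.internal 1 h).comp X.d))
      (g := LinearMap.id) ?_ x
    rw [homPart_comp_right X.internal X.internal X.internal X.d_isHom,
      homPart_comp_left X.internal X.internal X.internal X.d_isHom,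
      homPart_comp_right X.internal Y.internal X.internal f.lin_isHom]
    norm_num
    rw [← homPart_add, ← homPart_add, e2, homPart_self _ _ isHom_id]
  · refine LinearMap.congr_fun (f := f.lin.comp (homPart Y.internal X.internal 0 p) +
      (Y.d.comp (homPart Y.internal Y.internal 1 h') + (homPart Y.internal Y.internal 1 h').comp Y.d))
      (g := LinearMap.id) ?_ y
    rw [homPart_comp_right Y.internal Y.internal Y.internal Y.d_isHom,
      homPart_comp_left Y.internal Y.internal Y.internal Y.d_isHom,
      homPart_comp_left Y.internal X.internal Y.internal f.lin_isHom]
    norm_num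
    rw [← homPart_add, ← homPart_add, e3, homPart_self _ _ isHom_id]

theorem IsHEquiv.isQuasiIso {f : DGHom X Y} (hf : IsHEquiv f) : f.IsQuasiIso := by
  obtain ⟨p, h, h', -, -, -, hp, h1, h2⟩ := hf
  refine ⟨fun x hx => ?_, fun y hy => ⟨p y, ?_, h' y, ?_⟩⟩
  · rintro ⟨y, hy⟩
    refine ⟨p y + h x, ?_⟩
    have := h1 x
    rw [hx, map_zero, add_zero, f.lin_apply, ← hy, hp] at this
    rw [map_add, this]
  · rw [← hp, hy, map_zero]
  · have := h2 y
    rw [hy, map_zero, add_zero] at this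
    exact this.symm

theorem DGHom.isQuasiIso_of_bijective {f : DGHom X Y} (hf : Function.Bijective f.toFun) :
    f.IsQuasiIso := by
  refine ⟨fun x _ => ?_, fun y hy => ?_⟩
  · rintro ⟨y, hy⟩
    obtain ⟨x', rfl⟩ := hf.2 y
    exact ⟨x', hf.1 (by rw [f.map_d, hy])⟩
  · obtain ⟨x, rfl⟩ := hf.2 y
    exact ⟨x, hf.1 (by rw [f.map_d, hy, map_zero]), 0, by simp⟩

end Equivalences

/-! ### Tensor products of homotopies -/

section TensorHomotopy

variable {k : Type*} [Field k] {X Y X' Y' : Type*} [AddCommGroup X] [Module k X]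
  [AddCommGroup Y] [Module k Y] [AddCommGroup X'] [Module k X'] [AddCommGroup Y'] [Module k Y']
  {gX : ℤ → Submodule k X} {gY : ℤ → Submodule k Y}
  {gX' : ℤ → Submodule k X'} {gY' : ℤ → Submodule k Y'}

theorem IsHom.tensor {e e' : ℤ} {f : X →ₗ[k] X'} {g : Y →ₗ[k] Y'} (hf : IsHom gX gX' e f)
    (hg : IsHom gY gY' e' g) {e'' : ℤ} (h : e + e' = e'') :
    IsHom (tensorGr gX gY) (tensorGr gX' gY') e'' (TensorProduct.map f g) := by
  intro n t ht
  refine tensorGr_map (fun i j x y hn hx hy => ?_) ht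
  rw [TensorProduct.map_tmul]
  exact tmul_mem (hf i x hx) (hg j y hy) (by omega)

/-- The homotopy `h ⊗ 1 + α ⊗ h'` on a tensor product. -/
def tensorH (hX : DirectSum.IsInternal gX) (α h : X →ₗ[k] X) (h' : Y →ₗ[k] Y) :
    X ⊗[k] Y →ₗ[k] X ⊗[k] Y :=
  TensorProduct.map h LinearMap.id + TensorProduct.map (α.comp (sgn hX)) h'

theorem tensorH_tmul (hX : DirectSum.IsInternal gX) (α h : X →ₗ[k] X) (h' : Y →ₗ[k] Y) (x : X)
    (y : Y) : tensorH hX α h h' (x ⊗ₜ y) = h x ⊗ₜ y + α (sgn hX x) ⊗ₜ h' y := rfl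

theorem IsHom.tensorH (hX : DirectSum.IsInternal gX) {α h : X →ₗ[k] X} {h' : Y →ₗ[k] Y}
    (hα : IsHom gX gX 0 α) (hh : IsHom gX gX 1 h) (hh' : IsHom gY gY 1 h') :
    IsHom (tensorGr gX gY) (tensorGr gX gY) 1 (tensorH hX α h h') :=
  (hh.tensor isHom_id rfl).add ((hα.comp (isHom_sgn hX) rfl).tensor hh' rfl)

/-- Homotopies `h`, `h'` from the identities to `α`, `β` give the homotopy `h ⊗ 1 + α ⊗ h'` from the
identity to `α ⊗ β`. -/
theorem tensor_homotopy (hX : DirectSum.IsInternal gX)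
    {dX α h : X →ₗ[k] X} {dY β h' : Y →ₗ[k] Y} (hdX : IsHom gX gX (-1) dX)
    (hdd : ∀ x, dX (dX x) = 0) (hα : IsHom gX gX 0 α) (hh : IsHom gX gX 1 h)
    (h1 : ∀ x, α x + (dX (h x) + h (dX x)) = x) (h2 : ∀ y, β y + (dY (h' y) + h' (dY y)) = y)
    (t : X ⊗[k] Y) :
    TensorProduct.map α β t + (tensorD hX dX dY (tensorH hX α h h' t) +
      tensorH hX α h h' (tensorD hX dX dY t)) = t := by
  induction t with
  | zero => simp
  | add s t hs ht =>
    conv_rhs => rw [← hs, ← ht]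
    simp only [map_add]
    abel
  | tmul x y =>
    have e1 : ∀ x, dX (α x) = α (dX x) := fun x => by
      have a1 : α x = x - (dX (h x) + h (dX x)) := eq_sub_of_add_eq (h1 x)
      have a2 : α (dX x) = dX x - (dX (h (dX x)) + h (dX (dX x))) := eq_sub_of_add_eq (h1 (dX x))
      rw [a1, a2]; simp [hdd]
    have e2 : ∀ x, sgn hX (dX x) = - dX (sgn hX x) := sgn_odd hX hX (by decide) hdX
    have e3 : ∀ x, sgn hX (h x) = - h (sgn hX x) := sgn_odd hX hX (by decide) hh
    have e4 : ∀ x, sgn hX (α x) = α (sgn hX x) := sgn_hom_zero hX hX hα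
    have key : x ⊗ₜ[k] y = α x ⊗ₜ[k] (β y + (dY (h' y) + h' (dY y))) +
        (dX (h x) + h (dX x)) ⊗ₜ[k] y := by rw [h2, ← TensorProduct.add_tmul, h1]
    refine Eq.trans ?_ key.symm
    simp only [TensorProduct.map_tmul, tensorD_tmul, tensorH_tmul, map_add,
      e1, e2, e3, e4, sgn_sgn,
      TensorProduct.add_tmul, TensorProduct.tmul_add, map_neg, TensorProduct.neg_tmul]
    abel

end TensorHomotopy

/-! ### Dg modules over the polynomial ring: morphisms, tensor products and graded duals -/

section Poly

open MvPolynomial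

variable {k : Type u} [Field k] {c : ℕ} {deg : Fin c → ℕ}

/-- A `k`-linear map that commutes with the variables is `S`-linear. -/
theorem poly_linear {P Q : Type*} [AddCommGroup P] [AddCommGroup Q] [Module k P] [Module k Q]
    [Module (Poly k c) P] [Module (Poly k c) Q] [IsScalarTower k (Poly k c) P]
    [IsScalarTower k (Poly k c) Q] (f : P →ₗ[k] Q)
    (hf : ∀ i x, f ((X i : Poly k c) • x) = (X i : Poly k c) • f x) (s : Poly k c) (x : P) :
    f (s • x) = s • f x := by
  induction s using MvPolynomial.induction_on generalizing x with
  | C a =>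
    have : (C a : Poly k c) = algebraMap k _ a := rfl
    rw [this, algebraMap_smul, algebraMap_smul, map_smul]
  | add p q hp hq => rw [add_smul, add_smul, map_add, hp, hq]
  | mul_X p i hp => rw [mul_smul, mul_smul, hp, hf]

/-- A morphism of dg `S`-modules from a `k`-linear map that commutes with the variables. -/
def DGHom.ofLin {P Q : DGPoly k deg} (f : P.carrier →ₗ[k] Q.carrier) (hf : IsHom P.gr Q.gr 0 f)
    (hd : ∀ x, f (P.d x) = Q.d (f x))
    (hX : ∀ i x, f ((X i : Poly k c) • x) = (X i : Poly k c) • f x) : DGHom P Q where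
  toFun := { toFun := f, map_add' := map_add f, map_smul' := poly_linear f hX }
  map_mem := fun {i x} hx => by have := hf i x hx; rwa [add_zero] at this
  map_d := hd

theorem DGHom.toFun_smul_X {P Q : DGPoly k deg} (f : DGHom P Q) (i : Fin c) (x : P.carrier) :
    f.lin ((X i : Poly k c) • x) = (X i : Poly k c) • f.lin x := map_smul f.toFun _ x

variable (hdeg : ∀ i, Odd (deg i))

/-- The tensor product of two morphisms of dg `S`-modules. -/
def diagTensorMap {P P' Q Q' : DGPoly k deg} (f : DGHom P P') (g : DGHom Q Q') :
    DGHom (diagTensor hdeg P Q) (diagTensor hdeg P' Q') :=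
  DGHom.ofLin (P := diagTensor hdeg P Q) (Q := diagTensor hdeg P' Q')
    (TensorProduct.map f.lin g.lin : P.carrier ⊗[k] Q.carrier →ₗ[k] P'.carrier ⊗[k] Q'.carrier)
    (f.lin_isHom.tensor g.lin_isHom rfl)
    (by
      intro t
      show TensorProduct.map f.lin g.lin (tensorD P.internal P.d Q.d t) =
        tensorD P'.internal P'.d Q'.d (TensorProduct.map f.lin g.lin t)
      refine TensorProduct.induction_on t (by simp) (fun x y => ?_) (fun s t hs ht => ?_)
      · simp only [tensorD_tmul, map_add, TensorProduct.map_tmul, f.lin_d, g.lin_d,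
          sgn_hom_zero P.internal P'.internal f.lin_isHom]
      · simp only [map_add, hs, ht])
    (by
      intro i t
      show TensorProduct.map f.lin g.lin (diagAct P Q (X i) t) =
        diagAct P' Q' (X i) (TensorProduct.map f.lin g.lin t)
      refine TensorProduct.induction_on t (by simp) (fun x y => ?_) (fun s t hs ht => ?_)
      · simp only [diagAct_X, map_add, TensorProduct.map_tmul, f.toFun_smul_X, g.toFun_smul_X]
      · simp only [map_add, hs, ht])

theorem IsHEquiv.diagTensorMap {P P' Q Q' : DGPoly k deg} {f : DGHom P P'} {g : DGHom Q Q'}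
    (hf : IsHEquiv f) (hg : IsHEquiv g) : IsHEquiv (diagTensorMap hdeg f g) := by
  obtain ⟨p, h, h', hp, hh, hh', hpd, h1, h2⟩ := hf
  obtain ⟨q, l, l', hq, hl, hl', hqd, l1, l2⟩ := hg
  have hpf : IsHom P.gr P.gr 0 (p.comp f.lin) := hp.comp f.lin_isHom rfl
  have hfp : IsHom P'.gr P'.gr 0 (f.lin.comp p) := f.lin_isHom.comp hp rfl
  refine ⟨TensorProduct.map p q, tensorH P.internal (p.comp f.lin) h l,
    tensorH P'.internal (f.lin.comp p) h' l', hp.tensor hq rfl,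
    IsHom.tensorH P.internal hpf hh hl, IsHom.tensorH P'.internal hfp hh' hl', ?_, ?_, ?_⟩
  · intro t
    show TensorProduct.map p q (tensorD P'.internal P'.d Q'.d t) =
      tensorD P.internal P.d Q.d (TensorProduct.map p q t)
    refine TensorProduct.induction_on t (by simp) (fun x y => ?_) (fun s t hs ht => ?_)
    · simp only [tensorD_tmul, map_add, TensorProduct.map_tmul, hpd, hqd,
        sgn_hom_zero P'.internal P.internal hp]
    · simp only [map_add, hs, ht]
  · intro t
    have := tensor_homotopy P.internal P.d_isHom P.d_d hpf hh h1
      (β := q.comp g.lin) l1 t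
    rw [TensorProduct.map_comp] at this
    exact this
  · intro t
    have := tensor_homotopy P'.internal P'.d_isHom P'.d_d hfp hh' h2
      (β := g.lin.comp q) l2 t
    rw [TensorProduct.map_comp] at this
    exact this

end Poly

/-! ### Graded duals -/

section GradedDual

variable {k : Type*} [Field k] {X Y Z : Type*} [AddCommGroup X] [Module k X]
  [AddCommGroup Y] [Module k Y] [AddCommGroup Z] [Module k Z]
  {gX : ℤ → Submodule k X} {gY : ℤ → Submodule k Y} {gZ : ℤ → Submodule k Z}

/-- The graded dual of a graded vector space: the functionals that vanish on all but finitely many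
homogeneous components. -/
abbrev GDual (gX : ℤ → Submodule k X) := HomSp (AlgHom.id k k) gX

/-- The value of an element of the graded dual. -/
abbrev ev (gX : ℤ → Submodule k X) : GDual gX →ₗ[k] X →ₗ[k] k := HomSp.toLin (AlgHom.id k k) gX

theorem mem_homPiece_id {n : ℤ} {f : X →ₗ[k] k} :
    f ∈ homPiece (AlgHom.id k k) gX n ↔ ∀ i, i ≠ -n → ∀ x ∈ gX i, f x = 0 :=
  ⟨fun h => h.2, fun h => ⟨fun a x => by simp, h⟩⟩

theorem mem_gradedHom_id (hX : DirectSum.IsInternal gX) {f : X →ₗ[k] k} :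
    f ∈ gradedHom (AlgHom.id k k) gX ↔ ∃ s : Finset ℤ, ∀ i ∉ s, ∀ x ∈ gX i, f x = 0 := by
  classical
  constructor
  · intro hf
    refine Submodule.iSup_induction (homPiece (AlgHom.id k k) gX)
      (motive := fun f => ∃ s : Finset ℤ, ∀ i ∉ s, ∀ x ∈ gX i, f x = 0) hf ?_ ?_ ?_
    · intro n f hf
      exact ⟨{-n}, fun i hi => mem_homPiece_id.1 hf i (by simpa using hi)⟩
    · exact ⟨∅, fun _ _ _ _ => rfl⟩
    · rintro f g ⟨s, hs⟩ ⟨t, ht⟩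
      refine ⟨s ∪ t, fun i hi x hx => ?_⟩
      rw [Finset.mem_union, not_or] at hi
      rw [LinearMap.add_apply, hs i hi.1 x hx, ht i hi.2 x hx, add_zero]
  · rintro ⟨s, hs⟩
    have : f = ∑ i ∈ s, f.comp (proj hX i) := by
      refine ext_gr hX fun n x hx => ?_
      rw [LinearMap.sum_apply]
      by_cases hn : n ∈ s
      · rw [Finset.sum_eq_single n]
        · rw [LinearMap.comp_apply, proj_self hX hx]
        · intro b _ hb
          rw [LinearMap.comp_apply, proj_of_mem hX hx, if_neg (Ne.symm hb), map_zero]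
        · intro h; exact absurd hn h
      · rw [hs n hn x hx]
        refine (Finset.sum_eq_zero fun i hi => ?_).symm
        rw [LinearMap.comp_apply, proj_of_mem hX hx, if_neg (fun h : n = i => hn (h ▸ hi)), map_zero]
    rw [this]
    refine sum_mem fun i _ => homPiece_le _ _ (-i) (mem_homPiece_id.2 fun j hj x hx => ?_)
    rw [LinearMap.comp_apply, proj_of_mem hX hx, if_neg (by simpa using hj), map_zero]

/-- Precomposition with a homogeneous map. -/
def pre {e : ℤ} (T : X →ₗ[k] Y) (hT : IsHom gX gY e T) : GDual gY →ₗ[k] GDual gX where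
  toFun f := HomSp.mk ((ev gY f).comp T) (by
    have h1 : gradedHom (AlgHom.id k k) gY ≤
        (gradedHom (AlgHom.id k k) gX).comap (LinearMap.lcomp k k T) := by
      refine gradedHom_le fun n g hg => homPiece_le _ gX (n + e) (mem_homPiece_id.2 ?_)
      intro i hi x hx
      exact mem_homPiece_id.1 hg (i + e) (by omega) _ (hT i x hx)
    exact h1 f.toLin_mem)
  map_add' _ _ := rfl
  map_smul' _ _ := rfl

theorem pre_apply {e : ℤ} (T : X →ₗ[k] Y) (hT : IsHom gX gY e T) (f : GDual gY) (x : X) :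
    ev gX (pre T hT f) x = ev gY f (T x) := rfl

theorem isHom_pre {e : ℤ} (T : X →ₗ[k] Y) (hT : IsHom gX gY e T) :
    IsHom (homGr (AlgHom.id k k) gY) (homGr (AlgHom.id k k) gX) e (pre T hT) := by
  intro n f hf
  refine mem_homPiece_id.2 fun i hi x hx => ?_
  exact mem_homPiece_id.1 hf (i + e) (by omega) _ (hT i x hx)

theorem sgn_ev (hX : DirectSum.IsInternal gX) (f : GDual gX) (x : X) :
    ev gX (sgn (homGr_internal (AlgHom.id k k) hX) f) x = ev gX f (sgn hX x) := by
  have : sgn (homGr_internal (AlgHom.id k k) hX) = pre (sgn hX) (isHom_sgn hX) := by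
    refine ext_gr (homGr_internal (AlgHom.id k k) hX) fun n f hf => HomSp.ext fun x => ?_
    rw [sgn_of_mem (homGr_internal (AlgHom.id k k) hX) hf]
    refine LinearMap.congr_fun (f := ev gX ((-1 : k) ^ n • f)) (g := ev gX (pre _ _ f)) ?_ x
    refine ext_gr hX fun i x hx => ?_
    rw [pre_apply, sgn_of_mem hX hx, map_smul, map_smul, LinearMap.smul_apply]
    by_cases hi : i = -n
    · rw [hi, zpow_neg, ← inv_zpow, inv_neg_one]
    · have : ev gX f x = 0 := mem_homPiece_id.1 hf i hi x hx
      rw [this, smul_zero, smul_zero]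
  rw [this, pre_apply]

/-- The projection on the components of even degree. -/
def evenPart (hX : DirectSum.IsInternal gX) : X →ₗ[k] X :=
  (Finsupp.lsum k (fun i : ℤ => if Even i then (LinearMap.id : X →ₗ[k] X) else 0)).comp (coact hX)

theorem evenPart_of_mem (hX : DirectSum.IsInternal gX) {i : ℤ} {x : X} (hx : x ∈ gX i) :
    evenPart hX x = if Even i then x else 0 := by
  simp only [evenPart, LinearMap.comp_apply, coact_of_mem hX hx]
  split_ifs with h <;> simp [h]

/-- The map `x ⊗ y ↦ (-1)^{|x||y|} x ⊗ y`. -/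
def koszulSign (hX : DirectSum.IsInternal gX) (hY : DirectSum.IsInternal gY) :
    X ⊗[k] Y →ₗ[k] X ⊗[k] Y :=
  TensorProduct.map (evenPart hX) LinearMap.id +
    TensorProduct.map (LinearMap.id - evenPart hX) (sgn hY)

theorem koszulSign_tmul (hX : DirectSum.IsInternal gX) (hY : DirectSum.IsInternal gY) {i j : ℤ}
    {x : X} {y : Y} (hx : x ∈ gX i) (hy : y ∈ gY j) :
    koszulSign hX hY (x ⊗ₜ y) = (-1 : k) ^ (i * j) • (x ⊗ₜ[k] y) := by
  simp only [koszulSign, LinearMap.add_apply, TensorProduct.map_tmul, LinearMap.sub_apply,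
    LinearMap.id_apply, evenPart_of_mem hX hx, sgn_of_mem hY hy]
  split_ifs with h
  · simp [(h.mul_right j).neg_one_zpow]
  · rw [Int.not_even_iff_odd] at h
    rw [zpow_mul, h.neg_one_zpow]
    simp

theorem tensor_ext_gr (hX : DirectSum.IsInternal gX) (hY : DirectSum.IsInternal gY)
    {f g : X ⊗[k] Y →ₗ[k] Z}
    (h : ∀ i j x y, x ∈ gX i → y ∈ gY j → f (x ⊗ₜ y) = g (x ⊗ₜ y)) : f = g := by
  refine TensorProduct.ext (ext_gr hX fun i x hx => ext_gr hY fun j y hy => ?_)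
  exact h i j x y hx hy

theorem sgn_tensor (hX : DirectSum.IsInternal gX) (hY : DirectSum.IsInternal gY) :
    sgn (tensor_internal hX hY) = TensorProduct.map (sgn hX) (sgn hY) := by
  refine tensor_ext_gr hX hY fun i j x y hx hy => ?_
  rw [sgn_of_mem _ (tmul_mem hx hy rfl), TensorProduct.map_tmul, sgn_of_mem hX hx, sgn_of_mem hY hy,
    TensorProduct.smul_tmul_smul, zpow_add₀ (by simp)]

theorem koszulSign_koszulSign (hX : DirectSum.IsInternal gX) (hY : DirectSum.IsInternal gY)
    (t : X ⊗[k] Y) : koszulSign hX hY (koszulSign hX hY t) = t := by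
  have : (koszulSign hX hY).comp (koszulSign hX hY) = LinearMap.id := by
    refine tensor_ext_gr hX hY fun i j x y hx hy => ?_
    rw [LinearMap.comp_apply, koszulSign_tmul hX hY hx hy, map_smul, koszulSign_tmul hX hY hx hy,
      smul_smul, ← mul_zpow]
    simp
  exact LinearMap.congr_fun this t

theorem isHom_koszulSign (hX : DirectSum.IsInternal gX) (hY : DirectSum.IsInternal gY) :
    IsHom (tensorGr gX gY) (tensorGr gX gY) 0 (koszulSign hX hY) := by
  intro n t ht
  rw [add_zero]
  refine tensorGr_map (fun i j x y hn hx hy => ?_) ht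
  rw [koszulSign_tmul hX hY hx hy]
  exact Submodule.smul_mem _ _ (tmul_mem hx hy hn)

/-- The pairing of `X* ⊗ Y*` with `X ⊗ Y` is nondegenerate on the left, without finiteness assumptions.
-/
theorem dualDistrib_injective :
    Function.Injective (TensorProduct.dualDistrib k X Y) := by
  rw [injective_iff_map_eq_zero]
  intro t ht
  let b := Module.Free.chooseBasis k (Module.Dual k Y)
  obtain ⟨m, rfl⟩ := (TensorProduct.equivFinsuppOfBasisRight (M := Module.Dual k X) b).symm.surjective t
  have hm : m = 0 := by
    refine Finsupp.ext fun i => LinearMap.ext fun x => ?_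
    have h1 : m.sum (fun i f => f x • b i) = 0 := by
      refine LinearMap.ext fun y => ?_
      have := LinearMap.congr_fun ht (x ⊗ₜ y)
      rw [TensorProduct.equivFinsuppOfBasisRight_symm_apply, Finsupp.sum, map_sum,
        LinearMap.sum_apply] at this
      rw [Finsupp.sum, LinearMap.sum_apply]
      simpa using this
    have h2 := congrArg (fun z => b.repr z i) h1
    simp only [Finsupp.sum, map_sum, map_smul, Module.Basis.repr_self, Finsupp.finsetSum_apply,
      Finsupp.smul_apply, Finsupp.single_apply, map_zero, Finsupp.zero_apply] at h2
    by_cases hi : i ∈ m.support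
    · rw [Finset.sum_eq_single i (fun j _ hj => by simp [hj]) (fun h => absurd hi h)] at h2
      simpa using h2
    · rw [Finsupp.notMem_support_iff.1 hi]; rfl
  rw [hm, map_zero]

/-- The pairing `f ⊗ g ↦ (x ⊗ y ↦ (-1)^{|x||y|} f(x) g(y))` as a functional. -/
def pairing (hX : DirectSum.IsInternal gX) (hY : DirectSum.IsInternal gY) :
    GDual gX ⊗[k] GDual gY →ₗ[k] (X ⊗[k] Y →ₗ[k] k) :=
  (LinearMap.lcomp k k (koszulSign hX hY)).comp
    ((TensorProduct.dualDistrib k X Y).comp (TensorProduct.map (ev gX) (ev gY)))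

theorem pairing_tmul (hX : DirectSum.IsInternal gX) (hY : DirectSum.IsInternal gY) (f : GDual gX)
    (g : GDual gY) {i j : ℤ} {x : X} {y : Y} (hx : x ∈ gX i) (hy : y ∈ gY j) :
    pairing hX hY (f ⊗ₜ g) (x ⊗ₜ y) = (-1 : k) ^ (i * j) * (ev gX f x * ev gY g y) := by
  simp only [pairing, LinearMap.comp_apply, LinearMap.lcomp_apply, koszulSign_tmul hX hY hx hy,
    TensorProduct.map_tmul, map_smul, TensorProduct.dualDistrib_apply, smul_eq_mul]

theorem pairing_mem (hX : DirectSum.IsInternal gX) (hY : DirectSum.IsInternal gY) {n : ℤ}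
    {t : GDual gX ⊗[k] GDual gY}
    (ht : t ∈ tensorGr (homGr (AlgHom.id k k) gX) (homGr (AlgHom.id k k) gY) n) :
    pairing hX hY t ∈ homPiece (AlgHom.id k k) (tensorGr gX gY) n := by
  refine tensorGr_map (fun p q f g hn hf hg => mem_homPiece_id.2 fun m hm t ht => ?_) ht
  rw [← LinearMap.mem_ker]
  refine tensorGr_map (f := LinearMap.id) (fun i j x y hij hx hy => ?_) ht
  rw [LinearMap.id_apply, LinearMap.mem_ker, pairing_tmul hX hY f g hx hy]
  by_cases hi : i = -p
  · have : ev gY g y = 0 := mem_homPiece_id.1 hg j (by omega) y hy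
    rw [this, mul_zero, mul_zero]
  · have : ev gX f x = 0 := mem_homPiece_id.1 hf i hi x hx
    rw [this, zero_mul, mul_zero]

/-- The pairing with values in the graded dual. -/
def gPairing (hX : DirectSum.IsInternal gX) (hY : DirectSum.IsInternal gY) :
    GDual gX ⊗[k] GDual gY →ₗ[k] GDual (tensorGr gX gY) where
  toFun t := HomSp.mk (pairing hX hY t) (mem_of_top (tensor_internal
    (homGr_internal (AlgHom.id k k) hX) (homGr_internal (AlgHom.id k k) hY))
    (P := (gradedHom (AlgHom.id k k) (tensorGr gX gY)).comap (pairing hX hY))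
    (fun n t ht => homPiece_le _ _ n (pairing_mem hX hY ht)) t)
  map_add' s t := HomSp.ext fun x => by simp
  map_smul' r t := HomSp.ext fun x => by simp

theorem ev_gPairing (hX : DirectSum.IsInternal gX) (hY : DirectSum.IsInternal gY)
    (t : GDual gX ⊗[k] GDual gY) :
    ev (tensorGr gX gY) (gPairing hX hY t) = pairing hX hY t := rfl

theorem isHom_gPairing (hX : DirectSum.IsInternal gX) (hY : DirectSum.IsInternal gY) :
    IsHom (tensorGr (homGr (AlgHom.id k k) gX) (homGr (AlgHom.id k k) gY))
      (homGr (AlgHom.id k k) (tensorGr gX gY)) 0 (gPairing hX hY) := fun n t ht => by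
  rw [add_zero]
  exact pairing_mem hX hY ht

theorem gPairing_injective (hX : DirectSum.IsInternal gX) (hY : DirectSum.IsInternal gY) :
    Function.Injective (gPairing hX hY) := by
  rw [injective_iff_map_eq_zero]
  intro t ht
  have h1 : pairing hX hY t = 0 := by rw [← ev_gPairing, ht, map_zero]
  have h2 : TensorProduct.dualDistrib k X Y (TensorProduct.map (ev gX) (ev gY) t) = 0 := by
    refine LinearMap.ext fun z => ?_
    have := LinearMap.congr_fun h1 (koszulSign hX hY z)
    simpa [pairing, koszulSign_koszulSign] using this
  refine (injective_iff_map_eq_zero _).1 (TensorProduct.map_injective_of_flat_flat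
    (ev gX) (ev gY) (fun f f' h => HomSp.ext fun x => LinearMap.congr_fun h x)
    (fun f f' h => HomSp.ext fun x => LinearMap.congr_fun h x)) t ?_
  exact (injective_iff_map_eq_zero _).1 dualDistrib_injective _ h2

/-- Let `α` and `β` be maps of degree `0` that vanish in low degrees, and let `α` have finite rank in each
degree. Then every functional on `X ⊗ Y`, composed with `α ⊗ β`, comes from the tensor product of the
graded duals: only finitely many degrees of `X` matter for it, and in these `α` is a finite sum of maps of
rank one. -/
theorem exists_gPairing (hX : DirectSum.IsInternal gX) (hY : DirectSum.IsInternal gY)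
    {α : X →ₗ[k] X} {β : Y →ₗ[k] Y} (hα : IsHom gX gX 0 α) (hβ : IsHom gY gY 0 β)
    (hfin : ∀ n, FiniteDimensional k ((gX n).map α)) {a b : ℤ}
    (ha : ∀ n < a, ∀ x ∈ gX n, α x = 0) (hb : ∀ n < b, ∀ y ∈ gY n, β y = 0)
    (φ : GDual (tensorGr gX gY)) :
    ∃ ψ, gPairing hX hY ψ = pre (TensorProduct.map α β) (hα.tensor hβ rfl) φ := by
  classical
  obtain ⟨S, hS⟩ := (mem_gradedHom_id (tensor_internal hX hY)).1 φ.toLin_mem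
  change ∀ i ∉ S, ∀ x ∈ tensorGr gX gY i, ev (tensorGr gX gY) φ x = 0 at hS
  have hdec : ∀ n, ∃ (N : ℕ) (v : Fin N → X) (ξ : Fin N → X →ₗ[k] k),
      (∀ t, v t ∈ (gX n).map α) ∧ (∀ x, (α.comp (proj hX n)) x = ∑ t, ξ t x • v t) ∧
      ∀ t x, (α.comp (proj hX n)) x = 0 → ξ t x = 0 := fun n =>
    exists_finite_rank (P := (gX n).map α) fun x => ⟨proj hX n x, proj_mem hX n x, rfl⟩
  choose N v ξ hv hsum hξ using hdec
  have hvn : ∀ n t, v n t ∈ gX n := fun n t => by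
    obtain ⟨x, hx, h⟩ := hv n t
    rw [← h]
    simpa using hα n x hx
  have hξn : ∀ n t m x, x ∈ gX m → m ≠ n → ξ n t x = 0 := fun n t m x hx hm => by
    refine hξ n t x ?_
    rw [LinearMap.comp_apply, proj_of_mem hX hx, if_neg hm, map_zero]
  let ξ' : ∀ n, Fin (N n) → GDual gX := fun n t => HomSp.mk (ξ n t)
    ((mem_gradedHom_id hX).2 ⟨{n}, fun i hi x hx => hξn n t i x hx (by simpa using hi)⟩)
  let η : ∀ n, Fin (N n) → Y →ₗ[k] k := fun n t =>
    (ev (tensorGr gX gY) φ).comp ((koszulSign hX hY).comp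
      ((TensorProduct.mk k X Y (v n t)).comp β))
  have hη : ∀ n t m y, y ∈ gY m → n + m ∉ S → η n t y = 0 := fun n t m y hy hm => by
    have h1 : β y ∈ gY m := by simpa using hβ m y hy
    refine hS _ hm _ ?_
    have := isHom_koszulSign hX hY _ _ (tmul_mem (hvn n t) h1 rfl)
    rw [add_zero] at this
    exact this
  let η' : ∀ n, Fin (N n) → GDual gY := fun n t => HomSp.mk (η n t)
    ((mem_gradedHom_id hY).2 ⟨S.image fun s => s - n, fun i hi y hy => hη n t i y hy fun h =>
      hi (Finset.mem_image.2 ⟨_, h, by ring⟩)⟩)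
  -- only finitely many degrees of `X` contribute: those `≥ a` and `≤ s - b` for some `s ∈ S`
  let R : Finset ℤ := S.biUnion fun s => Finset.Icc a (s - b)
  refine ⟨∑ n ∈ R, ∑ t, ξ' n t ⊗ₜ η' n t, HomSp.ext fun z => ?_⟩
  refine LinearMap.congr_fun (f := ev (tensorGr gX gY) _) (g := ev (tensorGr gX gY) _) ?_ z
  refine tensor_ext_gr hX hY fun i j x y hx hy => ?_
  have hαx : α x = ∑ t, ξ i t x • v i t := by
    rw [← hsum, LinearMap.comp_apply, proj_self hX hx]
  have hβy : β y ∈ gY j := by simpa using hβ j y hy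
  have key : ∑ t, (-1 : k) ^ (i * j) * (ξ i t x * η i t y) =
      ev (tensorGr gX gY) φ (α x ⊗ₜ β y) := by
    rw [hαx, TensorProduct.sum_tmul, map_sum]
    refine Finset.sum_congr rfl fun t _ => ?_
    have : η i t y = (-1 : k) ^ (i * j) * ev (tensorGr gX gY) φ (v i t ⊗ₜ β y) := by
      show ev (tensorGr gX gY) φ (koszulSign hX hY (v i t ⊗ₜ β y)) = _
      rw [koszulSign_tmul hX hY (hvn i t) hβy, map_smul, smul_eq_mul]
    rw [this, ← TensorProduct.smul_tmul', map_smul, smul_eq_mul]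
    have h2 : (-1 : k) ^ (i * j) * (-1 : k) ^ (i * j) = 1 := by rw [← mul_zpow]; simp
    linear_combination (ξ i t x * ev (tensorGr gX gY) φ (v i t ⊗ₜ β y)) * h2
  rw [pre_apply, TensorProduct.map_tmul, ← key, ev_gPairing]
  simp only [map_sum, LinearMap.sum_apply, pairing_tmul hX hY _ _ hx hy]
  have e1 : ∀ n t, ev gX (ξ' n t) x = ξ n t x := fun n t => rfl
  have e2 : ∀ n t, ev gY (η' n t) y = η n t y := fun n t => rfl
  simp only [e1, e2]
  by_cases hi : i ∈ R
  · rw [Finset.sum_eq_single i]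
    · intro n _ hn
      refine Finset.sum_eq_zero fun t _ => ?_
      rw [hξn n t i x hx (Ne.symm hn), zero_mul, mul_zero]
    · intro h; exact absurd hi h
  · rw [key]
    refine (Finset.sum_eq_zero fun n hn => Finset.sum_eq_zero fun t _ => ?_).trans ?_
    · rw [hξn n t i x hx (fun h => hi (h ▸ hn)), zero_mul, mul_zero]
    · symm
      by_cases h1 : i < a
      · rw [ha i h1 x hx, TensorProduct.zero_tmul, map_zero]
      by_cases h2 : j < b
      · rw [hb j h2 y hy, TensorProduct.tmul_zero, map_zero]
      refine hS (i + j) (fun hS' => hi ?_) _ (tmul_mem (by simpa using hα i x hx) hβy rfl)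
      exact Finset.mem_biUnion.2 ⟨i + j, hS', Finset.mem_Icc.2 ⟨by omega, by omega⟩⟩

end GradedDual

/-! ### Duals and tensor products -/

section FiniteType

variable {k : Type u} [Field k] {A : Type u} [Ring A] [Algebra k A] {𝒜 : ℤ → Submodule k A}

/-- A map homotopic to the identity is a chain map. -/
theorem chain_of_homotopy {V : Type*} [AddCommGroup V] [Module k V] {d π h : V →ₗ[k] V}
    (hd : ∀ v, d (d v) = 0) (hh : ∀ v, π v + (d (h v) + h (d v)) = v) (v : V) :
    π (d v) = d (π v) := by
  have a1 : π v = v - (d (h v) + h (d v)) := eq_sub_of_add_eq (hh v)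
  have a2 : π (d v) = d v - (d (h (d v)) + h (d (d v))) := eq_sub_of_add_eq (hh (d v))
  rw [a1, a2]; simp [hd]

/-- A complex on which the identity is homotopic to a homogeneous map that has finite rank in each
degree and vanishes in low degrees. -/
def HasFiniteType (X : DGModule 𝒜) : Prop :=
  ∃ h π : X.carrier →ₗ[k] X.carrier, IsHom X.gr X.gr 1 h ∧ IsHom X.gr X.gr 0 π ∧
    (∀ x, π x + (X.d (h x) + h (X.d x)) = x) ∧
    (∀ n, FiniteDimensional k ((X.gr n).map π)) ∧ ∃ b : ℤ, ∀ n < b, ∀ x ∈ X.gr n, π x = 0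

end FiniteType

section Dual

open MvPolynomial

/-- The trivial grading of `k`. -/
def trivGr (k : Type u) [Field k] (n : ℤ) : Submodule k k := if n = 0 then ⊤ else ⊥

theorem trivGr_top (k : Type u) [Field k] : ⨆ n, trivGr k n = ⊤ :=
  eq_top_iff.2 (le_trans (by simp [trivGr]) (le_iSup (trivGr k) 0))

variable {k : Type u} [Field k]

/-- The complex of vector spaces underlying a dg module, as a dg module over `k`. -/
def DGModule.complex {A : Type u} [Ring A] [Algebra k A] {𝒜 : ℤ → Submodule k A}
    (X : DGModule 𝒜) : DGModule (trivGr k) where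
  carrier := X.carrier
  gr := X.gr
  internal := X.internal
  smul_mem := by
    intro i j a x ha hx
    by_cases hi : i = 0
    · subst hi; rw [zero_add]; exact Submodule.smul_mem _ _ hx
    · rw [trivGr, if_neg hi, Submodule.mem_bot] at ha
      rw [ha, zero_smul]; exact zero_mem _
  d := X.d
  d_mem := X.d_mem
  d_d := X.d_d
  d_smul := by
    intro i a x ha
    by_cases hi : i = 0
    · subst hi; rw [map_smul, zpow_zero, one_smul]
    · rw [trivGr, if_neg hi, Submodule.mem_bot] at ha
      rw [ha, zero_smul, map_zero, zero_smul, smul_zero]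

variable {c : ℕ} {deg : Fin c → ℕ} (hdeg : ∀ i, Odd (deg i))

theorem sgn_X_smul (C : DGPoly k deg) (i : Fin c) (x : C.carrier)
    (hdeg : ∀ i, Odd (deg i)) :
    sgn C.internal ((X i : Poly k c) • x) = (X i : Poly k c) • sgn C.internal x :=
  sgn_even C.internal (Algebra.lsmul k k C.carrier (X i : Poly k c)) (wt_even hdeg i)
    (fun _ _ hx => X_smul_mem C hx) x

/-- The graded `k`-dual of a dg `S`-module. -/
def dual (C : DGPoly k deg) : DGPoly k deg :=
  DGPoly.ofAct hdeg (GDual C.gr) (homGr _ _) (homGr_internal _ C.internal)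
    (homD (AlgHom.id k k) C.complex (trivGr_top k)) (homD_mem _ C.complex _)
    (homD_homD _ C.complex _)
    (homAct (AlgHom.id k k) C.gr (wt deg) (Algebra.lsmul k k C.carrier)
      (fun _ _ _ hx => X_smul_mem C hx) (fun _ a x => smul_comm _ a x))
    (homAct_mem _ _ _ _ _ _)
    (fun i f => HomSp.ext fun x => by
      have h1 : (X i : Poly k c) • sgn C.internal (C.d x) =
          sgn C.internal (C.d ((X i : Poly k c) • x)) := by
        rw [d_X hdeg, sgn_X_smul C _ _ hdeg]
      exact congrArg (fun z => - HomSp.toLin _ _ f z) h1)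

/-- The functional underlying an element of the dual. -/
abbrev dualEv (C : DGPoly k deg) : (dual hdeg C).carrier →ₗ[k] C.carrier →ₗ[k] k := ev C.gr

theorem dual_d (C : DGPoly k deg) (f : (dual hdeg C).carrier) (x : C.carrier) :
    dualEv hdeg C ((dual hdeg C).d f) x = - dualEv hdeg C f (sgn C.internal (C.d x)) := rfl

theorem dual_X (C : DGPoly k deg) (i : Fin c) (f : (dual hdeg C).carrier) (x : C.carrier) :
    dualEv hdeg C ((X i : Poly k c) • f) x = dualEv hdeg C f ((X i : Poly k c) • x) := rfl

theorem dual_ext {C : DGPoly k deg} {f g : (dual hdeg C).carrier}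
    (h : ∀ x, dualEv hdeg C f x = dualEv hdeg C g x) : f = g := HomSp.ext h

/-- Precomposition with a homogeneous map, as a map between duals of dg modules. -/
def dualPre {C D : DGPoly k deg} {e : ℤ} (T : C.carrier →ₗ[k] D.carrier)
    (hT : IsHom C.gr D.gr e T) : (dual hdeg D).carrier →ₗ[k] (dual hdeg C).carrier := pre T hT

theorem dualPre_apply {C D : DGPoly k deg} {e : ℤ} (T : C.carrier →ₗ[k] D.carrier)
    (hT : IsHom C.gr D.gr e T) (f : (dual hdeg D).carrier) (x : C.carrier) :
    dualEv hdeg C (dualPre hdeg T hT f) x = dualEv hdeg D f (T x) := rfl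

theorem isHom_dualPre {C D : DGPoly k deg} {e : ℤ} (T : C.carrier →ₗ[k] D.carrier)
    (hT : IsHom C.gr D.gr e T) : IsHom (dual hdeg D).gr (dual hdeg C).gr e (dualPre hdeg T hT) :=
  isHom_pre T hT

theorem dualPre_d {C D : DGPoly k deg} (T : C.carrier →ₗ[k] D.carrier)
    (hT : IsHom C.gr D.gr 0 T) (hd : ∀ x, T (C.d x) = D.d (T x)) (f : (dual hdeg D).carrier) :
    dualPre hdeg T hT ((dual hdeg D).d f) = (dual hdeg C).d (dualPre hdeg T hT f) :=
  dual_ext hdeg fun x => by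
    rw [dualPre_apply, dual_d, dual_d, dualPre_apply, ← sgn_hom_zero C.internal D.internal hT, hd]

theorem dualPre_X {C D : DGPoly k deg} {e : ℤ} (T : C.carrier →ₗ[k] D.carrier)
    (hT : IsHom C.gr D.gr e T) (hX : ∀ i x, T ((X i : Poly k c) • x) = (X i : Poly k c) • T x)
    (i : Fin c) (f : (dual hdeg D).carrier) :
    dualPre hdeg T hT ((X i : Poly k c) • f) = (X i : Poly k c) • dualPre hdeg T hT f :=
  dual_ext hdeg fun x => by
    rw [dualPre_apply, dual_X, dual_X, dualPre_apply, hX]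

/-- The dual `f ↦ f ∘ sgn ∘ h` of a homotopy `h`. -/
def dualH {C : DGPoly k deg} (h : C.carrier →ₗ[k] C.carrier) (hh : IsHom C.gr C.gr 1 h) :
    (dual hdeg C).carrier →ₗ[k] (dual hdeg C).carrier :=
  dualPre hdeg (e := 1) ((sgn C.internal).comp h) ((isHom_sgn C.internal).comp hh rfl)

/-- The dual of a homotopy from the identity to `α` is a homotopy from the identity to the dual of `α`.
The sign involution in `dualH` compensates the sign in the differential of the dual. -/
theorem dual_homotopy {C : DGPoly k deg} {α h : C.carrier →ₗ[k] C.carrier}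
    (hα : IsHom C.gr C.gr 0 α) (hh : IsHom C.gr C.gr 1 h)
    (h1 : ∀ x, α x + (C.d (h x) + h (C.d x)) = x) (f : (dual hdeg C).carrier) :
    dualPre hdeg α hα f + ((dual hdeg C).d (dualH hdeg h hh f) +
      dualH hdeg h hh ((dual hdeg C).d f)) = f := by
  refine dual_ext hdeg fun x => ?_
  have e1 : ∀ x, sgn C.internal (h x) = - h (sgn C.internal x) :=
    sgn_odd C.internal C.internal (by decide) hh
  have e2 : ∀ x, sgn C.internal (C.d x) = - C.d (sgn C.internal x) :=
    sgn_odd C.internal C.internal (by decide) C.d_isHom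
  have h2 := congrArg (dualEv hdeg C f) (h1 x)
  rw [map_add, map_add] at h2
  rw [map_add, map_add, LinearMap.add_apply, LinearMap.add_apply, dualPre_apply, dual_d, dualH,
    dualPre_apply, dualPre_apply, dual_d, LinearMap.comp_apply, LinearMap.comp_apply, e1 (sgn _ _),
    map_neg, sgn_sgn, neg_neg, e2, sgn_sgn, map_neg, neg_neg,
    add_comm (dualEv hdeg C f (h (C.d x)))]
  exact h2

/-- The dual of a morphism. -/
def dualMap {C D : DGPoly k deg} (f : DGHom C D) : DGHom (dual hdeg D) (dual hdeg C) :=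
  DGHom.ofLin (dualPre hdeg f.lin f.lin_isHom) (isHom_dualPre hdeg _ _)
    (dualPre_d hdeg _ _ f.lin_d) (dualPre_X hdeg _ _ f.toFun_smul_X)

theorem IsHEquiv.dualMap {C D : DGPoly k deg} {f : DGHom C D} (hf : IsHEquiv f) :
    IsHEquiv (dualMap hdeg f) := by
  obtain ⟨p, h, h', hp, hh, hh', hpd, h1, h2⟩ := hf
  exact ⟨dualPre hdeg p hp, dualH hdeg h' hh', dualH hdeg h hh, isHom_dualPre hdeg _ _,
    isHom_dualPre hdeg _ _, isHom_dualPre hdeg _ _, dualPre_d hdeg p hp hpd,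
    dual_homotopy hdeg (α := f.lin.comp p) (f.lin_isHom.comp hp rfl) hh' h2,
    dual_homotopy hdeg (α := p.comp f.lin) (hp.comp f.lin_isHom rfl) hh h1⟩

/-- The element `x ⊗ y` of the dg module `P ⊗ Q`. -/
def dmk (P Q : DGPoly k deg) : P.carrier →ₗ[k] Q.carrier →ₗ[k] (diagTensor hdeg P Q).carrier :=
  TensorProduct.mk k P.carrier Q.carrier

section

variable {hdeg} {P Q : DGPoly k deg}

theorem d_dmk (x : P.carrier) (y : Q.carrier) : (diagTensor hdeg P Q).d (dmk hdeg P Q x y) =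
    dmk hdeg P Q (P.d x) y + dmk hdeg P Q (sgn P.internal x) (Q.d y) :=
  tensorD_tmul _ _ _ _ _

theorem sgn_dmk (x : P.carrier) (y : Q.carrier) :
    sgn (diagTensor hdeg P Q).internal (dmk hdeg P Q x y) =
      dmk hdeg P Q (sgn P.internal x) (sgn Q.internal y) :=
  LinearMap.congr_fun (sgn_tensor P.internal Q.internal) _

theorem X_dmk (i : Fin c) (x : P.carrier) (y : Q.carrier) :
    (X i : Poly k c) • dmk hdeg P Q x y =
      dmk hdeg P Q ((X i : Poly k c) • x) y + dmk hdeg P Q x ((X i : Poly k c) • y) :=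
  diagAct_X P Q i x y

theorem dmk_ext {Z : Type*} [AddCommGroup Z] [Module k Z]
    {f g : (diagTensor hdeg P Q).carrier →ₗ[k] Z}
    (h : ∀ x y, f (dmk hdeg P Q x y) = g (dmk hdeg P Q x y)) : f = g :=
  TensorProduct.ext' (M := P.carrier) (N := Q.carrier) h

theorem dmk_ext_gr {Z : Type*} [AddCommGroup Z] [Module k Z]
    {f g : (diagTensor hdeg P Q).carrier →ₗ[k] Z}
    (h : ∀ i j x y, x ∈ P.gr i → y ∈ Q.gr j → f (dmk hdeg P Q x y) = g (dmk hdeg P Q x y)) :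
    f = g :=
  tensor_ext_gr P.internal Q.internal h

end

/-- The natural map from the tensor product of the duals to the dual of the tensor product, as a
linear map. -/
def dualTensorLin (P Q : DGPoly k deg) : (diagTensor hdeg (dual hdeg P) (dual hdeg Q)).carrier
    →ₗ[k] (dual hdeg (diagTensor hdeg P Q)).carrier :=
  gPairing P.internal Q.internal

theorem dualTensorLin_dmk {P Q : DGPoly k deg} (f : (dual hdeg P).carrier)
    (g : (dual hdeg Q).carrier) {i j : ℤ} {x : P.carrier} {y : Q.carrier} (hx : x ∈ P.gr i)
    (hy : y ∈ Q.gr j) :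
    dualEv hdeg _ (dualTensorLin hdeg P Q (dmk hdeg _ _ f g)) (dmk hdeg P Q x y) =
      (-1 : k) ^ (i * j) * (dualEv hdeg P f x * dualEv hdeg Q g y) :=
  pairing_tmul P.internal Q.internal f g hx hy

theorem dualTensorLin_d (P Q : DGPoly k deg)
    (t : (diagTensor hdeg (dual hdeg P) (dual hdeg Q)).carrier) :
    dualTensorLin hdeg P Q ((diagTensor hdeg (dual hdeg P) (dual hdeg Q)).d t) =
      (dual hdeg (diagTensor hdeg P Q)).d (dualTensorLin hdeg P Q t) := by
  refine LinearMap.congr_fun (f := (dualTensorLin hdeg P Q).comp (DGModule.d _))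
    (g := (DGModule.d _).comp (dualTensorLin hdeg P Q)) (dmk_ext fun f g => ?_) t
  refine dual_ext hdeg fun z => ?_
  refine LinearMap.congr_fun (f := dualEv hdeg (diagTensor hdeg P Q) _)
    (g := dualEv hdeg (diagTensor hdeg P Q) _) (dmk_ext_gr fun i j x y hx hy => ?_) z
  have hdx := P.d_mem i x hx
  have hdy := Q.d_mem j y hy
  have e3 : dualEv hdeg P (sgn (dual hdeg P).internal f) x =
    dualEv hdeg P f (sgn P.internal x) := sgn_ev P.internal f x
  rw [LinearMap.comp_apply, LinearMap.comp_apply, d_dmk, map_add, map_add, LinearMap.add_apply,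
    dualTensorLin_dmk hdeg _ _ hx hy, dualTensorLin_dmk hdeg _ _ hx hy, dual_d, dual_d, dual_d,
    d_dmk, map_add, map_add, sgn_dmk, sgn_dmk, sgn_sgn,
    dualTensorLin_dmk hdeg _ _ (sgn_mem _ hdx) (sgn_mem _ hy),
    dualTensorLin_dmk hdeg _ _ hx (sgn_mem _ hdy), e3, sgn_of_mem _ hx, sgn_of_mem _ hy,
    map_smul, map_smul]
  have s1 : (-1 : k) ^ ((i - 1) * j) * (-1) ^ j = (-1) ^ (i * j) := by
    rw [← zpow_add₀ (by simp)]; congr 1; ring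
  have s2 : (-1 : k) ^ (i * (j - 1)) = (-1) ^ (i * j) * (-1) ^ i := by
    have : (-1 : k) ^ (i * (j - 1)) * ((-1) ^ i * (-1) ^ i) = (-1) ^ (i * j) * (-1) ^ i := by
      rw [← zpow_add₀ (by simp), ← zpow_add₀ (by simp), ← zpow_add₀ (by simp)]
      congr 1; ring
    rwa [← mul_zpow, neg_one_mul, neg_neg, one_zpow, mul_one] at this
  rw [s2, ← s1]
  simp only [smul_eq_mul]
  ring

theorem dualTensorLin_X (P Q : DGPoly k deg) (i : Fin c)
    (t : (diagTensor hdeg (dual hdeg P) (dual hdeg Q)).carrier) :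
    dualTensorLin hdeg P Q ((X i : Poly k c) • t) =
      (X i : Poly k c) • dualTensorLin hdeg P Q t := by
  refine LinearMap.congr_fun (f := (dualTensorLin hdeg P Q).comp
      (Algebra.lsmul k k _ (X i : Poly k c)))
    (g := (Algebra.lsmul k k _ (X i : Poly k c)).comp (dualTensorLin hdeg P Q))
    (dmk_ext fun f g => ?_) t
  refine dual_ext hdeg fun z => ?_
  refine LinearMap.congr_fun (f := dualEv hdeg (diagTensor hdeg P Q) _)
    (g := dualEv hdeg (diagTensor hdeg P Q) _) (dmk_ext_gr fun p q x y hx hy => ?_) z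
  have hw : Even (wt deg i : ℤ) := (Int.even_coe_nat _).2 (wt_even hdeg i)
  have s1 : (-1 : k) ^ ((p - wt deg i) * q) = (-1) ^ (p * q) := by
    rw [sub_mul, zpow_sub₀ (by simp), (hw.mul_right q).neg_one_zpow, div_one]
  have s2 : (-1 : k) ^ (p * (q - wt deg i)) = (-1) ^ (p * q) := by
    rw [mul_sub, zpow_sub₀ (by simp), (hw.mul_left p).neg_one_zpow, div_one]
  rw [LinearMap.comp_apply, LinearMap.comp_apply, Algebra.lsmul_coe, Algebra.lsmul_coe]
  beta_reduce
  rw [X_dmk, dual_X, X_dmk, map_add, map_add, map_add, LinearMap.add_apply,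
    dualTensorLin_dmk hdeg _ _ hx hy, dualTensorLin_dmk hdeg _ _ hx hy,
    dualTensorLin_dmk hdeg _ _ (X_smul_mem P hx) hy,
    dualTensorLin_dmk hdeg _ _ hx (X_smul_mem Q hy), s1, s2, dual_X, dual_X]

/-- The natural map from the tensor product of the duals to the dual of the tensor product. -/
def dualTensor (P Q : DGPoly k deg) :
    DGHom (diagTensor hdeg (dual hdeg P) (dual hdeg Q)) (dual hdeg (diagTensor hdeg P Q)) :=
  DGHom.ofLin (dualTensorLin hdeg P Q) (isHom_gPairing P.internal Q.internal)
    (dualTensorLin_d hdeg P Q) (dualTensorLin_X hdeg P Q)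

theorem dualTensor_pre {P Q : DGPoly k deg} {α : P.carrier →ₗ[k] P.carrier}
    {β : Q.carrier →ₗ[k] Q.carrier} (hα : IsHom P.gr P.gr 0 α) (hβ : IsHom Q.gr Q.gr 0 β)
    (t : GDual P.gr ⊗[k] GDual Q.gr) :
    gPairing P.internal Q.internal (TensorProduct.map (pre α hα) (pre β hβ) t) =
      pre (TensorProduct.map α β) (hα.tensor hβ rfl) (gPairing P.internal Q.internal t) := by
  refine TensorProduct.induction_on t (by simp) (fun f g => ?_)
    (fun s t hs ht => by simp only [map_add, hs, ht])
  refine HomSp.ext fun z => ?_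
  refine LinearMap.congr_fun (f := ev (tensorGr P.gr Q.gr) _) (g := ev (tensorGr P.gr Q.gr) _) ?_ z
  refine tensor_ext_gr P.internal Q.internal fun i j x y hx hy => ?_
  have h1 := hα i x hx
  have h2 := hβ j y hy
  rw [add_zero] at h1 h2
  rw [TensorProduct.map_tmul, pre_apply, ev_gPairing, ev_gPairing, TensorProduct.map_tmul,
    pairing_tmul _ _ _ _ hx hy, pairing_tmul _ _ _ _ h1 h2, pre_apply, pre_apply]

/-- For complexes of finite type, dualizing commutes with tensor products up to quasi-isomorphism: the map
is injective, and the map `α ⊗ β`, which is homotopic to the identity, takes every functional into its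
image. -/
theorem dualTensor_isQuasiIso {P Q : DGPoly k deg} (hP : HasFiniteType P) (hQ : HasFiniteType Q) :
    (dualTensor hdeg P Q).IsQuasiIso := by
  obtain ⟨h, α, hh, hα, h1, hfin, a, ha⟩ := hP
  obtain ⟨l, β, hl, hβ, l1, -, b, hb⟩ := hQ
  let T := diagTensor hdeg P Q
  let αβ : T.carrier →ₗ[k] T.carrier := TensorProduct.map α β
  have hαβ : IsHom T.gr T.gr 0 αβ := hα.tensor hβ rfl
  let H : T.carrier →ₗ[k] T.carrier := tensorH P.internal α h l
  have hH : IsHom T.gr T.gr 1 H := IsHom.tensorH P.internal hα hh hl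
  have hT : ∀ t, αβ t + (T.d (H t) + H (T.d t)) = t :=
    tensor_homotopy P.internal P.d_isHom P.d_d hα hh h1 l1
  have hTc : ∀ t, αβ (T.d t) = T.d (αβ t) := chain_of_homotopy T.d_d hT
  let E := diagTensor hdeg (dual hdeg P) (dual hdeg Q)
  let K : E.carrier →ₗ[k] E.carrier := tensorH (dual hdeg P).internal (dualPre hdeg α hα)
    (dualH hdeg h hh) (dualH hdeg l hl)
  let κ : E.carrier →ₗ[k] E.carrier :=
    TensorProduct.map (dualPre hdeg α hα) (dualPre hdeg β hβ)
  have hE : ∀ t : E.carrier, κ t + (E.d (K t) + K (E.d t)) = t :=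
    tensor_homotopy (dual hdeg P).internal (dual hdeg P).d_isHom (dual hdeg P).d_d
      (isHom_dualPre hdeg α hα) (isHom_dualPre hdeg _ _) (dual_homotopy hdeg hα hh h1)
      (dual_homotopy hdeg hβ hl l1)
  have hinj : Function.Injective (dualTensor hdeg P Q).toFun :=
    gPairing_injective P.internal Q.internal
  have hmap : ∀ t : E.carrier, (dualTensor hdeg P Q).toFun (κ t) =
      dualPre hdeg (C := T) (D := T) αβ hαβ ((dualTensor hdeg P Q).toFun t) :=
    dualTensor_pre hα hβ
  have hex : ∀ φ : (dual hdeg T).carrier, ∃ ψ : E.carrier,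
      (dualTensor hdeg P Q).toFun ψ = dualPre hdeg (C := T) (D := T) αβ hαβ φ :=
    exists_gPairing P.internal Q.internal hα hβ hfin ha hb
  refine ⟨fun ψ hψ => ?_, fun φ hφ => ?_⟩
  -- if the image of `ψ` is the boundary of `φ`, then `κ ψ`, homologous to `ψ`, is the boundary of the
  -- preimage of `φ ∘ (α ⊗ β)`
  · rintro ⟨φ, hφ⟩
    obtain ⟨ψ', hψ'⟩ := hex φ
    refine ⟨ψ' + K ψ, ?_⟩
    have h2 : κ ψ = E.d ψ' := by
      refine hinj ?_
      rw [hmap, (dualTensor hdeg P Q).map_d, hψ', ← hφ]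
      exact dualPre_d hdeg αβ hαβ hTc φ
    have h3 := hE ψ
    rw [h2, hψ, map_zero, add_zero] at h3
    rw [map_add, h3]
  · obtain ⟨ψ, hψ⟩ := hex φ
    refine ⟨ψ, hinj ?_, dualH hdeg (C := T) H hH φ, ?_⟩
    · rw [(dualTensor hdeg P Q).map_d, hψ, map_zero]
      refine (dualPre_d hdeg αβ hαβ hTc φ).symm.trans ?_
      rw [hφ, map_zero]
    · have := dual_homotopy hdeg (C := T) hαβ hH hT φ
      rw [hφ, map_zero, add_zero] at this
      rw [hψ]
      exact this.symm

end Dual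

/-! ### The coalgebra `Γ` dual to the polynomial ring -/

section Gamma

open MvPolynomial

variable {k : Type u} [Field k] {c : ℕ} {deg : Fin c → ℕ}

theorem gamAct_ev (s : Poly k c) (γ : Gam k deg) (t : Poly k c) :
    ev (sGr k deg) (gamAct k deg s γ) t = ev (sGr k deg) γ (s * t) := rfl

theorem weight_neg (w : Fin c → ℕ) (m : Fin c →₀ ℕ) :
    Finsupp.weight (fun i => -(w i : ℤ)) m = -(Finsupp.weight w m : ℤ) := by
  simp [Finsupp.weight_apply, Finsupp.sum]

theorem monomial_mem_sGr (m : Fin c →₀ ℕ) (r : k) :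
    monomial m r ∈ sGr k deg (-(Finsupp.weight (wt deg) m : ℤ)) := by
  rw [← weight_neg]
  exact isWeightedHomogeneous_monomial _ _ _ rfl

theorem mem_gamGr {n : ℤ} {γ : Gam k deg} :
    γ ∈ gamGr k deg n ↔ ∀ m : Fin c →₀ ℕ, (Finsupp.weight (wt deg) m : ℤ) ≠ n →
      ev (sGr k deg) γ (monomial m 1) = 0 := by
  constructor
  · intro h m hm
    exact mem_homPiece_id.1 h _ (by simpa using hm) _ (monomial_mem_sGr m 1)
  · intro h
    refine mem_homPiece_id.2 fun i hi s hs => ?_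
    refine polyGr_induction (wt deg) (P := LinearMap.ker (ev (sGr k deg) γ)) (fun m hm => ?_) hs
    refine h m fun h' => hi ?_
    rw [weight_neg] at hm
    omega

theorem gam_ext {γ γ' : Gam k deg}
    (h : ∀ m, ev (sGr k deg) γ (monomial m 1) = ev (sGr k deg) γ' (monomial m 1)) : γ = γ' := by
  refine HomSp.ext fun s => ?_
  refine LinearMap.congr_fun (f := ev (sGr k deg) γ) (g := ev (sGr k deg) γ') ?_ s
  refine LinearMap.ext fun s => ?_
  induction s using MvPolynomial.induction_on' with
  | monomial m a =>
    have : (monomial m a : Poly k c) = a • monomial m 1 := by simp [smul_monomial]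
    rw [this, map_smul, map_smul, h]
  | add p q hp hq => rw [map_add, map_add, hp, hq]

theorem gamGr_neg {n : ℤ} (hn : n < 0) {γ : Gam k deg} (h : γ ∈ gamGr k deg n) : γ = 0 :=
  gam_ext fun m => by
    rw [mem_gamGr.1 h m (by omega)]; rfl

theorem sgn_gam (hdeg : ∀ i, Odd (deg i)) (γ : Gam k deg) :
    sgn (homGr_internal (AlgHom.id k k) (polyGr_internal (wt deg))) γ = γ := by
  refine HomSp.ext fun s => ?_
  rw [sgn_ev (polyGr_internal (wt deg))]
  congr 1
  have : sgn (polyGr_internal (k := k) (wt deg)) = LinearMap.id := by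
    refine ext_gr (polyGr_internal (k := k) (wt deg)) fun n s hs => ?_
    rw [sgn_of_mem _ hs]
    rcases polyGr_even (wt deg) (wt_even hdeg) hs s with h | h
    · exact h
    · rw [h, smul_zero, map_zero]
  rw [this]; rfl

variable (k deg) in
/-- The functional that extracts the coefficient of a monomial; these functionals are the divided
power basis of `Γ`. -/
def gamCoeff (m : Fin c →₀ ℕ) : Gam k deg :=
  HomSp.mk (lcoeff k m) (homPiece_le _ _ (Finsupp.weight (wt deg) m : ℤ) (mem_homPiece_id.2 (by
    intro i hi s hs
    by_contra h
    have h1 := hs h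
    rw [weight_neg] at h1
    exact hi h1.symm)))

theorem gamCoeff_ev (m : Fin c →₀ ℕ) (s : Poly k c) :
    ev (sGr k deg) (gamCoeff k deg m) s = coeff m s := rfl

variable (k deg) in
/-- The unit of `Γ`: the augmentation of `S`. -/
abbrev gamOne : Gam k deg := gamCoeff k deg 0

theorem gamAct_gamOne (i : Fin c) : gamAct k deg (X i) (gamOne k deg) = 0 :=
  HomSp.ext fun s => by
    classical
    rw [gamAct_ev, gamCoeff_ev, coeff_X_mul', if_neg (by simp)]; rfl

/-- The elements of `Γ` killed by all variables are the multiples of the unit. -/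
theorem eq_smul_gamOne {γ : Gam k deg} (h : ∀ i, gamAct k deg (X i) γ = 0) :
    γ = ev (sGr k deg) γ 1 • gamOne k deg := by
  refine gam_ext fun m => ?_
  rw [map_smul, LinearMap.smul_apply, gamCoeff_ev, coeff_monomial]
  by_cases hm : m = 0
  · subst hm
    rw [if_pos rfl, smul_eq_mul, mul_one]
    rfl
  · obtain ⟨i, hi⟩ := Finsupp.ne_iff.1 hm
    have h2 : Finsupp.single i 1 ≤ m := by
      rw [Finsupp.single_le_iff]
      exact Nat.one_le_iff_ne_zero.2 hi
    have h1 : (monomial m (1 : k)) = X i * monomial (m - Finsupp.single i 1) 1 := by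
      rw [X, monomial_mul, one_mul, add_tsub_cancel_of_le h2]
    rw [if_neg hm, smul_zero, h1, ← gamAct_ev, h i]
    rfl

theorem finite_weight (n : ℤ) :
    {m : Fin c →₀ ℕ | (Finsupp.weight (wt deg) m : ℤ) = n}.Finite := by
  refine (Finsupp.finite_of_nat_weight_le (wt deg) (fun i => by simp) n.toNat).subset ?_
  intro m hm
  have : (Finsupp.weight (wt deg) m : ℤ) = n := hm
  show Finsupp.weight (wt deg) m ≤ n.toNat
  omega

theorem gam_sum {n : ℤ} {γ : Gam k deg} (h : γ ∈ gamGr k deg n) :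
    γ = ∑ m ∈ (finite_weight (deg := deg) n).toFinset,
      ev (sGr k deg) γ (monomial m 1) • gamCoeff k deg m := by
  classical
  refine gam_ext fun m => ?_
  simp only [map_sum, LinearMap.sum_apply, map_smul, LinearMap.smul_apply, gamCoeff_ev,
    coeff_monomial]
  by_cases hm : m ∈ (finite_weight (deg := deg) n).toFinset
  · rw [Finset.sum_eq_single m (fun b _ hb => by simp [Ne.symm hb])
      (fun h => absurd hm h)]
    simp
  · rw [mem_gamGr.1 h m (by simpa using hm)]
    refine (Finset.sum_eq_zero fun b hb => ?_).symm
    rw [if_neg (fun h : m = b => hm (h ▸ hb)), smul_zero]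

theorem finite_gamGr (n : ℤ) : FiniteDimensional k (gamGr k deg n) := by
  classical
  have h : gamGr k deg n ≤ Submodule.span k
      (((finite_weight (deg := deg) n).toFinset.image (gamCoeff k deg) : Finset (Gam k deg)) :
        Set (Gam k deg)) := by
    intro γ hγ
    rw [gam_sum hγ]
    refine sum_mem fun m hm => Submodule.smul_mem _ _ (Submodule.subset_span ?_)
    exact Finset.mem_coe.2 (Finset.mem_image_of_mem _ hm)
  exact Submodule.finiteDimensional_of_le h

/-- Every homogeneous functional on `Γ` is the evaluation at an element of `S`. -/
theorem exists_eval {n : ℤ} (f : Gam k deg →ₗ[k] k) (hf : ∀ i, i ≠ n → ∀ γ ∈ gamGr k deg i, f γ = 0) :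
    ∃ s : Poly k c, ∀ γ, f γ = ev (sGr k deg) γ s := by
  let S := (finite_weight (deg := deg) n).toFinset
  refine ⟨∑ m ∈ S, f (gamCoeff k deg m) • monomial m 1, fun γ => ?_⟩
  refine LinearMap.congr_fun (f := f) (g := (ev (sGr k deg)).flip _) ?_ γ
  refine ext_gr (homGr_internal (AlgHom.id k k) (polyGr_internal (wt deg))) fun i γ hγ => ?_
  rw [LinearMap.flip_apply]
  simp only [map_sum, map_smul, smul_eq_mul]
  by_cases hi : i = n
  · subst hi
    conv_lhs => rw [gam_sum hγ]
    rw [map_sum]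
    refine Finset.sum_congr rfl fun m _ => ?_
    rw [map_smul, smul_eq_mul, mul_comm]
  · rw [hf i hi γ hγ]
    refine (Finset.sum_eq_zero fun m hm => ?_).symm
    rw [mem_gamGr.1 hγ m, mul_zero]
    have : (Finsupp.weight (wt deg) m : ℤ) = n := by simpa [S] using hm
    omega

/-- Division of polynomials by a variable, dropping the remainder. -/
def divX (k : Type u) [Field k] (i : Fin c) : Poly k c →ₗ[k] Poly k c where
  toFun s := divMonomial s (Finsupp.single i 1)
  map_add' s t := add_divMonomial s t _
  map_smul' r s := by ext m; simp [coeff_divMonomial]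

theorem isHom_divX (i : Fin c) : IsHom (sGr k deg) (sGr k deg) (wt deg i) (divX k i) := by
  intro n s hs m hm
  have h1 : coeff (Finsupp.single i 1 + m) s ≠ 0 := by
    rw [← coeff_divMonomial]; exact hm
  have h2 := hs h1
  rw [map_add, Finsupp.weight_single] at h2
  show Finsupp.weight (fun i => -(wt deg i : ℤ)) m = n + wt deg i
  rw [← h2, one_smul]
  ring

/-- The operator on `Γ` dual to division by a variable, a right inverse of the action of this
variable: it raises a divided power. -/
def gamRaise (k : Type u) [Field k] (deg : Fin c → ℕ) (i : Fin c) : Gam k deg →ₗ[k] Gam k deg :=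
  pre (divX k i) (isHom_divX i)

theorem gamRaise_ev (i : Fin c) (γ : Gam k deg) (s : Poly k c) :
    ev (sGr k deg) (gamRaise k deg i γ) s = ev (sGr k deg) γ (divX k i s) := rfl

theorem isHom_gamRaise (i : Fin c) :
    IsHom (gamGr k deg) (gamGr k deg) (wt deg i) (gamRaise k deg i) :=
  isHom_pre (divX k i) (isHom_divX i)

theorem isHom_gamAct (i : Fin c) :
    IsHom (gamGr k deg) (gamGr k deg) (-(wt deg i : ℤ)) (gamAct k deg (X i)) := fun n γ hγ => by
  rw [← sub_eq_add_neg]; exact gamAct_mem i hγ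

theorem gamAct_gamRaise_self (i : Fin c) (γ : Gam k deg) :
    gamAct k deg (X i) (gamRaise k deg i γ) = γ :=
  HomSp.ext fun s => by
    rw [gamAct_ev, gamRaise_ev]
    congr 1
    exact X_mul_divMonomial i s

theorem gamAct_gamRaise {i j : Fin c} (hij : i ≠ j) (γ : Gam k deg) :
    gamAct k deg (X i) (gamRaise k deg j γ) = gamRaise k deg j (gamAct k deg (X i) γ) :=
  HomSp.ext fun s => by
    classical
    rw [gamAct_ev, gamRaise_ev, gamRaise_ev, gamAct_ev]
    congr 1
    ext m
    show coeff m (divMonomial (X i * s) _) = coeff m (X i * divMonomial s _)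
    have h1 : i ∈ (Finsupp.single j 1 + m).support ↔ i ∈ m.support := by
      simp [Finsupp.single_apply, hij.symm]
    rw [coeff_divMonomial, coeff_X_mul', coeff_X_mul', coeff_divMonomial]
    by_cases h : i ∈ m.support
    · rw [if_pos h, if_pos (h1.2 h)]
      congr 1
      ext l
      have : m i ≠ 0 := by simpa using h
      simp only [Finsupp.coe_tsub, Finsupp.coe_add, Pi.sub_apply, Pi.add_apply,
        Finsupp.single_apply]
      by_cases hl : i = l
      · subst hl; simp [hij.symm]
      · simp [hl]
    · rw [if_neg h, if_neg (fun h' => h (h1.1 h'))]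

/-- The projection of `Γ` on the part in which the `i`-th divided power does not occur. -/
def gamKill (k : Type u) [Field k] (deg : Fin c → ℕ) (i : Fin c) : Module.End k (Gam k deg) :=
  1 - gamRaise k deg i * gamAct k deg (X i)

theorem gamAct_gamKill_self (i : Fin c) (γ : Gam k deg) :
    gamAct k deg (X i) (gamKill k deg i γ) = 0 := by
  simp [gamKill, gamAct_gamRaise_self]

theorem gamAct_gamKill {i j : Fin c} (hij : i ≠ j) (γ : Gam k deg) :
    gamAct k deg (X i) (gamKill k deg j γ) = gamKill k deg j (gamAct k deg (X i) γ) := by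
  simp [gamKill, gamAct_gamRaise hij, gamAct_comm i j]

variable (k deg) in
/-- The projection of `Γ` on the part in which none of the divided powers in a list occurs. -/
def gamKillList (l : List (Fin c)) : Module.End k (Gam k deg) := (l.map (gamKill k deg)).prod

theorem gamAct_gamKillList {l : List (Fin c)} {i : Fin c} (hi : i ∈ l) (γ : Gam k deg) :
    gamAct k deg (X i) (gamKillList k deg l γ) = 0 := by
  induction l with
  | nil => simp at hi
  | cons j l ih =>
    rw [gamKillList, List.map_cons, List.prod_cons, Module.End.mul_apply]
    by_cases h : i = j
    · subst h; exact gamAct_gamKill_self i _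
    · rw [gamAct_gamKill h]
      have := ih ((List.mem_cons.1 hi).resolve_left h)
      rw [gamKillList] at this
      rw [this, map_zero]

theorem gamKillList_finRange (γ : Gam k deg) :
    ∃ r : k, gamKillList k deg (List.finRange c) γ = r • gamOne k deg :=
  ⟨_, eq_smul_gamOne fun i => gamAct_gamKillList (List.mem_finRange i) γ⟩

end Gamma

/-! ### Complexes of finite type -/

section FiniteTypeExamples

variable {k : Type u} [Field k] {A : Type u} [Ring A] [Algebra k A] {𝒜 : ℤ → Submodule k A}

/-- The identity of a complex is homotopic to a projection `π` on a copy of the homology. -/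
theorem exists_homology_retraction (X : DGModule 𝒜) :
    ∃ (h π : X.carrier →ₗ[k] X.carrier) (q : Homology X →ₗ[k] X.carrier),
      IsHom X.gr X.gr 1 h ∧ IsHom X.gr X.gr 0 π ∧
      (∀ x, π x + (X.d (h x) + h (X.d x)) = x) ∧ (∀ x, X.d (π x) = 0) ∧
      ∀ n, ∀ x ∈ X.gr n, π x ∈ (homologyGr X n).map q := by
  obtain ⟨h, hh, hd⟩ := exists_graded_inverse X.internal X.d_isHom
  let r : X.carrier →ₗ[k] X.carrier := LinearMap.id - X.d.comp h
  let l : X.carrier →ₗ[k] X.carrier := LinearMap.id - h.comp X.d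
  have hr : IsHom X.gr X.gr 0 r := isHom_id.sub (X.d_isHom.comp hh rfl)
  have hl : IsHom X.gr X.gr 0 l := isHom_id.sub (hh.comp X.d_isHom rfl)
  have hlk : ∀ x, X.d (l x) = 0 := fun x => by simp [l, hd]
  let q : Homology X →ₗ[k] X.carrier := Submodule.liftQ _
    (r.comp (LinearMap.ker X.d).subtype) (by
      rintro ⟨x, hx⟩ ⟨y, hy⟩
      have hy' : X.d y = x := hy
      subst hy'
      simp [r, hd])
  refine ⟨h - X.d.comp (h.comp h), r.comp l, q,
    hh.sub (X.d_isHom.comp (hh.comp hh rfl) (by norm_num)), hr.comp hl rfl, fun x => ?_,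
    fun x => ?_, fun n x hx => ?_⟩
  · simp only [r, l, LinearMap.comp_apply, LinearMap.sub_apply, LinearMap.id_apply, map_sub, X.d_d]
    abel
  · show X.d (l x - X.d (h (l x))) = 0
    rw [map_sub, hlk, X.d_d, sub_zero]
  · have h1 := hl n x hx
    rw [add_zero] at h1
    exact ⟨_, ⟨⟨l x, hlk x⟩, h1, rfl⟩, rfl⟩

/-- A complex with degreewise finite-dimensional homology that vanishes in low degrees retracts, up to
homotopy, to its homology. -/
theorem IsFgBoundedBelow.hasFiniteType {X : DGModule 𝒜} (hX : IsFgBoundedBelow X) :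
    HasFiniteType X := by
  obtain ⟨h, π, q, hh, hπ, h1, -, h2⟩ := exists_homology_retraction X
  obtain ⟨hfin, b, hb⟩ := hX
  refine ⟨h, π, hh, hπ, h1, fun n => ?_, b, fun n hn x hx => ?_⟩
  · have := hfin n
    refine Submodule.finiteDimensional_of_le (S₂ := (homologyGr X n).map q) ?_
    rintro _ ⟨x, hx, rfl⟩
    exact h2 n x hx
  · have := h2 n x hx
    rwa [hb n hn, Submodule.map_bot, Submodule.mem_bot] at this

/-- The property of being of finite type is invariant under homotopy equivalences. -/
theorem HasFiniteType.of_isHEquiv {X Y : DGModule 𝒜} {f : DGHom X Y} (hf : IsHEquiv f)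
    (hY : HasFiniteType Y) : HasFiniteType X := by
  obtain ⟨p, h, -, hp, hh, -, hpd, h1, -⟩ := hf
  obtain ⟨l, π, hl, hπ, l1, hfin, b, hb⟩ := hY
  have hf0 : ∀ n, ∀ x ∈ X.gr n, f.lin x ∈ Y.gr n := fun n x hx => f.map_mem hx
  refine ⟨h + p.comp (l.comp f.lin), p.comp (π.comp f.lin),
    hh.add (hp.comp (hl.comp f.lin_isHom rfl) rfl), hp.comp (hπ.comp f.lin_isHom rfl) rfl,
    fun x => ?_, fun n => ?_, b, fun n hn x hx => ?_⟩
  · have e1 := congrArg p (l1 (f.lin x))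
    rw [map_add, map_add, hpd] at e1
    simp only [LinearMap.comp_apply, LinearMap.add_apply, map_add, f.lin_d]
    conv_rhs => rw [← h1 x, ← e1]
    abel
  · have := hfin n
    refine Submodule.finiteDimensional_of_le (S₂ := ((Y.gr n).map π).map p) ?_
    rintro _ ⟨x, hx, rfl⟩
    exact ⟨_, ⟨_, hf0 n x hx, rfl⟩, rfl⟩
  · rw [LinearMap.comp_apply, LinearMap.comp_apply, hb n hn _ (hf0 n x hx), map_zero]

end FiniteTypeExamples

/-! ### The twisted tensor product `Γ ⊗ M` -/

section Twisted

open MvPolynomial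

variable {k : Type u} [Field k] {c : ℕ} {deg : Fin c → ℕ} (M : DGExt k deg)

/-- The vector space `Γ ⊗ M`. -/
abbrev KSp : Type u := Gam k deg ⊗[k] M.carrier

/-- The grading of `Γ ⊗ M`. -/
abbrev kGr (n : ℤ) : Submodule k (KSp M) := tensorGr (gamGr k deg) M.gr n

theorem gamGr_internal : DirectSum.IsInternal (gamGr k deg) :=
  homGr_internal (AlgHom.id k k) (polyGr_internal (wt deg))

theorem kGr_internal : DirectSum.IsInternal (kGr M) := tensor_internal gamGr_internal M.internal

/-- The differential `1 ⊗ ∂`. -/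
def kD0 : Module.End k (KSp M) := TensorProduct.map LinearMap.id M.d

/-- The twisting term `∑ χ i ⊗ e i` of the differential of `Γ ⊗ M`. -/
def kTau : Module.End k (KSp M) := ∑ i, TensorProduct.map (gamAct k deg (X i)) (eAct M i)

theorem isHom_eAct (i : Fin c) : IsHom M.gr M.gr (deg i) (eAct M i) := fun n m hm => by
  rw [add_comm]; exact M.smul_mem (gen_mem deg i) hm

theorem isHom_kTau : IsHom (kGr M) (kGr M) (-1) (kTau M) := by
  intro n t ht
  rw [kTau, LinearMap.sum_apply]
  refine sum_mem fun i _ => ?_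
  exact (isHom_gamAct i).tensor (isHom_eAct M i) (by push_cast; ring) n t ht

theorem isHom_kD0 : IsHom (kGr M) (kGr M) (-1) (kD0 M) := isHom_id.tensor M.d_isHom rfl

theorem kTau_sq : kTau M * kTau M = 0 := by
  refine sum_sq_zero _ _ (fun i => ?_) (fun i j => ?_)
  · refine TensorProduct.ext' fun γ m => ?_
    simp [gen_smul_sq]
  · refine TensorProduct.ext' fun γ m => ?_
    simp only [Module.End.mul_apply, TensorProduct.map_tmul, Algebra.lsmul_coe,
      gen_smul_anticomm M i j, gamAct_comm i j, TensorProduct.tmul_neg, LinearMap.neg_apply]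

theorem kD0_kTau (hdeg : ∀ i, Odd (deg i)) : kD0 M * kTau M = -(kTau M * kD0 M) := by
  rw [kTau, Finset.mul_sum, Finset.sum_mul, ← Finset.sum_neg_distrib]
  refine Finset.sum_congr rfl fun i _ => TensorProduct.ext' fun γ m => ?_
  simp [kD0, d_gen M hdeg, TensorProduct.tmul_neg]

theorem kD0_sq : kD0 M * kD0 M = 0 := TensorProduct.ext' fun γ m => by simp [kD0, M.d_d]

/-- The differential of `Γ ⊗ M`. -/
def kD : Module.End k (KSp M) := kD0 M + kTau M

theorem kD_tmul (γ : Gam k deg) (m : M.carrier) : kD M (γ ⊗ₜ m) =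
    γ ⊗ₜ M.d m + ∑ i, gamAct k deg (X i) γ ⊗ₜ (gen k i • m) := by
  rw [kD, LinearMap.add_apply, kTau, LinearMap.sum_apply]
  rfl

theorem kD_kD (hdeg : ∀ i, Odd (deg i)) (t : KSp M) : kD M (kD M t) = 0 := by
  have h : kD M * kD M = 0 := by
    rw [kD, add_mul, mul_add, mul_add, kD0_sq, kTau_sq, kD0_kTau M hdeg]
    abel
  exact LinearMap.congr_fun h t

theorem kAct_d (i : Fin c) : Commute (kD M)
    (TensorProduct.map (gamAct k deg (X i)) LinearMap.id : Module.End k (KSp M)) := by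
  refine TensorProduct.ext' fun γ m => ?_
  simp only [Module.End.mul_apply, kD, LinearMap.add_apply, kD0, kTau, LinearMap.sum_apply,
    TensorProduct.map_tmul, LinearMap.id_apply, map_add, map_sum, gamAct_comm i]

/-- The dg `S`-module `Γ ⊗ M` with the differential `1 ⊗ ∂ + ∑ χ i ⊗ e i`; its graded dual is
`d M`. -/
def K (hdeg : ∀ i, Odd (deg i)) : DGPoly k deg :=
  DGPoly.ofAct hdeg (KSp M) (kGr M) (kGr_internal M) (kD M)
    ((isHom_kD0 M).add (isHom_kTau M)) (kD_kD M hdeg)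
    ((Module.End.rTensorAlgHom k (Gam k deg) M.carrier).comp (gamAct k deg))
    (fun i j t ht => by
      have h := (isHom_gamAct i).tensor (isHom_id (gX := M.gr)) (add_zero _) j t ht
      rwa [← sub_eq_add_neg] at h)
    (fun i t => LinearMap.congr_fun (kAct_d M i) t)

variable {M} (hdeg : ∀ i, Odd (deg i))

variable (M) in
/-- The element `γ ⊗ m` of `K M`. -/
def kmk : Gam k deg →ₗ[k] M.carrier →ₗ[k] (K M hdeg).carrier :=
  TensorProduct.mk k (Gam k deg) M.carrier

variable {hdeg}

theorem kmk_ext {Z : Type*} [AddCommGroup Z] [Module k Z] {f g : (K M hdeg).carrier →ₗ[k] Z}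
    (h : ∀ γ m, f (kmk M hdeg γ m) = g (kmk M hdeg γ m)) : f = g :=
  TensorProduct.ext' (M := Gam k deg) (N := M.carrier) h

theorem sgn_kmk (γ : Gam k deg) (m : M.carrier) :
    sgn (K M hdeg).internal (kmk M hdeg γ m) = kmk M hdeg γ (sgn M.internal m) := by
  have h := LinearMap.congr_fun (sgn_tensor (gamGr_internal (k := k) (deg := deg)) M.internal)
    (γ ⊗ₜ m)
  rw [TensorProduct.map_tmul, sgn_gam hdeg] at h
  exact h

theorem kD_one (m : M.carrier) : kD M (gamOne k deg ⊗ₜ m) = gamOne k deg ⊗ₜ M.d m := by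
  rw [kD_tmul]
  simp [gamAct_gamOne]

/-! The filtration of `Γ ⊗ M` by the degree in `Γ`. -/

variable (M) in
/-- The part of `Γ ⊗ M` where the degree in `Γ` is at most `j`. -/
def gamFil (j : ℤ) : Submodule k (KSp M) :=
  Submodule.span k {t | ∃ i γ m, i ≤ j ∧ γ ∈ gamGr k deg i ∧ t = γ ⊗ₜ[k] m}

theorem gamFil_mono {i j : ℤ} (h : i ≤ j) : gamFil M i ≤ gamFil M j := by
  refine Submodule.span_mono ?_
  rintro _ ⟨l, γ, m, hl, hγ, rfl⟩
  exact ⟨l, γ, m, hl.trans h, hγ, rfl⟩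

theorem exists_mem_gamFil (t : KSp M) : ∃ j, t ∈ gamFil M j := by
  have h1 : ∀ γ : Gam k deg, ∃ j, ∀ m, γ ⊗ₜ[k] m ∈ gamFil M j := by
    intro γ
    have hγ : γ ∈ ⨆ i, gamGr k deg i := by
      rw [gamGr_internal.submodule_iSup_eq_top]; trivial
    refine Submodule.iSup_induction _ (motive := fun γ : Gam k deg => ∃ j, ∀ m, γ ⊗ₜ[k] m ∈ gamFil M j)
      hγ ?_ ⟨0, fun m => by rw [TensorProduct.zero_tmul]; exact zero_mem _⟩ ?_
    · intro i γ hγ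
      exact ⟨i, fun m => Submodule.subset_span ⟨i, γ, m, le_rfl, hγ, rfl⟩⟩
    · rintro γ γ' ⟨i, hi⟩ ⟨j, hj⟩
      refine ⟨max i j, fun m => ?_⟩
      rw [TensorProduct.add_tmul]
      exact add_mem (gamFil_mono (le_max_left _ _) (hi m)) (gamFil_mono (le_max_right _ _) (hj m))
  induction t using TensorProduct.induction_on with
  | zero => exact ⟨0, zero_mem _⟩
  | tmul γ m => exact (h1 γ).imp fun j hj => hj m
  | add s t hs ht =>
    obtain ⟨i, hi⟩ := hs
    obtain ⟨j, hj⟩ := ht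
    exact ⟨max i j, add_mem (gamFil_mono (le_max_left _ _) hi) (gamFil_mono (le_max_right _ _) hj)⟩

theorem gamFil_neg {j : ℤ} (hj : j < 0) {t : KSp M} (ht : t ∈ gamFil M j) : t = 0 := by
  have : gamFil M j ≤ ⊥ := by
    refine Submodule.span_le.2 ?_
    rintro _ ⟨i, γ, m, hi, hγ, rfl⟩
    rw [gamGr_neg (by omega) hγ, TensorProduct.zero_tmul]
    exact zero_mem _
  exact this ht

/-- An endomorphism of `Γ ⊗ M` that lowers the degree in `Γ` is locally nilpotent. -/
theorem locally_nilpotent_of_gamFil {n : Module.End k (KSp M)}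
    (hn : ∀ i γ m, γ ∈ gamGr k deg i → n (γ ⊗ₜ m) ∈ gamFil M (i - 1)) (t : KSp M) :
    ∃ r : ℕ, (n ^ r) t = 0 := by
  have h1 : ∀ j, ∀ t ∈ gamFil M j, n t ∈ gamFil M (j - 1) := by
    intro j t ht
    refine (Submodule.span_le.2 ?_ : gamFil M j ≤ (gamFil M (j - 1)).comap n) ht
    rintro _ ⟨i, γ, m, hi, hγ, rfl⟩
    exact gamFil_mono (by omega) (hn i γ m hγ)
  have h2 : ∀ r : ℕ, ∀ j, ∀ t ∈ gamFil M j, (n ^ r) t ∈ gamFil M (j - r) := by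
    intro r
    induction r with
    | zero => intro j t ht; simpa using ht
    | succ r ih =>
      intro j t ht
      have := ih _ _ (h1 j t ht)
      rw [pow_succ, Module.End.mul_apply]
      convert this using 2
      push_cast; ring
  obtain ⟨j, hj⟩ := exists_mem_gamFil t
  exact ⟨(j + 1).toNat, gamFil_neg (by omega) (h2 _ j t hj)⟩

theorem gamAct_tmul_mem_gamFil {i : Fin c} {n : ℤ} {γ : Gam k deg} (hγ : γ ∈ gamGr k deg n)
    (m : M.carrier) : gamAct k deg (X i) γ ⊗ₜ[k] m ∈ gamFil M (n - 1) :=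
  Submodule.subset_span ⟨_, _, m, by simp, gamAct_mem i hγ, rfl⟩

end Twisted

/-! ### Functoriality and finiteness of `Γ ⊗ M` -/

section TwistedFunctor

open MvPolynomial

variable {k : Type u} [Field k] {c : ℕ} {deg : Fin c → ℕ} {M N : DGExt k deg}

/-- The action of a variable on `Γ ⊗ M`. -/
def kX (M : DGExt k deg) (i : Fin c) : Module.End k (KSp M) :=
  TensorProduct.map (gamAct k deg (X i)) LinearMap.id

/-- The right inverse `gamRaise ⊗ 1` of the action of a variable on `Γ ⊗ M`. -/
def kRaise (M : DGExt k deg) (i : Fin c) : Module.End k (KSp M) :=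
  TensorProduct.map (gamRaise k deg i) LinearMap.id

theorem kX_tmul (i : Fin c) (γ : Gam k deg) (m : M.carrier) :
    kX M i (γ ⊗ₜ m) = gamAct k deg (X i) γ ⊗ₜ m := rfl

theorem kRaise_tmul (i : Fin c) (γ : Gam k deg) (m : M.carrier) :
    kRaise M i (γ ⊗ₜ m) = gamRaise k deg i γ ⊗ₜ m := rfl

theorem kX_kRaise_self (i : Fin c) (t : KSp M) : kX M i (kRaise M i t) = t := by
  refine LinearMap.congr_fun (f := (kX M i).comp (kRaise M i)) (g := LinearMap.id)
    (TensorProduct.ext' fun γ m => ?_) t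
  simp [kX_tmul, kRaise_tmul, gamAct_gamRaise_self]

theorem kX_kRaise {i j : Fin c} (hij : i ≠ j) (t : KSp M) :
    kX M i (kRaise M j t) = kRaise M j (kX M i t) := by
  refine LinearMap.congr_fun (f := (kX M i).comp (kRaise M j)) (g := (kRaise M j).comp (kX M i))
    (TensorProduct.ext' fun γ m => ?_) t
  simp [kX_tmul, kRaise_tmul, gamAct_gamRaise hij]

theorem kX_comm (i j : Fin c) (t : KSp M) : kX M i (kX M j t) = kX M j (kX M i t) := by
  refine LinearMap.congr_fun (f := (kX M i).comp (kX M j)) (g := (kX M j).comp (kX M i))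
    (TensorProduct.ext' fun γ m => ?_) t
  simp [kX_tmul, gamAct_comm i j]

theorem kX_nilpotent (i : Fin c) (t : KSp M) : ∃ r : ℕ, (kX M i ^ r) t = 0 :=
  locally_nilpotent_of_gamFil (fun _ _ m hγ => gamAct_tmul_mem_gamFil hγ m) t

theorem kX_kD (i : Fin c) (t : KSp M) : kX M i (kD M t) = kD M (kX M i t) :=
  (LinearMap.congr_fun (kAct_d M i) t).symm

/-- The elements of `Γ ⊗ M` killed by all variables are those of `1 ⊗ M`. -/
theorem exists_one_tmul {t : KSp M} (h : ∀ i, kX M i t = 0) :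
    ∃ m : M.carrier, t = gamOne k deg ⊗ₜ m := by
  have h1 : ∀ l : List (Fin c), TensorProduct.map (gamKillList k deg l) LinearMap.id t = t := by
    intro l
    induction l with
    | nil => exact LinearMap.congr_fun TensorProduct.map_id t
    | cons i l ih =>
      have e1 : (TensorProduct.map (gamKillList k deg (i :: l)) LinearMap.id :
          Module.End k (KSp M)) = (1 - (kRaise M i).comp (kX M i)).comp
            (TensorProduct.map (gamKillList k deg l) LinearMap.id) := by
        refine TensorProduct.ext' fun γ m => ?_
        simp [gamKillList, gamKill, kX_tmul, kRaise_tmul, TensorProduct.sub_tmul]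
      rw [e1, LinearMap.comp_apply, ih]
      simp [h i]
  rw [← h1 (List.finRange c)]
  clear h h1
  induction t using TensorProduct.induction_on with
  | zero => exact ⟨0, by simp⟩
  | tmul γ m =>
    obtain ⟨r, hr⟩ := gamKillList_finRange γ
    exact ⟨r • m, by rw [TensorProduct.map_tmul, hr, TensorProduct.smul_tmul]; rfl⟩
  | add s t hs ht =>
    obtain ⟨m, hm⟩ := hs
    obtain ⟨m', hm'⟩ := ht
    exact ⟨m + m', by rw [map_add, hm, hm', TensorProduct.tmul_add]⟩

variable (M) in
/-- The evaluation `γ ⊗ m ↦ γ(1) m`. -/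
def kAug : KSp M →ₗ[k] M.carrier :=
  (TensorProduct.lid k M.carrier).toLinearMap.comp
    (TensorProduct.map ((ev (sGr k deg)).flip 1) LinearMap.id)

theorem kAug_tmul (γ : Gam k deg) (m : M.carrier) :
    kAug M (γ ⊗ₜ m) = ev (sGr k deg) γ 1 • m := rfl

theorem kAug_one (m : M.carrier) : kAug M (gamOne k deg ⊗ₜ m) = m := by
  rw [kAug_tmul, gamCoeff_ev, coeff_zero_one, one_smul]

theorem kX_one (i : Fin c) (m : M.carrier) : kX M i (gamOne k deg ⊗ₜ m) = 0 := by
  rw [kX_tmul, gamAct_gamOne, TensorProduct.zero_tmul]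

theorem one_tmul_injective {m m' : M.carrier} (h : gamOne k deg ⊗ₜ[k] m = gamOne k deg ⊗ₜ m') :
    m = m' := by
  rw [← kAug_one m, h, kAug_one]

/-- The elements of `Γ ⊗ M` killed by all variables form the complex `1 ⊗ M`, so that dévissage along the
variables applies. -/
theorem K_acyclic_iff (hdeg : ∀ i, Odd (deg i)) : Acyclic (K M hdeg).d ↔ Acyclic M.d := by
  show Acyclic (kD M) ↔ _
  refine (acyclic_iff_ker (kD M) (kD_kD M hdeg) (kX M) (kRaise M) kX_kD
    kX_kRaise_self (fun i j h => kX_kRaise h) kX_comm kX_nilpotent).trans ⟨fun h m hm => ?_,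
      fun h t ht hd => ?_⟩
  · obtain ⟨w, hw, hwm⟩ := h (gamOne k deg ⊗ₜ m) (fun i => kX_one i m)
      (by rw [kD_one, hm, TensorProduct.tmul_zero])
    obtain ⟨w', rfl⟩ := exists_one_tmul hw
    exact ⟨w', one_tmul_injective (by rw [← kD_one, hwm])⟩
  · obtain ⟨m, rfl⟩ := exists_one_tmul ht
    obtain ⟨w, hw⟩ := h m (one_tmul_injective (by rw [← kD_one, hd, TensorProduct.tmul_zero]))
    exact ⟨_, fun i => kX_one i w, by rw [kD_one, hw]⟩

/-- The map `1 ⊗ f` on `Γ ⊗ M`. -/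
def kMap (f : DGHom M N) : KSp M →ₗ[k] KSp N := TensorProduct.map LinearMap.id f.lin

theorem kMap_tmul (f : DGHom M N) (γ : Gam k deg) (m : M.carrier) :
    kMap f (γ ⊗ₜ m) = γ ⊗ₜ f.lin m := rfl

theorem kMap_kD (f : DGHom M N) (t : KSp M) : kMap f (kD M t) = kD N (kMap f t) := by
  refine LinearMap.congr_fun (f := (kMap f).comp (kD M)) (g := (kD N).comp (kMap f))
    (TensorProduct.ext' fun γ m => ?_) t
  have e2 : ∀ i (m : M.carrier), f.lin (gen k i • m) = gen k i • f.lin m :=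
    fun i m => map_smul f.toFun _ _
  simp only [LinearMap.comp_apply, kD_tmul, map_add, map_sum, kMap_tmul, f.lin_d, e2]

theorem kMap_kX (f : DGHom M N) (i : Fin c) (t : KSp M) : kMap f (kX M i t) = kX N i (kMap f t) :=
  LinearMap.congr_fun (f := (kMap f).comp (kX M i)) (g := (kX N i).comp (kMap f))
    (TensorProduct.ext' fun γ m => rfl) t

/-- The morphism of dg `S`-modules `Γ ⊗ M → Γ ⊗ N` induced by a morphism `M → N`. -/
def Kmap (hdeg : ∀ i, Odd (deg i)) (f : DGHom M N) : DGHom (K M hdeg) (K N hdeg) :=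
  DGHom.ofLin (P := K M hdeg) (Q := K N hdeg) (kMap f) (isHom_id.tensor f.lin_isHom rfl)
    (kMap_kD f) (kMap_kX f)

/-- Dévissage along the variables, applied to the mapping cone of `Γ ⊗ M → Γ ⊗ N`, reduces this to the cone
of `M → N`. -/
theorem DGHom.IsQuasiIso.Kmap (hdeg : ∀ i, Odd (deg i)) {f : DGHom M N} (hf : f.IsQuasiIso) :
    (Kmap hdeg f).IsQuasiIso := by
  rw [DGHom.isQuasiIso_iff] at hf ⊢
  show Acyclic (coneD (kD M) (kD N) (kMap f))
  refine (acyclic_iff_ker _ (coneD_coneD (kD_kD M hdeg) (kD_kD N hdeg) (kMap_kD f))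
    (fun i => (kX M i).prodMap (kX N i)) (fun i => (kRaise M i).prodMap (kRaise N i))
    (fun i v => ?_) (fun i v => Prod.ext (kX_kRaise_self i _) (kX_kRaise_self i _))
    (fun i j hij v => Prod.ext (kX_kRaise hij _) (kX_kRaise hij _))
    (fun i j v => Prod.ext (kX_comm i j _) (kX_comm i j _)) (fun i v => ?_)).2 ?_
  · refine Prod.ext ?_ ?_
    · show kX M i (-kD M v.1) = -kD M (kX M i v.1)
      rw [map_neg, kX_kD]
    · show kX N i (kMap f v.1 + kD N v.2) = kMap f (kX M i v.1) + kD N (kX N i v.2)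
      rw [map_add, kX_kD, kMap_kX]
  · have e1 : ∀ (r : ℕ) s t, (((kX M i).prodMap (kX N i)) ^ r) (s, t) =
        ((kX M i ^ r) s, (kX N i ^ r) t) := by
      intro r
      induction r with
      | zero => intro s t; rfl
      | succ r ih => intro s t; simp only [pow_succ, Module.End.mul_apply, LinearMap.prodMap_apply, ih]
    obtain ⟨a, ha⟩ := kX_nilpotent i v.1
    obtain ⟨b, hb⟩ := kX_nilpotent i v.2
    refine ⟨a + b, (e1 _ _ _).trans (Prod.ext ?_ ?_)⟩
    · show (kX M i ^ (a + b)) v.1 = 0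
      rw [add_comm, pow_add, Module.End.mul_apply, ha, map_zero]
    · show (kX N i ^ (a + b)) v.2 = 0
      rw [pow_add, Module.End.mul_apply, hb, map_zero]
  · rintro ⟨s, t⟩ hst hd
    obtain ⟨m, rfl⟩ := exists_one_tmul fun i => congrArg Prod.fst (hst i)
    obtain ⟨n, rfl⟩ := exists_one_tmul fun i => congrArg Prod.snd (hst i)
    rw [coneD_apply, Prod.mk_eq_zero] at hd
    obtain ⟨hd1, hd2⟩ := hd
    dsimp only at hd1 hd2
    rw [kD_one, ← TensorProduct.tmul_neg, ← TensorProduct.tmul_zero _ (gamOne k deg)] at hd1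
    rw [kD_one, kMap_tmul, ← TensorProduct.tmul_add,
      ← TensorProduct.tmul_zero _ (gamOne k deg)] at hd2
    obtain ⟨⟨m', n'⟩, hw⟩ := hf (m, n)
      (Prod.ext (one_tmul_injective hd1) (one_tmul_injective hd2))
    rw [coneD_apply, Prod.mk.injEq] at hw
    refine ⟨(gamOne k deg ⊗ₜ m', gamOne k deg ⊗ₜ n'),
      fun i => Prod.ext (kX_one i m') (kX_one i n'), ?_⟩
    rw [coneD_apply]
    dsimp only
    rw [kD_one, kD_one, kMap_tmul, ← TensorProduct.tmul_neg, ← TensorProduct.tmul_add]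
    exact Prod.ext (by rw [hw.1]) (by rw [hw.2])

/-- A homotopy from the identity of `M` to `π` induces one for `Γ ⊗ M`, from the identity to
`A' (1 ⊗ π) A` with graded endomorphisms `A` and `A'`, all compatible with the action of `S`. This is the
perturbation lemma for the twisting term `τ = ∑ χ i ⊗ e i`; it applies because `τ (1 ⊗ h)` lowers the degree
in `Γ`, hence is locally nilpotent. -/
theorem K_perturbation (hdeg : ∀ i, Odd (deg i)) {h π : M.carrier →ₗ[k] M.carrier}
    (hh : IsHom M.gr M.gr 1 h) (h1 : ∀ x, π x + (M.d (h x) + h (M.d x)) = x) :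
    ∃ A A' H : Module.End k (KSp M), IsHom (kGr M) (kGr M) 0 A ∧ IsHom (kGr M) (kGr M) 0 A' ∧
      IsHom (kGr M) (kGr M) 1 H ∧ (∀ i, Commute (kX M i) A) ∧ (∀ i, Commute (kX M i) A') ∧
      (∀ i, Commute (kX M i) H) ∧
      ∀ t, A' (TensorProduct.map LinearMap.id π (A t)) + (kD M (H t) + H (kD M t)) = t := by
  let h' : Module.End k (KSp M) := TensorProduct.map LinearMap.id h
  have hh' : IsHom (kGr M) (kGr M) 1 h' := isHom_id.tensor hh rfl
  have hn : IsHom (kGr M) (kGr M) 0 (kTau M * h') := (isHom_kTau M).comp hh' rfl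
  obtain ⟨a, ha, ha', haP⟩ := exists_inverse_one_add (n := kTau M * h') (fun t =>
    locally_nilpotent_of_gamFil (fun i γ m hγ => by
      rw [Module.End.mul_apply, TensorProduct.map_tmul, kTau, LinearMap.sum_apply]
      exact sum_mem fun i _ => gamAct_tmul_mem_gamFil hγ _) t)
  have hhom : IsHom (kGr M) (kGr M) 0 a := by
    intro n t ht
    rw [add_zero]
    exact haP (kGr M n) (fun v hv => by have := hn n v hv; rwa [add_zero] at this) t ht
  have cτ : ∀ i, Commute (kX M i) (kTau M) := fun i => by
    refine TensorProduct.ext' fun γ m => ?_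
    simp only [Module.End.mul_apply, kTau, LinearMap.sum_apply, TensorProduct.map_tmul, kX_tmul,
      map_sum, gamAct_comm i]
  have ch : ∀ i, Commute (kX M i) h' := fun i => TensorProduct.ext' fun γ m => rfl
  have ca : ∀ i, Commute (kX M i) a := by
    intro i
    have e : kX M i * (1 + kTau M * h') = (1 + kTau M * h') * kX M i :=
      ((Commute.one_right _).add_right ((cτ i).mul_right (ch i))).eq
    calc kX M i * a = (a * (1 + kTau M * h')) * kX M i * a := by rw [ha, one_mul]
      _ = a * ((1 + kTau M * h') * kX M i) * a := by simp only [mul_assoc]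
      _ = a * kX M i * ((1 + kTau M * h') * a) := by rw [← e]; simp only [mul_assoc]
      _ = a * kX M i := by rw [ha', mul_one]
  have key := perturbation (d := kD0 M) (τ := kTau M) (h := h')
    (π := (TensorProduct.map LinearMap.id π : Module.End k (KSp M))) (kTau_sq M) (kD0_kTau M hdeg)
    (by
      refine TensorProduct.ext' fun γ m => ?_
      simp only [LinearMap.add_apply, Module.End.mul_apply, LinearMap.sub_apply, kD0, h',
        TensorProduct.map_tmul, LinearMap.id_apply, Module.End.one_apply,
        ← TensorProduct.tmul_add, ← TensorProduct.tmul_sub]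
      rw [eq_sub_of_add_eq' (h1 m)]) ha ha'
  refine ⟨a, 1 - h' * a * kTau M, h' * a, hhom,
    isHom_id.sub ((hh'.comp hhom rfl).comp (isHom_kTau M) rfl), hh'.comp hhom rfl, ca,
    fun i => (Commute.one_right _).sub_right (((ch i).mul_right (ca i)).mul_right (cτ i)),
    fun i => (ch i).mul_right (ca i), fun t => ?_⟩
  have := LinearMap.congr_fun key t
  exact add_eq_of_eq_sub' this

/-- The degree of `Γ` is bounded below and `Γ` is finite-dimensional in each degree, so that `1 ⊗ π` inherits
the finiteness of `π`; it passes to the twisted differential by perturbation. -/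
theorem HasFiniteType.K (hdeg : ∀ i, Odd (deg i)) (hM : HasFiniteType M) :
    HasFiniteType (K M hdeg) := by
  obtain ⟨h, π, hh, hπ, h1, hfin, b, hb⟩ := hM
  obtain ⟨A, A', H, hA, hA', hH, -, -, -, h2⟩ := K_perturbation hdeg hh h1
  let π' : Module.End k (KSp M) := TensorProduct.map LinearMap.id π
  have hπ' : IsHom (kGr M) (kGr M) 0 π' := isHom_id.tensor hπ rfl
  have hA0 : ∀ n, ∀ t ∈ kGr M n, A t ∈ kGr M n := fun n t ht => by
    have := hA n t ht
    rwa [add_zero] at this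
  refine ⟨H, A'.comp (π'.comp A), hH, hA'.comp (hπ'.comp hA rfl) rfl, h2, fun n => ?_, b,
    fun n hn t ht => ?_⟩
  · let Q : Submodule k (KSp M) := ⨆ i ∈ Finset.Icc 0 (n - b),
      Submodule.map₂ (TensorProduct.mk k (Gam k deg) M.carrier) (gamGr k deg i)
        ((M.gr (n - i)).map π)
    have hQ : FiniteDimensional k Q := by
      refine (Submodule.fg_iff_finiteDimensional _).1 (Submodule.fg_biSup _ _ fun i _ => ?_)
      have h3 := finite_gamGr (k := k) (deg := deg) i
      have h4 := hfin (n - i)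
      exact Submodule.FG.map₂ _ ((Submodule.fg_iff_finiteDimensional _).2 h3)
        ((Submodule.fg_iff_finiteDimensional _).2 h4)
    have hQ' : ∀ t ∈ kGr M n, π' t ∈ Q := fun t ht => by
      refine tensorGr_map (fun i j γ m hn hγ hm => ?_) ht
      rw [TensorProduct.map_tmul, LinearMap.id_apply]
      by_cases hi : i ∈ Finset.Icc 0 (n - b)
      · refine Submodule.mem_iSup_of_mem i (Submodule.mem_iSup_of_mem hi ?_)
        obtain rfl : j = n - i := by omega
        exact Submodule.apply_mem_map₂ _ hγ ⟨m, hm, rfl⟩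
      · rw [Finset.mem_Icc, not_and_or, not_le, not_le] at hi
        rcases hi with hi | hi
        · rw [gamGr_neg hi hγ, TensorProduct.zero_tmul]; exact zero_mem _
        · rw [hb j (by omega) m hm, TensorProduct.tmul_zero]; exact zero_mem _
    show FiniteDimensional k ((kGr M n).map (A'.comp (π'.comp A)))
    have hQA : FiniteDimensional k (Q.map A') := Module.Finite.map Q A'
    refine Submodule.finiteDimensional_of_le (S₂ := Q.map A') ?_
    rintro _ ⟨t, ht, rfl⟩
    exact ⟨_, hQ' _ (hA0 n t ht), rfl⟩
  · have h3 : ∀ t ∈ kGr M n, π' t ∈ (⊥ : Submodule k (KSp M)) := fun t ht => by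
      refine tensorGr_map (fun i j γ m hn hγ hm => ?_) ht
      rw [TensorProduct.map_tmul, LinearMap.id_apply, Submodule.mem_bot]
      by_cases hi : i < 0
      · rw [gamGr_neg hi hγ, TensorProduct.zero_tmul]
      · rw [hb j (by omega) m hm, TensorProduct.tmul_zero]
    have h4 : π' (A t) = 0 := h3 _ (hA0 n t ht)
    show A' (π' (A t)) = 0
    rw [h4, map_zero]

end TwistedFunctor

/-! ### The product of `Γ` -/

section GammaProduct

open MvPolynomial

variable {k : Type u} [Field k] {c : ℕ} {deg : Fin c → ℕ}

theorem isHom_diag : IsHom (sGr k deg) (tensorGr (sGr k deg) (sGr k deg)) 0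
    (diag k c).toLinearMap := by
  intro n s hs
  have h1 : (1 : Poly k c ⊗[k] Poly k c) ∈ tensorGr (sGr k deg) (sGr k deg) 0 :=
    tmul_mem (isWeightedHomogeneous_one k _) (isWeightedHomogeneous_one k _) (add_zero 0)
  have h2 := act_mem (wt deg) (gr := tensorGr (sGr k deg) (sGr k deg))
    ((Algebra.lmul k (Poly k c ⊗[k] Poly k c)).comp (diag k c)) (fun i j t ht => ?_) hs h1
  · simpa using h2
  · have e : ∀ j (x : Poly k c), x ∈ sGr k deg j → X i * x ∈ sGr k deg (-(wt deg i : ℤ) + j) :=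
      fun j x hx => IsWeightedHomogeneous.mul (X_mem_polyGr (wt deg) i) hx
    refine tensorGr_map (fun p q x y hn hx hy => ?_) ht
    simp only [AlgHom.comp_apply, diag, aeval_X, Algebra.coe_lmul_eq_mul, LinearMap.mul_apply',
      add_mul, Algebra.TensorProduct.tmul_mul_tmul, one_mul]
    exact add_mem (tmul_mem (e p x hx) hy (by omega)) (tmul_mem hx (e q y hy) (by omega))

/-- The functional on `S ⊗ S` given by a pair of elements of `Γ`; no signs occur as the degrees are
even. -/
theorem pairing_gam (hdeg : ∀ i, Odd (deg i)) (γ γ' : Gam k deg) (s t : Poly k c) :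
    pairing (polyGr_internal (k := k) (wt deg)) (polyGr_internal (wt deg)) (γ ⊗ₜ γ') (s ⊗ₜ t) =
      ev (sGr k deg) γ s * ev (sGr k deg) γ' t := by
  have : pairing (polyGr_internal (k := k) (wt deg)) (polyGr_internal (wt deg)) (γ ⊗ₜ γ') =
      TensorProduct.dualDistrib k _ _ (ev (sGr k deg) γ ⊗ₜ ev (sGr k deg) γ') := by
    refine tensor_ext_gr (polyGr_internal (k := k) (wt deg)) (polyGr_internal (wt deg))
      fun i j x y hx hy => ?_
    rw [pairing_tmul _ _ _ _ hx hy, TensorProduct.dualDistrib_apply, zpow_mul]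
    rcases polyGr_even (wt deg) (wt_even hdeg) hx (1 : k) with h | h
    · rw [smul_eq_mul, mul_one] at h
      rw [h, one_zpow, one_mul]
    · rw [h, map_zero, zero_mul, mul_zero]
  rw [this, TensorProduct.dualDistrib_apply]

/-- The product of `Γ`, dual to the diagonal of `S`. -/
def gmul : Gam k deg ⊗[k] Gam k deg →ₗ[k] Gam k deg :=
  (pre (diag k c).toLinearMap isHom_diag).comp
    (gPairing (polyGr_internal (wt deg)) (polyGr_internal (wt deg)))

theorem isHom_gmul : IsHom (tensorGr (gamGr k deg) (gamGr k deg)) (gamGr k deg) 0 gmul :=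
  (isHom_pre _ isHom_diag).comp (isHom_gPairing _ _) rfl

theorem gmul_ev (t : Gam k deg ⊗[k] Gam k deg) (s : Poly k c) :
    ev (sGr k deg) (gmul t) s = pairing (polyGr_internal (wt deg)) (polyGr_internal (wt deg)) t
      (diag k c s) := rfl

/-- The variables act on `Γ` by derivations. -/
theorem gamAct_gmul (hdeg : ∀ i, Odd (deg i)) (i : Fin c) (γ γ' : Gam k deg) :
    gamAct k deg (X i) (gmul (γ ⊗ₜ γ')) =
      gmul (gamAct k deg (X i) γ ⊗ₜ γ') + gmul (γ ⊗ₜ gamAct k deg (X i) γ') := by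
  refine HomSp.ext fun s => ?_
  have key : ∀ t : Poly k c ⊗[k] Poly k c,
      pairing (polyGr_internal (wt deg)) (polyGr_internal (wt deg)) (γ ⊗ₜ γ')
        ((X i ⊗ₜ[k] 1 + 1 ⊗ₜ[k] X i) * t) =
      pairing (polyGr_internal (wt deg)) (polyGr_internal (wt deg))
        (gamAct k deg (X i) γ ⊗ₜ γ') t +
      pairing (polyGr_internal (wt deg)) (polyGr_internal (wt deg))
        (γ ⊗ₜ gamAct k deg (X i) γ') t := by
    intro t
    induction t using TensorProduct.induction_on with
    | zero => simp
    | tmul p q =>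
      rw [add_mul, Algebra.TensorProduct.tmul_mul_tmul, Algebra.TensorProduct.tmul_mul_tmul,
        one_mul, one_mul, map_add, pairing_gam hdeg, pairing_gam hdeg, pairing_gam hdeg,
        pairing_gam hdeg, gamAct_ev, gamAct_ev]
    | add p q hp hq => rw [mul_add, map_add, hp, hq, map_add, map_add]; abel
  rw [map_add, LinearMap.add_apply, gamAct_ev, gmul_ev, gmul_ev, gmul_ev, map_mul]
  have e : diag k c (X i) = X i ⊗ₜ[k] 1 + 1 ⊗ₜ[k] X i := aeval_X _ i
  rw [e, key]

theorem gamOne_gmul (hdeg : ∀ i, Odd (deg i)) (γ : Gam k deg) :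
    gmul (gamOne k deg ⊗ₜ γ) = γ := by
  refine HomSp.ext fun s => ?_
  have h1 : ∀ t : Poly k c ⊗[k] Poly k c,
      pairing (polyGr_internal (wt deg)) (polyGr_internal (wt deg)) (gamOne k deg ⊗ₜ γ) t =
      ev (sGr k deg) γ (Algebra.TensorProduct.lift (Algebra.ofId k (Poly k c) |>.comp (aeval 0))
        (AlgHom.id k (Poly k c)) (fun _ _ => Commute.all _ _) t) := by
    intro t
    induction t using TensorProduct.induction_on with
    | zero => simp
    | tmul p q =>
      rw [pairing_gam hdeg, gamCoeff_ev, Algebra.TensorProduct.lift_tmul]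
      have : (aeval (0 : Fin c → k)) p = coeff 0 p := by
        rw [← constantCoeff_eq, aeval_zero]; rfl
      rw [AlgHom.comp_apply, this, Algebra.ofId_apply, AlgHom.id_apply, ← Algebra.smul_def,
        map_smul, smul_eq_mul]
    | add p q hp hq => rw [map_add, hp, hq, map_add, map_add]
  rw [gmul_ev, h1]
  congr 1
  refine AlgHom.congr_fun (φ₁ := (Algebra.TensorProduct.lift
    ((Algebra.ofId k (Poly k c)).comp (aeval 0)) (AlgHom.id k (Poly k c))
      (fun _ _ => Commute.all _ _)).comp (diag k c)) (φ₂ := AlgHom.id k (Poly k c)) ?_ s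
  refine MvPolynomial.algHom_ext fun i => ?_
  simp [diag]

end GammaProduct

/-! ### Pairings of dg `Λ`-modules -/

section Pairings

open MvPolynomial

variable {k : Type u} [Field k] {c : ℕ} {deg : Fin c → ℕ} {M N Z : DGExt k deg}

/-- Chain maps `B : M ⊗ N → Z` that are balanced and linear over the generators of `Λ`. -/
structure IsPairing (B : M.carrier ⊗[k] N.carrier →ₗ[k] Z.carrier) : Prop where
  map_d : ∀ x y, B (M.d x ⊗ₜ y) + B (sgn M.internal x ⊗ₜ N.d y) = Z.d (B (x ⊗ₜ y))
  map_left : ∀ (i : Fin c) x y, B ((gen k i • x) ⊗ₜ y) = gen k i • B (x ⊗ₜ y)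
  map_right : ∀ (i : Fin c) x y, B (sgn M.internal x ⊗ₜ (gen k i • y)) = gen k i • B (x ⊗ₜ y)

/-- The map `(γ ⊗ x) ⊗ (γ' ⊗ y) ↦ γ γ' ⊗ B (x ⊗ y)`. -/
def kPair (B : M.carrier ⊗[k] N.carrier →ₗ[k] Z.carrier) : KSp M ⊗[k] KSp N →ₗ[k] KSp Z :=
  (TensorProduct.map gmul B).comp
    (TensorProduct.tensorTensorTensorComm k (Gam k deg) M.carrier (Gam k deg) N.carrier).toLinearMap

theorem kPair_tmul (B : M.carrier ⊗[k] N.carrier →ₗ[k] Z.carrier) (γ γ' : Gam k deg)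
    (x : M.carrier) (y : N.carrier) :
    kPair B ((γ ⊗ₜ x) ⊗ₜ (γ' ⊗ₜ y)) = gmul (γ ⊗ₜ γ') ⊗ₜ B (x ⊗ₜ y) := rfl

theorem kk_ext {Y : Type*} [AddCommGroup Y] [Module k Y] {f g : KSp M ⊗[k] KSp N →ₗ[k] Y}
    (h : ∀ γ x γ' y, f ((γ ⊗ₜ x) ⊗ₜ (γ' ⊗ₜ y)) = g ((γ ⊗ₜ x) ⊗ₜ (γ' ⊗ₜ y))) : f = g :=
  TensorProduct.ext (TensorProduct.ext' fun γ x => TensorProduct.ext' fun γ' y => h γ x γ' y)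

theorem sgn_kGr (hdeg : ∀ i, Odd (deg i)) (γ : Gam k deg) (m : M.carrier) :
    sgn (kGr_internal M) (γ ⊗ₜ m) = γ ⊗ₜ sgn M.internal m :=
  sgn_kmk (hdeg := hdeg) γ m

theorem isHom_kPair {B : M.carrier ⊗[k] N.carrier →ₗ[k] Z.carrier}
    (hB : IsHom (tensorGr M.gr N.gr) Z.gr 0 B) :
    IsHom (tensorGr (kGr M) (kGr N)) (kGr Z) 0 (kPair B) := by
  intro n t ht
  refine tensorGr_map (fun p q s t hn hs ht => ?_) ht
  refine tensorGr_map (f := (kPair B).comp ((TensorProduct.mk k _ _).flip t))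
    (fun i j γ x hp hγ hx => ?_) hs
  refine tensorGr_map (f := (kPair B).comp (TensorProduct.mk k _ _ (γ ⊗ₜ x)))
    (fun i' j' γ' y hq hγ' hy => ?_) ht
  exact tmul_mem (isHom_gmul _ _ (tmul_mem hγ hγ' rfl)) (hB _ _ (tmul_mem hx hy rfl)) (by omega)

theorem IsPairing.kPair_d (hdeg : ∀ i, Odd (deg i))
    {B : M.carrier ⊗[k] N.carrier →ₗ[k] Z.carrier} (hB : IsPairing B) (t : KSp M ⊗[k] KSp N) :
    kPair B (tensorD (kGr_internal M) (kD M) (kD N) t) = kD Z (kPair B t) := by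
  refine LinearMap.congr_fun (f := (kPair B).comp (tensorD (kGr_internal M) (kD M) (kD N)))
    (g := (kD Z).comp (kPair B)) (kk_ext fun γ x γ' y => ?_) t
  simp only [LinearMap.comp_apply, tensorD_tmul, kPair_tmul, kD_tmul, sgn_kGr hdeg,
    TensorProduct.add_tmul, TensorProduct.tmul_add, TensorProduct.sum_tmul, TensorProduct.tmul_sum,
    map_add, map_sum, gamAct_gmul hdeg, hB.map_left, hB.map_right, ← hB.map_d,
    Finset.sum_add_distrib]
  abel

theorem kPair_X (hdeg : ∀ i, Odd (deg i)) (B : M.carrier ⊗[k] N.carrier →ₗ[k] Z.carrier)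
    (i : Fin c) (t : KSp M ⊗[k] KSp N) :
    kPair B (TensorProduct.map (kX M i) LinearMap.id t + TensorProduct.map LinearMap.id (kX N i) t) =
      kX Z i (kPair B t) := by
  refine LinearMap.congr_fun (f := (kPair B).comp (TensorProduct.map (kX M i) LinearMap.id +
      TensorProduct.map LinearMap.id (kX N i)))
    (g := (kX Z i).comp (kPair B)) (kk_ext fun γ x γ' y => ?_) t
  simp only [LinearMap.comp_apply, LinearMap.add_apply, TensorProduct.map_tmul, kX_tmul,
    LinearMap.id_apply, map_add, kPair_tmul, gamAct_gmul hdeg, TensorProduct.add_tmul]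

end Pairings

/-! ### The Koszul complex `Γ ⊗ Λ` -/

section Koszul

open MvPolynomial

variable {k : Type u} [Field k] {c : ℕ} {deg : Fin c → ℕ}

variable (k deg) in
/-- `Λ` as a dg module over itself. -/
def extDG : DGExt k deg where
  carrier := Ext k c
  gr := extGr k deg
  internal := extGr_internal deg
  smul_mem := extGr_mul
  d := 0
  d_mem := fun _ _ _ => zero_mem _
  d_d := fun _ => rfl
  d_smul := fun _ _ => by simp

variable (k deg) in
/-- The identification of `Λ` with the space underlying the dg module `Λ`. -/
def ofExt : Ext k c ≃ₗ[k] (extDG k deg).carrier := LinearEquiv.refl k (Ext k c)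

theorem smul_ofExt (a b : Ext k c) : a • ofExt k deg b = ofExt k deg (a * b) := rfl

theorem d_ofExt (a : Ext k c) : (extDG k deg).d (ofExt k deg a) = 0 := rfl

theorem inv_of_mem (hdeg : ∀ i, Odd (deg i)) {n : ℤ} {a : Ext k c} (ha : a ∈ extGr k deg n) :
    inv a = ((-1 : k) ^ n) • a := by
  have h := involute_of_mem hdeg ha
  rw [AlgHom.toLinearMap_apply]
  exact h

theorem sgn_ofExt (hdeg : ∀ i, Odd (deg i)) (a : Ext k c) :
    sgn (extDG k deg).internal (ofExt k deg a) = ofExt k deg (inv a) := by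
  refine LinearMap.congr_fun (f := sgn (extGr_internal (k := k) deg)) (g := inv) ?_ a
  refine ext_gr (extGr_internal (k := k) deg) fun n a ha => ?_
  rw [sgn_of_mem _ ha, inv_of_mem hdeg ha]

theorem klm_ext {Y : Type*} [AddCommGroup Y] [Module k Y] {f g : KSp (extDG k deg) →ₗ[k] Y}
    (h : ∀ γ a, f (γ ⊗ₜ ofExt k deg a) = g (γ ⊗ₜ ofExt k deg a)) : f = g :=
  TensorProduct.ext' h

variable (k) in
/-- The contraction of `Λ` with the `j`-th dual basis vector. -/
def contr (j : Fin c) : Ext k c →ₗ[k] Ext k c :=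
  CliffordAlgebra.contractLeft (Q := (0 : QuadraticForm k (Fin c → k))) (LinearMap.proj j)

theorem contr_gen_mul (i j : Fin c) (a : Ext k c) :
    contr k j (gen k i * a) = (if i = j then a else 0) - gen k i * contr k j a := by
  have h := CliffordAlgebra.contractLeft_ι_mul (Q := (0 : QuadraticForm k (Fin c → k)))
    (d := LinearMap.proj j) (Pi.single i 1) a
  refine h.trans ?_
  congr 1
  by_cases hij : i = j
  · subst hij; simp
  · simp [hij, Pi.single_apply, Ne.symm hij]

theorem contr_one (j : Fin c) : contr k j 1 = 0 := CliffordAlgebra.contractLeft_one _ _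

theorem isHom_contr (j : Fin c) : IsHom (extGr k deg) (extGr k deg) (-(deg j : ℤ)) (contr k j) := by
  have key : ∀ l : List (Fin c), contr k j (l.map (gen k)).prod ∈
      extGr k deg ((l.map fun i => (deg i : ℤ)).sum + -(deg j : ℤ)) := by
    intro l
    induction l with
    | nil => simp [contr_one]
    | cons i l ih =>
      rw [List.map_cons (f := gen k), List.prod_cons, contr_gen_mul, List.map_cons, List.sum_cons]
      refine sub_mem ?_ ?_
      · split_ifs with h
        · subst h
          convert prod_mem_extGr (k := k) deg l using 1
          ring
        · exact zero_mem _
      · rw [add_assoc]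
        exact extGr_mul (gen_mem deg i) ih
  intro n x hx
  refine extGr_le (P := (extGr k deg (n + -(deg j : ℤ))).comap (contr k j)) (fun l hl => ?_) hx
  rw [← hl]
  exact key l

variable (k) in
/-- The projection of `Λ` on the part in which `e j` does not occur. -/
def extKill (j : Fin c) : Module.End k (Ext k c) := 1 - (LinearMap.mulLeft k (gen k j)).comp (contr k j)

theorem extKill_apply (j : Fin c) (a : Ext k c) :
    extKill k j a = a - gen k j * contr k j a := rfl

theorem extKill_gen_mul_self (j : Fin c) (a : Ext k c) : extKill k j (gen k j * a) = 0 := by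
  rw [extKill_apply, contr_gen_mul, if_pos rfl, mul_sub, ← mul_assoc (gen k j) (gen k j), gen_sq,
    zero_mul, sub_zero, sub_self]

theorem extKill_gen_mul {i j : Fin c} (h : i ≠ j) (a : Ext k c) :
    extKill k j (gen k i * a) = gen k i * extKill k j a := by
  rw [extKill_apply, contr_gen_mul, if_neg h, zero_sub, mul_neg, sub_neg_eq_add, ← mul_assoc,
    gen_anticomm j i, extKill_apply, mul_sub, neg_mul, mul_assoc]
  abel

variable (k) in
/-- The projection of `Λ` on the part in which none of the generators in a list occurs. -/
def extKillList (l : List (Fin c)) : Module.End k (Ext k c) := (l.map (extKill k)).prod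

theorem extKillList_cons (j : Fin c) (l : List (Fin c)) (a : Ext k c) :
    extKillList k (j :: l) a = extKill k j (extKillList k l a) := rfl

theorem extKillList_gen_mul_of_notMem {l : List (Fin c)} {i : Fin c} (h : i ∉ l) (a : Ext k c) :
    extKillList k l (gen k i * a) = gen k i * extKillList k l a := by
  induction l with
  | nil => rfl
  | cons j l ih =>
    rw [List.mem_cons, not_or] at h
    rw [extKillList_cons, ih h.2, extKill_gen_mul h.1, extKillList_cons]

theorem extKillList_gen_mul {l : List (Fin c)} {i : Fin c} (h : i ∈ l) (a : Ext k c) :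
    extKillList k l (gen k i * a) = 0 := by
  induction l with
  | nil => simp at h
  | cons j l ih =>
    by_cases hl : i ∈ l
    · rw [extKillList_cons, ih hl, map_zero]
    · obtain rfl : i = j := (List.mem_cons.1 h).resolve_right hl
      rw [extKillList_cons, extKillList_gen_mul_of_notMem hl, extKill_gen_mul_self]

theorem extKillList_one (l : List (Fin c)) : extKillList k l (1 : Ext k c) = 1 := by
  induction l with
  | nil => rfl
  | cons j l ih => rw [extKillList_cons, ih, extKill_apply, contr_one, mul_zero, sub_zero]

theorem extKillList_finRange (a : Ext k c) : ∃ r : k, extKillList k (List.finRange c) a = r • 1 := by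
  have : extKillList k (List.finRange c) a ∈ Submodule.span k {(1 : Ext k c)} := by
    refine ext_induction (P := (Submodule.span k {(1 : Ext k c)}).comap
      (extKillList k (List.finRange c))) (fun l => ?_) a
    rw [Submodule.mem_comap]
    cases l with
    | nil =>
      rw [List.map_nil, List.prod_nil, extKillList_one]
      exact Submodule.mem_span_singleton_self _
    | cons i l =>
      rw [List.map_cons, List.prod_cons, extKillList_gen_mul (List.mem_finRange i)]
      exact zero_mem _
  obtain ⟨r, hr⟩ := Submodule.mem_span_singleton.1 this
  exact ⟨r, hr.symm⟩

variable (k deg) in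
/-- The homotopy on `Γ ⊗ Λ` that raises the `j`-th divided power and contracts with the `j`-th
generator of `Λ`. -/
def koszulH (j : Fin c) : Module.End k (KSp (extDG k deg)) :=
  TensorProduct.map (gamRaise k deg j) (contr k j)

theorem koszulH_tmul (j : Fin c) (γ : Gam k deg) (a : Ext k c) :
    koszulH k deg j (γ ⊗ₜ ofExt k deg a) = gamRaise k deg j γ ⊗ₜ ofExt k deg (contr k j a) := rfl

variable (k deg) in
/-- The projection of `Γ ⊗ Λ` on the part in which the variables in a list do not occur. -/
def koszulP (l : List (Fin c)) : Module.End k (KSp (extDG k deg)) :=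
  TensorProduct.map (gamKillList k deg l) (extKillList k l)

theorem koszulP_tmul (l : List (Fin c)) (γ : Gam k deg) (a : Ext k c) :
    koszulP k deg l (γ ⊗ₜ ofExt k deg a) =
      gamKillList k deg l γ ⊗ₜ ofExt k deg (extKillList k l a) := rfl

theorem koszulP_nil : koszulP k deg [] = 1 := klm_ext fun γ a => rfl

theorem koszulP_cons (j : Fin c) (l : List (Fin c)) :
    koszulP k deg (j :: l) = koszulP k deg [j] * koszulP k deg l := klm_ext fun γ a => rfl

theorem kD_ofExt (γ : Gam k deg) (a : Ext k c) : kD (extDG k deg) (γ ⊗ₜ ofExt k deg a) =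
    ∑ i, gamAct k deg (X i) γ ⊗ₜ ofExt k deg (gen k i * a) := by
  rw [kD_tmul, d_ofExt, TensorProduct.tmul_zero, zero_add]
  rfl

/-- Only the term `χ j ⊗ e j` of the differential contributes: the others anticommute with the homotopy.
-/
theorem koszulH_homotopy (j : Fin c) : kD (extDG k deg) * koszulH k deg j +
    koszulH k deg j * kD (extDG k deg) = 1 - koszulP k deg [j] := by
  refine klm_ext fun γ a => ?_
  have hP : koszulP k deg [j] (γ ⊗ₜ ofExt k deg a) =
    gamKill k deg j γ ⊗ₜ ofExt k deg (extKill k j a) := rfl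
  rw [LinearMap.add_apply, Module.End.mul_apply, Module.End.mul_apply, koszulH_tmul, kD_ofExt,
    kD_ofExt, map_sum, LinearMap.sub_apply, hP, Module.End.one_apply, ← Finset.sum_add_distrib,
    Finset.sum_eq_single j]
  · rw [koszulH_tmul, gamAct_gamRaise_self, contr_gen_mul, if_pos rfl, extKill_apply]
    simp only [gamKill, LinearMap.sub_apply, Module.End.one_apply, Module.End.mul_apply,
      TensorProduct.sub_tmul, TensorProduct.tmul_sub, map_sub]
    abel
  · intro i _ hij
    rw [koszulH_tmul, contr_gen_mul, if_neg hij, gamAct_gamRaise hij, zero_sub, map_neg,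
      TensorProduct.tmul_neg, add_neg_cancel]
  · intro h; exact absurd (Finset.mem_univ j) h

theorem isHom_koszulH (j : Fin c) :
    IsHom (kGr (extDG k deg)) (kGr (extDG k deg)) 1 (koszulH k deg j) :=
  (isHom_gamRaise j).tensor (isHom_contr j) (by push_cast; ring)

/-- The homotopies of the single variables compose. -/
theorem exists_koszul_homotopy (hdeg : ∀ i, Odd (deg i)) (l : List (Fin c)) :
    ∃ H : Module.End k (KSp (extDG k deg)), IsHom (kGr (extDG k deg)) (kGr (extDG k deg)) 1 H ∧
      IsHom (kGr (extDG k deg)) (kGr (extDG k deg)) 0 (koszulP k deg l) ∧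
      kD (extDG k deg) * H + H * kD (extDG k deg) = 1 - koszulP k deg l := by
  have hDD : kD (extDG k deg) * kD (extDG k deg) = 0 := LinearMap.ext (kD_kD _ hdeg)
  have hD : IsHom (kGr (extDG k deg)) (kGr (extDG k deg)) (-1) (kD (extDG k deg)) :=
    (K (extDG k deg) hdeg).d_isHom
  induction l with
  | nil =>
    exact ⟨0, isHom_zero 1, by rw [koszulP_nil]; exact isHom_id, by rw [koszulP_nil]; simp⟩
  | cons j l ih =>
    obtain ⟨H, hH, hP, hHP⟩ := ih
    have hc : kD (extDG k deg) * koszulP k deg l = koszulP k deg l * kD (extDG k deg) := by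
      have : koszulP k deg l = 1 - (kD (extDG k deg) * H + H * kD (extDG k deg)) := by
        rw [hHP]; abel
      rw [this]
      simp only [mul_sub, sub_mul, mul_add, add_mul, ← mul_assoc, hDD, mul_one, one_mul, zero_mul]
      rw [mul_assoc H, hDD, mul_zero, zero_add, add_zero]
    have hj : IsHom (kGr (extDG k deg)) (kGr (extDG k deg)) 0 (koszulP k deg [j]) := by
      have : koszulP k deg [j] = 1 - (kD (extDG k deg) * koszulH k deg j +
          koszulH k deg j * kD (extDG k deg)) := by
        rw [koszulH_homotopy]; abel
      rw [this]
      exact isHom_id.sub ((hD.comp (isHom_koszulH j) rfl).add ((isHom_koszulH j).comp hD rfl))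
    refine ⟨H + koszulH k deg j * koszulP k deg l, hH.add ((isHom_koszulH j).comp hP rfl), ?_, ?_⟩
    · rw [koszulP_cons]; exact hj.comp hP rfl
    · calc _ = (kD (extDG k deg) * H + H * kD (extDG k deg)) + (kD (extDG k deg) * koszulH k deg j *
            koszulP k deg l + koszulH k deg j * (koszulP k deg l * kD (extDG k deg))) := by
            noncomm_ring
        _ = (kD (extDG k deg) * H + H * kD (extDG k deg)) + (kD (extDG k deg) * koszulH k deg j +
            koszulH k deg j * kD (extDG k deg)) * koszulP k deg l := by
            rw [← hc]; noncomm_ring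
        _ = 1 - koszulP k deg (j :: l) := by
            rw [hHP, koszulH_homotopy, koszulP_cons j l, sub_mul, one_mul]; abel

variable (N : DGExt k deg)

/-- The action `Λ ⊗ N → N` of `Λ` on a dg module. -/
def actPair : (extDG k deg).carrier ⊗[k] N.carrier →ₗ[k] N.carrier :=
  TensorProduct.lift ((Algebra.lsmul k k N.carrier).toLinearMap.comp
    (ofExt k deg).symm.toLinearMap)

theorem actPair_tmul (a : Ext k c) (x : N.carrier) : actPair N (ofExt k deg a ⊗ₜ x) = a • x := rfl

theorem d_smul_involute (hdeg : ∀ i, Odd (deg i)) (a : Ext k c) (x : N.carrier) :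
    N.d (a • x) = inv a • N.d x := by
  refine LinearMap.congr_fun (f := N.d.comp ((Algebra.lsmul k k N.carrier).toLinearMap.flip x))
    (g := ((Algebra.lsmul k k N.carrier).toLinearMap.flip (N.d x)).comp inv) ?_ a
  refine ext_gr (extGr_internal (k := k) deg) fun n a ha => ?_
  show N.d (a • x) = inv a • N.d x
  rw [N.d_smul x ha, inv_of_mem hdeg ha, smul_assoc]

theorem isPairing_actPair (hdeg : ∀ i, Odd (deg i)) : IsPairing (actPair N) where
  map_d a x := by
    obtain ⟨a, rfl⟩ := (ofExt k deg).surjective a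
    rw [d_ofExt, TensorProduct.zero_tmul, map_zero, zero_add, sgn_ofExt hdeg, actPair_tmul,
      actPair_tmul, d_smul_involute N hdeg]
  map_left i a x := by
    obtain ⟨a, rfl⟩ := (ofExt k deg).surjective a
    rw [smul_ofExt, actPair_tmul, actPair_tmul, mul_smul]
  map_right i a x := by
    obtain ⟨a, rfl⟩ := (ofExt k deg).surjective a
    rw [sgn_ofExt hdeg, actPair_tmul, actPair_tmul, ← mul_smul, ← mul_smul, gen_mul]
    rfl

/-- The section `z ↦ (1 ⊗ 1) ⊗ z` of the map `(Γ ⊗ Λ) ⊗ (Γ ⊗ N) → Γ ⊗ N`. -/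
def koszulS : KSp N →ₗ[k] KSp (extDG k deg) ⊗[k] KSp N :=
  TensorProduct.mk k _ _ (gamOne k deg ⊗ₜ[k] ofExt k deg 1)

theorem kPair_koszulS (hdeg : ∀ i, Odd (deg i)) (z : KSp N) :
    kPair (actPair N) (koszulS N z) = z := by
  refine LinearMap.congr_fun (f := (kPair (actPair N)).comp (koszulS N)) (g := LinearMap.id)
    (TensorProduct.ext' fun γ x => ?_) z
  rw [LinearMap.comp_apply, koszulS, TensorProduct.mk_apply, kPair_tmul, gamOne_gmul hdeg,
    actPair_tmul, one_smul, LinearMap.id_apply]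

theorem koszulS_d (hdeg : ∀ i, Odd (deg i)) (z : KSp N) :
    koszulS N (kD N z) = tensorD (kGr_internal (extDG k deg)) (kD _) (kD N) (koszulS N z) := by
  rw [koszulS, TensorProduct.mk_apply, TensorProduct.mk_apply, tensorD_tmul, sgn_kGr hdeg,
    sgn_ofExt hdeg, kD_one, d_ofExt, TensorProduct.tmul_zero, TensorProduct.zero_tmul, zero_add,
    AlgHom.toLinearMap_apply, map_one (CliffordAlgebra.involute)]

/-- The product `K Λ ⊗ K N → K N` is a quasi-isomorphism: as `K Λ` contracts to the line of `1 ⊗ 1`, every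
cycle of `K Λ ⊗ K N` is homologous to one in the image of the section `koszulS`. -/
theorem koszul_acyclic (hdeg : ∀ i, Odd (deg i)) :
    Acyclic (coneD (tensorD (kGr_internal (extDG k deg)) (kD _) (kD N)) (kD N)
      (kPair (actPair N))) := by
  let D := tensorD (kGr_internal (extDG k deg)) (kD _) (kD N)
  let m := kPair (actPair N)
  have hm : ∀ t, m (D t) = kD N (m t) := (isPairing_actPair N hdeg).kPair_d hdeg
  obtain ⟨H, hH, -, hHP⟩ := exists_koszul_homotopy (k := k) hdeg (List.finRange c)
  -- every cycle is homologous to one in the image of the section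
  have key : ∀ z, D z = 0 → ∃ u w, z = D u + koszulS N w := by
    intro z hz
    have h1 : ∀ z, D (TensorProduct.map H LinearMap.id z) + TensorProduct.map H LinearMap.id (D z) =
        z - TensorProduct.map (koszulP k deg (List.finRange c)) LinearMap.id z := by
      intro z
      refine LinearMap.congr_fun (f := D.comp (TensorProduct.map H LinearMap.id) +
        (TensorProduct.map H LinearMap.id).comp D) (g := LinearMap.id -
          TensorProduct.map (koszulP k deg (List.finRange c)) LinearMap.id)
        (TensorProduct.ext' fun s t => ?_) z
      have h2 := LinearMap.congr_fun hHP s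
      simp only [LinearMap.add_apply, Module.End.mul_apply, LinearMap.sub_apply,
        Module.End.one_apply] at h2
      simp only [LinearMap.add_apply, LinearMap.comp_apply, LinearMap.sub_apply,
        TensorProduct.map_tmul, LinearMap.id_apply, D, tensorD_tmul, map_add]
      rw [← TensorProduct.sub_tmul, ← h2, TensorProduct.add_tmul,
        sgn_odd (kGr_internal _) (kGr_internal _) (by decide) hH, TensorProduct.neg_tmul]
      abel
    have h2 : ∀ z, ∃ w, TensorProduct.map (koszulP k deg (List.finRange c)) LinearMap.id z =
        koszulS N w := by
      intro z
      induction z using TensorProduct.induction_on with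
      | zero => exact ⟨0, by simp⟩
      | add s t hs ht =>
        obtain ⟨w, hw⟩ := hs
        obtain ⟨w', hw'⟩ := ht
        exact ⟨w + w', by rw [map_add, hw, hw', map_add]⟩
      | tmul s t =>
        have h3 : ∃ r : k, koszulP k deg (List.finRange c) s =
            r • (gamOne k deg ⊗ₜ[k] ofExt k deg 1) := by
          induction s using TensorProduct.induction_on with
          | zero => exact ⟨0, by simp⟩
          | add s t hs ht =>
            obtain ⟨r, hr⟩ := hs
            obtain ⟨r', hr'⟩ := ht
            exact ⟨r + r', by rw [map_add, hr, hr', add_smul]⟩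
          | tmul γ a =>
            obtain ⟨a, rfl⟩ := (ofExt k deg).surjective a
            obtain ⟨r, hr⟩ := gamKillList_finRange γ
            obtain ⟨r', hr'⟩ := extKillList_finRange a
            refine ⟨r * r', ?_⟩
            rw [koszulP_tmul, hr, hr', map_smul, TensorProduct.smul_tmul_smul]
        obtain ⟨r, hr⟩ := h3
        refine ⟨r • t, ?_⟩
        rw [TensorProduct.map_tmul, hr, TensorProduct.smul_tmul]
        rfl
    obtain ⟨w, hw⟩ := h2 z
    refine ⟨TensorProduct.map H LinearMap.id z, w, ?_⟩
    have := h1 z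
    rw [hz, map_zero, add_zero, hw] at this
    rw [this]; abel
  rintro ⟨z, y⟩ hzy
  rw [coneD_apply, Prod.mk_eq_zero, neg_eq_zero] at hzy
  obtain ⟨hz, hy⟩ := hzy
  dsimp only at hz hy
  obtain ⟨u, w, rfl⟩ := key z hz
  have hw : w = kD N (-(m u) - y) := by
    have h3 : m (koszulS N w) = w := kPair_koszulS N hdeg w
    have h4 : m (D u + koszulS N w) + kD N y = 0 := hy
    rw [map_add, hm, h3] at h4
    rw [map_sub, map_neg]
    rw [eq_sub_iff_add_eq, eq_neg_iff_add_eq_zero, ← h4]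
    abel
  refine ⟨(-u - koszulS N (-(m u) - y), 0), Prod.ext ?_ ?_⟩
  · show -D (-u - koszulS N (-(m u) - y)) = D u + koszulS N w
    have h5 : koszulS N w = D (koszulS N (-(m u) - y)) := by
      rw [← koszulS_d N hdeg, ← hw]
    rw [h5, map_sub, map_neg]
    abel
  · show m (-u - koszulS N (-(m u) - y)) + kD N 0 = y
    have h3 : m (koszulS N (-(m u) - y)) = -(m u) - y := kPair_koszulS N hdeg _
    rw [map_sub, h3, map_neg, map_zero]
    abel

end Koszul

/-! ### The tensor product over `Λ` -/

section SignPowers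

variable {k : Type*} [Field k] {X : Type*} [AddCommGroup X] [Module k X]
  {gX : ℤ → Submodule k X} (hX : DirectSum.IsInternal gX)

/-- The `n`-th power of the sign involution. -/
def sgnPow (n : ℤ) : X →ₗ[k] X := if Even n then LinearMap.id else sgn hX

theorem sgnPow_of_mem (n : ℤ) {i : ℤ} {x : X} (hx : x ∈ gX i) :
    sgnPow hX n x = ((-1 : k) ^ (n * i)) • x := by
  rw [sgnPow, zpow_mul]
  split_ifs with h
  · rw [h.neg_one_zpow, one_zpow, one_smul, LinearMap.id_apply]
  · rw [(Int.not_even_iff_odd.1 h).neg_one_zpow, sgn_of_mem hX hx]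

theorem sgnPow_sgnPow (n : ℤ) (x : X) : sgnPow hX n (sgnPow hX n x) = x := by
  rw [sgnPow]
  split_ifs with h
  · rfl
  · exact sgn_sgn hX x

theorem sgnPow_d (n : ℤ) {d : X →ₗ[k] X} (hd : IsHom gX gX (-1) d) (x : X) :
    sgnPow hX n (d x) = ((-1 : k) ^ n) • d (sgnPow hX n x) := by
  rw [sgnPow]
  split_ifs with h
  · rw [h.neg_one_zpow, one_smul]; rfl
  · rw [(Int.not_even_iff_odd.1 h).neg_one_zpow, sgn_odd hX hX (by decide) hd, neg_smul, one_smul]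

theorem neg_one_zpow_mul_self (n : ℤ) : (-1 : k) ^ n * (-1) ^ n = 1 := by
  rw [← mul_zpow]; simp

end SignPowers

section QuotientModules

variable {k : Type u} [Field k] {A : Type u} [Ring A] [Algebra k A] {𝒜 : ℤ → Submodule k A}
  (X : DGModule 𝒜) (h𝒜 : ⨆ i, 𝒜 i = ⊤) (s : Set X.carrier) (hs : ∀ x ∈ s, ∃ i, x ∈ X.gr i)
  (hd : ∀ x ∈ s, X.d x ∈ Submodule.span A s)

/-- The projection of a dg module on a quotient. -/
def DGModule.quotientProj : X.carrier →ₗ[A] (X.quotient h𝒜 s hs hd).carrier := QSp.proj s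

theorem DGModule.quotientProj_d (x : X.carrier) :
    (X.quotient h𝒜 s hs hd).d (X.quotientProj h𝒜 s hs hd x) =
      X.quotientProj h𝒜 s hs hd (X.d x) := rfl

theorem DGModule.quotientProj_smul (r : k) (x : X.carrier) :
    X.quotientProj h𝒜 s hs hd (r • x) = r • X.quotientProj h𝒜 s hs hd x := rfl

theorem DGModule.quotientProj_surjective : Function.Surjective (X.quotientProj h𝒜 s hs hd) :=
  QSp.proj_surjective s

theorem DGModule.quotientProj_mem {n : ℤ} {x : X.carrier} (hx : x ∈ X.gr n) :
    X.quotientProj h𝒜 s hs hd x ∈ (X.quotient h𝒜 s hs hd).gr n := ⟨x, hx, rfl⟩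

theorem DGModule.quotientProj_eq_zero {x : X.carrier} (hx : x ∈ s) :
    X.quotientProj h𝒜 s hs hd x = 0 := QSp.proj_eq_zero.2 (Submodule.subset_span hx)

/-- Linear maps on a quotient of a dg module. -/
def DGModule.quotientLift {Y : Type*} [AddCommGroup Y] [Module k Y] (f : X.carrier →ₗ[k] Y)
    (hf : ∀ x ∈ Submodule.span A s, f x = 0) : (X.quotient h𝒜 s hs hd).carrier →ₗ[k] Y :=
  QSp.lift s f hf

end QuotientModules

section TensorOver

open MvPolynomial

variable {k : Type u} [Field k] {c : ℕ} {deg : Fin c → ℕ} (F N : DGExt k deg)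

theorem sgnPow_smul (n : ℤ) {p : ℤ} {a : Ext k c} (ha : a ∈ extGr k deg p) (x : N.carrier) :
    sgnPow N.internal n (a • x) = ((-1 : k) ^ (n * p)) • a • sgnPow N.internal n x := by
  rw [sgnPow]
  split_ifs with h
  · rw [zpow_mul, h.neg_one_zpow, one_zpow, one_smul]; rfl
  · rw [zpow_mul, (Int.not_even_iff_odd.1 h).neg_one_zpow, sgn_smul N ha]

theorem sgn_smul_inv (hdeg : ∀ i, Odd (deg i)) (a : Ext k c) (x : N.carrier) :
    sgn N.internal (a • x) = inv a • sgn N.internal x := by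
  refine LinearMap.congr_fun
    (f := (sgn N.internal).comp ((Algebra.lsmul k k N.carrier).toLinearMap.flip x))
    (g := ((Algebra.lsmul k k N.carrier).toLinearMap.flip (sgn N.internal x)).comp inv) ?_ a
  refine ext_gr (extGr_internal (k := k) deg) fun n a ha => ?_
  show sgn N.internal (a • x) = inv a • sgn N.internal x
  rw [sgn_smul N ha, inv_of_mem hdeg ha, smul_assoc]

/-- The tensor product of dg modules over `Λ`. -/
abbrev tOver : DGExt k deg := tensorOver (extGr_top deg) F N

/-- The projection of `F ⊗_k N` on `F ⊗_Λ N`. -/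
def omk : F.carrier ⊗[k] N.carrier →ₗ[k] (tOver F N).carrier where
  toFun t := (tensorLeft F N).quotientProj (extGr_top deg) (tensorRel F N) _ _ t
  map_add' s t := map_add ((tensorLeft F N).quotientProj (extGr_top deg) (tensorRel F N) _ _) s t
  map_smul' r t := (tensorLeft F N).quotientProj_smul (extGr_top deg) (tensorRel F N) _ _ r t

variable {F N}

theorem omk_surjective : Function.Surjective (omk F N) :=
  (tensorLeft F N).quotientProj_surjective _ _ _ _

theorem smul_omk (a : Ext k c) (x : F.carrier) (y : N.carrier) :
    a • omk F N (x ⊗ₜ y) = omk F N ((a • x) ⊗ₜ y) := 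
  (map_smul ((tensorLeft F N).quotientProj (extGr_top deg) (tensorRel F N) _ _) a
    (show (tensorLeft F N).carrier from x ⊗ₜ[k] y)).symm

theorem d_omk (x : F.carrier) (y : N.carrier) : (tOver F N).d (omk F N (x ⊗ₜ y)) =
    omk F N (F.d x ⊗ₜ y) + omk F N (sgn F.internal x ⊗ₜ N.d y) := by
  rw [← map_add, ← tensorD_tmul]
  exact (tensorLeft F N).quotientProj_d (extGr_top deg) (tensorRel F N) _ _ _

theorem isHom_omk : IsHom (tensorGr F.gr N.gr) (tOver F N).gr 0 (omk F N) := fun n t ht => by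
  rw [add_zero]
  exact (tensorLeft F N).quotientProj_mem (extGr_top deg) (tensorRel F N) _ _ ht

theorem omk_rel {p j : ℤ} {a : Ext k c} {x : F.carrier} (ha : a ∈ extGr k deg p)
    (hx : x ∈ F.gr j) (y : N.carrier) :
    omk F N ((a • x) ⊗ₜ y) = ((-1 : k) ^ (p * j)) • omk F N (x ⊗ₜ (a • y)) := by
  refine LinearMap.congr_fun
    (f := (omk F N).comp (TensorProduct.mk k F.carrier N.carrier (a • x)))
    (g := ((-1 : k) ^ (p * j)) • (omk F N).comp ((TensorProduct.mk k F.carrier N.carrier x).comp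
      (Algebra.lsmul k k N.carrier a))) ?_ y
  refine ext_gr N.internal fun l y hy => ?_
  have h : omk F N ((a • x) ⊗ₜ y - ((-1 : k) ^ (p * j)) • (x ⊗ₜ (a • y))) = 0 :=
    (tensorLeft F N).quotientProj_eq_zero (extGr_top deg) (tensorRel F N) _ _
      ⟨p, j, l, a, x, y, ha, hx, hy, rfl⟩
  rw [map_sub, map_smul] at h
  exact sub_eq_zero.1 h

theorem isPairing_omk (hdeg : ∀ i, Odd (deg i)) : IsPairing (Z := tOver F N) (omk F N) where
  map_d x y := (d_omk x y).symm
  map_left i x y := (smul_omk _ x y).symm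
  map_right i x y := by
    rw [smul_omk]
    refine LinearMap.congr_fun (f := (omk F N).comp (((TensorProduct.mk k _ _).flip
        (gen k i • y)).comp (sgn F.internal)))
      (g := (omk F N).comp (((TensorProduct.mk k _ _).flip y).comp (eAct F i))) ?_ x
    refine ext_gr F.internal fun j x hx => ?_
    have h : (-1 : k) ^ ((deg i : ℤ) * j) = (-1) ^ j := by
      rw [zpow_mul, Odd.neg_one_zpow ((Int.odd_coe_nat _).2 (hdeg i))]
    show omk F N (sgn F.internal x ⊗ₜ (gen k i • y)) = omk F N ((gen k i • x) ⊗ₜ y)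
    rw [omk_rel (gen_mem deg i) hx, h, sgn_of_mem _ hx, ← TensorProduct.smul_tmul', map_smul]

variable (F N) in
/-- The morphism `K F ⊗ K N → K (F ⊗_Λ N)` of dg `S`-modules given by the product of `Γ`. -/
def kMul (hdeg : ∀ i, Odd (deg i)) :
    DGHom (diagTensor hdeg (K F hdeg) (K N hdeg)) (K (tOver F N) hdeg) :=
  DGHom.ofLin (P := diagTensor hdeg (K F hdeg) (K N hdeg)) (Q := K (tOver F N) hdeg)
    (kPair (Z := tOver F N) (omk F N)) (isHom_kPair isHom_omk) ((isPairing_omk hdeg).kPair_d hdeg)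
    (fun i t => by
      refine Eq.trans (congrArg _ ?_) (kPair_X hdeg (Z := tOver F N) (omk F N) i t)
      refine LinearMap.congr_fun (f := diagAct (K F hdeg) (K N hdeg) (X i))
        (g := TensorProduct.map (kX F i) LinearMap.id + TensorProduct.map LinearMap.id (kX N i))
        (TensorProduct.ext' fun x y => ?_) t
      exact diagAct_X (K F hdeg) (K N hdeg) i x y)

end TensorOver

/-! ### Coordinates over a semifree dg module -/

section Coordinates

variable {k : Type*} [Field k] {G X Y : Type*} [AddCommGroup G] [Module k G] [AddCommGroup X]
  [Module k X] [AddCommGroup Y] [Module k Y] {I : Type*}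

open Classical in
/-- Coordinates on a tensor product from coordinates on the right factor. -/
def tensorFinsuppRight (f : X →ₗ[k] I →₀ Y) : G ⊗[k] X →ₗ[k] I →₀ G ⊗[k] Y :=
  (TensorProduct.finsuppRight k k G Y I).toLinearMap.comp (TensorProduct.map LinearMap.id f)

theorem tensorFinsuppRight_apply (f : X →ₗ[k] I →₀ Y) (g : G) (x : X) (j : I) :
    tensorFinsuppRight f (g ⊗ₜ[k] x) j = g ⊗ₜ f x j := by
  classical
  exact TensorProduct.finsuppRight_apply_tmul_apply (R := k) (S := k) g (f x) j

theorem tensorFinsuppRight_single {f : X →ₗ[k] I →₀ Y} {g : G} {x : X} {i : I} {y : Y}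
    (h : f x = Finsupp.single i y) :
    tensorFinsuppRight f (g ⊗ₜ[k] x) = Finsupp.single i (g ⊗ₜ y) := by
  classical
  ext j
  rw [tensorFinsuppRight_apply, h, Finsupp.single_apply, Finsupp.single_apply]
  split_ifs <;> simp

open Classical in
/-- Coordinates on a tensor product from coordinates on the left factor. -/
def tensorFinsuppLeft (f : X →ₗ[k] I →₀ Y) : X ⊗[k] G →ₗ[k] I →₀ Y ⊗[k] G :=
  (TensorProduct.finsuppLeft k k Y G I).toLinearMap.comp (TensorProduct.map f LinearMap.id)

theorem tensorFinsuppLeft_apply (f : X →ₗ[k] I →₀ Y) (g : G) (x : X) (j : I) :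
    tensorFinsuppLeft f (x ⊗ₜ[k] g) j = f x j ⊗ₜ g := by
  classical
  exact TensorProduct.finsuppLeft_apply_tmul_apply (R := k) (S := k) (f x) g j

theorem tensorFinsuppLeft_single {f : X →ₗ[k] I →₀ Y} {g : G} {x : X} {i : I} {y : Y}
    (h : f x = Finsupp.single i y) :
    tensorFinsuppLeft f (x ⊗ₜ[k] g) = Finsupp.single i (y ⊗ₜ g) := by
  classical
  ext j
  rw [tensorFinsuppLeft_apply, h, Finsupp.single_apply, Finsupp.single_apply]
  split_ifs <;> simp

end Coordinates

section Semifree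

open MvPolynomial

variable {k : Type u} [Field k] {c : ℕ} {deg : Fin c → ℕ} {F N : DGExt k deg} {I : Type u}
  (b : Module.Basis I (Ext k c) F.carrier)

/-- `k`-linear maps on `F` that agree on the homogeneous multiples of the basis elements are equal. -/
theorem semifree_ext {Y : Type*} [AddCommGroup Y] [Module k Y] {f g : F.carrier →ₗ[k] Y}
    (h : ∀ i p (a : Ext k c), a ∈ extGr k deg p → f (a • b i) = g (a • b i)) : f = g := by
  have h1 : ∀ i (a : Ext k c), f (a • b i) = g (a • b i) := fun i a => by
    refine LinearMap.congr_fun (f := f.comp ((Algebra.lsmul k k F.carrier).toLinearMap.flip (b i)))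
      (g := g.comp ((Algebra.lsmul k k F.carrier).toLinearMap.flip (b i))) ?_ a
    exact ext_gr (extGr_internal (k := k) deg) fun n a ha => h i n a ha
  refine LinearMap.ext fun x => ?_
  obtain ⟨l, rfl⟩ := b.repr.symm.surjective x
  induction l using Finsupp.induction_linear with
  | zero => simp
  | add l l' hl hl' => rw [map_add, map_add, hl, hl', map_add]
  | single i a => rw [Module.Basis.repr_symm_single]; exact h1 i a

/-- The coordinates over `Λ`, as a `k`-linear map. -/
def coords : F.carrier →ₗ[k] I →₀ Ext k c := (b.repr.restrictScalars k).toLinearMap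

theorem coords_smul (i : I) (a : Ext k c) : coords b (a • b i) = Finsupp.single i a := by
  show b.repr (a • b i) = _
  rw [map_smul, b.repr_self, Finsupp.smul_single, smul_eq_mul, mul_one]

variable (nb : I → ℤ)

/-- The map `F ⊗_k N → (I →₀ N)` that induces the coordinates of `F ⊗_Λ N` given by a basis of `F`: it sends
`a b_i ⊗ y` to `(-1)^{|b_i||y|} a y` in the place `i`, the sign being that of moving `b_i` past `y`. -/
def tensorCoords : F.carrier ⊗[k] N.carrier →ₗ[k] I →₀ N.carrier :=
  (Finsupp.lsum k fun i => (Finsupp.lsingle i).comp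
    ((TensorProduct.lift (Algebra.lsmul k k N.carrier).toLinearMap).comp
      (TensorProduct.map LinearMap.id (sgnPow N.internal (nb i))))).comp
  (tensorFinsuppLeft (coords b))

theorem tensorCoords_smul (i : I) (a : Ext k c) (y : N.carrier) :
    tensorCoords b nb ((a • b i) ⊗ₜ y) = Finsupp.single i (a • sgnPow N.internal (nb i) y) := by
  rw [tensorCoords, LinearMap.comp_apply, tensorFinsuppLeft_single (coords_smul b i a),
    Finsupp.lsum_single]
  rfl

theorem tensorCoords_apply (x : F.carrier) (y : N.carrier) (j : I) :
    tensorCoords b nb (x ⊗ₜ y) j = b.repr x j • sgnPow N.internal (nb j) y := by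
  refine LinearMap.congr_fun (f := (Finsupp.lapply j).comp ((tensorCoords b nb).comp
      ((TensorProduct.mk k _ _).flip y)))
    (g := ((Algebra.lsmul k k N.carrier).toLinearMap.flip (sgnPow N.internal (nb j) y)).comp
      ((Finsupp.lapply j).comp (coords b))) (semifree_ext b fun i p a ha => ?_) x
  show tensorCoords b nb ((a • b i) ⊗ₜ y) j = (coords b (a • b i)) j • _
  rw [tensorCoords_smul, coords_smul]
  by_cases h : i = j
  · subst h; rw [Finsupp.single_eq_same, Finsupp.single_eq_same]
  · rw [Finsupp.single_eq_of_ne' h, Finsupp.single_eq_of_ne' h, zero_smul]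

/-- Homogeneous elements of `Λ` commute up to sign. -/
theorem ext_graded_comm (hdeg : ∀ i, Odd (deg i)) {p q : ℤ} {a a' : Ext k c}
    (ha : a ∈ extGr k deg p) (ha' : a' ∈ extGr k deg q) :
    a * a' = ((-1 : k) ^ (p * q)) • (a' * a) := by
  refine LinearMap.mem_eqLocus.1 (extGr_le (P := LinearMap.eqLocus (LinearMap.mulRight k a')
    (((-1 : k) ^ (p * q)) • LinearMap.mulLeft k a')) (fun l hl => ?_) ha)
  rw [LinearMap.mem_eqLocus, LinearMap.mulRight_apply, LinearMap.smul_apply,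
    LinearMap.mulLeft_apply]
  subst hl
  clear ha
  induction l with
  | nil => simp
  | cons i l ih =>
    have h1 : gen k i * a' = ((-1 : k) ^ ((deg i : ℤ) * q)) • (a' * gen k i) := by
      rw [gen_mul, involute_of_mem hdeg ha', smul_mul_assoc, zpow_mul,
        Odd.neg_one_zpow ((Int.odd_coe_nat _).2 (hdeg i))]
    rw [List.map_cons, List.map_cons, List.prod_cons, List.sum_cons, mul_assoc, ih,
      mul_smul_comm, ← mul_assoc, h1, smul_mul_assoc, smul_smul, ← zpow_add₀ (by simp), mul_assoc]
    congr 2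
    ring

variable {nb}

/-- The coordinates respect the relations `a x ⊗ y = (-1)^{|a||x|} x ⊗ a y` of the tensor product over `Λ`.
-/
theorem tensorCoords_rel (hdeg : ∀ i, Odd (deg i)) (hb : ∀ i, b i ∈ F.gr (nb i)) {p : ℤ}
    {a : Ext k c} (ha : a ∈ extGr k deg p) (x : F.carrier) (y : N.carrier) :
    tensorCoords b nb ((a • x) ⊗ₜ y) =
      tensorCoords b nb (sgnPow F.internal p x ⊗ₜ (a • y)) := by
  refine LinearMap.congr_fun
    (f := (tensorCoords b nb).comp (((TensorProduct.mk k F.carrier N.carrier).flip y).comp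
      (Algebra.lsmul k k F.carrier a)))
    (g := (tensorCoords b nb).comp (((TensorProduct.mk k F.carrier N.carrier).flip (a • y)).comp
      (sgnPow F.internal p))) (semifree_ext b fun i q a' ha' => ?_) x
  show tensorCoords b nb ((a • a' • b i) ⊗ₜ y) =
    tensorCoords b nb (sgnPow F.internal p (a' • b i) ⊗ₜ (a • y))
  rw [sgnPow_of_mem F.internal p (F.smul_mem ha' (hb i)), ← mul_smul,
    ← TensorProduct.smul_tmul' ((-1 : k) ^ (p * (q + nb i))), map_smul, tensorCoords_smul,
    tensorCoords_smul, sgnPow_smul N _ ha, smul_comm a' ((-1 : k) ^ (nb i * p)), Finsupp.smul_single, smul_smul,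
    ext_graded_comm hdeg ha ha', smul_assoc, mul_smul, ← zpow_add₀ (by simp)]
  have : (-1 : k) ^ (p * (q + nb i) + nb i * p) = (-1) ^ (p * q) * (-1) ^ (2 * (p * nb i)) := by
    rw [← zpow_add₀ (by simp)]; congr 1; ring
  rw [this, Even.neg_one_zpow (even_two_mul _), mul_one]

variable (nb) in
/-- The coordinates `I →₀ N` of `F ⊗_Λ N` given by a basis of `F`. -/
def overCoords (hdeg : ∀ i, Odd (deg i)) (hb : ∀ i, b i ∈ F.gr (nb i)) :
    (tOver F N).carrier →ₗ[k] I →₀ N.carrier :=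
  (tensorLeft F N).quotientLift (extGr_top deg) (tensorRel F N) _ _ (tensorCoords b nb)
    (span_induction_gr (X := F.carrier ⊗[k] N.carrier) (extGr_top deg) (by
      rintro q a' ha' _ ⟨p, j, l, a, x, y, ha, hx, hy, rfl⟩
      show tensorCoords b nb (a' • ((a • x) ⊗ₜ y - ((-1 : k) ^ (p * j)) • (x ⊗ₜ (a • y)))) = 0
      have h1 := tensorCoords_rel (N := N) b hdeg hb ha (a' • x) y
      rw [sgnPow_of_mem F.internal p (F.smul_mem ha' hx),
        ← TensorProduct.smul_tmul' ((-1 : k) ^ (p * (q + j))), map_smul] at h1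
      have h0 : a' • ((a • x) ⊗ₜ[k] y - ((-1 : k) ^ (p * j)) • (x ⊗ₜ[k] (a • y))) =
          (a' • a • x) ⊗ₜ[k] y - ((-1 : k) ^ (p * j)) • ((a' • x) ⊗ₜ[k] (a • y)) := by
        rw [smul_sub, smul_comm a', TensorProduct.smul_tmul', TensorProduct.smul_tmul']
      refine (congrArg (tensorCoords b nb) h0).trans ?_
      rw [← mul_smul,
        ext_graded_comm hdeg ha' ha, smul_assoc, mul_smul,
        ← TensorProduct.smul_tmul' ((-1 : k) ^ (q * p)), map_sub, map_smul, map_smul, h1, smul_smul, ← zpow_add₀ (by simp), sub_eq_zero]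
      congr 1
      have : (-1 : k) ^ (q * p + p * (q + j)) = (-1) ^ (p * j) * (-1) ^ (2 * (p * q)) := by
        rw [← zpow_add₀ (by simp)]; congr 1; ring
      rw [this, Even.neg_one_zpow (even_two_mul _), mul_one]))

variable (hdeg : ∀ i, Odd (deg i)) (hb : ∀ i, b i ∈ F.gr (nb i))

theorem overCoords_omk (t : F.carrier ⊗[k] N.carrier) :
    overCoords b nb hdeg hb (omk F N t) = tensorCoords b nb t := rfl

variable (N nb) in
/-- The sign involution to the power `nb i` on `Γ ⊗ N`. -/
def kTwist (i : I) : KSp N →ₗ[k] KSp N := TensorProduct.map LinearMap.id (sgnPow N.internal (nb i))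

theorem kTwist_kTwist (i : I) (z : KSp N) : kTwist N nb i (kTwist N nb i z) = z := by
  refine LinearMap.congr_fun (f := (kTwist N nb i).comp (kTwist N nb i)) (g := LinearMap.id)
    (TensorProduct.ext' fun γ y => ?_) z
  show γ ⊗ₜ sgnPow N.internal (nb i) (sgnPow N.internal (nb i) y) = _
  rw [sgnPow_sgnPow]; rfl

theorem kTwist_kD (hdeg : ∀ i, Odd (deg i)) (i : I) (z : KSp N) :
    kD N (kTwist N nb i z) = ((-1 : k) ^ (nb i)) • kTwist N nb i (kD N z) := by
  refine LinearMap.congr_fun (f := (kD N).comp (kTwist N nb i))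
    (g := ((-1 : k) ^ (nb i)) • (kTwist N nb i).comp (kD N)) (TensorProduct.ext' fun γ y => ?_) z
  show kD N (γ ⊗ₜ sgnPow N.internal (nb i) y) = ((-1 : k) ^ (nb i)) • kTwist N nb i (kD N (γ ⊗ₜ y))
  rw [kD_tmul, kD_tmul, map_add, map_sum, smul_add, Finset.smul_sum]
  congr 1
  · show _ = (-1 : k) ^ (nb i) • (γ ⊗ₜ[k] sgnPow N.internal (nb i) (N.d y))
    rw [sgnPow_d _ _ N.d_isHom, TensorProduct.tmul_smul, smul_smul, neg_one_zpow_mul_self, one_smul]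
  · refine Finset.sum_congr rfl fun j _ => ?_
    show _ = (-1 : k) ^ (nb i) •
      (gamAct k deg (X j) γ ⊗ₜ[k] sgnPow N.internal (nb i) (gen k j • y))
    rw [sgnPow_smul N _ (gen_mem deg j), mul_comm, zpow_mul,
      Odd.neg_one_zpow ((Int.odd_coe_nat _).2 (hdeg j)),
      TensorProduct.tmul_smul ((-1 : k) ^ nb i), smul_smul,
      neg_one_zpow_mul_self, one_smul]

variable (nb) in
/-- The coordinates of `K F ⊗ K N` in `K Λ ⊗ K N` given by a basis of `F`. -/
def kTensorCoords : KSp F ⊗[k] KSp N →ₗ[k] I →₀ (KSp (extDG k deg) ⊗[k] KSp N) :=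
  (Finsupp.lsum k fun i => (Finsupp.lsingle i).comp
    (TensorProduct.map LinearMap.id (kTwist N nb i))).comp
  (tensorFinsuppLeft (tensorFinsuppRight
    ((Finsupp.mapRange.linearMap (ofExt k deg).toLinearMap).comp (coords b))))

theorem kTensorCoords_smul (γ : Gam k deg) (a : Ext k c) (i : I) (z : KSp N) :
    kTensorCoords b nb ((γ ⊗ₜ (a • b i)) ⊗ₜ z) =
      Finsupp.single i ((γ ⊗ₜ ofExt k deg a) ⊗ₜ kTwist N nb i z) := by
  rw [kTensorCoords, LinearMap.comp_apply, tensorFinsuppLeft_single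
    (tensorFinsuppRight_single (i := i) (y := ofExt k deg a) (by
      rw [LinearMap.comp_apply, coords_smul, Finsupp.mapRange.linearMap_apply,
        Finsupp.mapRange_single]; rfl)),
    Finsupp.lsum_single]
  rfl

theorem kTensorCoords_apply (γ : Gam k deg) (x : F.carrier) (z : KSp N) (j : I) :
    kTensorCoords b nb ((γ ⊗ₜ x) ⊗ₜ z) j =
      (γ ⊗ₜ ofExt k deg (b.repr x j)) ⊗ₜ kTwist N nb j z := by
  refine LinearMap.congr_fun (f := (Finsupp.lapply j).comp ((kTensorCoords b nb).comp
      (((TensorProduct.mk k _ _).flip z).comp (TensorProduct.mk k _ _ γ))))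
    (g := ((TensorProduct.mk k _ _).flip (kTwist N nb j z)).comp ((TensorProduct.mk k _ _ γ).comp
      ((ofExt k deg).toLinearMap.comp ((Finsupp.lapply j).comp (coords b)))))
    (semifree_ext b fun i p a ha => ?_) x
  show kTensorCoords b nb ((γ ⊗ₜ (a • b i)) ⊗ₜ z) j =
    (γ ⊗ₜ ofExt k deg (coords b (a • b i) j)) ⊗ₜ kTwist N nb j z
  rw [kTensorCoords_smul, coords_smul]
  by_cases h : i = j
  · subst h; rw [Finsupp.single_eq_same, Finsupp.single_eq_same]
  · rw [Finsupp.single_eq_of_ne' h, Finsupp.single_eq_of_ne' h, map_zero, TensorProduct.tmul_zero,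
      TensorProduct.zero_tmul]

variable (nb) in
/-- The coordinates of `K (F ⊗_Λ N)` in `K N` given by a basis of `F`. -/
def kOverCoords : KSp (tOver F N) →ₗ[k] I →₀ KSp N :=
  tensorFinsuppRight (overCoords b nb hdeg hb)

theorem kOverCoords_apply (γ : Gam k deg) (x : F.carrier) (y : N.carrier) (j : I) :
    kOverCoords b nb hdeg hb (γ ⊗ₜ omk F N (x ⊗ₜ y)) j =
      γ ⊗ₜ (b.repr x j • sgnPow N.internal (nb j) y) := by
  rw [kOverCoords, tensorFinsuppRight_apply, overCoords_omk, tensorCoords_apply]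

theorem kOverCoords_smul (γ : Gam k deg) (a : Ext k c) (i : I) (y : N.carrier) :
    kOverCoords b nb hdeg hb (γ ⊗ₜ omk F N ((a • b i) ⊗ₜ y)) =
      Finsupp.single i (γ ⊗ₜ (a • sgnPow N.internal (nb i) y)) := by
  rw [kOverCoords, tensorFinsuppRight_single]
  rw [overCoords_omk, tensorCoords_smul]

end Semifree

/-! ### The product map of a semifree dg module -/

section Coordinates

variable {k : Type*} [Field k] {A B V W : Type*} [AddCommGroup A] [Module k A] [AddCommGroup B]
  [Module k B] [AddCommGroup V] [Module k V] [AddCommGroup W] [Module k W] {I : Type*}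
  {α : I → A →ₗ[k] V} {β : I → B →ₗ[k] W} {p : V →ₗ[k] I →₀ A} {q : W →ₗ[k] I →₀ B}

/-- Coordinates on a product from coordinates on the factors. -/
def prodCoords (h1 : ∀ i a, p (α i a) = Finsupp.single i a) (h2 : ∀ v, Finsupp.lsum k α (p v) = v)
    (h3 : ∀ i b, q (β i b) = Finsupp.single i b) (h4 : ∀ w, Finsupp.lsum k β (q w) = w) :
    (I →₀ A × B) ≃ₗ[k] V × W :=
  LinearEquiv.ofLinearMap
    (Finsupp.lsum k fun i => (α i).prodMap (β i))
    (((Finsupp.mapRange.linearMap (LinearMap.inl k A B)).comp p).coprod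
      ((Finsupp.mapRange.linearMap (LinearMap.inr k A B)).comp q))
    (by
      have e1 : ∀ l : I →₀ A, Finsupp.lsum k (fun i => (α i).prodMap (β i))
          (Finsupp.mapRange.linearMap (LinearMap.inl k A B) l) = (Finsupp.lsum k α l, 0) := by
        intro l
        induction l using Finsupp.induction_linear with
        | zero => rw [map_zero, map_zero, map_zero]; rfl
        | add l l' h h' => rw [map_add, map_add, h, h', map_add]; simp
        | single i w =>
          rw [Finsupp.mapRange.linearMap_apply, Finsupp.mapRange_single, Finsupp.lsum_single,
            Finsupp.lsum_single]
          simp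
      have e2 : ∀ l : I →₀ B, Finsupp.lsum k (fun i => (α i).prodMap (β i))
          (Finsupp.mapRange.linearMap (LinearMap.inr k A B) l) = (0, Finsupp.lsum k β l) := by
        intro l
        induction l using Finsupp.induction_linear with
        | zero => rw [map_zero, map_zero, map_zero]; rfl
        | add l l' h h' => rw [map_add, map_add, h, h', map_add]; simp
        | single i w =>
          rw [Finsupp.mapRange.linearMap_apply, Finsupp.mapRange_single, Finsupp.lsum_single,
            Finsupp.lsum_single]
          simp
      refine LinearMap.ext fun v => ?_
      simp only [LinearMap.comp_apply, LinearMap.coprod_apply, map_add, e1, e2, h2, h4]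
      simp)
    (by
      refine Finsupp.lhom_ext fun i w => ?_
      obtain ⟨w, z⟩ := w
      rw [LinearMap.comp_apply, Finsupp.lsum_single, LinearMap.prodMap_apply,
        LinearMap.coprod_apply, LinearMap.comp_apply, LinearMap.comp_apply, h1, h3,
        Finsupp.mapRange.linearMap_apply, Finsupp.mapRange.linearMap_apply,
        Finsupp.mapRange_single, Finsupp.mapRange_single, ← Finsupp.single_add]
      simp)

theorem prodCoords_single (h1 : ∀ i a, p (α i a) = Finsupp.single i a)
    (h2 : ∀ v, Finsupp.lsum k α (p v) = v) (h3 : ∀ i b, q (β i b) = Finsupp.single i b)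
    (h4 : ∀ w, Finsupp.lsum k β (q w) = w) (i : I) (w : A × B) :
    prodCoords h1 h2 h3 h4 (Finsupp.single i w) = (α i w.1, β i w.2) :=
  Finsupp.lsum_single _ _ _ _

theorem prodCoords_symm (h1 : ∀ i a, p (α i a) = Finsupp.single i a)
    (h2 : ∀ v, Finsupp.lsum k α (p v) = v) (h3 : ∀ i b, q (β i b) = Finsupp.single i b)
    (h4 : ∀ w, Finsupp.lsum k β (q w) = w) (v : V × W) (j : I) :
    (prodCoords h1 h2 h3 h4).symm v j = (p v.1 j, q v.2 j) := by
  show Finsupp.mapRange (LinearMap.inl k A B) (map_zero _) (p v.1) j +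
    Finsupp.mapRange (LinearMap.inr k A B) (map_zero _) (q v.2) j = _
  rw [Finsupp.mapRange_apply, Finsupp.mapRange_apply]
  simp

end Coordinates

section Semifree

open MvPolynomial

variable {k : Type u} [Field k] {c : ℕ} {deg : Fin c → ℕ} {F N : DGExt k deg} {I : Type u}
  (b : Module.Basis I (Ext k c) F.carrier) {nb : I → ℤ}

/-- Tensors in `K F ⊗ K N` are determined by the products with the elements of a basis of `F`. -/
theorem kTensor_ext {Y : Type*} [AddCommGroup Y] [Module k Y] {f g : KSp F ⊗[k] KSp N →ₗ[k] Y}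
    (h : ∀ γ i p (a : Ext k c) z, a ∈ extGr k deg p →
      f ((γ ⊗ₜ (a • b i)) ⊗ₜ z) = g ((γ ⊗ₜ (a • b i)) ⊗ₜ z)) : f = g := by
  refine TensorProduct.ext (TensorProduct.ext (LinearMap.ext fun γ => ?_))
  refine semifree_ext b fun i p a ha => LinearMap.ext fun z => ?_
  exact h γ i p a z ha

theorem kOver_ext {Y : Type*} [AddCommGroup Y] [Module k Y] {f g : KSp (tOver F N) →ₗ[k] Y}
    (h : ∀ γ i p (a : Ext k c) y, a ∈ extGr k deg p →
      f (γ ⊗ₜ omk F N ((a • b i) ⊗ₜ y)) = g (γ ⊗ₜ omk F N ((a • b i) ⊗ₜ y))) : f = g := by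
  refine TensorProduct.ext (LinearMap.ext fun γ => LinearMap.ext fun w => ?_)
  obtain ⟨t, rfl⟩ := omk_surjective w
  refine LinearMap.congr_fun (f := (f.comp (TensorProduct.mk k _ _ γ)).comp (omk F N))
    (g := (g.comp (TensorProduct.mk k _ _ γ)).comp (omk F N)) (TensorProduct.ext ?_) t
  refine semifree_ext b fun i p a ha => LinearMap.ext fun y => ?_
  exact h γ i p a y ha

variable (N nb) in
/-- The inclusion of a summand `K Λ ⊗ K N` of `K F ⊗ K N`. -/
def kTensorIncl (i : I) : KSp (extDG k deg) ⊗[k] KSp N →ₗ[k] KSp F ⊗[k] KSp N :=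
  TensorProduct.map (TensorProduct.map LinearMap.id
    (((Algebra.lsmul k k F.carrier).toLinearMap.flip (b i)).comp (ofExt k deg).symm.toLinearMap))
    (kTwist N nb i)

theorem kTensorIncl_tmul (i : I) (γ : Gam k deg) (a : Ext k c) (z : KSp N) :
    kTensorIncl N b nb i ((γ ⊗ₜ ofExt k deg a) ⊗ₜ z) = (γ ⊗ₜ (a • b i)) ⊗ₜ kTwist N nb i z := rfl

theorem kTensorLam_ext {Y : Type*} [AddCommMonoid Y] [Module k Y]
    {f g : KSp (extDG k deg) ⊗[k] KSp N →ₗ[k] Y}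
    (h : ∀ γ a z, f ((γ ⊗ₜ ofExt k deg a) ⊗ₜ z) = g ((γ ⊗ₜ ofExt k deg a) ⊗ₜ z)) : f = g :=
  TensorProduct.ext (TensorProduct.ext' fun γ a => LinearMap.ext fun z => h γ a z)

variable (N nb) in
/-- The inclusion of a summand `K N` of `K (F ⊗_Λ N)`. -/
def kOverIncl (i : I) : KSp N →ₗ[k] KSp (tOver F N) :=
  TensorProduct.map LinearMap.id ((omk F N).comp ((TensorProduct.mk k F.carrier N.carrier (b i)).comp
    (sgnPow N.internal (nb i))))

theorem kOverIncl_tmul (i : I) (γ : Gam k deg) (y : N.carrier) :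
    kOverIncl N b nb i (γ ⊗ₜ y) = γ ⊗ₜ omk F N (b i ⊗ₜ sgnPow N.internal (nb i) y) := rfl

theorem kTensorCoords_incl (i : I) (w : KSp (extDG k deg) ⊗[k] KSp N) :
    kTensorCoords b nb (kTensorIncl N b nb i w) = Finsupp.single i w := by
  refine LinearMap.congr_fun (f := (kTensorCoords b nb).comp (kTensorIncl N b nb i))
    (g := Finsupp.lsingle i) (kTensorLam_ext fun γ a z => ?_) w
  rw [LinearMap.comp_apply, kTensorIncl_tmul, kTensorCoords_smul, kTwist_kTwist]
  rfl

variable (hdeg : ∀ i, Odd (deg i)) (hb : ∀ i, b i ∈ F.gr (nb i))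

theorem kOverCoords_incl (i : I) (z : KSp N) :
    kOverCoords b nb hdeg hb (kOverIncl N b nb i z) = Finsupp.single i z := by
  refine LinearMap.congr_fun (f := (kOverCoords b nb hdeg hb).comp (kOverIncl N b nb i))
    (g := Finsupp.lsingle i) (TensorProduct.ext' fun γ y => ?_) z
  have h := kOverCoords_smul b hdeg hb γ 1 i (sgnPow N.internal (nb i) y)
  rw [one_smul, one_smul, sgnPow_sgnPow] at h
  exact h

theorem sum_kTensorIncl (t : KSp F ⊗[k] KSp N) :
    Finsupp.lsum k (kTensorIncl N b nb) (kTensorCoords b nb t) = t := by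
  refine LinearMap.congr_fun (f := (Finsupp.lsum k (kTensorIncl N b nb)).comp (kTensorCoords b nb))
    (g := LinearMap.id) (kTensor_ext b fun γ i p a z _ => ?_) t
  rw [LinearMap.comp_apply, kTensorCoords_smul, Finsupp.lsum_single, kTensorIncl_tmul,
    kTwist_kTwist]
  rfl

theorem sum_kOverIncl (t : KSp (tOver F N)) :
    Finsupp.lsum k (kOverIncl N b nb) (kOverCoords b nb hdeg hb t) = t := by
  refine LinearMap.congr_fun
    (f := (Finsupp.lsum k (kOverIncl N b nb)).comp (kOverCoords b nb hdeg hb))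
    (g := LinearMap.id) (kOver_ext b fun γ i p a y ha => ?_) t
  rw [LinearMap.comp_apply, kOverCoords_smul, Finsupp.lsum_single, kOverIncl_tmul,
    sgnPow_smul N _ ha, sgnPow_sgnPow, TensorProduct.tmul_smul ((-1 : k) ^ (nb i * p)), map_smul,
    omk_rel ha (hb i), mul_comm p]
  rfl

variable (N nb) in
/-- Coordinates on the cone of `K F ⊗ K N → K (F ⊗_Λ N)` in the cone of `K Λ ⊗ K N → K N`. -/
def coneCoords : (I →₀ (KSp (extDG k deg) ⊗[k] KSp N) × KSp N) ≃ₗ[k]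
    (KSp F ⊗[k] KSp N) × KSp (tOver F N) :=
  prodCoords (kTensorCoords_incl (nb := nb) b) (sum_kTensorIncl (nb := nb) b)
    (kOverCoords_incl b hdeg hb) (sum_kOverIncl b hdeg hb)

theorem coneCoords_single (i : I) (w : (KSp (extDG k deg) ⊗[k] KSp N) × KSp N) :
    coneCoords N b nb hdeg hb (Finsupp.single i w) =
      (kTensorIncl N b nb i w.1, kOverIncl N b nb i w.2) :=
  prodCoords_single (kTensorCoords_incl (nb := nb) b) (sum_kTensorIncl (nb := nb) b)
    (kOverCoords_incl b hdeg hb) (sum_kOverIncl b hdeg hb) i w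

theorem coneCoords_symm (v : (KSp F ⊗[k] KSp N) × KSp (tOver F N)) (j : I) :
    (coneCoords N b nb hdeg hb).symm v j =
      (kTensorCoords b nb v.1 j, kOverCoords b nb hdeg hb v.2 j) :=
  prodCoords_symm (kTensorCoords_incl (nb := nb) b) (sum_kTensorIncl (nb := nb) b)
    (kOverCoords_incl b hdeg hb) (sum_kOverIncl b hdeg hb) v j

theorem kOverCoords_kPair (t : KSp F ⊗[k] KSp N) (j : I) :
    kOverCoords b nb hdeg hb (kPair (Z := tOver F N) (omk F N) t) j =
      kPair (actPair N) (kTensorCoords b nb t j) := by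
  refine LinearMap.congr_fun (f := (Finsupp.lapply j).comp ((kOverCoords b nb hdeg hb).comp
    (kPair (Z := tOver F N) (omk F N))))
    (g := (kPair (actPair N)).comp ((Finsupp.lapply j).comp (kTensorCoords b nb)))
    (kk_ext fun γ x γ' y => ?_) t
  show kOverCoords b nb hdeg hb (kPair (Z := tOver F N) (omk F N) ((γ ⊗ₜ x) ⊗ₜ (γ' ⊗ₜ y))) j =
    kPair (actPair N) (kTensorCoords b nb ((γ ⊗ₜ x) ⊗ₜ (γ' ⊗ₜ y)) j)
  rw [kPair_tmul, kOverCoords_apply, kTensorCoords_apply]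
  exact (kPair_tmul (actPair N) _ _ _ _).symm

/-- The inclusion of the summand of the basis element `b i` commutes with the differentials up to a term with
the differential of `b i`, which has coordinates of lower level only. -/
theorem kTensorIncl_d (hdeg : ∀ i, Odd (deg i)) (hb : ∀ i, b i ∈ F.gr (nb i)) (i : I)
    (γ : Gam k deg) (a : Ext k c) (z : KSp N) :
    tensorD (kGr_internal F) (kD F) (kD N) (kTensorIncl N b nb i ((γ ⊗ₜ ofExt k deg a) ⊗ₜ z)) =
      (γ ⊗ₜ (inv a • F.d (b i))) ⊗ₜ kTwist N nb i z + kTensorIncl N b nb i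
        (tensorD (kGr_internal (extDG k deg)) (kD _) (kD N) ((γ ⊗ₜ ofExt k deg a) ⊗ₜ z)) := by
  have h1 : sgn (kGr_internal F) (γ ⊗ₜ (a • b i)) ⊗ₜ[k] kD N (kTwist N nb i z) =
      (γ ⊗ₜ (inv a • b i)) ⊗ₜ kTwist N nb i (kD N z) := by
    rw [sgn_kGr hdeg, sgn_smul_inv F hdeg, sgn_of_mem _ (hb i), kTwist_kD hdeg,
      smul_comm (inv a) ((-1 : k) ^ nb i),
      TensorProduct.tmul_smul ((-1 : k) ^ nb i), TensorProduct.tmul_smul ((-1 : k) ^ nb i) γ,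
      ← TensorProduct.smul_tmul' ((-1 : k) ^ nb i), smul_smul, neg_one_zpow_mul_self, one_smul]
  have h2 : kTensorIncl N b nb i (kD (extDG k deg) (γ ⊗ₜ ofExt k deg a) ⊗ₜ z) =
      (∑ l, gamAct k deg (X l) γ ⊗ₜ (gen k l • a • b i)) ⊗ₜ kTwist N nb i z := by
    rw [kD_ofExt, TensorProduct.sum_tmul, TensorProduct.sum_tmul, map_sum]
    refine Finset.sum_congr rfl fun l _ => ?_
    rw [kTensorIncl_tmul, mul_smul]
  rw [kTensorIncl_tmul, tensorD_tmul, tensorD_tmul, h1, map_add, h2, sgn_kGr hdeg, sgn_ofExt hdeg,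
    kTensorIncl_tmul, kD_tmul, d_smul_involute F hdeg, TensorProduct.add_tmul]
  exact add_assoc _ _ _

theorem kTensorCoords_d (hdeg : ∀ i, Odd (deg i)) (hb : ∀ i, b i ∈ F.gr (nb i)) {i j : I}
    (hij : b.repr (F.d (b i)) j = 0) (w : KSp (extDG k deg) ⊗[k] KSp N) :
    kTensorCoords b nb (tensorD (kGr_internal F) (kD F) (kD N) (kTensorIncl N b nb i w)) j =
      Finsupp.single i (tensorD (kGr_internal (extDG k deg)) (kD _) (kD N) w) j := by
  refine LinearMap.congr_fun (f := (Finsupp.lapply j).comp ((kTensorCoords b nb).comp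
    ((tensorD (kGr_internal F) (kD F) (kD N)).comp (kTensorIncl N b nb i))))
    (g := (Finsupp.lapply j).comp ((Finsupp.lsingle i).comp
      (tensorD (kGr_internal (extDG k deg)) (kD _) (kD N)))) (kTensorLam_ext fun γ a z => ?_) w
  refine (congrArg (fun t => kTensorCoords b nb t j) (kTensorIncl_d b hdeg hb i γ a z)).trans ?_
  rw [map_add, kTensorCoords_incl, Finsupp.add_apply, kTensorCoords_apply, map_smul,
    Finsupp.smul_apply, hij, smul_zero, map_zero, TensorProduct.tmul_zero,
    TensorProduct.zero_tmul, zero_add]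
  rfl

theorem kOverCoords_d {i j : I} (hij : b.repr (F.d (b i)) j = 0) (z : KSp N) :
    kOverCoords b nb hdeg hb (kD (tOver F N) (kOverIncl N b nb i z)) j =
      Finsupp.single i (kD N z) j := by
  refine LinearMap.congr_fun (f := (Finsupp.lapply j).comp ((kOverCoords b nb hdeg hb).comp
    ((kD (tOver F N)).comp (kOverIncl N b nb i))))
    (g := (Finsupp.lapply j).comp ((Finsupp.lsingle i).comp (kD N)))
    (TensorProduct.ext' fun γ y => ?_) z
  show kOverCoords b nb hdeg hb (kD (tOver F N) (kOverIncl N b nb i (γ ⊗ₜ y))) j =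
    Finsupp.single i (kD N (γ ⊗ₜ y)) j
  have h1 : sgn F.internal (b i) ⊗ₜ[k] N.d (sgnPow N.internal (nb i) y) =
      b i ⊗ₜ sgnPow N.internal (nb i) (N.d y) := by
    rw [sgn_of_mem _ (hb i), sgnPow_d _ _ N.d_isHom]
    exact TensorProduct.smul_tmul _ _ _
  rw [kOverIncl_tmul, kD_tmul, kD_tmul, d_omk, h1, TensorProduct.tmul_add, map_add, map_add,
    Finsupp.add_apply, Finsupp.add_apply, kOverCoords_apply, hij, zero_smul,
    TensorProduct.tmul_zero, zero_add, Finsupp.single_add, Finsupp.add_apply]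
  have h2 := kOverCoords_smul b hdeg hb γ 1 i (sgnPow N.internal (nb i) (N.d y))
  rw [one_smul, one_smul, sgnPow_sgnPow] at h2
  rw [h2, map_sum, Finsupp.single_finsetSum]
  congr 2
  refine Finset.sum_congr rfl fun l _ => ?_
  rw [smul_omk, kOverCoords_smul, sgnPow_sgnPow]

variable (N) in
/-- The cone of `K F ⊗ K N → K (F ⊗_Λ N)` is, up to terms of lower level, a direct sum of copies of the cone for
`F = Λ`, one for each element of a semifree basis. -/
theorem IsSemifree.kMul_isQuasiIso (hF : IsSemifree F) : (kMul F N hdeg).IsQuasiIso := by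
  obtain ⟨I, b, level, hb, hd⟩ := hF
  choose nb hb using hb
  have hz : ∀ i j, level i ≤ level j → b.repr (F.d (b i)) j = 0 := fun i j hij => by
    by_contra h
    have h1 := b.mem_span_image.1 (hd i) (Finsupp.mem_support_iff.2 h)
    exact absurd hij (not_le.2 h1)
  rw [DGHom.isQuasiIso_iff]
  refine acyclic_of_levels (V := (KSp F ⊗[k] KSp N) × KSp (tOver F N)) level
    (coneD (tensorD (kGr_internal F) (kD F) (kD N)) (kD (tOver F N))
      (kPair (Z := tOver F N) (omk F N))) ?_ _ (koszul_acyclic N hdeg) (coneCoords N b nb hdeg hb) ?_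
  · exact coneD_coneD (tensorD_tensorD (kGr_internal F) (K F hdeg).d_mem (kD_kD F hdeg)
      (kD_kD N hdeg)) (kD_kD _ hdeg) ((isPairing_omk hdeg).kPair_d hdeg)
  · intro i w j hij
    rw [coneCoords_single, coneD_apply, coneCoords_symm, map_neg, Finsupp.neg_apply,
      kTensorCoords_d b hdeg hb (hz i j hij), map_add, Finsupp.add_apply, kOverCoords_kPair,
      kTensorCoords_incl, kOverCoords_d b hdeg hb (hz i j hij), coneD_apply]
    by_cases h : i = j
    · subst h
      simp only [Finsupp.single_eq_same]
    · simp only [Finsupp.single_eq_of_ne' h, neg_zero, map_zero, add_zero, Prod.mk_zero_zero]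

end Semifree

/-! ### The dual of the universal resolution -/

section DualResolution

open MvPolynomial

variable {k : Type u} [Field k] {c : ℕ} {deg : Fin c → ℕ} (M : DGExt k deg)

theorem algebraMapInv_of_mem {n : ℤ} (hn : n ≠ 0) {a : Ext k c} (ha : a ∈ extGr k deg n) :
    (ExteriorAlgebra.algebraMapInv : Ext k c →ₐ[k] k) a = 0 := by
  refine LinearMap.mem_ker.1 (extGr_le (P := LinearMap.ker
    (ExteriorAlgebra.algebraMapInv : Ext k c →ₐ[k] k).toLinearMap) (fun l hl => ?_) ha)
  rw [LinearMap.mem_ker, AlgHom.toLinearMap_apply]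
  cases l with
  | nil => exact absurd (by simpa using hl.symm) hn
  | cons i l =>
    have h : (ExteriorAlgebra.algebraMapInv : Ext k c →ₐ[k] k) (gen k i) = 0 := by
      simp [gen, ExteriorAlgebra.algebraMapInv]
    rw [List.map_cons, List.prod_cons, map_mul, h, zero_mul]

theorem algebraMapInv_gen (i : Fin c) :
    (ExteriorAlgebra.algebraMapInv : Ext k c →ₐ[k] k) (gen k i) = 0 := by
  simp [gen, ExteriorAlgebra.algebraMapInv]

/-- The graded dual `Hom_Λ(u M, k)`. -/
abbrev UDual := HomSp (ExteriorAlgebra.algebraMapInv : Ext k c →ₐ[k] k) (univGr M)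

/-- The value of an element of `Hom_Λ(u M, k)`. -/
abbrev uEv : UDual M →ₗ[k] UnivSp M →ₗ[k] k := HomSp.toLin _ _

theorem uEv_smul (f : UDual M) (a : Ext k c) (t : UnivSp M) :
    uEv M f (a • t) = (ExteriorAlgebra.algebraMapInv : Ext k c →ₐ[k] k) a * uEv M f t := by
  have h : gradedHom (ExteriorAlgebra.algebraMapInv : Ext k c →ₐ[k] k) (univGr M) ≤
      LinearMap.ker ((LinearMap.applyₗ (a • t) : (UnivSp M →ₗ[k] k) →ₗ[k] k) -
        (ExteriorAlgebra.algebraMapInv : Ext k c →ₐ[k] k) a •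
          (LinearMap.applyₗ t : (UnivSp M →ₗ[k] k) →ₗ[k] k)) :=
    gradedHom_le fun n g hg => by
      rw [LinearMap.mem_ker, LinearMap.sub_apply, sub_eq_zero]
      exact hg.1 a t
  have h1 := LinearMap.mem_ker.1 (h f.toLin_mem)
  rw [LinearMap.sub_apply, sub_eq_zero] at h1
  exact h1

theorem uEv_tmul (f : UDual M) (a : Ext k c) (z : KSp M) :
    uEv M f (a ⊗ₜ z) = (ExteriorAlgebra.algebraMapInv : Ext k c →ₐ[k] k) a * uEv M f (1 ⊗ₜ z) := by
  rw [← uEv_smul, TensorProduct.smul_tmul', smul_eq_mul, mul_one]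

/-- Restriction of `Λ`-linear maps on `u M = Λ ⊗ (Γ ⊗ M)` to `Γ ⊗ M`. -/
def uRestrict : UDual M →ₗ[k] GDual (kGr M) where
  toFun f := HomSp.mk ((uEv M f).comp (TensorProduct.mk k (Ext k c) (KSp M) 1)) (by
    have h : gradedHom (ExteriorAlgebra.algebraMapInv : Ext k c →ₐ[k] k) (univGr M) ≤
        (gradedHom (AlgHom.id k k) (kGr M)).comap
          (LinearMap.lcomp k k (TensorProduct.mk k (Ext k c) (KSp M) 1)) :=
      gradedHom_le fun n g hg => homPiece_le _ _ n (mem_homPiece_id.2 fun i hi z hz =>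
        hg.2 i hi _ (tmul_mem (prod_mem_extGr deg []) hz (zero_add i)))
    exact h f.toLin_mem)
  map_add' _ _ := rfl
  map_smul' _ _ := rfl

theorem uRestrict_apply (f : UDual M) (z : KSp M) :
    ev (kGr M) (uRestrict M f) z = uEv M f (1 ⊗ₜ z) := rfl

theorem isHom_uRestrict : IsHom (homGr (ExteriorAlgebra.algebraMapInv : Ext k c →ₐ[k] k) (univGr M))
    (homGr (AlgHom.id k k) (kGr M)) 0 (uRestrict M) := fun n f hf => by
  rw [add_zero]
  exact mem_homPiece_id.2 fun i hi z hz =>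
    hf.2 i hi _ (tmul_mem (prod_mem_extGr deg []) hz (zero_add i))

theorem uRestrict_injective : Function.Injective (uRestrict M) := by
  rw [injective_iff_map_eq_zero]
  intro f hf
  refine HomSp.ext fun t => ?_
  refine LinearMap.congr_fun (f := uEv M f) (g := uEv M 0) (TensorProduct.ext' fun a z => ?_) t
  have h : uEv M f (1 ⊗ₜ z) = 0 := by rw [← uRestrict_apply, hf]; rfl
  rw [uEv_tmul, h, mul_zero]
  rfl

theorem uRestrict_surjective : Function.Surjective (uRestrict M) := by
  intro g
  let E : (KSp M →ₗ[k] k) →ₗ[k] (UnivSp M →ₗ[k] k) :=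
    (TensorProduct.dualDistrib k (Ext k c) (KSp M)).comp (TensorProduct.mk k _ _
      (ExteriorAlgebra.algebraMapInv : Ext k c →ₐ[k] k).toLinearMap)
  have hE : ∀ g a z, E g (a ⊗ₜ z) = (ExteriorAlgebra.algebraMapInv : Ext k c →ₐ[k] k) a * g z :=
    fun g a z => TensorProduct.dualDistrib_apply _ _ _ _
  have h : gradedHom (AlgHom.id k k) (kGr M) ≤
      (gradedHom (ExteriorAlgebra.algebraMapInv : Ext k c →ₐ[k] k) (univGr M)).comap E := by
    refine gradedHom_le fun n g hg => homPiece_le _ _ n ⟨fun a t => ?_, fun i hi t ht => ?_⟩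
    · induction t using TensorProduct.induction_on with
      | zero => simp
      | add s t hs ht => rw [smul_add, map_add, hs, ht, map_add, mul_add]
      | tmul b z => rw [TensorProduct.smul_tmul', hE, hE, smul_eq_mul, map_mul, mul_assoc]
    · refine (Submodule.mem_bot k).1 (tensorGr_map (f := E g) (fun p q a z hpq ha hz => ?_) ht)
      rw [Submodule.mem_bot, hE]
      by_cases hp : p = 0
      · rw [mem_homPiece_id.1 hg q (by omega) z hz, mul_zero]
      · rw [algebraMapInv_of_mem hp ha, zero_mul]
  refine ⟨HomSp.mk (E (ev (kGr M) g)) (h g.toLin_mem), HomSp.ext fun z => ?_⟩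
  have h1 := hE (ev (kGr M) g) 1 z
  rw [map_one, one_mul] at h1
  exact h1

theorem univD_one_tmul (z : KSp M) :
    univD M (1 ⊗ₜ z) = 1 ⊗ₜ kD M z - ∑ i, gen k i • (1 ⊗ₜ[k] kX M i z : UnivSp M) := by
  refine LinearMap.congr_fun (f := (univD M).comp (TensorProduct.mk k (Ext k c) (KSp M) 1))
    (g := (TensorProduct.mk k (Ext k c) (KSp M) 1).comp (kD M) -
      ∑ i, (Algebra.lsmul k k (UnivSp M) (gen k i)).comp
        ((TensorProduct.mk k (Ext k c) (KSp M) 1).comp (kX M i)))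
    (TensorProduct.ext' fun γ m => ?_) z |>.trans ?_
  · rw [LinearMap.comp_apply, TensorProduct.mk_apply, univD, LinearMap.add_apply, univD0_tmul,
      map_one, LinearMap.sum_apply, LinearMap.sub_apply, LinearMap.comp_apply, kD_tmul,
      TensorProduct.mk_apply, TensorProduct.tmul_add, TensorProduct.tmul_sum, LinearMap.sum_apply,
      add_sub_assoc, ← Finset.sum_sub_distrib]
    congr 1
    refine Finset.sum_congr rfl fun i _ => ?_
    rw [univD1_tmul, map_one]
    rfl
  · rw [LinearMap.sub_apply, LinearMap.sum_apply]
    rfl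

theorem sgn_one_tmul (z : KSp M) : sgn (univGr_internal M) (1 ⊗ₜ z) =
    1 ⊗ₜ sgn (kGr_internal M) z := by
  have h := LinearMap.congr_fun (sgn_tensor (extGr_internal (k := k) deg) (kGr_internal M)) (1 ⊗ₜ z)
  have h1 : (1 : Ext k c) ∈ extGr k deg 0 := prod_mem_extGr deg []
  rw [TensorProduct.map_tmul, sgn_of_mem (extGr_internal (k := k) deg) h1, zpow_zero, one_smul] at h
  exact h

theorem uEv_sgn_smul (hdeg : ∀ i, Odd (deg i)) (f : UDual M) (i : Fin c) (t : UnivSp M) :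
    uEv M f (sgn (univGr_internal M) (gen k i • t)) = 0 := by
  have h : sgn (univGr_internal M) (gen k i • t) =
      ((-1 : k) ^ (deg i : ℤ)) • gen k i • sgn (univGr_internal M) t :=
    sgn_smul (univ M hdeg) (gen_mem deg i) t
  rw [h, map_smul, uEv_smul M f (gen k i), algebraMapInv_gen, zero_mul, smul_zero]

theorem uEv_sgn_d (hdeg : ∀ i, Odd (deg i)) (f : UDual M) (z : KSp M) :
    uEv M f (sgn (univGr_internal M) (univD M (1 ⊗ₜ z))) =
      uEv M f (1 ⊗ₜ sgn (kGr_internal M) (kD M z)) := by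
  rw [univD_one_tmul, map_sub, map_sub, map_sum, map_sum,
    Finset.sum_eq_zero fun i _ => uEv_sgn_smul M hdeg f i _, sub_zero, sgn_one_tmul]

/-- The isomorphism `Hom_Λ(u M, k) ≅ Hom_k(Γ ⊗ M, k)` of dg `S`-modules. -/
def dgDualToDual (hdeg : ∀ i, Odd (deg i)) : DGHom (dgDual M hdeg) (dual hdeg (K M hdeg)) :=
  DGHom.ofLin (P := dgDual M hdeg) (Q := dual hdeg (K M hdeg)) (uRestrict M) (isHom_uRestrict M)
    (fun f => dual_ext hdeg fun z => congrArg Neg.neg (uEv_sgn_d M hdeg f z))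
    (fun i f => dual_ext hdeg fun z => rfl)

/-- `dgDualToDual` is bijective: a functional on `Γ ⊗ M` extends uniquely to a map `Λ ⊗ (Γ ⊗ M) → k` that is
linear over `Λ`, acting on `k` through the augmentation. -/
theorem dgDualToDual_isQuasiIso (hdeg : ∀ i, Odd (deg i)) :
    (dgDualToDual M hdeg).IsQuasiIso :=
  DGHom.isQuasiIso_of_bijective ⟨uRestrict_injective M, uRestrict_surjective M⟩

end DualResolution

/-! ### The dual of a derived tensor product -/

section DerivedTensor

variable {k : Type u} [Field k] {c : ℕ} {deg : Fin c → ℕ}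

theorem DerivedIso.of_quasiIso {A : Type u} [Ring A] [Algebra k A] {𝒜 : ℤ → Submodule k A}
    {X Y : DGModule 𝒜} {f : DGHom X Y} (hf : f.IsQuasiIso) : DerivedIso X Y :=
  Relation.EqvGen.rel _ _ ⟨f, hf⟩

/-- The identity of a dg module. -/
def DGHom.id {A : Type u} [Ring A] [Algebra k A] {𝒜 : ℤ → Submodule k A} (X : DGModule 𝒜) :
    DGHom X X := ⟨LinearMap.id, fun hx => hx, fun _ => rfl⟩

theorem isHEquiv_id {A : Type u} [Ring A] [Algebra k A] {𝒜 : ℤ → Submodule k A}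
    (X : DGModule 𝒜) : IsHEquiv (DGHom.id X) :=
  (DGHom.isQuasiIso_of_bijective Function.bijective_id).isHEquiv

/-- The dual of `M ⊗ᴸ N` is the tensor product of the duals. The comparison maps are morphisms of dg
`S`-modules; the essential ones are the dual of the product map `K F ⊗ K N → K (F ⊗_Λ N)` and the
comparison map of `dualTensor_isQuasiIso`. -/
theorem derivedIso_dgDual_tensorOver (hdeg : ∀ i, Odd (deg i)) {M N F : DGExt k deg}
    (hM : IsFgBoundedBelow M) (hN : IsFgBoundedBelow N) (hF : IsSemifree F) {φ : DGHom F M}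
    (hφ : φ.IsQuasiIso) :
    DerivedIso (dgDual (tOver F N) hdeg) (diagTensor hdeg (dgDual M hdeg) (dgDual N hdeg)) := by
  have hKF : HasFiniteType (K F hdeg) := (hM.hasFiniteType.of_isHEquiv hφ.isHEquiv).K hdeg
  have hKN : HasFiniteType (K N hdeg) := hN.hasFiniteType.K hdeg
  have e1 := DerivedIso.of_quasiIso (dgDualToDual_isQuasiIso (tOver F N) hdeg)
  have e2 := DerivedIso.of_quasiIso
    ((hF.kMul_isQuasiIso N hdeg).isHEquiv.dualMap hdeg).isQuasiIso
  have e3 := DerivedIso.of_quasiIso (dualTensor_isQuasiIso hdeg hKF hKN)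
  have e4 := DerivedIso.of_quasiIso (IsHEquiv.diagTensorMap hdeg
    ((hφ.Kmap hdeg).isHEquiv.dualMap hdeg) (isHEquiv_id (dual hdeg (K N hdeg)))).isQuasiIso
  have e5 := DerivedIso.of_quasiIso (IsHEquiv.diagTensorMap hdeg
    (dgDualToDual_isQuasiIso M hdeg).isHEquiv (dgDualToDual_isQuasiIso N hdeg).isHEquiv).isQuasiIso
  exact e1.trans _ _ _ (e2.trans _ _ _ (e3.symm.trans _ _ _ ((e4.symm).trans _ _ _ e5.symm)))

end DerivedTensor

/-! ### Finite generation of the homology of the dual -/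

section Acyclicity

variable {k : Type u} [Field k] {A : Type u} [Ring A] [Algebra k A] {𝒜 : ℤ → Submodule k A}

theorem acyclic_iff_subsingleton (X : DGModule 𝒜) : Acyclic X.d ↔ Subsingleton (Homology X) := by
  rw [Submodule.Quotient.subsingleton_iff, eq_top_iff]
  constructor
  · rintro h ⟨x, hx⟩ -
    exact h x hx
  · intro h x hx
    exact h (x := ⟨x, hx⟩) trivial

theorem Acyclic.exists_graded_contraction {X : DGModule 𝒜} (hX : Acyclic X.d) :
    ∃ h : X.carrier →ₗ[k] X.carrier, IsHom X.gr X.gr 1 h ∧ ∀ x, X.d (h x) + h (X.d x) = x := by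
  obtain ⟨h, π, q, hh, -, h1, -, h2⟩ := exists_homology_retraction X
  have := (acyclic_iff_subsingleton X).1 hX
  have hπ : π = 0 := ext_gr X.internal fun n x hx => by
    obtain ⟨y, -, hy⟩ := h2 n x hx
    rw [← hy, Subsingleton.elim y 0, map_zero]
    rfl
  refine ⟨h, hh, fun x => ?_⟩
  have := h1 x
  rwa [hπ, LinearMap.zero_apply, zero_add] at this

end Acyclicity

section FiniteGeneration

open MvPolynomial

variable {k : Type u} [Field k] {c : ℕ} {deg : Fin c → ℕ}

/-- Over a field, a complex is acyclic if and only if its graded dual is. -/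
theorem dual_acyclic_iff (hdeg : ∀ i, Odd (deg i)) (C : DGPoly k deg) :
    Acyclic (dual hdeg C).d ↔ Acyclic C.d := by
  constructor
  · intro hC
    obtain ⟨h, π, -, hh, hπ, h1, hd, -⟩ := exists_homology_retraction C
    intro t ht
    have hdπ : ∀ x, π (C.d x) = 0 := fun x => by rw [chain_of_homotopy C.d_d h1, hd]
    have h0 : π t = 0 := by
      refine eq_zero_of_proj C.internal fun n => ?_
      by_contra hn
      obtain ⟨ξ, hξ⟩ : ∃ ξ : C.carrier →ₗ[k] k, ξ (proj C.internal n (π t)) ≠ 0 := by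
        by_contra h
        push Not at h
        exact hn ((Module.forall_dual_apply_eq_zero_iff k _).1 h)
      -- the functional `ξ ∘ π` is a cycle that does not vanish on the cycle `t`
      let f : (dual hdeg C).carrier := HomSp.mk (ξ.comp ((proj C.internal n).comp π))
        (homPiece_le _ _ (-n) (mem_homPiece_id.2 fun i hi x hx => by
          have := hπ i x hx
          rw [add_zero] at this
          rw [LinearMap.comp_apply, LinearMap.comp_apply, proj_of_mem C.internal this,
            if_neg (by omega), map_zero]))
      have hf : (dual hdeg C).d f = 0 := dual_ext hdeg fun x => by
        rw [dual_d, sgn_d C.internal C.d C.d_mem, map_neg, neg_neg]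
        show ξ (proj C.internal n (π (C.d _))) = 0
        rw [hdπ, map_zero, map_zero]
      obtain ⟨g, hg⟩ := hC f hf
      have h2 : dualEv hdeg C f t = 0 := by
        rw [← hg, dual_d, ht, map_zero, map_zero, neg_zero]
      exact hξ h2
    refine ⟨h t, ?_⟩
    have := h1 t
    rwa [h0, ht, map_zero, zero_add, add_zero] at this
  · intro hC f hf
    obtain ⟨h, hh, h1⟩ := hC.exists_graded_contraction
    have h2 := dual_homotopy hdeg (isHom_zero 0) hh (fun x => (zero_add _).trans (h1 x)) f
    have h3 : dualPre hdeg (0 : C.carrier →ₗ[k] C.carrier) (isHom_zero 0) f = 0 :=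
      dual_ext hdeg fun x => map_zero (dualEv hdeg C f)
    rw [h3, hf, map_zero, add_zero, zero_add] at h2
    exact ⟨_, h2⟩

/-- Functionals on `Γ` that only see finitely many degrees are evaluations at elements of `S`. -/
theorem exists_eval_of_finite (T : Finset ℤ) (f : Gam k deg →ₗ[k] k)
    (hf : ∀ i ∉ T, ∀ γ ∈ gamGr k deg i, f γ = 0) :
    ∃ s : Poly k c, ∀ γ, f γ = ev (sGr k deg) γ s := by
  classical
  have h1 : ∀ n, ∃ s : Poly k c, ∀ γ, f (proj gamGr_internal n γ) = ev (sGr k deg) γ s := fun n =>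
    exists_eval (n := n) (f.comp (proj gamGr_internal n)) fun i hi γ hγ => by
      rw [LinearMap.comp_apply, proj_of_mem _ hγ, if_neg hi, map_zero]
  choose s hs using h1
  refine ⟨∑ n ∈ T, s n, fun γ => ?_⟩
  refine LinearMap.congr_fun (f := f) (g := (ev (sGr k deg)).flip _)
    (ext_gr gamGr_internal fun i γ hγ => ?_) γ
  rw [LinearMap.flip_apply, map_sum, ← Finset.sum_congr rfl fun n _ => hs n γ]
  by_cases hi : i ∈ T
  · rw [Finset.sum_eq_single i (fun n _ hn => by
      rw [proj_of_mem _ hγ, if_neg (Ne.symm hn), map_zero]) (fun h => absurd hi h),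
      proj_self _ hγ]
  · rw [hf i hi γ hγ, Finset.sum_eq_zero fun n hn => by
      rw [proj_of_mem _ hγ, if_neg (fun h : i = n => hi (h ▸ hn)), map_zero]]

/-- The components of the vectors of a finite-dimensional subspace lie in finitely many degrees. -/
theorem exists_finite_degrees {X : Type*} [AddCommGroup X] [Module k X] {gX : ℤ → Submodule k X}
    (hX : DirectSum.IsInternal gX) (P : Submodule k X) [FiniteDimensional k P] :
    ∃ T : Finset ℤ, ∀ v ∈ P, coact hX v ∈ Finsupp.supported X k (T : Set ℤ) := by
  classical
  obtain ⟨S, hS⟩ := (Submodule.fg_iff_finiteDimensional P).2 ‹_›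
  refine ⟨S.biUnion fun v => (coact hX v).support, fun v hv => ?_⟩
  rw [← hS] at hv
  refine (Submodule.span_le.2 ?_ : Submodule.span k (S : Set X) ≤
    (Finsupp.supported X k ((S.biUnion fun v => (coact hX v).support : Finset ℤ) : Set ℤ)).comap
      (coact hX)) hv
  intro w hw
  rw [SetLike.mem_coe, Submodule.mem_comap, Finsupp.mem_supported]
  exact_mod_cast Finset.subset_biUnion_of_mem (fun v => (coact hX v).support) hw

/-- For an element `f` of the graded dual of `Γ ⊗ M` and a vector `v` of `M`, the functional
`γ ↦ f (γ ⊗ v)` is the evaluation at an element of `S`, since it only sees finitely many degrees of `γ`. -/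
theorem exists_eval_tmul {M : DGExt k deg} (f : GDual (kGr M)) {T : Finset ℤ} {v : M.carrier}
    (hv : coact M.internal v ∈ Finsupp.supported M.carrier k (T : Set ℤ)) :
    ∃ s : Poly k c, ∀ γ, ev (kGr M) f (γ ⊗ₜ v) = ev (sGr k deg) γ s := by
  classical
  obtain ⟨U, hU⟩ := (mem_gradedHom_id (kGr_internal M)).1 f.toLin_mem
  have hsum : v = ∑ i ∈ T, proj M.internal i v := by
    refine eq_of_sub_eq_zero (eq_zero_of_proj M.internal fun j => ?_)
    rw [map_sub, map_sum]
    by_cases hj : j ∈ T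
    · rw [Finset.sum_eq_single j (fun i _ hi => by
        rw [proj_of_mem M.internal (proj_mem M.internal i v), if_neg hi]) (fun h => absurd hj h),
        proj_self M.internal (proj_mem M.internal j v), sub_self]
    · rw [Finset.sum_eq_zero fun i hi => by
        rw [proj_of_mem M.internal (proj_mem M.internal i v), if_neg (fun h : i = j => hj (h ▸ hi))],
        sub_zero]
      by_contra h
      exact hj ((Finsupp.mem_supported _ _).1 hv (Finsupp.mem_support_iff.2 h))
  refine exists_eval_of_finite ((U ×ˢ T).image fun p => p.1 - p.2)
    ((ev (kGr M) f).comp ((TensorProduct.mk k _ _).flip v)) fun j hj γ hγ => ?_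
  show ev (kGr M) f (γ ⊗ₜ v) = 0
  rw [hsum, TensorProduct.tmul_sum, map_sum]
  refine Finset.sum_eq_zero fun i hi => hU (j + i) (fun h => hj ?_) _
    (tmul_mem hγ (proj_mem M.internal i v) rfl)
  exact Finset.mem_image.2 ⟨(j + i, i), Finset.mem_product.2 ⟨h, hi⟩, by simp⟩

/-- If the homology of `M` is finite-dimensional, then all cycles of the dual of `K M` are homologous to
elements of a finitely generated `S`-submodule. The dual of the homotopy of `K_perturbation` takes a cycle
`f` to the homologous cycle `f ∘ A' ∘ (1 ⊗ π) ∘ A`. As `π` has finite rank, `π = ∑ ξ_t v_t`, the functional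
`f ∘ A' ∘ (1 ⊗ π)` is an `S`-linear combination of the functionals `γ ⊗ m ↦ γ(1) ξ_t(m)`. -/
theorem exists_fg_cycles (hdeg : ∀ i, Odd (deg i)) (M : DGExt k deg)
    [FiniteDimensional k (Homology M)] :
    ∃ G : Submodule (Poly k c) (dual hdeg (K M hdeg)).carrier, G.FG ∧
      ∀ f, (dual hdeg (K M hdeg)).d f = 0 → ∃ g ∈ G, ∃ w, f = g + (dual hdeg (K M hdeg)).d w := by
  obtain ⟨h, π, q, hh, hπ, h1, -, h2⟩ := exists_homology_retraction M
  obtain ⟨A, A', H, hA, hA', hH, hXA, -, -, hHom⟩ := K_perturbation hdeg hh h1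
  have hr : ∀ x, π x ∈ LinearMap.range q := fun x =>
    mem_of_top M.internal (P := (LinearMap.range q).comap π) (fun n x hx => by
      obtain ⟨y, -, hy⟩ := h2 n x hx
      exact ⟨y, hy⟩) x
  obtain ⟨r, v, ξ, hv, hξ, hξ0⟩ := exists_finite_rank hr
  obtain ⟨T, hT⟩ := exists_finite_degrees M.internal (LinearMap.range q)
  have hT0 : ∀ i ∉ T, ∀ x ∈ M.gr i, π x = 0 := fun i hi x hx => by
    have h3 := hπ i x hx
    rw [add_zero] at h3
    have h4 := hT _ (hr x)
    rw [coact_of_mem M.internal h3, Finsupp.mem_supported] at h4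
    by_contra h5
    exact hi (h4 (Finsupp.mem_support_iff.2 (by rwa [Finsupp.single_eq_same])))
  -- the functionals `γ ⊗ m ↦ γ(1) ξ_t(m)`
  let e : Fin r → KSp M →ₗ[k] k := fun t => (ξ t).comp (kAug M)
  have he : ∀ t, e t ∈ gradedHom (AlgHom.id k k) (kGr M) := fun t => by
    refine (mem_gradedHom_id (kGr_internal M)).2 ⟨T, fun i hi z hz => ?_⟩
    refine (Submodule.mem_bot k).1 (tensorGr_map (f := e t) (fun a b γ x hab hγ hx => ?_) hz)
    rw [Submodule.mem_bot]
    show ξ t (kAug M (γ ⊗ₜ x)) = 0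
    rw [kAug_tmul, map_smul]
    by_cases ha : a = 0
    · rw [hξ0 t x (hT0 b (by rwa [show b = i by omega]) x hx), smul_zero]
    · have h5 : ∀ i : ℤ, i ≠ -a → ∀ s ∈ sGr k deg i, ev (sGr k deg) γ s = 0 := mem_homPiece_id.1 hγ
      rw [h5 0 (by omega) 1 (isWeightedHomogeneous_one k _), zero_smul]
  let π' : Module.End k (KSp M) := TensorProduct.map LinearMap.id π
  have hπ' : IsHom (kGr M) (kGr M) 0 π' := isHom_id.tensor hπ rfl
  let P := dual hdeg (K M hdeg)
  let g : Fin r → P.carrier := fun t => HomSp.mk (e t) (he t)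
  let pA : P.carrier →ₗ[k] P.carrier := dualPre hdeg (C := K M hdeg) (D := K M hdeg) A hA
  let pAS : P.carrier →ₗ[Poly k c] P.carrier :=
    { toFun := pA
      map_add' := map_add pA
      map_smul' := poly_linear pA (dualPre_X hdeg (C := K M hdeg) (D := K M hdeg) A hA
        fun i x => (LinearMap.congr_fun (hXA i).eq x).symm) }
  refine ⟨(Submodule.span (Poly k c) (Set.range fun t => g t)).map pAS,
    (Submodule.fg_span (Set.finite_range _)).map _, fun f hf => ?_⟩
  have hPi : IsHom (kGr M) (kGr M) 0 (A'.comp (π'.comp A)) := hA'.comp (hπ'.comp hA rfl) rfl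
  have h3 := dual_homotopy hdeg (C := K M hdeg) hPi hH hHom f
  rw [hf, map_zero, add_zero] at h3
  refine ⟨_, ?_, _, h3.symm⟩
  let f₁ : GDual (kGr M) := pre A' hA' f
  have h4 : ∀ t, ∃ s : Poly k c, ∀ γ, ev (kGr M) f₁ (γ ⊗ₜ v t) = ev (sGr k deg) γ s := fun t =>
    exists_eval_tmul f₁ (hT _ (hv t))
  choose s hs using h4
  refine ⟨∑ t, s t • g t, sum_mem fun t _ => Submodule.smul_mem _ _
    (Submodule.subset_span ⟨t, rfl⟩), ?_⟩
  have h5 : (∑ t, s t • g t : P.carrier) = pre π' hπ' f₁ := by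
    refine dual_ext hdeg fun z => ?_
    refine LinearMap.congr_fun (f := dualEv hdeg (K M hdeg) (∑ t, s t • g t))
      (g := dualEv hdeg (K M hdeg) (pre π' hπ' f₁)) (kmk_ext fun γ m => ?_) z
    rw [map_sum, LinearMap.sum_apply]
    show _ = ev (kGr M) f₁ (γ ⊗ₜ π m)
    rw [hξ, TensorProduct.tmul_sum, map_sum]
    refine Finset.sum_congr rfl fun t _ => ?_
    show ξ t (kAug M (gamAct k deg (s t) γ ⊗ₜ m)) = _
    rw [kAug_tmul, map_smul, TensorProduct.tmul_smul, map_smul, hs, gamAct_ev, mul_one,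
      smul_eq_mul, smul_eq_mul, mul_comm]
  rw [h5]
  rfl

end FiniteGeneration

/-! ### Supports and the Künneth isomorphism -/

section Support

open MvPolynomial

variable {k : Type u} [Field k] {c : ℕ} {deg : Fin c → ℕ} (hdeg : ∀ i, Odd (deg i))

/-- The localization at `p` is non-zero if and only if some element is killed by no homogeneous `s ∉ p`. -/
theorem mem_Supp {H : Type u} [AddCommGroup H] [Module (Poly k c) H] {p : ProjS k deg} :
    p ∈ Supp deg H ↔ ∃ m : H, ∀ s ∈ homogeneousCompl p, s • m ≠ 0 := by
  show Nontrivial _ ↔ _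
  rw [← not_subsingleton_iff_nontrivial, LocalizedModule.subsingleton_iff]
  push Not
  rfl

/-- The class of a cycle. -/
def cls (P : DGPoly k deg) : LinearMap.ker P.d →ₗ[k] polyHomology hdeg P where
  toFun z := Submodule.Quotient.mk ⟨z.1, z.2⟩
  map_add' _ _ := rfl
  map_smul' _ _ := rfl

variable {hdeg} {P Q : DGPoly k deg}

theorem cls_surjective : Function.Surjective (cls hdeg P) := by
  intro m
  obtain ⟨⟨z, hz⟩, rfl⟩ := Submodule.Quotient.mk_surjective _ m
  exact ⟨⟨z, hz⟩, rfl⟩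

theorem cls_eq_zero {z : P.carrier} (hz : P.d z = 0) :
    cls hdeg P ⟨z, hz⟩ = 0 ↔ ∃ w, P.d w = z :=
  Submodule.Quotient.mk_eq_zero _

theorem d_smul_poly (hdeg : ∀ i, Odd (deg i)) (s : Poly k c) (z : P.carrier) :
    P.d (s • z) = s • P.d z := (dLin hdeg P).map_smul s z

theorem d_smul_eq_zero (hdeg : ∀ i, Odd (deg i)) (s : Poly k c) {z : P.carrier} (hz : P.d z = 0) :
    P.d (s • z) = 0 := by rw [d_smul_poly hdeg, hz, smul_zero]

theorem smul_cls (s : Poly k c) {z : P.carrier} (hz : P.d z = 0) :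
    s • cls hdeg P ⟨z, hz⟩ = cls hdeg P ⟨s • z, d_smul_eq_zero hdeg s hz⟩ := rfl

theorem mem_Supp_homology {p : ProjS k deg} : p ∈ Supp (k := k) deg (polyHomology hdeg P) ↔
    ∃ z, P.d z = 0 ∧ ∀ s ∈ homogeneousCompl p, ∀ w, P.d w ≠ s • z := by
  rw [mem_Supp (k := k)]
  constructor
  · rintro ⟨m, hm⟩
    obtain ⟨⟨z, hz⟩, rfl⟩ := cls_surjective m
    refine ⟨z, hz, fun s hs w hw => hm s hs ?_⟩
    exact (smul_cls s hz).trans ((cls_eq_zero _).2 ⟨w, hw⟩)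
  · rintro ⟨z, hz, h⟩
    refine ⟨cls hdeg P ⟨z, hz⟩, fun s hs h0 => ?_⟩
    rw [smul_cls] at h0
    obtain ⟨w, hw⟩ := (cls_eq_zero _).1 h0
    exact h s hs w hw

variable (hdeg) in
theorem DGHom.IsQuasiIso.supp_eq {f : DGHom P Q} (hf : f.IsQuasiIso) :
    Supp (k := k) deg (polyHomology hdeg P) = Supp (k := k) deg (polyHomology hdeg Q) := by
  ext p
  rw [mem_Supp_homology (k := k), mem_Supp_homology (k := k)]
  constructor
  · rintro ⟨z, hz, h⟩
    refine ⟨f.toFun z, by rw [← f.map_d, hz, map_zero], fun s hs w hw => ?_⟩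
    obtain ⟨x, hx⟩ := hf.1 (s • z) (d_smul_eq_zero hdeg s hz) ⟨w, by rw [hw, map_smul]⟩
    exact h s hs x hx
  · rintro ⟨y, hy, h⟩
    obtain ⟨x, hx, y', rfl⟩ := hf.2 y hy
    refine ⟨x, hx, fun s hs w hw => h s hs (f.toFun w + s • y') ?_⟩
    rw [map_add, ← f.map_d, hw, map_smul, d_smul_poly hdeg, smul_add]

variable (hdeg) in
/-- Supports of homology are invariant under isomorphisms in the derived category. -/
theorem DerivedIso.supp_eq (h : DerivedIso P Q) :
    Supp (k := k) deg (polyHomology hdeg P) = Supp (k := k) deg (polyHomology hdeg Q) := by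
  induction h with
  | rel P Q h => obtain ⟨f, hf⟩ := h; exact hf.supp_eq hdeg
  | refl P => rfl
  | symm P Q _ ih => exact ih.symm
  | trans P Q R _ _ ih ih' => exact ih.trans ih'

/-- The action of `S ⊗ S` on a tensor product of `S`-modules. -/
def tAct (k : Type*) [Field k] (c : ℕ) (X Y : Type*) [AddCommGroup X] [Module k X] [Module (Poly k c) X]
    [IsScalarTower k (Poly k c) X] [AddCommGroup Y] [Module k Y] [Module (Poly k c) Y]
    [IsScalarTower k (Poly k c) Y] : Poly k c ⊗[k] Poly k c →ₐ[k] Module.End k (X ⊗[k] Y) :=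
  (Module.endTensorEndAlgHom (R := k) (S := k) (A := k) (M := X) (N := Y)).comp
    (Algebra.TensorProduct.map (Algebra.lsmul k k X) (Algebra.lsmul k k Y))

theorem tAct_tmul {X Y : Type*} [AddCommGroup X] [Module k X] [Module (Poly k c) X]
    [IsScalarTower k (Poly k c) X] [AddCommGroup Y] [Module k Y] [Module (Poly k c) Y]
    [IsScalarTower k (Poly k c) Y] (s t : Poly k c) (x : X) (y : Y) :
    tAct k c X Y (s ⊗ₜ t) (x ⊗ₜ y) = (s • x) ⊗ₜ (t • y) := by
  simp [tAct, Module.endTensorEndAlgHom_apply]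

/-- Chosen representatives `σ` of the homology classes, and an extension `R` to all elements of the map
from cycles to their classes. -/
theorem exists_homology_section (P : DGPoly k deg) :
    ∃ (R : P.carrier →ₗ[k] polyHomology hdeg P)
      (σ : polyHomology hdeg P →ₗ[k] P.carrier), (∀ x, P.d (σ x) = 0) ∧ (∀ z, R (P.d z) = 0) ∧
      (∀ z, P.d z = 0 → ∃ w, z = σ (R z) + P.d w) ∧
      ∀ (s : Poly k c) x, R (s • σ x) = s • x := by
  obtain ⟨R, hR⟩ := LinearMap.exists_extend (cls hdeg P)
  obtain ⟨σ, hσ⟩ := (cls hdeg P).exists_rightInverse_of_surjective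
    (LinearMap.range_eq_top.2 cls_surjective)
  have hR' : ∀ z (hz : P.d z = 0), R z = cls hdeg P ⟨z, hz⟩ := fun z hz =>
    LinearMap.congr_fun hR ⟨z, hz⟩
  have hσ' : ∀ x, cls hdeg P ⟨σ x, (σ x).2⟩ = x := fun x => LinearMap.congr_fun hσ x
  refine ⟨R, (LinearMap.ker P.d).subtype.comp σ, fun x => (σ x).2, fun z => ?_, fun z hz => ?_,
    fun s x => ?_⟩
  · rw [hR' _ (P.d_d z)]
    exact (cls_eq_zero _).2 ⟨z, rfl⟩
  · have h1 : cls hdeg P (⟨z, hz⟩ - σ (R z)) = 0 := by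
      rw [map_sub, ← hR' z hz, sub_eq_zero]
      exact (hσ' _).symm
    obtain ⟨w, hw⟩ := (cls_eq_zero (hdeg := hdeg) (⟨z, hz⟩ - σ (R z)).2).1 h1
    refine ⟨w, ?_⟩
    rw [hw]
    exact (add_sub_cancel (σ (R z)).1 z).symm
  · show R (s • (σ x).1) = s • x
    rw [hR' _ (d_smul_eq_zero hdeg s (σ x).2), ← smul_cls s (σ x).2, hσ']

set_option maxHeartbeats 1000000 in
/-- The Künneth isomorphism: mutually inverse maps, up to boundaries, between the cycles of a tensor
product and the tensor product of the homologies. -/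
theorem exists_kunneth (P Q : DGPoly k deg) :
    ∃ (κ : P.carrier ⊗[k] Q.carrier →ₗ[k] polyHomology hdeg P ⊗[k] polyHomology hdeg Q)
      (σ : polyHomology hdeg P ⊗[k] polyHomology hdeg Q →ₗ[k] P.carrier ⊗[k] Q.carrier),
      (∀ t, κ (tensorD P.internal P.d Q.d t) = 0) ∧ (∀ t, tensorD P.internal P.d Q.d (σ t) = 0) ∧
      (∀ z, tensorD P.internal P.d Q.d z = 0 → ∃ w, z = σ (κ z) + tensorD P.internal P.d Q.d w) ∧
      ∀ u t, κ (tAct k c P.carrier Q.carrier u (σ t)) =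
        tAct k c (polyHomology hdeg P) (polyHomology hdeg Q) u t := by
  obtain ⟨R, σ, h1, h2, h3, h4⟩ := exists_homology_section (hdeg := hdeg) P
  obtain ⟨R', σ', h1', h2', h3', h4'⟩ := exists_homology_section (hdeg := hdeg) Q
  obtain ⟨h, π, -, hh, hπ, e1, hd, -⟩ := exists_homology_retraction P
  obtain ⟨h', π', -, hh', hπ', e1', hd', -⟩ := exists_homology_retraction Q
  let D := tensorD P.internal P.d Q.d
  let κ : P.carrier ⊗[k] Q.carrier →ₗ[k] polyHomology hdeg P ⊗[k] polyHomology hdeg Q :=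
    TensorProduct.map R R'
  let τ : polyHomology hdeg P ⊗[k] polyHomology hdeg Q →ₗ[k] P.carrier ⊗[k] Q.carrier :=
    TensorProduct.map σ σ'
  have hκ : ∀ t, κ (D t) = 0 := fun t => by
    refine LinearMap.congr_fun (f := κ.comp D) (g := 0) (TensorProduct.ext' fun x y => ?_) t
    show κ (D (x ⊗ₜ y)) = 0
    rw [show D (x ⊗ₜ y) = _ from tensorD_tmul _ _ _ _ _, map_add]
    show R (P.d x) ⊗ₜ[k] R' y + R (sgn P.internal x) ⊗ₜ[k] R' (Q.d y) = 0
    rw [h2, h2', TensorProduct.zero_tmul, TensorProduct.tmul_zero, add_zero]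
  -- a tensor of cycles is homologous to the tensor of the chosen representatives
  have hcyc : ∀ x y, P.d x = 0 → Q.d y = 0 → ∃ w, x ⊗ₜ[k] y = τ (κ (x ⊗ₜ y)) + D w := by
    intro x y hx hy
    obtain ⟨u, hu⟩ := h3 x hx
    obtain ⟨v, hv⟩ := h3' y hy
    refine ⟨u ⊗ₜ y + sgn P.internal (σ (R x)) ⊗ₜ v, ?_⟩
    have e2 : D (u ⊗ₜ y) = P.d u ⊗ₜ y := by
      rw [show D (u ⊗ₜ y) = _ from tensorD_tmul _ _ _ _ _, hy, TensorProduct.tmul_zero, add_zero]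
    have e3 : D (sgn P.internal (σ (R x)) ⊗ₜ v) = σ (R x) ⊗ₜ Q.d v := by
      have e4 : P.d (sgn P.internal (σ (R x))) = 0 := by
        rw [← neg_eq_zero, ← sgn_d P.internal P.d P.d_mem, h1, map_zero]
      rw [show D (sgn P.internal (σ (R x)) ⊗ₜ v) = _ from tensorD_tmul _ _ _ _ _, e4, sgn_sgn,
        TensorProduct.zero_tmul, zero_add]
    rw [map_add, e2, e3]
    show x ⊗ₜ[k] y = σ (R x) ⊗ₜ[k] σ' (R' y) + _
    rw [add_comm (P.d u ⊗ₜ[k] y), ← add_assoc, ← TensorProduct.tmul_add, ← hv,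
      ← TensorProduct.add_tmul, ← hu]
  have hππ : ∀ t, ∃ w, TensorProduct.map π π' t = τ (κ (TensorProduct.map π π' t)) + D w := by
    intro t
    induction t using TensorProduct.induction_on with
    | zero => exact ⟨0, by simp⟩
    | add s t hs ht =>
      obtain ⟨w, hw⟩ := hs
      obtain ⟨w', hw'⟩ := ht
      refine ⟨w + w', ?_⟩
      rw [map_add, map_add, map_add, map_add]
      nth_rewrite 1 [hw]
      nth_rewrite 1 [hw']
      abel
    | tmul x y => exact hcyc _ _ (hd x) (hd' y)
  refine ⟨κ, τ, hκ, fun t => ?_, fun z hz => ?_, fun u t => ?_⟩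
  · refine LinearMap.congr_fun (f := D.comp τ) (g := 0) (TensorProduct.ext' fun x y => ?_) t
    show D (σ x ⊗ₜ σ' y) = 0
    rw [show D (σ x ⊗ₜ σ' y) = _ from tensorD_tmul _ _ _ _ _, h1, h1', TensorProduct.zero_tmul,
      TensorProduct.tmul_zero, add_zero]
  · have e2 := tensor_homotopy P.internal P.d_isHom P.d_d hπ hh e1 e1' z
    rw [hz, map_zero, add_zero] at e2
    obtain ⟨w, hw⟩ := hππ z
    have e3 : κ z = κ (TensorProduct.map π π' z) := by
      rw [← e2, map_add, hκ, add_zero, e2]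
    rw [e3]
    refine ⟨w + tensorH P.internal π h h' z, ?_⟩
    rw [map_add, ← add_assoc, ← hw]
    exact e2.symm
  · induction u using TensorProduct.induction_on with
    | zero => simp
    | add u v hu hv => simp only [map_add, LinearMap.add_apply, hu, hv]
    | tmul s s' =>
      induction t using TensorProduct.induction_on with
      | zero => simp
      | add t t' ht ht' => simp only [map_add, ht, ht']
      | tmul x y =>
        show κ (tAct k c _ _ (s ⊗ₜ s') (σ x ⊗ₜ σ' y)) = _
        rw [tAct_tmul, tAct_tmul]
        show R (s • σ x) ⊗ₜ[k] R' (s' • σ' y) = _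
        rw [h4, h4']

/-- By the Künneth isomorphism, the support of `P ⊗ Q` is that of the `S`-module `H(P) ⊗ H(Q)`, on which `S`
acts through `Δ`. -/
theorem mem_Supp_diagTensor {p : ProjS k deg} :
    p ∈ Supp (k := k) deg (polyHomology hdeg (diagTensor hdeg P Q)) ↔
      ∃ t : polyHomology hdeg P ⊗[k] polyHomology hdeg Q, ∀ s ∈ homogeneousCompl p,
        tAct k c (polyHomology hdeg P) (polyHomology hdeg Q) (diag k c s) t ≠ 0 := by
  obtain ⟨κ, σ, h1, h2, h3, h4⟩ := exists_kunneth (hdeg := hdeg) P Q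
  let T := diagTensor hdeg P Q
  let D := tensorD P.internal P.d Q.d
  rw [mem_Supp_homology (k := k)]
  constructor
  · rintro ⟨z, hz, h⟩
    refine ⟨κ z, fun s hs h0 => ?_⟩
    obtain ⟨w, hw⟩ := h3 z hz
    have e1 : s • (show T.carrier from z) =
        s • (show T.carrier from σ (κ z)) + T.d (s • (show T.carrier from w)) := by
      rw [d_smul_poly hdeg, ← smul_add]
      exact congrArg (fun x : T.carrier => s • x) hw
    have e2 : κ (s • (show T.carrier from z)) = 0 := by
      refine (congrArg κ e1).trans ((map_add κ _ _).trans ?_)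
      refine (congrArg₂ (· + ·) (h4 (diag k c s) (κ z)) (h1 _)).trans ?_
      rw [h0, add_zero]
    obtain ⟨w', hw'⟩ := h3 (s • (show T.carrier from z)) (d_smul_eq_zero (P := T) hdeg s hz)
    refine h s hs w' ?_
    refine Eq.symm (hw'.trans ?_)
    rw [e2, map_zero, zero_add]
    rfl
  · rintro ⟨t, ht⟩
    refine ⟨σ t, h2 t, fun s hs w hw => ht s hs ?_⟩
    rw [← h4]
    refine (congrArg κ (show tAct k c P.carrier Q.carrier (diag k c s) (σ t) = D w from hw.symm)).trans
      (h1 w)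

end Support

/-! ### The join of two closed subsets of `Proj S` -/

section Join

open MvPolynomial

theorem algHom_mem_projGr {k : Type*} [Field k] {σ τ : Type*} {w : σ → ℕ} {w' : τ → ℕ}
    (ψ : MvPolynomial σ k →ₐ[k] MvPolynomial τ k)
    (hψ : ∀ i, ψ (X i) ∈ projGr k w' (w i)) {n : ℕ} {s : MvPolynomial σ k}
    (hs : s ∈ projGr k w n) : ψ s ∈ projGr k w' n := by
  rw [s.as_sum, map_sum]
  refine sum_mem fun m hm => ?_
  have h1 : Finsupp.weight w m = n := hs (mem_support_iff.1 hm)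
  rw [monomial_eq, map_mul, ← algebraMap_eq, AlgHom.commutes, ← Algebra.smul_def, Finsupp.prod,
    map_prod]
  refine Submodule.smul_mem _ _ ?_
  have h2 : Finsupp.weight w m = ∑ i ∈ m.support, m i • w i := Finsupp.weight_apply w m
  rw [← h1, h2]
  refine IsWeightedHomogeneous.prod _ _ _ fun i _ => ?_
  rw [map_pow]
  exact IsWeightedHomogeneous.pow (hψ i) (m i)

variable (k : Type u) [Field k] {c : ℕ} (deg : Fin c → ℕ)

/-- The first inclusion `S → S ⊗ S`, as a graded homomorphism. -/
def inlGr : projGr k (wt deg) →+*ᵍ projGr k (Sum.elim (wt deg) (wt deg)) where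
  __ := (rename Sum.inl : Poly k c →ₐ[k] MvPolynomial (Fin c ⊕ Fin c) k).toRingHom
  map_mem hs := algHom_mem_projGr (rename Sum.inl) (fun i => by
    rw [rename_X]; exact isWeightedHomogeneous_X k _ _) hs

/-- The second inclusion `S → S ⊗ S`, as a graded homomorphism. -/
def inrGr : projGr k (wt deg) →+*ᵍ projGr k (Sum.elim (wt deg) (wt deg)) where
  __ := (rename Sum.inr : Poly k c →ₐ[k] MvPolynomial (Fin c ⊕ Fin c) k).toRingHom
  map_mem hs := algHom_mem_projGr (rename Sum.inr) (fun i => by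
    rw [rename_X]; exact isWeightedHomogeneous_X k _ _) hs

theorem diagSum_X (i : Fin c) : diagSum k c (X i) = X (Sum.inl i) + X (Sum.inr i) := by
  simp [diagSum, diag, tensorToSum]

/-- The diagonal `S → S ⊗ S`, as a graded homomorphism. -/
def diagGr : projGr k (wt deg) →+*ᵍ projGr k (Sum.elim (wt deg) (wt deg)) where
  __ := (diagSum k c).toRingHom
  map_mem hs := algHom_mem_projGr (diagSum k c) (fun i => by
    rw [diagSum_X]
    exact add_mem (isWeightedHomogeneous_X k _ (Sum.inl i))
      (isWeightedHomogeneous_X k _ (Sum.inr i))) hs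

variable {k deg}

theorem X_mem_irrelevant (i : Fin c) :
    (X i : Poly k c) ∈ (HomogeneousIdeal.irrelevant (projGr k (wt deg))).toIdeal := by
  have h : (X i : Poly k c) ∈ projGr k (wt deg) (wt deg i) := isWeightedHomogeneous_X k _ i
  refine (HomogeneousIdeal.mem_irrelevant_iff (projGr k (wt deg)) _).2 ?_
  rw [GradedRing.proj_apply, DirectSum.decompose_of_mem_ne _ h (by simp)]

theorem decompose_zero (s : Poly k c) :
    ((DirectSum.decompose (projGr k (wt deg)) s 0 : projGr k (wt deg) 0) : Poly k c) =
      C (coeff 0 s) :=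
  (weightedDecomposition.decompose'_apply k (wt deg) s 0).trans
    (weightedHomogeneousComponent_zero s (w := wt deg) fun i => by simp)

theorem irrelevant_le {I : Ideal (Poly k c)} (h : ∀ i, X i ∈ I) :
    (HomogeneousIdeal.irrelevant (projGr k (wt deg))).toIdeal ≤ I := by
  intro s hs
  have h1 := (HomogeneousIdeal.mem_irrelevant_iff (projGr k (wt deg)) _).1 hs
  rw [GradedRing.proj_apply, decompose_zero, C_eq_zero] at h1
  refine (Ideal.span_le.2 ?_ : Ideal.span (X '' Set.univ) ≤ I) (mem_ideal_span_X_image.2 ?_)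
  · rintro _ ⟨i, -, rfl⟩
    exact h i
  · intro m hm
    by_contra! h2
    have h3 : m = 0 := Finsupp.ext fun i => h2 i trivial
    rw [h3, mem_support_iff] at hm
    exact hm h1

/-- A proper homogeneous ideal lies in `S^{>0}`: the part of degree `0` is the field `k`. -/
theorem le_irrelevant {I : Ideal (Poly k c)} (hI : I.IsHomogeneous (projGr k (wt deg)))
    (hne : I ≠ ⊤) : I ≤ (HomogeneousIdeal.irrelevant (projGr k (wt deg))).toIdeal := by
  intro s hs
  refine (HomogeneousIdeal.mem_irrelevant_iff (projGr k (wt deg)) _).2 ?_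
  have h1 := hI 0 hs
  rw [decompose_zero] at h1
  rw [GradedRing.proj_apply, decompose_zero]
  by_contra h3
  refine hne (Ideal.eq_top_of_isUnit_mem _ h1 ?_)
  exact (isUnit_iff_ne_zero.2 fun h => h3 (by rw [h, C_0])).map C

theorem le_homogeneousCore {R σ : Type*} [CommRing R] [SetLike σ R]
    [AddSubmonoidClass σ R] {𝒜 : ℕ → σ} [GradedRing 𝒜] {I : HomogeneousIdeal 𝒜} {J : Ideal R}
    (h : I.toIdeal ≤ J) : I.toIdeal ≤ (J.homogeneousCore 𝒜).toIdeal := by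
  rw [← I.toIdeal_homogeneousCore_eq_self]
  exact Ideal.homogeneousCore_mono 𝒜 h

/-- If `U` is defined by `I`, then every homogeneous prime that contains `I` contains the largest ideal
in `S^{>0}` that defines `U`. -/
theorem defIdeal_le {I : HomogeneousIdeal (projGr k (wt deg))} {U : Set (ProjS k deg)}
    (hU : ∀ p : ProjS k deg, p ∈ U ↔ I.toIdeal ≤ p.asHomogeneousIdeal.toIdeal)
    {p : HomogeneousIdeal (projGr k (wt deg))} (hp : p.toIdeal.IsPrime)
    (hIp : I.toIdeal ≤ p.toIdeal) : defIdeal U ≤ p.toIdeal := by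
  by_cases h : HomogeneousIdeal.irrelevant (projGr k (wt deg)) ≤ p
  · exact inf_le_right.trans h
  · refine inf_le_left.trans fun s hs => ?_
    exact (ProjectiveSpectrum.mem_vanishingIdeal _ _).1 hs ⟨p, hp, h⟩ ((hU ⟨p, hp, h⟩).2 hIp)

theorem le_defIdeal {I : HomogeneousIdeal (projGr k (wt deg))} {U : Set (ProjS k deg)}
    (hU : ∀ p : ProjS k deg, p ∈ U ↔ I.toIdeal ≤ p.asHomogeneousIdeal.toIdeal)
    (hI : I ≤ HomogeneousIdeal.irrelevant (projGr k (wt deg))) : I.toIdeal ≤ defIdeal U :=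
  le_inf (fun _ hs => (ProjectiveSpectrum.mem_vanishingIdeal _ _).2 fun p hp => (hU p).1 hp hs) hI

/-- The join of the zero loci of `I` and `J` consists of the primes `q` such that `Δ` maps no homogeneous
element outside `q` into `I ⊗ S + S ⊗ J`. -/
theorem mem_join {I J : HomogeneousIdeal (projGr k (wt deg))} {U V : Set (ProjS k deg)}
    (hU : ∀ p : ProjS k deg, p ∈ U ↔ I.toIdeal ≤ p.asHomogeneousIdeal.toIdeal)
    (hV : ∀ p : ProjS k deg, p ∈ V ↔ J.toIdeal ≤ p.asHomogeneousIdeal.toIdeal)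
    (hI : I ≤ HomogeneousIdeal.irrelevant (projGr k (wt deg)))
    (hJ : J ≤ HomogeneousIdeal.irrelevant (projGr k (wt deg))) {q : ProjS k deg} :
    q ∈ join U V ↔ ∀ s ∈ homogeneousCompl q, diagSum k c s ∉
      I.toIdeal.map (rename Sum.inl : _ →ₐ[k] MvPolynomial (Fin c ⊕ Fin c) k) ⊔
        J.toIdeal.map (rename Sum.inr : _ →ₐ[k] MvPolynomial (Fin c ⊕ Fin c) k) := by
  constructor
  · intro hq s hs hsa
    have hcl : join U V ⊆ ProjectiveSpectrum.zeroLocus (projGr k (wt deg)) {s} := by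
      refine closure_minimal ?_ (ProjectiveSpectrum.isClosed_zeroLocus _ _)
      rintro p ⟨P, ⟨⟨hP1, hP2⟩, -⟩, hp⟩
      rw [ProjectiveSpectrum.mem_zeroLocus, Set.singleton_subset_iff]
      show s ∈ p.asHomogeneousIdeal.toIdeal
      rw [hp]
      exact sup_le ((Ideal.map_mono (le_defIdeal hU hI)).trans hP1)
        ((Ideal.map_mono (le_defIdeal hV hJ)).trans hP2) hsa
    exact hs.2 (Set.singleton_subset_iff.1 (hcl hq))
  · intro hq
    let a : HomogeneousIdeal (projGr k (Sum.elim (wt deg) (wt deg))) :=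
      I.map (inlGr k deg) ⊔ J.map (inrGr k deg)
    have ha : a.toIdeal = I.toIdeal.map (rename Sum.inl : _ →ₐ[k] MvPolynomial (Fin c ⊕ Fin c) k) ⊔
        J.toIdeal.map (rename Sum.inr : _ →ₐ[k] MvPolynomial (Fin c ⊕ Fin c) k) :=
      HomogeneousIdeal.toIdeal_sup _ _
    rw [← ha] at hq
    obtain ⟨P', hP', haP', hdis⟩ := Ideal.exists_le_prime_disjoint a.toIdeal
      ((homogeneousCompl q).map (diagSum k c)) (Set.disjoint_left.2 (by
        rintro _ hx ⟨s, hs, rfl⟩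
        exact hq s hs hx))
    let P := P'.homogeneousCore (projGr k (Sum.elim (wt deg) (wt deg)))
    have hP : P.toIdeal.IsPrime := hP'.homogeneousCore
    have haP : a.toIdeal ≤ P.toIdeal := le_homogeneousCore haP'
    have hPP' : P.toIdeal ≤ P' := Ideal.toIdeal_homogeneousCore_le _ _
    have hPq : (P.comap (diagGr k deg)).toIdeal ≤ q.asHomogeneousIdeal.toIdeal := by
      intro s hs
      by_contra hsq
      -- some homogeneous component of `s` lies outside `q`
      obtain ⟨n, hn⟩ : ∃ n, ((DirectSum.decompose (projGr k (wt deg)) s n :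
          projGr k (wt deg) n) : Poly k c) ∉ q.asHomogeneousIdeal.toIdeal := by
        by_contra! h
        exact hsq ((Ideal.IsHomogeneous.mem_iff (projGr k (wt deg)) q.asHomogeneousIdeal.isHomogeneous).2 h)
      refine Set.disjoint_left.1 hdis (hPP' ((P.comap (diagGr k deg)).isHomogeneous n hs)) ?_
      exact ⟨_, ⟨⟨n, SetLike.coe_mem _⟩, hn⟩, rfl⟩
    obtain ⟨i, hi⟩ : ∃ i, diagSum k c (X i) ∉ P.toIdeal := by
      by_contra! h
      exact q.not_irrelevant_le ((irrelevant_le h : _ ≤ (P.comap (diagGr k deg)).toIdeal).trans hPq)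
    have hPirr : ¬ HomogeneousIdeal.irrelevant (projGr k (Sum.elim (wt deg) (wt deg))) ≤ P := by
      intro h
      refine hi (h ?_)
      have h3 : diagSum k c (X i) ∈ projGr k (Sum.elim (wt deg) (wt deg)) (wt deg i) :=
        (diagGr k deg).map_mem (isWeightedHomogeneous_X k _ i)
      rw [HomogeneousIdeal.mem_irrelevant_iff, GradedRing.proj_apply,
        DirectSum.decompose_of_mem_ne _ h3 (by simp)]
    let p : ProjS k deg := ⟨P.comap (diagGr k deg), inferInstance, fun h =>
      hi (h (X_mem_irrelevant i))⟩
    have hp : p ∈ {p : ProjS k deg | ∃ P ∈ prodLocus U V \ antiDiagonal k deg,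
        p.asHomogeneousIdeal.toIdeal = P.asHomogeneousIdeal.toIdeal.comap (diagSum k c)} := by
      refine ⟨⟨P, hP, hPirr⟩, ⟨⟨Ideal.map_le_iff_le_comap.2 ?_, Ideal.map_le_iff_le_comap.2 ?_⟩,
        fun h => hi (h i)⟩, rfl⟩
      · exact defIdeal_le hU (p := P.comap (inlGr k deg)) inferInstance
          (Ideal.map_le_iff_le_comap.1 (le_sup_left.trans (ha.ge.trans haP)))
      · exact defIdeal_le hV (p := P.comap (inrGr k deg)) inferInstance
          (Ideal.map_le_iff_le_comap.1 (le_sup_right.trans (ha.ge.trans haP)))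
    exact closure_mono (Set.singleton_subset_iff.2 hp)
      ((ProjectiveSpectrum.le_iff_mem_closure _ p q).1 hPq)

end Join

/-! ### The annihilator of a tensor product -/

section Annihilator

open MvPolynomial

variable {k : Type u} [Field k] {c : ℕ} {X Y : Type u} [AddCommGroup X] [Module k X]
  [Module (Poly k c) X] [IsScalarTower k (Poly k c) X] [AddCommGroup Y] [Module k Y]
  [Module (Poly k c) Y] [IsScalarTower k (Poly k c) Y]

variable (k c X Y) in
/-- The ideal `ann X ⊗ S + S ⊗ ann Y` of `S ⊗ S`. -/
def annSum : Ideal (MvPolynomial (Fin c ⊕ Fin c) k) :=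
  (Module.annihilator (Poly k c) X).map
      (rename Sum.inl : _ →ₐ[k] MvPolynomial (Fin c ⊕ Fin c) k) ⊔
    (Module.annihilator (Poly k c) Y).map
      (rename Sum.inr : _ →ₐ[k] MvPolynomial (Fin c ⊕ Fin c) k)

/-- The inverse of the identification `S ⊗ S = Sym (W ⊕ W)`. -/
def sumToTensor (k : Type*) [Field k] (c : ℕ) : MvPolynomial (Fin c ⊕ Fin c) k →ₐ[k] Poly k c ⊗[k] Poly k c :=
  aeval (Sum.elim (fun i => MvPolynomial.X i ⊗ₜ 1) (fun i => 1 ⊗ₜ MvPolynomial.X i))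

theorem sumToTensor_inl (s : Poly k c) : sumToTensor k c (rename Sum.inl s) = s ⊗ₜ 1 := by
  have : (sumToTensor k c).comp (rename Sum.inl) = Algebra.TensorProduct.includeLeft :=
    MvPolynomial.algHom_ext fun i => by simp [sumToTensor]
  exact DFunLike.congr_fun this s

theorem sumToTensor_inr (s : Poly k c) : sumToTensor k c (rename Sum.inr s) = 1 ⊗ₜ s := by
  have : (sumToTensor k c).comp (rename Sum.inr) = Algebra.TensorProduct.includeRight :=
    MvPolynomial.algHom_ext fun i => by simp [sumToTensor]
  exact DFunLike.congr_fun this s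

theorem tensorToSum_tmul (s t : Poly k c) :
    tensorToSum k c (s ⊗ₜ t) = rename Sum.inl s * rename Sum.inr t := rfl

theorem sumToTensor_tensorToSum (u : Poly k c ⊗[k] Poly k c) :
    sumToTensor k c (tensorToSum k c u) = u := by
  induction u using TensorProduct.induction_on with
  | zero => simp
  | add u v hu hv => rw [map_add, map_add, hu, hv]
  | tmul s t =>
    rw [tensorToSum_tmul, map_mul, sumToTensor_inl, sumToTensor_inr,
      Algebra.TensorProduct.tmul_mul_tmul, one_mul, mul_one]

/-- The ideal `ann X ⊗ S + S ⊗ ann Y` annihilates `X ⊗ Y`. -/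
theorem tAct_eq_zero_of_mem {u : Poly k c ⊗[k] Poly k c}
    (hu : tensorToSum k c u ∈ annSum k c X Y) : tAct k c X Y u = 0 := by
  have h : annSum k c X Y ≤ RingHom.ker ((tAct k c X Y).comp (sumToTensor k c)) := by
    refine sup_le (Ideal.map_le_iff_le_comap.2 fun s hs => ?_)
      (Ideal.map_le_iff_le_comap.2 fun s hs => ?_)
    · show tAct k c X Y (sumToTensor k c (rename Sum.inl s)) = 0
      rw [sumToTensor_inl]
      refine TensorProduct.ext' fun x y => ?_
      rw [tAct_tmul, Module.mem_annihilator.1 hs, TensorProduct.zero_tmul, LinearMap.zero_apply]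
    · show tAct k c X Y (sumToTensor k c (rename Sum.inr s)) = 0
      rw [sumToTensor_inr]
      refine TensorProduct.ext' fun x y => ?_
      rw [tAct_tmul, Module.mem_annihilator.1 hs, TensorProduct.tmul_zero, LinearMap.zero_apply]
  have h2 : tAct k c X Y (sumToTensor k c (tensorToSum k c u)) = 0 := h hu
  rwa [sumToTensor_tensorToSum] at h2

/-- A tensor whose components with respect to finite products on both sides vanish is zero. -/
theorem tmul_pi_eq_zero {ι κ : Type*} [Fintype ι] [Fintype κ] [DecidableEq ι] [DecidableEq κ]
    (t : (ι → X) ⊗[k] (κ → Y))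
    (h : ∀ a b, TensorProduct.map (LinearMap.proj a : (ι → X) →ₗ[k] X)
      (LinearMap.proj b : (κ → Y) →ₗ[k] Y) t = 0) : t = 0 := by
  have e : t = ∑ a, ∑ b, TensorProduct.map (LinearMap.single k (fun _ : ι => X) a)
      (LinearMap.single k (fun _ : κ => Y) b)
      (TensorProduct.map (LinearMap.proj a : (ι → X) →ₗ[k] X)
      (LinearMap.proj b : (κ → Y) →ₗ[k] Y) t) := by
    clear h
    induction t using TensorProduct.induction_on with
    | zero => simp
    | add s t hs ht => simp only [map_add, Finset.sum_add_distrib, ← hs, ← ht]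
    | tmul x y =>
      simp only [TensorProduct.map_tmul, ← TensorProduct.tmul_sum, ← TensorProduct.sum_tmul]
      congr 1
      · exact (Finset.univ_sum_single x).symm
      · exact (Finset.univ_sum_single y).symm
  rw [e]
  exact Finset.sum_eq_zero fun a _ => Finset.sum_eq_zero fun b _ => by rw [h, map_zero]

variable (k c) in
/-- A finitely generated `S`-module has an embedding of `S` modulo its annihilator into a finite power. -/
theorem exists_ker_eq_annihilator (X : Type u) [AddCommGroup X] [Module k X]
    [Module (Poly k c) X] [IsScalarTower k (Poly k c) X] [Module.Finite (Poly k c) X] :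
    ∃ (n : ℕ) (x : Fin n → X) (φ : Poly k c →ₗ[k] (Fin n → X)), (∀ s a, φ s a = s • x a) ∧
      LinearMap.ker φ = (Module.annihilator (Poly k c) X).restrictScalars k := by
  obtain ⟨n, x, hx⟩ := Module.Finite.exists_fin (R := Poly k c) (M := X)
  refine ⟨n, x, LinearMap.pi fun a => (LinearMap.toSpanSingleton (Poly k c) X (x a)).restrictScalars k,
    fun s a => rfl, ?_⟩
  ext s
  rw [LinearMap.mem_ker, Submodule.restrictScalars_mem, Module.mem_annihilator]
  constructor
  · intro h m
    have hm : m ∈ Submodule.span (Poly k c) (Set.range x) := by rw [hx]; trivial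
    refine (Submodule.span_le.2 ?_ : _ ≤ LinearMap.ker (LinearMap.lsmul (Poly k c) X s)) hm
    rintro _ ⟨a, rfl⟩
    exact congrFun h a
  · intro h
    funext a
    exact h (x a)

/-- Over a field, the annihilator of `X ⊗ Y` in `S ⊗ S` is `ann X ⊗ S + S ⊗ ann Y`, for finitely
generated `X` and `Y`: then `S / ann X` and `S / ann Y` embed in finite powers of `X` and `Y`. -/
theorem tAct_eq_zero_iff [Module.Finite (Poly k c) X] [Module.Finite (Poly k c) Y]
    {u : Poly k c ⊗[k] Poly k c} :
    tAct k c X Y u = 0 ↔ tensorToSum k c u ∈ annSum k c X Y := by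
  refine ⟨fun hu => ?_, tAct_eq_zero_of_mem⟩
  obtain ⟨n, x, φ, hφ, hφk⟩ := exists_ker_eq_annihilator k c X
  obtain ⟨m, y, ψ, hψ, hψk⟩ := exists_ker_eq_annihilator k c Y
  have h1 : TensorProduct.map φ ψ u = 0 := by
    refine tmul_pi_eq_zero _ fun a b => ?_
    have e : ∀ v : Poly k c ⊗[k] Poly k c, TensorProduct.map (LinearMap.proj a : (Fin n → X) →ₗ[k] X)
        (LinearMap.proj b : (Fin m → Y) →ₗ[k] Y) (TensorProduct.map φ ψ v) =
          tAct k c X Y v (x a ⊗ₜ y b) := by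
      intro v
      induction v using TensorProduct.induction_on with
      | zero => simp
      | add v w hv hw => simp only [map_add, hv, hw, LinearMap.add_apply]
      | tmul s t =>
        rw [tAct_tmul]
        show φ s a ⊗ₜ[k] ψ t b = _
        rw [hφ, hψ]
    rw [e, hu, LinearMap.zero_apply]
  have h2 : TensorProduct.map φ.rangeRestrict ψ.rangeRestrict u = 0 := by
    refine TensorProduct.map_injective_of_flat_flat (LinearMap.range φ).subtype
      (LinearMap.range ψ).subtype Subtype.val_injective Subtype.val_injective ?_
    rw [map_zero, ← LinearMap.comp_apply, ← TensorProduct.map_comp]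
    exact h1
  have h3 : u ∈ LinearMap.ker (TensorProduct.map φ.rangeRestrict ψ.rangeRestrict) := h2
  rw [TensorProduct.map_ker (f := (LinearMap.ker φ).subtype) (f' := (LinearMap.ker ψ).subtype)
    (LinearMap.exact_iff.2 (by rw [LinearMap.ker_rangeRestrict, Submodule.range_subtype]))
    φ.surjective_rangeRestrict
    (LinearMap.exact_iff.2 (by rw [LinearMap.ker_rangeRestrict, Submodule.range_subtype]))
    ψ.surjective_rangeRestrict] at h3
  refine (sup_le ?_ ?_ : _ ≤ ((annSum k c X Y).restrictScalars k).comap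
    (tensorToSum k c).toLinearMap) h3
  · rintro _ ⟨v, rfl⟩
    induction v using TensorProduct.induction_on with
    | zero => simp
    | add v w hv hw => rw [map_add]; exact add_mem hv hw
    | tmul s t =>
      have ht : t.1 ∈ Module.annihilator (Poly k c) Y := hψk.le t.2
      exact Ideal.mul_mem_left _ _ (Ideal.mem_sup_right (Ideal.mem_map_of_mem _ ht))
  · rintro _ ⟨v, rfl⟩
    induction v using TensorProduct.induction_on with
    | zero => simp
    | add v w hv hw => rw [map_add]; exact add_mem hv hw
    | tmul s t =>
      have hs : s.1 ∈ Module.annihilator (Poly k c) X := hφk.le s.2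
      exact Ideal.mul_mem_right _ _ (Ideal.mem_sup_left (Ideal.mem_map_of_mem _ hs))

/-- If every element of `X ⊗ Y` is killed by an element of `Δ(C)`, `C` a multiplicative set, then a single
element of `Δ(C)` kills all of `X ⊗ Y`. -/
theorem exists_forall_tAct_eq_zero [Module.Finite (Poly k c) X] [Module.Finite (Poly k c) Y]
    {C : Submonoid (Poly k c)}
    (h : ∀ t : X ⊗[k] Y, ∃ s ∈ C, tAct k c X Y (diag k c s) t = 0) :
    ∃ s ∈ C, tAct k c X Y (diag k c s) = 0 := by
  obtain ⟨n, x, hx⟩ := Module.Finite.exists_fin (R := Poly k c) (M := X)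
  obtain ⟨m, y, hy⟩ := Module.Finite.exists_fin (R := Poly k c) (M := Y)
  choose f hf hf0 using fun p : Fin n × Fin m => h (x p.1 ⊗ₜ y p.2)
  refine ⟨∏ p, f p, Submonoid.prod_mem _ fun p _ => hf p, ?_⟩
  have hgen : ∀ a b, tAct k c X Y (diag k c (∏ p, f p)) (x a ⊗ₜ y b) = 0 := by
    intro a b
    rw [← Finset.mul_prod_erase Finset.univ f (Finset.mem_univ (a, b)), mul_comm, map_mul, map_mul,
      Module.End.mul_apply, hf0 (a, b), map_zero]
  have hcomm : ∀ (s t : Poly k c) (z : X ⊗[k] Y) , tAct k c X Y (diag k c (∏ p, f p)) z = 0 →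
      tAct k c X Y (diag k c (∏ p, f p)) (tAct k c X Y (s ⊗ₜ t) z) = 0 := by
    intro s t z hz
    rw [← Module.End.mul_apply, ← map_mul, mul_comm, map_mul, Module.End.mul_apply, hz, map_zero]
  refine TensorProduct.ext' fun x' y' => ?_
  rw [LinearMap.zero_apply]
  have hx' : x' ∈ Submodule.span (Poly k c) (Set.range x) := by rw [hx]; trivial
  have hy' : y' ∈ Submodule.span (Poly k c) (Set.range y) := by rw [hy]; trivial
  induction hx' using Submodule.span_induction with
  | zero => rw [TensorProduct.zero_tmul, map_zero]
  | add a b _ _ ha hb => rw [TensorProduct.add_tmul, map_add, ha, hb, add_zero]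
  | smul s a _ ha =>
    have := hcomm s 1 _ ha
    rwa [tAct_tmul, one_smul] at this
  | mem a ha =>
    obtain ⟨a, rfl⟩ := ha
    induction hy' using Submodule.span_induction with
    | zero => rw [TensorProduct.tmul_zero, map_zero]
    | add a b _ _ ha hb => rw [TensorProduct.tmul_add, map_add, ha, hb, add_zero]
    | smul s a _ ha =>
      have := hcomm 1 s _ ha
      rwa [tAct_tmul, one_smul] at this
    | mem b hb =>
      obtain ⟨b, rfl⟩ := hb
      exact hgen a b

/-- The support of a finitely generated module is the zero locus of its annihilator. -/
theorem mem_Supp_iff_annihilator_le {deg : Fin c → ℕ} [Module.Finite (Poly k c) X]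
    (hX : (Module.annihilator (Poly k c) X).IsHomogeneous (projGr k (wt deg))) {p : ProjS k deg} :
    p ∈ Supp (k := k) deg X ↔
      Module.annihilator (Poly k c) X ≤ p.asHomogeneousIdeal.toIdeal := by
  rw [mem_Supp (k := k)]
  constructor
  · rintro ⟨x, hx⟩ s hs
    refine (Ideal.IsHomogeneous.mem_iff (projGr k (wt deg)) p.asHomogeneousIdeal.isHomogeneous).2
      fun n => ?_
    by_contra hn
    exact hx _ ⟨⟨n, SetLike.coe_mem _⟩, hn⟩ (Module.mem_annihilator.1 (hX n hs) x)
  · intro hp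
    by_contra! h
    obtain ⟨n, x, hx⟩ := Module.Finite.exists_fin (R := Poly k c) (M := X)
    choose f hf hf0 using fun a => h (x a)
    refine (Submonoid.prod_mem _ fun a (_ : a ∈ Finset.univ) => hf a).2 (hp ?_)
    rw [Module.mem_annihilator]
    intro m
    have hm : m ∈ Submodule.span (Poly k c) (Set.range x) := by rw [hx]; trivial
    refine (Submodule.span_le.2 ?_ :
      _ ≤ LinearMap.ker (LinearMap.lsmul (Poly k c) X (∏ a, f a))) hm
    rintro _ ⟨a, rfl⟩
    show (∏ a, f a) • x a = 0
    rw [← Finset.mul_prod_erase Finset.univ f (Finset.mem_univ a), mul_comm, mul_smul, hf0,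
      smul_zero]

end Annihilator

/-! ### Supports of tensor products -/

section HomologyModule

open MvPolynomial

variable {k : Type u} [Field k] {c : ℕ} {deg : Fin c → ℕ} {hdeg : ∀ i, Odd (deg i)}
  {P Q : DGPoly k deg}

variable (hdeg P) in
theorem polyHomology_subsingleton_iff : Subsingleton (polyHomology hdeg P) ↔ Acyclic P.d := by
  constructor
  · intro h z hz
    exact (cls_eq_zero (hdeg := hdeg) hz).1 (Subsingleton.elim _ _)
  · intro h
    refine subsingleton_of_forall_eq 0 fun m => ?_
    obtain ⟨⟨z, hz⟩, rfl⟩ := cls_surjective m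
    exact (cls_eq_zero hz).2 (h z hz)

variable (hdeg) in
/-- The homology is finite over `S` if every cycle is homologous to one in a finitely generated submodule,
which is Noetherian. -/
theorem finite_polyHomology {G : Submodule (Poly k c) P.carrier} (hG : G.FG)
    (h : ∀ f, P.d f = 0 → ∃ g ∈ G, ∃ w, f = g + P.d w) :
    Module.Finite (Poly k c) (polyHomology hdeg P) := by
  have := isNoetherian_of_fg_of_noetherian G hG
  let G' := G.comap (LinearMap.ker (dLin hdeg P)).subtype
  have hG' : Module.Finite (Poly k c) G' :=
    Module.Finite.of_injective (((LinearMap.ker (dLin hdeg P)).subtype.comp G'.subtype).codRestrict G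
      fun x => x.2) fun x y hxy => Subtype.ext (Subtype.ext (congrArg (fun g : G => g.1) hxy))
  refine Module.Finite.of_surjective ((Submodule.mkQ _).comp G'.subtype :
    G' →ₗ[Poly k c] polyHomology hdeg P) fun m => ?_
  obtain ⟨⟨z, hz⟩, rfl⟩ := Submodule.Quotient.mk_surjective _ m
  obtain ⟨g, hg, w, hw⟩ := h z hz
  have hdg : P.d g = 0 := by
    have h1 := congrArg P.d hw
    rw [map_add, P.d_d, add_zero] at h1
    exact h1.symm.trans hz
  refine ⟨⟨⟨g, hdg⟩, hg⟩, (Submodule.Quotient.eq _).2 ⟨-w, ?_⟩⟩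
  show P.d (-w) = g - z
  rw [hw, map_neg]
  abel

/-- The grading of `S` by lower degrees is the negative of the one used for `Proj S`. -/
theorem projGr_le_sGr (n : ℕ) {s : Poly k c} (hs : s ∈ projGr k (wt deg) n) :
    s ∈ sGr k deg (-(n : ℤ)) := by
  intro m hm
  have h1 : Finsupp.weight (wt deg) m = n := hs hm
  rw [← h1, Finsupp.weight_apply, Finsupp.weight_apply, Finsupp.sum, Finsupp.sum, Nat.cast_sum,
    ← Finset.sum_neg_distrib]
  refine Finset.sum_congr rfl fun i _ => ?_
  simp only [smul_eq_mul]
  push_cast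
  ring

theorem mem_annihilator_polyHomology {s : Poly k c} :
    s ∈ Module.annihilator (Poly k c) (polyHomology hdeg P) ↔
      ∀ z, P.d z = 0 → ∃ w, P.d w = s • z := by
  rw [Module.mem_annihilator]
  constructor
  · intro h z hz
    refine (cls_eq_zero (hdeg := hdeg) (d_smul_eq_zero hdeg s hz)).1 ?_
    rw [← smul_cls s hz, h]
  · intro h m
    obtain ⟨⟨z, hz⟩, rfl⟩ := cls_surjective m
    exact (smul_cls s hz).trans ((cls_eq_zero _).2 (h z hz))

/-- The homology is a graded module, so its annihilator is a homogeneous ideal. -/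
theorem annihilator_isHomogeneous : (Module.annihilator (Poly k c) (polyHomology hdeg P)).IsHomogeneous
    (projGr k (wt deg)) := by
  classical
  intro n s hs
  rw [mem_annihilator_polyHomology] at hs ⊢
  -- a component of the product of `s` with a homogeneous cycle
  have key : ∀ j x, x ∈ P.gr j → proj P.internal (j - n) (s • x) =
      ((DirectSum.decompose (projGr k (wt deg)) s n : projGr k (wt deg) n) : Poly k c) • x := by
    intro j x hx
    conv_lhs => rw [← DirectSum.sum_support_decompose (projGr k (wt deg)) s]
    rw [Finset.sum_smul, map_sum, Finset.sum_eq_single n]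
    · rw [proj_of_mem P.internal (P.smul_mem (projGr_le_sGr n (SetLike.coe_mem _)) hx), if_pos (by ring)]
    · intro i _ hi
      rw [proj_of_mem P.internal (P.smul_mem (projGr_le_sGr i (SetLike.coe_mem _)) hx),
        if_neg (by omega)]
    · intro hn
      rw [DFinsupp.notMem_support_iff.1 hn, ZeroMemClass.coe_zero, zero_smul, map_zero]
  intro z hz
  refine mem_of_proj P.internal (P := (LinearMap.range P.d).comap (Algebra.lsmul k k P.carrier
    ((DirectSum.decompose (projGr k (wt deg)) s n : projGr k (wt deg) n) : Poly k c)))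
    (fun j => ?_)
  have hdj : P.d (proj P.internal j z) = 0 := by
    rw [← proj_isHom P.internal P.internal P.d_isHom, hz, map_zero]
  obtain ⟨w, hw⟩ := hs _ hdj
  refine ⟨proj P.internal (j - n + 1) w, ?_⟩
  rw [← proj_isHom P.internal P.internal P.d_isHom, hw, add_neg_cancel_right]
  exact key j _ (proj_mem P.internal j z)

/-- For homologies that are finite over `S`, the support of the tensor product is determined by the annihilator
of `H(P) ⊗ H(Q)` in `S ⊗ S`. -/
theorem mem_Supp_tensor_iff [Module.Finite (Poly k c) (polyHomology hdeg P)]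
    [Module.Finite (Poly k c) (polyHomology hdeg Q)] {q : ProjS k deg} :
    q ∈ Supp (k := k) deg (polyHomology hdeg (diagTensor hdeg P Q)) ↔
      ∀ s ∈ homogeneousCompl q,
        diagSum k c s ∉ annSum k c (polyHomology hdeg P) (polyHomology hdeg Q) := by
  rw [mem_Supp_diagTensor]
  constructor
  · rintro ⟨t, ht⟩ s hs h
    refine ht s hs ?_
    exact LinearMap.congr_fun (tAct_eq_zero_of_mem (u := diag k c s) h) t
  · intro h
    by_contra! h'
    obtain ⟨s, hs, h0⟩ := exists_forall_tAct_eq_zero h'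
    exact h s hs (tAct_eq_zero_iff.1 h0)

/-- The support of a tensor product is the join of the supports. -/
theorem supp_diagTensor_eq_join [Module.Finite (Poly k c) (polyHomology hdeg P)]
    [Module.Finite (Poly k c) (polyHomology hdeg Q)] [Nontrivial (polyHomology hdeg P)]
    [Nontrivial (polyHomology hdeg Q)] :
    Supp (k := k) deg (polyHomology hdeg (diagTensor hdeg P Q)) =
      join (Supp (k := k) deg (polyHomology hdeg P)) (Supp (k := k) deg (polyHomology hdeg Q)) := by
  ext q
  rw [mem_Supp_tensor_iff, mem_join (k := k)
    (I := ⟨_, annihilator_isHomogeneous (hdeg := hdeg) (P := P)⟩)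
    (J := ⟨_, annihilator_isHomogeneous (hdeg := hdeg) (P := Q)⟩)
    (fun p => mem_Supp_iff_annihilator_le annihilator_isHomogeneous)
    (fun p => mem_Supp_iff_annihilator_le annihilator_isHomogeneous)
    (le_irrelevant annihilator_isHomogeneous
      (fun h => not_subsingleton (polyHomology hdeg P) (Module.annihilator_eq_top_iff.1 h)))
    (le_irrelevant annihilator_isHomogeneous
      (fun h => not_subsingleton (polyHomology hdeg Q) (Module.annihilator_eq_top_iff.1 h)))]
  rfl

theorem supp_diagTensor_eq_empty
    (h : Subsingleton (polyHomology hdeg P) ∨ Subsingleton (polyHomology hdeg Q)) :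
    Supp (k := k) deg (polyHomology hdeg (diagTensor hdeg P Q)) = ∅ := by
  rw [Set.eq_empty_iff_forall_notMem]
  intro q hq
  obtain ⟨t, ht⟩ := mem_Supp_diagTensor.1 hq
  have hs : ∀ t : polyHomology hdeg P ⊗[k] polyHomology hdeg Q, t = 0 := by
    intro t
    induction t using TensorProduct.induction_on with
    | zero => rfl
    | add a b ha hb => rw [ha, hb, add_zero]
    | tmul x y =>
      rcases h with h | h
      · rw [Subsingleton.elim x 0, TensorProduct.zero_tmul]
      · rw [Subsingleton.elim y 0, TensorProduct.tmul_zero]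
  exact ht 1 (one_mem _) (by rw [hs t, map_zero])

end HomologyModule

section CohSupport

variable {k : Type u} [Field k] {c : ℕ} {deg : Fin c → ℕ} (hdeg : ∀ i, Odd (deg i))

theorem cohSupport_eq (M : DGExt k deg) :
    cohSupport hdeg M = Supp (k := k) deg (polyHomology hdeg (dual hdeg (K M hdeg))) :=
  (dgDualToDual_isQuasiIso M hdeg).supp_eq hdeg

theorem cohSupport_tensorOver {M N F : DGExt k deg} (hM : IsFgBoundedBelow M)
    (hN : IsFgBoundedBelow N) (hF : IsSemifree F) {φ : DGHom F M} (hφ : φ.IsQuasiIso) :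
    cohSupport hdeg (tensorOver (extGr_top deg) F N) = Supp (k := k) deg (polyHomology hdeg
      (diagTensor hdeg (dual hdeg (K M hdeg)) (dual hdeg (K N hdeg)))) := by
  refine ((derivedIso_dgDual_tensorOver hdeg hM hN hF hφ).supp_eq hdeg).trans ?_
  exact (IsHEquiv.diagTensorMap hdeg (dgDualToDual_isQuasiIso M hdeg).isHEquiv
    (dgDualToDual_isQuasiIso N hdeg).isHEquiv).isQuasiIso.supp_eq hdeg

theorem subsingleton_polyHomology_dual_iff (M : DGExt k deg) :
    Subsingleton (polyHomology hdeg (dual hdeg (K M hdeg))) ↔ Subsingleton (Homology M) := by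
  rw [polyHomology_subsingleton_iff, dual_acyclic_iff, K_acyclic_iff, acyclic_iff_subsingleton]

end CohSupport

end

end DGJoin

theorem propositionp {k : Type u} [Field k] {c : ℕ} (deg : Fin c → ℕ) (hdeg : ∀ i, Odd (deg i))
    (M N : DGJoin.DGExt k deg) (hM : DGJoin.IsFgBoundedBelow M) (hN : DGJoin.IsFgBoundedBelow N)
    (F : DGJoin.DGExt k deg) (hF : DGJoin.IsSemifree F)
    (φ : DGJoin.DGHom F M) (hφ : φ.IsQuasiIso) :
    DGJoin.DerivedIso
      (DGJoin.dgDual (DGJoin.tensorOver (DGJoin.extGr_top deg) F N) hdeg)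
      (DGJoin.diagTensor hdeg (DGJoin.dgDual M hdeg) (DGJoin.dgDual N hdeg)) ∧
    (FiniteDimensional k (DGJoin.Homology M) → FiniteDimensional k (DGJoin.Homology N) →
      (Nontrivial (DGJoin.Homology M) → Nontrivial (DGJoin.Homology N) →
        DGJoin.cohSupport hdeg (DGJoin.tensorOver (DGJoin.extGr_top deg) F N) =
          DGJoin.join (DGJoin.cohSupport hdeg M) (DGJoin.cohSupport hdeg N)) ∧
      (Subsingleton (DGJoin.Homology M) ∨ Subsingleton (DGJoin.Homology N) →
        DGJoin.cohSupport hdeg (DGJoin.tensorOver (DGJoin.extGr_top deg) F N) = ∅)) := by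
  refine ⟨DGJoin.derivedIso_dgDual_tensorOver hdeg hM hN hF hφ, fun hM' hN' =>
    ⟨fun hM0 hN0 => ?_, fun h => ?_⟩⟩
  · obtain ⟨G, hG, hGc⟩ := DGJoin.exists_fg_cycles hdeg M
    obtain ⟨G', hG', hGc'⟩ := DGJoin.exists_fg_cycles hdeg N
    have := DGJoin.finite_polyHomology hdeg hG hGc
    have := DGJoin.finite_polyHomology hdeg hG' hGc'
    have : Nontrivial (DGJoin.polyHomology hdeg (DGJoin.dual hdeg (DGJoin.K M hdeg))) := by
      rw [← not_subsingleton_iff_nontrivial, DGJoin.subsingleton_polyHomology_dual_iff]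
      exact not_subsingleton _
    have : Nontrivial (DGJoin.polyHomology hdeg (DGJoin.dual hdeg (DGJoin.K N hdeg))) := by
      rw [← not_subsingleton_iff_nontrivial, DGJoin.subsingleton_polyHomology_dual_iff]
      exact not_subsingleton _
    rw [DGJoin.cohSupport_tensorOver hdeg hM hN hF hφ, DGJoin.cohSupport_eq, DGJoin.cohSupport_eq]
    exact DGJoin.supp_diagTensor_eq_join
  · rw [DGJoin.cohSupport_tensorOver hdeg hM hN hF hφ]
    refine DGJoin.supp_diagTensor_eq_empty (h.imp ?_ ?_) <;>
      exact (DGJoin.subsingleton_polyHomology_dual_iff hdeg _).2
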